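/- There is an absolute constant $C>0$ such that the following holds. Let $d\ge 1$ and $m\ge 0$ be integers, let $2<p\le 3$, and equip $\mathbb{Z}^d$ with the distance $|i-j|=\max_{1\le l\le d}|i_l-j_l|$. For $A,B\subset\mathbb{Z}^d$ put $\rho(A,B)=\inf\{|i-j| : i\in A,\ j\in B\}$ (with $\inf\emptyset=\infty$). Let $\mathcal{J}$ be a finite subset of $\mathbb{Z}^d$ and let $\{X_i, i\in\mathcal{J}\}$ be real random variables on a common probability space forming an $m$-dependent random field, i.e. $\{X_i, i\in A\}$ and $\{X_j, j\in B\}$ are independent for all $A,B\subset\mathcal{J}$ with $\rho(A,B)>m$. Assume that $EX_i=0$ and $E|X_i|^p<\infty$ for every $i\in\mathcal{J}$, and that $W=\sum_{i\in\mathcal{J}}X_i$ satisfies $\operatorname{Var}(W)=1$. Let $F$ be the distribution function of $W$ and $\Phi$ the standard normal distribution function. Then $$\sup_{z\in\mathbb{R}}|F(z)-\Phi(z)|\le 75(10m+1)^{(p-1)d}\sum_{i\in\mathcal{J}}E|X_i|^p,$$ and, for every $z\in\mathbb{R}$, $$|F(z)-\Phi(z)|\le C(1+|z|)^{-p}\,19^{pd}\,(m+1)^{(p-1)d}\sum_{i\in\mathcal{J}}E|X_i|^p.$$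 -/

import Mathlib

open MeasureTheory ProbabilityTheory
open scoped ENNReal

/-- The distance `ρ(A, B) = inf {|i - j| : i ∈ A, j ∈ B}` between two subsets of `ℤ^d`, where
`|i - j| = max_l |i_l - j_l|` is the distance carried by `Fin d → ℤ` in Mathlib.
The infimum over the empty set is `∞`. -/
noncomputable def latticeSetDist {d : ℕ} (A B : Set (Fin d → ℤ)) : ℝ≥0∞ :=
  ⨅ i ∈ A, ⨅ j ∈ B, edist i j

/-- `{X_i, i ∈ J}` is an `m`-dependent random field: for all subsets `A`, `B` of `J` with
`ρ(A, B) > m`, the families `{X_i, i ∈ A}` and `{X_j, j ∈ B}` are independent. -/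
def IsMDependentField {d : ℕ} {Ω : Type*} [MeasurableSpace Ω] (m : ℕ)
    (J : Set (Fin d → ℤ)) (X : (Fin d → ℤ) → Ω → ℝ) (μ : Measure Ω) : Prop :=
  ∀ A B : Set (Fin d → ℤ), A ⊆ J → B ⊆ J → (m : ℝ≥0∞) < latticeSetDist A B →
    IndepFun (fun (ω : Ω) (i : A) => X i ω) (fun (ω : Ω) (j : B) => X j ω) μ

/-!
# Berry–Esseen bounds for `m`-dependent random fields

The proof is Stein's method for a field `X` in which `X i` is independent of the variables at
distance more than `m` from `i` (`MDep`, `LocField`). With `Y i` the sum over the neighbours of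
`i`, independence of `X i` and `W - Y i` gives `E W f(W) = ∑ E X i (f(W) - f(W - Y i))`, and a
second use of independence compares this with `Var(W) E f'(W)`. The error is a sum of local terms
`E |X i Y i| * Θ i`, where `Θ i` is the oscillation of `f'` near `W` (`LocField.expand`).

For the solution `f` of Stein's equation with a piecewise linear test function `ramp z a`, the
derivative `f'` is the sum of the Lipschitz-like function `w f(w)` and of the ramp. The oscillation
of the ramp costs `1 / a` times the time spent by `W` in an interval of length `a`, so that a
concentration inequality `P(x ≤ W ≤ x + a) ≤ D a`, conditionally on the field near `i`, removes
the dependence on `a` (`LocField.stein_ramp`). The inequality itself comes from Stein's identity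
applied to the primitive `trapInt x a` of a trapezoid: the increments of the primitive are
integrals of the trapezoid against a random kernel `ksum`, whose mean has mass nearly
`Var(W)` (`PField.le_integral_kmean`), and whose fluctuations and mass far from the origin are
controlled by the moments
(`LocField.concentration_core`, `LocField.concentration_weighted`,
`PField.integral_sq_ksum_sub_le`). All error terms are bounded by
`b = κ ^ (p - 1) ∑ E |X i| ^ p`, where `κ` bounds the number of points in a ball of radius `5 m`.
The choice `a = 20 b` gives the uniform bound `PField.abs_cdf_sub_le_uniform`, and on the lattice
`κ = (10 m + 1) ^ d`.

For the nonuniform bound the variables are truncated at `1 / (2 κ)`, so that all local sums are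
bounded (`BddField`). Then `W` has a bounded fourth moment (`BddField.integral_pow_four_le`), the
concentration inequality can be weighted with `(1 + x) ^ 3`
(`BddField.concentration_nonuniform`), and so can the estimates for Stein's equation. The new
ingredient is a bound for the fluctuations of the kernel weighted by the square of the sum
(`BddField.integral_sq_mul_sq_le`). Truncation changes the variance by a multiple of `b`
(`PField.abs_integral_sq_trunc_sub_le`). The event that some `X i` is truncated and `W` is larger
than `z` has probability of order `z ^ (-p) * κ * b`: a large `X i` is independent of the sum far
from `i`, and the tail of that sum is known from the fourth moment at the scale `z`
(`PField.measureReal_largeSet_inter_le`). This gives an error of order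
`(1 + |z|) ^ (-p) * κ * b` (`PField.abs_cdf_sub_le_nonuniform`).

The factor `κ * b` would be too large if `κ` grew with `m`. Therefore the nonuniform bound is
applied to the sums over cubes of side `m + 1`, which form a field of range `1`, so that `κ`
depends only on `d`; passing to these sums multiplies the `p`-th moments by at most
`(m + 1) ^ ((p - 1) d)` (`lattice_nonuniform`).
-/

/-! ### Locally dependent fields -/

/-- The σ-algebra generated by the variables `X i`, `i ∈ A`. -/
@[reducible] def sigmaOf {ι Ω : Type*} (X : ι → Ω → ℝ) (A : Finset ι) : MeasurableSpace Ω :=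
  ⨆ i ∈ A, MeasurableSpace.comap (X i) inferInstance

open Classical in
/-- The neighbourhood of `i` of radius `r` in `J`, the unit of length being `m`. -/
noncomputable def nbhd {ι : Type*} [PseudoMetricSpace ι] (m : ℝ) (J : Finset ι) (r : ℕ) (i : ι) :
    Finset ι :=
  J.filter (fun j => dist i j ≤ r * m)

/-- The sum of the variables with index in `A`. -/
def psum {ι Ω : Type*} (X : ι → Ω → ℝ) (A : Finset ι) (ω : Ω) : ℝ := ∑ k ∈ A, X k ω

/-- The sum of the absolute values of the variables with index in `A`. It dominates every partial
sum over a subset of `A`, and serves as a common bound for all local quantities. -/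
def asum {ι Ω : Type*} (X : ι → Ω → ℝ) (A : Finset ι) (ω : Ω) : ℝ := ∑ k ∈ A, |X k ω|

/-- `m`-dependence of the field `X` over the finite index set `J`, phrased with σ-algebras. -/
structure MDep {ι Ω : Type*} [PseudoMetricSpace ι] [MeasurableSpace Ω] (m : ℝ) (J : Finset ι)
    (X : ι → Ω → ℝ) (μ : Measure Ω) : Prop where
  m_nonneg : 0 ≤ m
  meas : ∀ i ∈ J, Measurable (X i)
  indep : ∀ A B : Finset ι, A ⊆ J → B ⊆ J → (∀ a ∈ A, ∀ b ∈ B, m < dist a b) →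
    Indep (sigmaOf X A) (sigmaOf X B) μ

section Nbhd

variable {ι : Type*} [PseudoMetricSpace ι] {m : ℝ} {J : Finset ι}

lemma mem_nbhd {r : ℕ} {i j : ι} : j ∈ nbhd m J r i ↔ j ∈ J ∧ dist i j ≤ r * m := by
  simp [nbhd]

lemma nbhd_subset (r : ℕ) (i : ι) : nbhd m J r i ⊆ J := fun _ h => (mem_nbhd.1 h).1

lemma nbhd_symm {r : ℕ} {i j : ι} (hi : i ∈ J) (h : j ∈ nbhd m J r i) : i ∈ nbhd m J r j :=
  mem_nbhd.2 ⟨hi, by rw [dist_comm]; exact (mem_nbhd.1 h).2⟩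

lemma self_mem_nbhd (hm : 0 ≤ m) (r : ℕ) {i : ι} (hi : i ∈ J) : i ∈ nbhd m J r i :=
  mem_nbhd.2 ⟨hi, by rw [dist_self]; positivity⟩

lemma nbhd_mono (hm : 0 ≤ m) {r s : ℕ} (h : r ≤ s) (i : ι) : nbhd m J r i ⊆ nbhd m J s i := by
  intro j hj
  rw [mem_nbhd] at hj ⊢
  exact ⟨hj.1, hj.2.trans (by gcongr)⟩

lemma nbhd_trans {r s t : ℕ} (h : r + s = t) {i j : ι} (hj : j ∈ nbhd m J r i) :
    nbhd m J s j ⊆ nbhd m J t i := by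
  intro k hk
  rw [mem_nbhd] at hj hk ⊢
  refine ⟨hk.1, (dist_triangle i j k).trans ?_⟩
  subst h
  push_cast
  linarith [hj.2, hk.2]

open Classical in
lemma nbhd_subset_sdiff {r s t : ℕ} (h : r + s = t) {i j : ι} (hj : j ∈ J)
    (hij : j ∉ nbhd m J t i) : nbhd m J s j ⊆ J \ nbhd m J r i := by
  intro k hk
  rw [Finset.mem_sdiff]
  refine ⟨nbhd_subset _ _ hk, fun hki => hij ?_⟩
  exact nbhd_trans h hki (nbhd_symm hj hk)

open Classical in
lemma far_sdiff {r s : ℕ} (h : r + 1 = s) {i : ι} :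
    ∀ a ∈ nbhd m J r i, ∀ b ∈ J \ nbhd m J s i, m < dist a b := by
  intro a ha b hb
  rw [Finset.mem_sdiff, mem_nbhd] at hb
  rw [mem_nbhd] at ha
  have h1 : s * m < dist i b := by
    by_contra hc
    exact hb.2 ⟨hb.1, not_lt.1 hc⟩
  subst h
  push_cast at h1
  linarith [dist_triangle i a b, ha.2]

end Nbhd

section Sigma

variable {ι Ω : Type*} {X : ι → Ω → ℝ}

lemma sigmaOf_mono {A B : Finset ι} (h : A ⊆ B) : sigmaOf X A ≤ sigmaOf X B :=
  biSup_mono fun _ hi => h hi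

lemma measurable_sigmaOf {A : Finset ι} {i : ι} (hi : i ∈ A) : Measurable[sigmaOf X A] (X i) :=
  Measurable.of_comap_le (le_iSup₂_of_le (f := fun i (_ : i ∈ A) => MeasurableSpace.comap (X i) _)
    i hi le_rfl)

lemma measurable_psum {A B : Finset ι} (h : B ⊆ A) : Measurable[sigmaOf X A] (psum X B) := by
  unfold psum
  exact Finset.measurable_fun_sum B fun i hi => measurable_sigmaOf (h hi)

lemma measurable_asum {A B : Finset ι} (h : B ⊆ A) : Measurable[sigmaOf X A] (asum X B) := by
  unfold asum
  exact Finset.measurable_fun_sum B fun i hi =>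
    (measurable_norm.comp (measurable_sigmaOf (X := X) (h hi)) : _)

lemma asum_nonneg (A : Finset ι) (ω : Ω) : 0 ≤ asum X A ω :=
  Finset.sum_nonneg fun _ _ => abs_nonneg _

lemma asum_mono {A B : Finset ι} (h : A ⊆ B) (ω : Ω) : asum X A ω ≤ asum X B ω :=
  Finset.sum_le_sum_of_subset_of_nonneg h fun _ _ _ => abs_nonneg _

lemma abs_psum_le {A B : Finset ι} (h : A ⊆ B) (ω : Ω) : |psum X A ω| ≤ asum X B ω :=
  (Finset.abs_sum_le_sum_abs _ _).trans (asum_mono h ω)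

lemma abs_le_asum {A : Finset ι} {i : ι} (h : i ∈ A) (ω : Ω) : |X i ω| ≤ asum X A ω :=
  Finset.single_le_sum (f := fun k => |X k ω|) (fun _ _ => abs_nonneg _) h

open Classical in
lemma psum_sdiff {A B : Finset ι} (h : B ⊆ A) (ω : Ω) :
    psum X (A \ B) ω = psum X A ω - psum X B ω := by
  unfold psum
  rw [← Finset.sum_sdiff h]; ring

open Classical in
lemma measurable_psum_sub {A B : Finset ι} (h : B ⊆ A) :
    Measurable[sigmaOf X (A \ B)] (fun ω => psum X A ω - psum X B ω) := by
  have := measurable_psum (X := X) (le_refl (A \ B))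
  rwa [show psum X (A \ B) = fun ω => psum X A ω - psum X B ω from funext (psum_sdiff h)] at this

end Sigma

namespace MDep

variable {ι Ω : Type*} [PseudoMetricSpace ι] [mΩ : MeasurableSpace Ω] {m : ℝ} {J : Finset ι}
  {X : ι → Ω → ℝ} {μ : Measure Ω}

lemma sigmaOf_le (hX : MDep m J X μ) {A : Finset ι} (hA : A ⊆ J) : sigmaOf X A ≤ mΩ :=
  iSup₂_le fun i hi => (hX.meas i (hA hi)).comap_le

/-- Functions of far apart parts of the field are uncorrelated. -/
lemma integral_mul (hX : MDep m J X μ) {A B : Finset ι} (hA : A ⊆ J) (hB : B ⊆ J)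
    (hAB : ∀ a ∈ A, ∀ b ∈ B, m < dist a b) {u v : Ω → ℝ} (hu : Measurable[sigmaOf X A] u)
    (hv : Measurable[sigmaOf X B] v) :
    ∫ ω, u ω * v ω ∂μ = (∫ ω, u ω ∂μ) * ∫ ω, v ω ∂μ := by
  have h : IndepFun u v μ := by
    rw [IndepFun_iff_Indep]
    exact indep_of_indep_of_le_left (indep_of_indep_of_le_right (hX.indep A B hA hB hAB)
      hv.comap_le) hu.comap_le
  exact h.integral_mul_eq_mul_integral
    (hu.mono (hX.sigmaOf_le hA) le_rfl).aestronglyMeasurable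
    (hv.mono (hX.sigmaOf_le hB) le_rfl).aestronglyMeasurable

open Classical in
/-- A function of the field near `i` and a function of the field away from `i` are
uncorrelated. -/
lemma integral_mul_nbhd (hX : MDep m J X μ) {r s : ℕ} (h : r + 1 = s) (i : ι) {u v : Ω → ℝ}
    (hu : Measurable[sigmaOf X (nbhd m J r i)] u)
    (hv : Measurable[sigmaOf X (J \ nbhd m J s i)] v) :
    ∫ ω, u ω * v ω ∂μ = (∫ ω, u ω ∂μ) * ∫ ω, v ω ∂μ :=
  hX.integral_mul (nbhd_subset r i) Finset.sdiff_subset (far_sdiff h) hu hv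

open Classical in
/-- The integrability counterpart of `integral_mul_nbhd`. -/
lemma integrable_mul_nbhd (hX : MDep m J X μ) {r s : ℕ} (h : r + 1 = s) (i : ι) {u v : Ω → ℝ}
    (hu : Measurable[sigmaOf X (nbhd m J r i)] u)
    (hv : Measurable[sigmaOf X (J \ nbhd m J s i)] v) (hui : Integrable u μ)
    (hvi : Integrable v μ) : Integrable (fun ω => u ω * v ω) μ := by
  have h : IndepFun u v μ := by
    rw [IndepFun_iff_Indep]
    exact indep_of_indep_of_le_left (indep_of_indep_of_le_right
      (hX.indep _ _ (nbhd_subset r i) Finset.sdiff_subset (far_sdiff h))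
      hv.comap_le) hu.comap_le
  exact h.integrable_mul hui hvi

lemma measurable_psum (hX : MDep m J X μ) {A : Finset ι} (hA : A ⊆ J) : Measurable (psum X A) :=
  (_root_.measurable_psum (X := X) (subset_refl A)).mono (hX.sigmaOf_le hA) le_rfl

lemma measurable_asum (hX : MDep m J X μ) {A : Finset ι} (hA : A ⊆ J) : Measurable (asum X A) :=
  (_root_.measurable_asum (X := X) (subset_refl A)).mono (hX.sigmaOf_le hA) le_rfl

end MDep

/-! ### Gaussian tails and the Stein equation -/

section Stein

open Real Set Filter Topology

/-- The unnormalised tail of the standard normal distribution. -/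
noncomputable def gtail (w : ℝ) : ℝ := ∫ x in Ioi w, exp (-x ^ 2 / 2)

lemma integrable_gauss : Integrable (fun x : ℝ => exp (-x ^ 2 / 2)) := by
  have := integrable_exp_neg_mul_sq (b := 1 / 2) (by norm_num)
  refine this.congr (ae_of_all _ fun x => ?_)
  dsimp only; congr 1; ring

lemma gtail_nonneg (w : ℝ) : 0 ≤ gtail w :=
  setIntegral_nonneg measurableSet_Ioi fun _ _ => (exp_pos _).le

lemma integral_Iic_gauss (w : ℝ) : ∫ x in Iic w, exp (-x ^ 2 / 2) = gtail (-w) := by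
  have := integral_comp_neg_Iic w (fun x : ℝ => exp (-x ^ 2 / 2))
  rw [gtail, ← this]
  simp

lemma sqrt_two_pi_bounds : 2.5 ≤ √(2 * π) ∧ √(2 * π) ≤ 2.52 := by
  constructor
  · apply Real.le_sqrt_of_sq_le; nlinarith [pi_gt_d2]
  · rw [Real.sqrt_le_left (by norm_num)]; nlinarith [pi_lt_d2]

lemma integral_gauss : ∫ x : ℝ, exp (-x ^ 2 / 2) = √(2 * π) := by
  have := integral_gaussian (1 / 2)
  rw [show π / (1 / 2) = 2 * π by ring] at this
  rw [← this]
  congr 1; ext x; congr 1; ring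

lemma gtail_le_full (w : ℝ) : gtail w ≤ 2.52 := by
  refine le_trans ?_ sqrt_two_pi_bounds.2
  rw [← integral_gauss]
  exact setIntegral_le_integral integrable_gauss (ae_of_all _ fun _ => (exp_pos _).le)

lemma gtail_zero : gtail 0 ≤ 1.26 := by
  have := integral_gaussian_Ioi (1 / 2)
  rw [show π / (1 / 2) = 2 * π by ring] at this
  have h2 : gtail 0 = √(2 * π) / 2 := by
    rw [← this, gtail]; congr 1; ext x; congr 1; ring
  rw [h2]; linarith [sqrt_two_pi_bounds.2]

lemma exp_mul_gtail_le {w : ℝ} (hw : 0 ≤ w) : exp (w ^ 2 / 2) * gtail w ≤ 1.26 := by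
  have h1 : gtail w = ∫ y in Ioi (0 : ℝ), exp (-(y + w) ^ 2 / 2) := by
    rw [gtail]
    have := (measurePreserving_add_right volume w).setIntegral_preimage_emb
      (measurableEmbedding_addRight w) (fun x : ℝ => exp (-x ^ 2 / 2)) (Ioi w)
    rw [← this]
    simp
  rw [h1, ← integral_const_mul]
  refine le_trans ?_ gtail_zero
  rw [gtail]
  refine setIntegral_mono_on ?_ integrable_gauss.integrableOn measurableSet_Ioi ?_
  · exact ((integrable_gauss.comp_add_right w).const_mul _).integrableOn
  · intro y hy
    rw [← exp_add]
    apply exp_le_exp.2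
    have : 0 < y := hy
    nlinarith [mul_nonneg hw this.le]

/-- Bound for the Mills ratio; it bounds `w f(w)` for the Stein solution `f`. -/
lemma mul_exp_mul_gtail_le (w : ℝ) : w * (exp (w ^ 2 / 2) * gtail w) ≤ 1 := by
  have h1 : ∫ x in Ioi w, x * exp (-x ^ 2 / 2) = exp (-w ^ 2 / 2) := by
    have hint : Integrable (fun x : ℝ => x * exp (-x ^ 2 / 2)) := by
      refine (integrable_mul_exp_neg_mul_sq (b := 1 / 2) (by norm_num)).congr
        (ae_of_all _ fun x => ?_)
      dsimp only; congr 2; ring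
    have := integral_Ioi_of_hasDerivAt_of_tendsto' (a := w) (m := 0)
      (f := fun x => -exp (-x ^ 2 / 2)) (f' := fun x => x * exp (-x ^ 2 / 2)) ?_
      hint.integrableOn ?_
    · rw [this]; ring
    · intro x _
      have h := ((((hasDerivAt_id x).pow 2).neg.div_const 2).exp).neg
      refine h.congr_deriv ?_
      simp; ring
    · rw [show (0 : ℝ) = -0 by simp]
      apply Tendsto.neg
      apply tendsto_exp_atBot.comp
      have h2 : Tendsto (fun x : ℝ => x ^ 2) atTop atTop := tendsto_pow_atTop (by norm_num)
      have h3 := (h2.atTop_div_const (r := 2) (by norm_num))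
      have h4 := tendsto_neg_atTop_atBot.comp h3
      refine h4.congr fun x => ?_
      simp; ring
  have h2 : w * gtail w ≤ exp (-w ^ 2 / 2) := by
    rw [← h1, gtail, ← integral_const_mul]
    refine setIntegral_mono_on (integrable_gauss.const_mul _).integrableOn ?_ measurableSet_Ioi ?_
    · refine ((integrable_mul_exp_neg_mul_sq (b := 1 / 2) (by norm_num)).congr
        (ae_of_all _ fun x => ?_)).integrableOn
      dsimp only; congr 2; ring
    · intro y hy
      exact mul_le_mul_of_nonneg_right (le_of_lt hy) (exp_pos _).le
  calc w * (exp (w ^ 2 / 2) * gtail w) = exp (w ^ 2 / 2) * (w * gtail w) := by ring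
    _ ≤ exp (w ^ 2 / 2) * exp (-w ^ 2 / 2) := by gcongr
    _ = 1 := by rw [← exp_add]; simp; ring

lemma integral_gaussianReal_eq (h : ℝ → ℝ) :
    ∫ x, h x ∂(gaussianReal 0 1) = (√(2 * π))⁻¹ * ∫ x, h x * exp (-x ^ 2 / 2) := by
  rw [integral_gaussianReal_eq_integral_smul (by norm_num), ← integral_const_mul]
  congr 1; ext x
  simp [gaussianPDFReal]
  ring

/-- The bounded solution `f` of the Stein equation `f' (w) = w f (w) + h w - c`, where `c` is the
standard normal mean of `h`. -/
noncomputable def steinSol (h : ℝ → ℝ) (c w : ℝ) : ℝ :=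
  exp (w ^ 2 / 2) * ∫ x in Iic w, (h x - c) * exp (-x ^ 2 / 2)

/-- The derivative of `steinSol h c`. -/
noncomputable def steinDer (h : ℝ → ℝ) (c w : ℝ) : ℝ := w * steinSol h c w + (h w - c)

variable {h : ℝ → ℝ} {c : ℝ}

/-- Test functions for the Stein equation: continuous, with values in `[0, 1]`, and with standard
normal mean `c`. -/
structure SteinTest (h : ℝ → ℝ) (c : ℝ) : Prop where
  cont : Continuous h
  nonneg : ∀ x, 0 ≤ h x
  le_one : ∀ x, h x ≤ 1
  mean : ∫ x, h x ∂(gaussianReal 0 1) = c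

namespace SteinTest

lemma integrable (H : SteinTest h c) : Integrable (fun x => h x * exp (-x ^ 2 / 2)) := by
  refine integrable_gauss.bdd_mul (c := 1) H.cont.aestronglyMeasurable (ae_of_all _ fun x => ?_)
  rw [norm_eq_abs, abs_of_nonneg (H.nonneg x)]
  exact H.le_one x

lemma integrable_sub (H : SteinTest h c) :
    Integrable (fun x => (h x - c) * exp (-x ^ 2 / 2)) := by
  refine (H.integrable.sub (integrable_gauss.const_mul c)).congr (ae_of_all _ fun x => ?_)
  simp; ring

lemma mean_mul (H : SteinTest h c) : ∫ x, h x * exp (-x ^ 2 / 2) = √(2 * π) * c := by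
  rw [← H.mean, integral_gaussianReal_eq, ← mul_assoc, mul_inv_cancel₀, one_mul]
  positivity

lemma c_nonneg (H : SteinTest h c) : 0 ≤ c := by
  rw [← H.mean]; exact integral_nonneg H.nonneg

lemma integrable_gaussianReal (H : SteinTest h c) : Integrable h (gaussianReal 0 1) := by
  refine Integrable.of_bound (C := 1) H.cont.aestronglyMeasurable (ae_of_all _ fun x => ?_)
  rw [norm_eq_abs, abs_of_nonneg (H.nonneg x)]
  exact H.le_one x

lemma c_le_one (H : SteinTest h c) : c ≤ 1 := by
  rw [← H.mean]
  calc ∫ x, h x ∂(gaussianReal 0 1) ≤ ∫ _, (1 : ℝ) ∂(gaussianReal 0 1) :=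
        integral_mono H.integrable_gaussianReal (integrable_const _) H.le_one
    _ = 1 := by simp

lemma integral_eq_zero (H : SteinTest h c) : ∫ x, (h x - c) * exp (-x ^ 2 / 2) = 0 := by
  simp_rw [sub_mul]
  rw [integral_sub H.integrable (integrable_gauss.const_mul c), H.mean_mul, integral_const_mul,
    integral_gauss]
  ring

lemma abs_sub_le (H : SteinTest h c) (x : ℝ) : |h x - c| ≤ 1 := by
  rw [abs_le]
  constructor <;> linarith [H.nonneg x, H.le_one x, H.c_nonneg, H.c_le_one]

lemma integral_Iic_eq (H : SteinTest h c) (w : ℝ) :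
    ∫ x in Iic w, (h x - c) * exp (-x ^ 2 / 2) = -∫ x in Ioi w, (h x - c) * exp (-x ^ 2 / 2) := by
  have := intervalIntegral.integral_Iic_add_Ioi (b := w) H.integrable_sub.integrableOn
    H.integrable_sub.integrableOn
  rw [H.integral_eq_zero] at this
  linarith

lemma abs_integral_le (H : SteinTest h c) (s : Set ℝ) :
    |∫ x in s, (h x - c) * exp (-x ^ 2 / 2)| ≤ ∫ x in s, exp (-x ^ 2 / 2) := by
  refine (abs_integral_le_integral_abs).trans ?_
  refine integral_mono H.integrable_sub.abs.integrableOn integrable_gauss.integrableOn ?_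
  intro x
  dsimp only
  rw [abs_mul, abs_of_pos (exp_pos _)]
  exact mul_le_of_le_one_left (exp_pos _).le (H.abs_sub_le x)

lemma abs_steinSol_le' (H : SteinTest h c) (w : ℝ) :
    |steinSol h c w| ≤ exp (|w| ^ 2 / 2) * gtail |w| := by
  rw [steinSol, abs_mul, abs_of_pos (exp_pos _), sq_abs]
  gcongr
  rcases le_total 0 w with hw | hw
  · rw [H.integral_Iic_eq, abs_neg, abs_of_nonneg hw]
    exact H.abs_integral_le _
  · rw [abs_of_nonpos hw, ← integral_Iic_gauss]
    exact H.abs_integral_le _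

lemma abs_steinSol_le (H : SteinTest h c) (w : ℝ) : |steinSol h c w| ≤ 1.26 :=
  (H.abs_steinSol_le' w).trans (exp_mul_gtail_le (abs_nonneg w))

lemma abs_mul_steinSol_le (H : SteinTest h c) (w : ℝ) : |w * steinSol h c w| ≤ 1 := by
  rw [abs_mul]
  exact (mul_le_mul_of_nonneg_left (H.abs_steinSol_le' w) (abs_nonneg w)).trans
    (mul_exp_mul_gtail_le |w|)

lemma abs_steinDer_le (H : SteinTest h c) (w : ℝ) : |steinDer h c w| ≤ 2 := by
  refine (abs_add_le _ _).trans ?_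
  linarith [H.abs_mul_steinSol_le w, H.abs_sub_le w]

lemma hasDerivAt (H : SteinTest h c) (w : ℝ) :
    HasDerivAt (steinSol h c) (steinDer h c w) w := by
  have hc : Continuous (fun x => (h x - c) * exp (-x ^ 2 / 2)) := by
    have := H.cont; fun_prop
  have h1 : HasDerivAt (fun w => ∫ x in Iic w, (h x - c) * exp (-x ^ 2 / 2))
      ((h w - c) * exp (-w ^ 2 / 2)) w := by
    have h2 : (fun w => ∫ x in Iic w, (h x - c) * exp (-x ^ 2 / 2)) = fun w =>
        (∫ x in Iic (0 : ℝ), (h x - c) * exp (-x ^ 2 / 2)) +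
          ∫ x in (0 : ℝ)..w, (h x - c) * exp (-x ^ 2 / 2) := by
      ext w
      rw [← intervalIntegral.integral_Iic_sub_Iic H.integrable_sub.integrableOn
        H.integrable_sub.integrableOn]
      ring
    rw [h2]
    exact (intervalIntegral.integral_hasDerivAt_right (hc.intervalIntegrable _ _)
      (hc.stronglyMeasurableAtFilter _ _) hc.continuousAt).const_add _
  have h3 : HasDerivAt (fun w : ℝ => exp (w ^ 2 / 2)) (exp (w ^ 2 / 2) * w) w := by
    have h := (((hasDerivAt_id w).pow 2).div_const 2).exp
    refine h.congr_deriv ?_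
    simp
  refine (h3.mul h1).congr_deriv ?_
  rw [steinDer, steinSol]
  have : exp (w ^ 2 / 2) * exp (-w ^ 2 / 2) = 1 := by rw [← exp_add]; simp; ring
  linear_combination (h w - c) * this

lemma continuous_steinSol (H : SteinTest h c) : Continuous (steinSol h c) :=
  continuous_iff_continuousAt.2 fun w => (H.hasDerivAt w).continuousAt

lemma continuous_steinDer (H : SteinTest h c) : Continuous (steinDer h c) := by
  unfold steinDer
  have := H.continuous_steinSol
  have := H.cont
  fun_prop

/-- The regular part `w ↦ w f (w)` of `f'`. -/
lemma hasDerivAt_mul (H : SteinTest h c) (w : ℝ) :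
    HasDerivAt (fun w => w * steinSol h c w) (steinSol h c w + w * steinDer h c w) w := by
  have := (hasDerivAt_id w).mul (H.hasDerivAt w)
  refine this.congr_deriv ?_
  simp

lemma abs_deriv_mul_le (H : SteinTest h c) (w : ℝ) :
    |steinSol h c w + w * steinDer h c w| ≤ 1.26 + 2 * |w| := by
  refine (abs_add_le _ _).trans ?_
  rw [abs_mul]
  have := mul_le_mul_of_nonneg_left (H.abs_steinDer_le w) (abs_nonneg w)
  linarith [H.abs_steinSol_le w]

lemma steinSol_of_le {z : ℝ} (hz : ∀ x ≤ z, h x = 1) {w : ℝ} (hw : w ≤ z) :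
    steinSol h c w = (1 - c) * (exp (w ^ 2 / 2) * gtail (-w)) := by
  rw [steinSol, ← integral_Iic_gauss]
  have : ∫ x in Iic w, (h x - c) * exp (-x ^ 2 / 2) = ∫ x in Iic w, (1 - c) * exp (-x ^ 2 / 2) := by
    refine setIntegral_congr_fun measurableSet_Iic fun x hx => ?_
    rw [hz x (le_trans hx hw)]
  rw [this, integral_const_mul]
  ring

lemma one_sub_c_le (H : SteinTest h c) {z : ℝ} (hz0 : 0 ≤ z) (hz : ∀ x ≤ z, h x = 1) :
    1 - c ≤ exp (-z ^ 2 / 2) := by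
  have h1 : √(2 * π) * (1 - c) = ∫ x, (1 - h x) * exp (-x ^ 2 / 2) := by
    simp_rw [sub_mul, one_mul]
    rw [integral_sub integrable_gauss H.integrable, H.mean_mul, integral_gauss]; ring
  have h2 : ∫ x, (1 - h x) * exp (-x ^ 2 / 2) ≤ gtail z := by
    rw [gtail, ← integral_indicator measurableSet_Ioi]
    refine integral_mono ?_ (integrable_gauss.indicator measurableSet_Ioi) ?_
    · refine (integrable_gauss.sub H.integrable).congr (ae_of_all _ fun x => ?_)
      simp; ring
    · intro x
      by_cases hx : x ≤ z
      · rw [indicator_of_notMem (by simpa using hx)]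
        simp [hz x hx]
      · rw [indicator_of_mem (by simpa using hx)]
        exact mul_le_of_le_one_left (exp_pos _).le (by linarith [H.nonneg x])
  have h3 : gtail z ≤ 1.26 * exp (-z ^ 2 / 2) := by
    have := mul_le_mul_of_nonneg_left (exp_mul_gtail_le hz0) (exp_pos (-z ^ 2 / 2)).le
    rw [← mul_assoc, ← exp_add] at this
    rw [show -z ^ 2 / 2 + z ^ 2 / 2 = 0 by ring, exp_zero] at this
    linarith
  have h4 := sqrt_two_pi_bounds.1
  have h5 : 0 ≤ 1 - c := by linarith [H.c_le_one]
  nlinarith [exp_pos (-z ^ 2 / 2)]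

end SteinTest

lemma pow_mul_exp_le {z : ℝ} (hz : 0 ≤ z) : (1 + z) ^ 5 * exp (-(3 / 8) * z ^ 2) ≤ 3700 := by
  have h1 : (1 + z) ^ 5 ≤ 3700 * exp (3 / 8 * z ^ 2) := by
    have h2 := Real.pow_div_factorial_le_exp (x := 3 / 8 * z ^ 2) (by positivity) 3
    have h3 : (1 : ℝ) ≤ exp (3 / 8 * z ^ 2) := one_le_exp (by positivity)
    norm_num [Nat.factorial] at h2
    have h4 : (1 + z) ^ 5 ≤ 32 * (1 + z ^ 6) := by
      rcases le_total z 1 with h | h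
      · have : (1 + z) ^ 5 ≤ 2 ^ 5 := by gcongr; linarith
        have h6 : 0 ≤ z ^ 6 := by positivity
        linarith
      · have : (1 + z) ^ 5 ≤ (2 * z) ^ 5 := by gcongr; linarith
        have h6 : z ^ 5 * 1 ≤ z ^ 5 * z := by gcongr
        nlinarith
    have h5 : (3 / 8 * z ^ 2) ^ 3 = 27 / 512 * z ^ 6 := by ring
    rw [h5] at h2
    nlinarith
  calc (1 + z) ^ 5 * exp (-(3 / 8) * z ^ 2)
      ≤ 3700 * exp (3 / 8 * z ^ 2) * exp (-(3 / 8) * z ^ 2) := by gcongr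
    _ = 3700 := by rw [mul_assoc, ← exp_add]; simp

namespace SteinTest

variable {h : ℝ → ℝ} {c : ℝ}

/-- Away from the jump of `h` the Stein solution is superexponentially small: this is recorded as
a polynomial bound for `f'` and for the derivative of `w f (w)`. -/
lemma nonuniform (H : SteinTest h c) {z : ℝ} (hz : ∀ x ≤ z, h x = 1) (w : ℝ) :
    (1 + max z 0) ^ 3 * |steinDer h c w| ≤ 30000 * (1 + w ^ 4) ∧
    (1 + max z 0) ^ 3 * |steinSol h c w + w * steinDer h c w| ≤ 30000 * (1 + w ^ 4) := by
  set b := 1.26 + 2 * |w| with hb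
  have hb4 : (1 + 2 * |w|) ^ 4 ≤ 8 * (1 + 16 * w ^ 4) := by
    have : |w| ^ 4 = w ^ 4 := by rw [← abs_pow]; exact abs_of_nonneg (by positivity)
    have := add_pow_le (zero_le_one' ℝ) (by positivity : 0 ≤ 2 * |w|) 4
    norm_num [mul_pow] at this
    linarith
  have hd := H.abs_steinDer_le w
  have hg := H.abs_deriv_mul_le w
  have hw4 : 0 ≤ w ^ 4 := by positivity
  have hbw : b ≤ 4 * (1 + w ^ 4) := by
    have : |w| ^ 4 = w ^ 4 := by rw [← abs_pow]; exact abs_of_nonneg (by positivity)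
    nlinarith [sq_nonneg (|w| - 1), sq_nonneg (|w| ^ 2 - 1)]
  rcases le_or_gt z 0 with hz0 | hz0
  · rw [max_eq_right hz0]
    constructor <;> nlinarith
  rw [max_eq_left hz0.le]
  rcases lt_or_ge (z / 2) w with hw | hw
  · have h0 : 0 < w := by linarith
    rw [abs_of_pos h0] at hb4 hb hg
    have h1 : (1 + z) ^ 3 ≤ (1 + 2 * w) ^ 3 := by gcongr; linarith
    have h2 : (1 + 2 * w) ^ 3 ≤ (1 + 2 * w) ^ 4 := by
      rw [pow_succ _ 3]
      exact le_mul_of_one_le_right (by positivity) (by linarith)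
    constructor
    · calc (1 + z) ^ 3 * |steinDer h c w| ≤ (1 + 2 * w) ^ 4 * 2 := by
            gcongr; exact h1.trans h2
        _ ≤ _ := by nlinarith
    · calc (1 + z) ^ 3 * |steinSol h c w + w * steinDer h c w|
          ≤ (1 + 2 * w) ^ 3 * (1.26 * (1 + 2 * w)) := by
            gcongr; linarith
        _ = 1.26 * (1 + 2 * w) ^ 4 := by ring
        _ ≤ _ := by nlinarith
  · set q := 1 - c with hq
    have hq0 : 0 ≤ q := by linarith [H.c_le_one]
    have hqz : q ≤ exp (-z ^ 2 / 2) := H.one_sub_c_le hz0.le hz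
    set E := exp (-(3 / 8) * z ^ 2) with hE
    have hEz : q ≤ E := hqz.trans (exp_le_exp.2 (by nlinarith))
    have hP := pow_mul_exp_le hz0.le
    have hf := steinSol_of_le (c := c) hz (by linarith : w ≤ z)
    -- both `f` and `w f` are at most `3 (1 + z) E` on this range
    have hfE : |steinSol h c w| ≤ 3 * E ∧ |w * steinSol h c w| ≤ 3 * (1 + z) * E := by
      have hT0 : 0 ≤ exp (w ^ 2 / 2) * gtail (-w) := mul_nonneg (exp_pos _).le (gtail_nonneg _)
      rcases le_total w 0 with hw0 | hw0
      · have e1 := exp_mul_gtail_le (w := -w) (by linarith)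
        have e2 := mul_exp_mul_gtail_le (-w)
        rw [neg_sq] at e1 e2
        rw [abs_mul, hf, abs_mul, abs_of_nonneg hq0, abs_of_nonneg hT0, abs_of_nonpos hw0]
        refine ⟨by nlinarith, ?_⟩
        calc -w * (q * (exp (w ^ 2 / 2) * gtail (-w)))
            = q * (-w * (exp (w ^ 2 / 2) * gtail (-w))) := by ring
          _ ≤ E * 1 := by
            apply mul_le_mul hEz e2 _ (exp_pos _).le
            exact mul_nonneg (by linarith) hT0
          _ ≤ _ := by nlinarith [exp_pos (-(3 / 8) * z ^ 2)]
      · have e1 : exp (w ^ 2 / 2) * gtail (-w) ≤ exp (z ^ 2 / 8) * 2.52 := by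
          apply mul_le_mul _ (gtail_le_full _) (gtail_nonneg _) (exp_pos _).le
          apply exp_le_exp.2; nlinarith
        have e2 : q * (exp (w ^ 2 / 2) * gtail (-w)) ≤ 2.52 * E := by
          calc q * (exp (w ^ 2 / 2) * gtail (-w))
              ≤ exp (-z ^ 2 / 2) * (exp (z ^ 2 / 8) * 2.52) := by
                apply mul_le_mul hqz e1 hT0 (exp_pos _).le
            _ = 2.52 * E := by
                rw [← mul_assoc, ← exp_add, hE, mul_comm]; congr 2; ring
        rw [abs_mul, hf, abs_mul, abs_of_nonneg hq0, abs_of_nonneg hT0, abs_of_nonneg hw0]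
        have hE0 : 0 < E := exp_pos _
        refine ⟨by linarith, ?_⟩
        calc w * (q * (exp (w ^ 2 / 2) * gtail (-w))) ≤ (1 + z) * (2.52 * E) := by
              apply mul_le_mul (by linarith) e2 (mul_nonneg hq0 hT0) (by linarith)
          _ ≤ _ := by nlinarith
    have hE0 : 0 < E := exp_pos _
    have hder : |steinDer h c w| ≤ 4 * (1 + z) * E := by
      rw [steinDer, hz w (by linarith)]
      refine (abs_add_le _ _).trans ?_
      rw [← hq, abs_of_nonneg hq0]
      nlinarith [hfE.2]
    have h5 : (1 + z) ^ 4 * E ≤ 3700 := by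
      refine le_trans ?_ hP
      gcongr ?_ * E
      exact pow_le_pow_right₀ (by linarith) (by norm_num)
    refine ⟨?_, ?_⟩
    · calc (1 + z) ^ 3 * |steinDer h c w| ≤ (1 + z) ^ 3 * (4 * (1 + z) * E) := by gcongr
        _ = 4 * ((1 + z) ^ 4 * E) := by ring
        _ ≤ _ := by linarith
    · have h6 : |steinSol h c w + w * steinDer h c w| ≤ 4 * (1 + z) * E * (1 + |w|) := by
        refine (abs_add_le _ _).trans ?_
        rw [abs_mul]
        have := mul_le_mul_of_nonneg_left hder (abs_nonneg w)
        nlinarith [hfE.1]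
      have h7 : 1 + |w| ≤ 2 * (1 + w ^ 4) := by
        have : |w| ^ 4 = w ^ 4 := by rw [← abs_pow]; exact abs_of_nonneg (by positivity)
        nlinarith [sq_nonneg (|w| - 1), sq_nonneg (|w| ^ 2 - 1)]
      calc (1 + z) ^ 3 * |steinSol h c w + w * steinDer h c w|
          ≤ (1 + z) ^ 3 * (4 * (1 + z) * E * (1 + |w|)) := by gcongr
        _ = 4 * ((1 + z) ^ 4 * E) * (1 + |w|) := by ring
        _ ≤ 4 * 3700 * (2 * (1 + w ^ 4)) := by gcongr
        _ ≤ _ := by nlinarith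

end SteinTest

end Stein

/-! ### Ramp, trapezoid and kernel functions -/

section Ramp

open Real Set Filter Topology

/-- The indicator function of the interval `[x, x + a]`. -/
noncomputable def ivl (x a v : ℝ) : ℝ := if x ≤ v ∧ v ≤ x + a then 1 else 0

lemma ivl_nonneg (x a v : ℝ) : 0 ≤ ivl x a v := by unfold ivl; split_ifs <;> norm_num

lemma ivl_le_one (x a v : ℝ) : ivl x a v ≤ 1 := by unfold ivl; split_ifs <;> norm_num

lemma ivl_add (x a v t : ℝ) : ivl x a (v + t) = ivl (x - t) a v := by
  unfold ivl
  congr 1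
  rw [eq_iff_iff]
  constructor <;> rintro ⟨h1, h2⟩ <;> constructor <;> linarith

@[fun_prop]
lemma measurable_ivl (x a : ℝ) : Measurable (ivl x a) :=
  Measurable.ite (measurableSet_Icc (a := x) (b := x + a)) measurable_const measurable_const

/-- The continuous function equal to `1` up to `z`, to `0` from `z + a` on, and linear between. -/
noncomputable def ramp (z a w : ℝ) : ℝ := max 0 (min 1 ((z + a - w) / a))

variable {z a : ℝ}

lemma ramp_nonneg (z a w : ℝ) : 0 ≤ ramp z a w := le_max_left _ _

lemma ramp_le_one (z a w : ℝ) : ramp z a w ≤ 1 := max_le zero_le_one (min_le_left _ _)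

lemma ramp_of_le (ha : 0 < a) {w : ℝ} (hw : w ≤ z) : ramp z a w = 1 := by
  have : 1 ≤ (z + a - w) / a := by rw [le_div_iff₀ ha]; linarith
  rw [ramp, min_eq_left this]; norm_num

lemma ramp_of_ge (ha : 0 < a) {w : ℝ} (hw : z + a ≤ w) : ramp z a w = 0 := by
  have : (z + a - w) / a ≤ 0 := div_nonpos_of_nonpos_of_nonneg (by linarith) ha.le
  rw [ramp, min_eq_right (by linarith), max_eq_left this]

lemma continuous_ramp (z a : ℝ) : Continuous (ramp z a) := by
  unfold ramp; fun_prop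

lemma steinTest_ramp (z a : ℝ) :
    SteinTest (ramp z a) (∫ x, ramp z a x ∂(gaussianReal 0 1)) :=
  ⟨continuous_ramp z a, ramp_nonneg z a, ramp_le_one z a, rfl⟩

lemma ramp_eq_clamp (ha : 0 < a) (w : ℝ) : ramp z a w = (z + a - max z (min (z + a) w)) / a := by
  rcases le_total w z with h | h
  · rw [ramp_of_le ha h, min_eq_right (by linarith), max_eq_left h]
    field_simp; ring
  rcases le_total (z + a) w with h' | h'
  · rw [ramp_of_ge ha h', min_eq_left h', max_eq_right (by linarith)]; simp
  · rw [min_eq_right h', max_eq_right h, ramp, min_eq_right, max_eq_right]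
    · apply div_nonneg _ ha.le; linarith
    · rw [div_le_one ha]; linarith

/-- The oscillation of the ramp is controlled by the time spent in `[z, z + a]`. -/
lemma ramp_sub_le (ha : 0 < a) {U w x y : ℝ} (hU : U ≤ 1) (hx : |x - w| ≤ U) (hy : |y - w| ≤ U) :
    |ramp z a x - ramp z a y| ≤
      a⁻¹ * ∫ t in Icc (-1 : ℝ) 1, (if |t| ≤ U then 1 else 0) * ivl z a (w + t) := by
  wlog hxy : x ≤ y generalizing x y
  · rw [abs_sub_comm]; exact this hy hx (le_of_not_ge hxy)
  rw [abs_le] at hx hy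
  set X := max z (min (z + a) x)
  set Y := max z (min (z + a) y) with hY
  have hXY : X ≤ Y := max_le_max le_rfl (min_le_min le_rfl hxy)
  have h1 : |ramp z a x - ramp z a y| = a⁻¹ * (Y - X) := by
    rw [ramp_eq_clamp ha, ramp_eq_clamp ha, ← sub_div, abs_of_nonneg]
    · field_simp; ring
    · apply div_nonneg _ ha.le; linarith
  rw [h1]
  gcongr
  have h2 : ∀ t ∈ Ioc (X - w) (Y - w), t ∈ Icc (-1 : ℝ) 1 ∧
      (1 : ℝ) = (if |t| ≤ U then 1 else 0) * ivl z a (w + t) := by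
    rintro t ⟨ht1, ht2⟩
    have hYz : Y ≤ z + a := max_le (by linarith) (min_le_left _ _)
    have hXz : z ≤ X := le_max_left _ _
    have hXx : min (z + a) x ≤ X := le_max_right _ _
    have hYy : Y ≤ y := by
      rw [hY, max_le_iff]
      refine ⟨?_, min_le_right _ _⟩
      by_contra hc
      have : Y = z := by rw [hY, max_eq_left]; exact (min_le_right _ _).trans (not_le.1 hc).le
      linarith
    have hxX : x ≤ X := by
      rcases le_total (z + a) x with h | h
      · rw [min_eq_left h] at hXx; linarith
      · rwa [min_eq_right h] at hXx
    have ht : |t| ≤ U := by rw [abs_le]; constructor <;> linarith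
    refine ⟨abs_le.1 (ht.trans hU), ?_⟩
    rw [if_pos ht, ivl, if_pos ⟨by linarith, by linarith⟩, one_mul]
  have hm : Measurable (fun t : ℝ => (if |t| ≤ U then 1 else 0) * ivl z a (w + t)) := by
    apply Measurable.mul
    · exact Measurable.ite (measurableSet_le (by fun_prop) measurable_const) measurable_const
        measurable_const
    · fun_prop
  calc Y - X = ∫ t in Ioc (X - w) (Y - w), (1 : ℝ) := by
        simp [hXY]
    _ = ∫ t in Ioc (X - w) (Y - w), (if |t| ≤ U then 1 else 0) * ivl z a (w + t) :=
        setIntegral_congr_fun measurableSet_Ioc fun t ht => (h2 t ht).2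
    _ ≤ _ := by
        apply setIntegral_mono_set
        · apply Measure.integrableOn_of_bounded (M := 1) (by simp) hm.aestronglyMeasurable
          refine ae_of_all _ fun t => ?_
          rw [norm_mul]
          apply mul_le_one₀ _ (norm_nonneg _)
          · rw [norm_eq_abs, abs_of_nonneg (ivl_nonneg _ _ _)]; exact ivl_le_one _ _ _
          · split_ifs <;> simp
        · refine ae_of_all _ fun t => mul_nonneg ?_ (ivl_nonneg _ _ _)
          split_ifs <;> simp
        · exact LE.le.eventuallyLE fun t ht => (h2 t ht).1

lemma cdf_le_mean_ramp (ha : 0 < a) :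
    cdf (gaussianReal 0 1) z ≤ ∫ x, ramp z a x ∂(gaussianReal 0 1) := by
  rw [cdf_eq_real, ← integral_indicator_one measurableSet_Iic]
  refine integral_mono ((integrable_const 1).indicator measurableSet_Iic)
    (steinTest_ramp z a).integrable_gaussianReal fun x => ?_
  by_cases hx : x ≤ z
  · rw [indicator_of_mem (by simpa using hx), ramp_of_le ha hx]; rfl
  · rw [indicator_of_notMem (by simpa using hx)]; exact ramp_nonneg _ _ _

lemma mean_ramp_le_cdf (ha : 0 < a) :
    ∫ x, ramp z a x ∂(gaussianReal 0 1) ≤ cdf (gaussianReal 0 1) (z + a) := by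
  rw [cdf_eq_real, ← integral_indicator_one measurableSet_Iic]
  refine integral_mono (steinTest_ramp z a).integrable_gaussianReal
    ((integrable_const 1).indicator measurableSet_Iic) fun x => ?_
  by_cases hx : x ≤ z + a
  · rw [indicator_of_mem (by simpa using hx)]; exact ramp_le_one _ _ _
  · rw [indicator_of_notMem (by simpa using hx), ramp_of_ge ha (by linarith)]

lemma cdf_gaussian_eq (z : ℝ) :
    cdf (gaussianReal 0 1) z = (√(2 * π))⁻¹ * ∫ x in Iic z, exp (-x ^ 2 / 2) := by
  rw [cdf_eq_real, ← integral_indicator_one measurableSet_Iic, integral_gaussianReal_eq,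
    ← integral_indicator measurableSet_Iic]
  congr 2; ext x
  by_cases hx : x ≤ z <;> simp [hx]

lemma cdf_gaussian_sub_eq (z a : ℝ) :
    cdf (gaussianReal 0 1) (z + a) - cdf (gaussianReal 0 1) z =
      (√(2 * π))⁻¹ * ∫ x in z..(z + a), exp (-x ^ 2 / 2) := by
  rw [cdf_gaussian_eq, cdf_gaussian_eq, ← mul_sub, intervalIntegral.integral_Iic_sub_Iic
    integrable_gauss.integrableOn integrable_gauss.integrableOn]

lemma inv_sqrt_two_pi_le : (√(2 * π))⁻¹ ≤ 0.4 := by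
  have := sqrt_two_pi_bounds.1
  rw [inv_le_comm₀ (by linarith) (by norm_num)]
  norm_num at this ⊢; linarith

lemma cdf_gaussian_sub_le_of_bound (ha : 0 < a) {B : ℝ}
    (hB : ∀ x, z ≤ x → exp (-x ^ 2 / 2) ≤ B) :
    cdf (gaussianReal 0 1) (z + a) - cdf (gaussianReal 0 1) z ≤ 0.4 * (B * a) := by
  rw [cdf_gaussian_sub_eq]
  have h1 : ∫ x in z..(z + a), exp (-x ^ 2 / 2) ≤ ∫ _ in z..(z + a), B := by
    apply intervalIntegral.integral_mono_on (by linarith)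
    · exact integrable_gauss.intervalIntegrable
    · exact intervalIntegrable_const
    · intro x hx; exact hB x hx.1
  have h0 : 0 ≤ ∫ x in z..(z + a), exp (-x ^ 2 / 2) :=
    intervalIntegral.integral_nonneg (by linarith) fun _ _ => (exp_pos _).le
  simp at h1
  have := inv_sqrt_two_pi_le
  apply mul_le_mul this _ h0 (by norm_num)
  linarith

lemma cdf_gaussian_sub_le (ha : 0 < a) :
    cdf (gaussianReal 0 1) (z + a) - cdf (gaussianReal 0 1) z ≤ 0.4 * a := by
  have := cdf_gaussian_sub_le_of_bound (z := z) ha (B := 1) fun x _ =>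
    exp_le_one_iff.2 (by nlinarith [sq_nonneg x])
  linarith

lemma cdf_gaussian_sub_le_nonuniform (ha : 0 < a) :
    (1 + max z 0) ^ 3 * (cdf (gaussianReal 0 1) (z + a) - cdf (gaussianReal 0 1) z) ≤
      3700 * a := by
  rcases le_total z 0 with hz | hz
  · rw [max_eq_right hz]
    linarith [cdf_gaussian_sub_le (z := z) ha]
  · rw [max_eq_left hz]
    have h1 := cdf_gaussian_sub_le_of_bound (z := z) ha (B := exp (-(3 / 8) * z ^ 2)) fun x hx =>
      exp_le_exp.2 (by nlinarith)
    have h2 := pow_mul_exp_le hz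
    have h3 : (1 + z) ^ 3 ≤ (1 + z) ^ 5 := pow_le_pow_right₀ (by linarith) (by norm_num)
    calc _ ≤ (1 + z) ^ 3 * (0.4 * (exp (-(3 / 8) * z ^ 2) * a)) := by gcongr
      _ ≤ (1 + z) ^ 5 * (0.4 * (exp (-(3 / 8) * z ^ 2) * a)) := by gcongr
      _ = 0.4 * a * ((1 + z) ^ 5 * exp (-(3 / 8) * z ^ 2)) := by ring
      _ ≤ 0.4 * a * 3700 := by gcongr
      _ ≤ _ := by linarith

/-- The trapezoid equal to `1` on `[x, x + a]`, to `0` off `[x - a, x + 2 a]`, with slopes `a⁻¹`. -/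
noncomputable def trap (x a v : ℝ) : ℝ :=
  max 0 (min 1 (min ((v - (x - a)) / a) ((x + 2 * a - v) / a)))

lemma trap_nonneg (x a v : ℝ) : 0 ≤ trap x a v := le_max_left _ _

lemma trap_le_one (x a v : ℝ) : trap x a v ≤ 1 := max_le zero_le_one (min_le_left _ _)

@[fun_prop]
lemma continuous_trap (x a : ℝ) : Continuous (trap x a) := by unfold trap; fun_prop

lemma ivl_le_trap (ha : 0 < a) (x v : ℝ) : ivl x a v ≤ trap x a v := by
  unfold ivl
  split_ifs with h
  · have h1 : 1 ≤ (v - (x - a)) / a := by rw [le_div_iff₀ ha]; linarith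
    have h2 : 1 ≤ (x + 2 * a - v) / a := by rw [le_div_iff₀ ha]; linarith
    rw [trap]
    exact le_max_of_le_right (le_min le_rfl (le_min h1 h2))
  · exact trap_nonneg _ _ _

lemma trap_eq_zero (ha : 0 < a) {x v : ℝ} (h : v ≤ x - a ∨ x + 2 * a ≤ v) : trap x a v = 0 := by
  rw [trap, max_eq_left]
  refine (min_le_right _ _).trans ?_
  rcases h with h | h
  · exact (min_le_left _ _).trans (div_nonpos_of_nonpos_of_nonneg (by linarith) ha.le)
  · exact (min_le_right _ _).trans (div_nonpos_of_nonpos_of_nonneg (by linarith) ha.le)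

/-- The indicator function of three adjacent intervals, which cover the support of `trap x a`. -/
noncomputable def ivl3 (x a v : ℝ) : ℝ := ivl (x - a) a v + ivl x a v + ivl (x + a) a v

lemma ivl3_nonneg (x a v : ℝ) : 0 ≤ ivl3 x a v :=
  add_nonneg (add_nonneg (ivl_nonneg _ _ _) (ivl_nonneg _ _ _)) (ivl_nonneg _ _ _)

@[fun_prop]
lemma measurable_ivl3 (x a : ℝ) : Measurable (ivl3 x a) := by unfold ivl3; fun_prop

lemma trap_le_ivl3 (ha : 0 < a) (x v : ℝ) : trap x a v ≤ ivl3 x a v := by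
  by_cases h : v ≤ x - a ∨ x + 2 * a ≤ v
  · rw [trap_eq_zero ha h]; exact ivl3_nonneg _ _ _
  · push Not at h
    refine (trap_le_one _ _ _).trans ?_
    have h1 := ivl_nonneg (x - a) a v
    have h2 := ivl_nonneg x a v
    have h3 := ivl_nonneg (x + a) a v
    unfold ivl3
    rcases le_total v x with h4 | h4
    · have : ivl (x - a) a v = 1 := if_pos ⟨by linarith, by linarith⟩
      linarith
    rcases le_total v (x + a) with h5 | h5
    · have : ivl x a v = 1 := if_pos ⟨by linarith, by linarith⟩
      linarith
    · have : ivl (x + a) a v = 1 := if_pos ⟨by linarith, by linarith⟩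
      linarith

lemma abs_trap_sub_le (ha : 0 < a) (x v w : ℝ) : |trap x a v - trap x a w| ≤ |v - w| / a := by
  unfold trap
  refine (abs_max_sub_max_le_max _ _ _ _).trans (max_le ?_ ?_)
  · simp; positivity
  refine (abs_min_sub_min_le_max _ _ _ _).trans (max_le ?_ ?_)
  · simp; positivity
  refine (abs_min_sub_min_le_max _ _ _ _).trans (max_le (le_of_eq ?_) (le_of_eq ?_))
  · rw [← sub_div, abs_div, abs_of_pos ha]; congr 2; ring
  · rw [← sub_div, abs_div, abs_of_pos ha, abs_sub_comm v w]; congr 2; ring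

lemma trap_shift_le (ha : 0 < a) (x v t : ℝ) :
    |trap x a (v + t) - trap x a v| ≤ min 1 (|t| / a) * (ivl3 x a (v + t) + ivl3 x a v) := by
  have h1 := trap_le_ivl3 ha x (v + t)
  have h2 := trap_le_ivl3 ha x v
  have h3 := abs_trap_sub_le ha x (v + t) v
  have h4 := trap_nonneg x a (v + t)
  have h5 := trap_nonneg x a v
  have h6 := trap_le_one x a (v + t)
  have h7 := trap_le_one x a v
  rw [add_sub_cancel_left] at h3
  have h8 : |trap x a (v + t) - trap x a v| ≤ 1 := by rw [abs_le]; constructor <;> linarith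
  have h9 := le_min h8 h3
  by_cases hz : trap x a (v + t) = 0 ∧ trap x a v = 0
  · rw [hz.1, hz.2, sub_zero, abs_zero]
    have := ivl3_nonneg x a (v + t)
    have := ivl3_nonneg x a v
    positivity
  · refine h9.trans (le_mul_of_one_le_right (by positivity) ?_)
    by_contra hc
    -- the number of covering intervals is an integer
    have hint : ∀ u, ivl3 x a u = 0 ∨ 1 ≤ ivl3 x a u := by
      intro u
      unfold ivl3 ivl
      split_ifs <;> norm_num
    rcases hint (v + t) with e | e <;> rcases hint v with e' | e' <;> try linarith
    exact hz ⟨by linarith, by linarith⟩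

/-- The primitive of `trap x a` which vanishes far to the left. -/
noncomputable def trapInt (x a v : ℝ) : ℝ := ∫ t in (x - a)..v, trap x a t

lemma hasDerivAt_trapInt (x a v : ℝ) : HasDerivAt (trapInt x a) (trap x a v) v :=
  intervalIntegral.integral_hasDerivAt_right ((continuous_trap x a).intervalIntegrable _ _)
    ((continuous_trap x a).stronglyMeasurableAtFilter _ _) (continuous_trap x a).continuousAt

@[fun_prop]
lemma continuous_trapInt (x a : ℝ) : Continuous (trapInt x a) :=
  continuous_iff_continuousAt.2 fun v => (hasDerivAt_trapInt x a v).continuousAt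

lemma trapInt_sub (x a v w : ℝ) :
    trapInt x a v - trapInt x a w = ∫ t in w..v, trap x a t :=
  intervalIntegral.integral_interval_sub_left ((continuous_trap x a).intervalIntegrable _ _)
    ((continuous_trap x a).intervalIntegrable _ _)

lemma trapInt_eq_zero (ha : 0 < a) {x v : ℝ} (h : v ≤ x - a) : trapInt x a v = 0 := by
  rw [trapInt, intervalIntegral.integral_symm, neg_eq_zero]
  rw [intervalIntegral.integral_congr (g := fun _ => 0)]
  · simp
  · intro t ht
    rw [uIcc_of_le h] at ht
    exact trap_eq_zero ha (Or.inl ht.2)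

lemma trapInt_nonneg (ha : 0 < a) (x v : ℝ) : 0 ≤ trapInt x a v := by
  rcases le_total v (x - a) with h | h
  · rw [trapInt_eq_zero ha h]
  · exact intervalIntegral.integral_nonneg (μ := volume) h fun t _ => trap_nonneg x a t

lemma integral_trap_le (ha : 0 < a) (x v w : ℝ) : ∫ t in v..w, trap x a t ≤ 3 * a := by
  have hint : Integrable ((Icc (x - a) (x + 2 * a)).indicator (fun _ : ℝ => (1 : ℝ))) :=
    (integrable_indicator_iff measurableSet_Icc).2 (by simp)
  have hle : ∀ t, trap x a t ≤ (Icc (x - a) (x + 2 * a)).indicator (fun _ : ℝ => (1 : ℝ)) t := by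
    intro t
    by_cases ht : t ∈ Icc (x - a) (x + 2 * a)
    · rw [indicator_of_mem ht]; exact trap_le_one _ _ _
    · rw [indicator_of_notMem ht, trap_eq_zero ha]
      rw [mem_Icc, not_and_or, not_le, not_le] at ht
      exact ht.imp le_of_lt le_of_lt
  rcases le_total v w with h | h
  · rw [intervalIntegral.integral_of_le h]
    calc ∫ t in Ioc v w, trap x a t
        ≤ ∫ t in Ioc v w, (Icc (x - a) (x + 2 * a)).indicator (fun _ : ℝ => (1 : ℝ)) t :=
          integral_mono ((continuous_trap x a).integrableOn_Ioc) hint.integrableOn hle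
      _ ≤ ∫ t, (Icc (x - a) (x + 2 * a)).indicator (fun _ : ℝ => (1 : ℝ)) t :=
          setIntegral_le_integral hint (ae_of_all _ fun t => indicator_nonneg (by simp) t)
      _ = 3 * a := by
          rw [integral_indicator measurableSet_Icc]
          simp
          rw [max_eq_left] <;> linarith
  · rw [intervalIntegral.integral_symm]
    have := intervalIntegral.integral_nonneg (μ := volume) h fun t _ => trap_nonneg x a t
    linarith

lemma trapInt_le (ha : 0 < a) (x v : ℝ) : trapInt x a v ≤ 3 * a := integral_trap_le ha x _ _

lemma abs_trapInt_sub_le (ha : 0 < a) (x v w : ℝ) :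
    |trapInt x a v - trapInt x a w| ≤ 3 * a := by
  have h1 := trapInt_le ha x v
  have h2 := trapInt_le ha x w
  have h3 := trapInt_nonneg ha x v
  have h4 := trapInt_nonneg ha x w
  rw [abs_le]; constructor <;> linarith

lemma integral_trap_shift_le (ha : 0 < a) (x v : ℝ) :
    ∫ t in Icc (-1 : ℝ) 1, trap x a (v + t) ≤ 3 * a := by
  rw [integral_Icc_eq_integral_Ioc, ← intervalIntegral.integral_of_le (by norm_num),
    intervalIntegral.integral_comp_add_left]
  exact integral_trap_le ha _ _ _

/-- The kernel which represents the increments of a function by its derivative: `±1` for `t`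
between `0` and `-y`. -/
noncomputable def incKer (y t : ℝ) : ℝ :=
  if -y ≤ t ∧ t < 0 then 1 else if 0 ≤ t ∧ t < -y then -1 else 0

lemma abs_incKer_le_one (y t : ℝ) : |incKer y t| ≤ 1 := by unfold incKer; split_ifs <;> norm_num

lemma incKer_sq (y t : ℝ) : incKer y t ^ 2 = |incKer y t| := by
  unfold incKer; split_ifs <;> norm_num

lemma abs_incKer_le_of_lt {y t : ℝ} (h : |y| < |t|) : incKer y t = 0 := by
  unfold incKer
  split_ifs with h1 h2
  · exfalso
    rw [abs_of_neg h1.2, abs_of_pos (by linarith)] at h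
    linarith
  · exfalso
    rw [abs_of_nonneg h2.1, abs_of_neg (by linarith)] at h
    linarith
  · rfl

@[fun_prop]
lemma measurable_incKer : Measurable (fun q : ℝ × ℝ => incKer q.1 q.2) := by
  unfold incKer
  have h1 : MeasurableSet {q : ℝ × ℝ | -q.1 ≤ q.2 ∧ q.2 < 0} :=
    (measurableSet_le measurable_fst.neg measurable_snd).inter
      (measurableSet_lt measurable_snd measurable_const)
  have h2 : MeasurableSet {q : ℝ × ℝ | 0 ≤ q.2 ∧ q.2 < -q.1} :=
    (measurableSet_le measurable_const measurable_snd).inter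
      (measurableSet_lt measurable_snd measurable_fst.neg)
  exact Measurable.ite h1 measurable_const (Measurable.ite h2 measurable_const measurable_const)

/-- Increments of a primitive as integrals of the derivative over all of `[-1, 1]`, so that
increments of random length can be summed under one integral. -/
lemma integral_incKer_mul {y : ℝ} (hy : |y| ≤ 1) (f : ℝ → ℝ) :
    ∫ t in Icc (-1 : ℝ) 1, f t * incKer y t = ∫ t in (-y)..0, f t := by
  rw [abs_le] at hy
  rcases le_total 0 y with h | h
  · have : ∀ t, f t * incKer y t = (Ico (-y) 0).indicator f t := by
      intro t
      unfold incKer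
      by_cases h1 : -y ≤ t ∧ t < 0
      · rw [if_pos h1, indicator_of_mem (show t ∈ Ico (-y) 0 from h1), mul_one]
      · rw [if_neg h1, indicator_of_notMem (show t ∉ Ico (-y) 0 from h1),
          if_neg (by rintro ⟨h2, h3⟩; linarith), mul_zero]
    simp_rw [this]
    rw [setIntegral_indicator measurableSet_Ico, intervalIntegral.integral_of_le (by linarith),
      integral_Ioc_eq_integral_Ioo, inter_eq_self_of_subset_right, integral_Ico_eq_integral_Ioo]
    intro t ht
    exact ⟨by linarith [ht.1], by linarith [ht.2]⟩
  · have : ∀ t, f t * incKer y t = -(Ico 0 (-y)).indicator f t := by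
      intro t
      unfold incKer
      by_cases h1 : 0 ≤ t ∧ t < -y
      · rw [if_neg (by rintro ⟨h2, h3⟩; linarith), if_pos h1,
          indicator_of_mem (show t ∈ Ico 0 (-y) from h1), mul_neg_one]
      · rw [if_neg (by rintro ⟨h2, h3⟩; linarith), if_neg h1,
          indicator_of_notMem (show t ∉ Ico 0 (-y) from h1), mul_zero,
          neg_zero]
    simp_rw [this]
    rw [integral_neg, setIntegral_indicator measurableSet_Ico, intervalIntegral.integral_symm,
      intervalIntegral.integral_of_le (by linarith),
      integral_Ioc_eq_integral_Ioo, inter_eq_self_of_subset_right, integral_Ico_eq_integral_Ioo]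
    intro t ht
    exact ⟨by linarith [ht.1], by linarith [ht.2]⟩

lemma integral_trap_mul_incKer {y : ℝ} (hy : |y| ≤ 1) (x a v : ℝ) :
    ∫ t in Icc (-1 : ℝ) 1, trap x a (v + t) * incKer y t = trapInt x a v - trapInt x a (v - y) := by
  rw [integral_incKer_mul hy (fun t => trap x a (v + t)), trapInt_sub,
    intervalIntegral.integral_comp_add_left]
  simp [sub_eq_add_neg]

lemma integral_incKer {y : ℝ} (hy : |y| ≤ 1) : ∫ t in Icc (-1 : ℝ) 1, incKer y t = y := by
  have := integral_incKer_mul hy (fun _ => 1)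
  simpa using this

lemma integrable_incKer (y : ℝ) : Integrable (incKer y) (volume.restrict (Icc (-1 : ℝ) 1)) := by
  apply Measure.integrableOn_of_bounded (M := 1) (by simp)
  · exact (measurable_incKer.comp (measurable_const.prodMk measurable_id)).aestronglyMeasurable
  · exact ae_of_all _ fun t => abs_incKer_le_one y t

lemma abs_incKer_eq {y : ℝ} (t : ℝ) : |incKer y t| = (if 0 ≤ y then 1 else -1) * incKer y t := by
  unfold incKer
  by_cases hy : 0 ≤ y
  · rw [if_pos hy]
    split_ifs with h1 h2 <;> norm_num
    linarith [h2.1, h2.2]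
  · rw [if_neg hy]
    split_ifs with h1 h2 <;> norm_num
    linarith [h1.1, h1.2]

lemma integral_abs_incKer {y : ℝ} (hy : |y| ≤ 1) : ∫ t in Icc (-1 : ℝ) 1, |incKer y t| = |y| := by
  simp_rw [abs_incKer_eq]
  rw [integral_const_mul, integral_incKer hy]
  split_ifs with h
  · rw [abs_of_nonneg h, one_mul]
  · rw [abs_of_neg (by linarith)]; ring

end Ramp

/-! ### Expansion of `E W f(W)` -/

/-- A centred, square integrable, locally dependent field whose neighbourhoods of radius at most
`5` have at most `κ` elements. -/
structure LocField {ι Ω : Type*} [PseudoMetricSpace ι] [MeasurableSpace Ω] (m κ : ℝ)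
    (J : Finset ι) (X : ι → Ω → ℝ) (μ : Measure Ω) : Prop extends MDep m J X μ where
  memLp : ∀ i ∈ J, MemLp (X i) 2 μ
  mean : ∀ i ∈ J, ∫ ω, X i ω ∂μ = 0
  card_le : ∀ i ∈ J, ((nbhd m J 5 i).card : ℝ) ≤ κ

namespace LocField

variable {ι Ω : Type*} [PseudoMetricSpace ι] [mΩ : MeasurableSpace Ω] {m κ : ℝ} {J : Finset ι}
  {X : ι → Ω → ℝ} {μ : Measure Ω} 

lemma memLp_psum (hX : LocField m κ J X μ) {A : Finset ι} (hA : A ⊆ J) :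
    MemLp (psum X A) 2 μ := by
  have := memLp_finsetSum (μ := μ) (p := 2) A (f := X) fun i hi => hX.memLp i (hA hi)
  exact this.ae_eq (ae_of_all _ fun ω => by simp [psum])

lemma memLp_asum (hX : LocField m κ J X μ) {A : Finset ι} (hA : A ⊆ J) :
    MemLp (asum X A) 2 μ := by
  have := memLp_finsetSum (μ := μ) (p := 2) A (f := fun i ω => |X i ω|)
    fun i hi => (hX.memLp i (hA hi)).abs
  exact this.ae_eq (ae_of_all _ fun ω => by simp [asum])

lemma integrable_mul (hX : LocField m κ J X μ) {i : ι} (hi : i ∈ J) (r : ℕ) :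
    Integrable (fun ω => X i ω * psum X (nbhd m J r i) ω) μ :=
  (hX.memLp i hi).integrable_mul (hX.memLp_psum (nbhd_subset r i))

variable [IsProbabilityMeasure μ]

lemma integrable (hX : LocField m κ J X μ) {i : ι} (hi : i ∈ J) : Integrable (X i) μ :=
  (hX.memLp i hi).integrable (by norm_num)

lemma integrable_psum (hX : LocField m κ J X μ) {A : Finset ι} (hA : A ⊆ J) :
    Integrable (psum X A) μ :=
  (hX.memLp_psum hA).integrable (by norm_num)

lemma integral_psum (hX : LocField m κ J X μ) {A : Finset ι} (hA : A ⊆ J) :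
    ∫ ω, psum X A ω ∂μ = 0 := by
  unfold psum
  rw [integral_finsetSum _ fun i hi => hX.integrable (hA hi)]
  exact Finset.sum_eq_zero fun i hi => hX.mean i (hA hi)

omit [IsProbabilityMeasure μ] in
/-- Only the neighbours of `i` contribute to the covariance of `X i` with a partial sum. -/
lemma integral_mul_psum (hX : LocField m κ J X μ) {i : ι} (hi : i ∈ J) {A : Finset ι}
    (hA : A ⊆ J) (h : nbhd m J 1 i ⊆ A) :
    ∫ ω, X i ω * psum X A ω ∂μ = ∫ ω, X i ω * psum X (nbhd m J 1 i) ω ∂μ := by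
  classical
  have h1 : ∀ ω, X i ω * psum X A ω =
      X i ω * psum X (nbhd m J 1 i) ω + X i ω * psum X (A \ nbhd m J 1 i) ω := by
    intro ω; rw [psum_sdiff h]; ring
  simp_rw [h1]
  have h2 : ∫ ω, X i ω * psum X (A \ nbhd m J 1 i) ω ∂μ = 0 := by
    rw [hX.integral_mul_nbhd (r := 0) (s := 1) rfl i
      (measurable_sigmaOf (self_mem_nbhd hX.m_nonneg 0 hi))
      (measurable_psum (Finset.sdiff_subset_sdiff hA le_rfl)), hX.mean i hi, zero_mul]
  have h3 : Integrable (fun ω => X i ω * psum X (A \ nbhd m J 1 i) ω) μ :=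
    (hX.memLp i hi).integrable_mul (hX.memLp_psum (Finset.sdiff_subset.trans hA))
  rw [integral_add (hX.integrable_mul hi 1) h3, h2, add_zero]

omit [IsProbabilityMeasure μ] in
lemma integral_sq_psum (hX : LocField m κ J X μ) :
    ∫ ω, psum X J ω ^ 2 ∂μ = ∑ i ∈ J, ∫ ω, X i ω * psum X (nbhd m J 1 i) ω ∂μ := by
  have h1 : ∀ ω, psum X J ω ^ 2 = ∑ i ∈ J, X i ω * psum X J ω := by
    intro ω; rw [sq, ← Finset.sum_mul]; rfl
  simp_rw [h1]
  rw [integral_finsetSum]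
  · exact Finset.sum_congr rfl fun i hi => hX.integral_mul_psum hi le_rfl (nbhd_subset 1 i)
  · exact fun i hi => (hX.memLp i hi).integrable_mul (hX.memLp_psum le_rfl)

omit [IsProbabilityMeasure μ] in
/-- If the derivative `f'` oscillates by at most `Θ i` at distances up to
`∑_{j near i} |X j|` from `W`, then `E W f(W)` is close to `Var(W) E f'(W)`. -/
theorem expand (hX : LocField m κ J X μ) {f f' : ℝ → ℝ} (hf : ∀ x, HasDerivAt f (f' x) x)
    (hf' : Measurable f') {Θ : ι → Ω → ℝ}
    (hΘ : ∀ i ∈ J, ∀ ω, ∀ a b, |a - psum X J ω| ≤ asum X (nbhd m J 2 i) ω →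
      |b - psum X J ω| ≤ asum X (nbhd m J 2 i) ω → |a - b| ≤ asum X (nbhd m J 2 i) ω →
      |f' a - f' b| ≤ Θ i ω)
    (h1 : ∀ i ∈ J, Integrable (fun ω => X i ω * f (psum X J ω)) μ)
    (h2 : ∀ i ∈ J, Integrable
      (fun ω => X i ω * f (psum X J ω - psum X (nbhd m J 1 i) ω)) μ)
    (h3 : ∀ i ∈ J, Integrable (fun ω => f' (psum X J ω - psum X (nbhd m J 2 i) ω)) μ)
    (h4 : Integrable (fun ω => f' (psum X J ω)) μ)
    (h5 : ∀ i ∈ J, Integrable (Θ i) μ)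
    (h6 : ∀ i ∈ J, Integrable (fun ω => |X i ω * psum X (nbhd m J 1 i) ω| * Θ i ω) μ) :
    |∫ ω, psum X J ω * f (psum X J ω) ∂μ - (∫ ω, psum X J ω ^ 2 ∂μ) * ∫ ω, f' (psum X J ω) ∂μ| ≤
      ∑ i ∈ J, (∫ ω, |X i ω * psum X (nbhd m J 1 i) ω| * Θ i ω ∂μ +
        (∫ ω, |X i ω * psum X (nbhd m J 1 i) ω| ∂μ) * ∫ ω, Θ i ω ∂μ) := by
  classical
  have hfc : Continuous f := continuous_iff_continuousAt.2 fun x => (hf x).continuousAt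
  have e1 : ∫ ω, psum X J ω * f (psum X J ω) ∂μ = ∑ i ∈ J, ∫ ω, X i ω * f (psum X J ω) ∂μ := by
    rw [← integral_finsetSum _ h1]
    congr 1; ext ω; rw [← Finset.sum_mul]; rfl
  rw [e1, hX.integral_sq_psum, Finset.sum_mul, ← Finset.sum_sub_distrib]
  refine (Finset.abs_sum_le_sum_abs _ _).trans (Finset.sum_le_sum fun i hi => ?_)
  set W := psum X J
  set Y := psum X (nbhd m J 1 i)
  set Z := psum X (nbhd m J 2 i)
  have hm0 := hX.m_nonneg
  -- the leading term vanishes by independence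
  have e2 : ∫ ω, X i ω * f (W ω - Y ω) ∂μ = 0 := by
    have := hX.integral_mul_nbhd (r := 0) (s := 1) rfl i (u := X i)
      (v := fun ω => f (W ω - Y ω)) (measurable_sigmaOf (self_mem_nbhd hm0 0 hi))
      (hfc.measurable.comp (measurable_psum_sub (nbhd_subset 1 i)))
    rw [this, hX.mean i hi, zero_mul]
  have hXYm : Measurable[sigmaOf X (nbhd m J 1 i)] (fun ω => X i ω * Y ω) :=
    (measurable_sigmaOf (self_mem_nbhd hm0 1 hi)).mul (measurable_psum le_rfl)
  have hWZ : Measurable[sigmaOf X (J \ nbhd m J 2 i)] (fun ω => f' (W ω - Z ω)) :=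
    hf'.comp (measurable_psum_sub (nbhd_subset 2 i))
  have e3 : ∫ ω, (X i ω * Y ω) * f' (W ω - Z ω) ∂μ =
      (∫ ω, X i ω * Y ω ∂μ) * ∫ ω, f' (W ω - Z ω) ∂μ :=
    hX.integral_mul_nbhd rfl i hXYm hWZ
  have i3 : Integrable (fun ω => (X i ω * Y ω) * f' (W ω - Z ω)) μ :=
    hX.integrable_mul_nbhd rfl i hXYm hWZ (hX.integrable_mul hi 1) (h3 i hi)
  have hYV : ∀ ω, |Y ω| ≤ asum X (nbhd m J 2 i) ω := fun ω =>
    abs_psum_le (nbhd_mono hm0 (by norm_num) i) ω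
  have hZV : ∀ ω, |Z ω| ≤ asum X (nbhd m J 2 i) ω := fun ω => abs_psum_le le_rfl ω
  have hZY : ∀ ω, |Z ω - Y ω| ≤ asum X (nbhd m J 2 i) ω := fun ω => by
    rw [← psum_sdiff (nbhd_mono hm0 (by norm_num) i)]
    exact abs_psum_le Finset.sdiff_subset ω
  have hV0 : ∀ ω, 0 ≤ asum X (nbhd m J 2 i) ω := fun ω => asum_nonneg _ _
  have e4 : ∀ ω, |X i ω * f (W ω) - X i ω * f (W ω - Y ω) - X i ω * Y ω * f' (W ω - Z ω)| ≤
      |X i ω * Y ω| * Θ i ω := by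
    intro ω
    set V := asum X (nbhd m J 2 i) ω
    set c := f' (W ω - Z ω)
    have hmv := Convex.norm_image_sub_le_of_norm_hasDerivWithin_le
      (s := Set.Icc (W ω - V) (W ω + V) ∩ Set.Icc (W ω - Z ω - V) (W ω - Z ω + V))
      (f := fun x => f x - x * c) (f' := fun x => f' x - c)
      (x := W ω - Y ω) (y := W ω) (C := Θ i ω) ?_ ?_ ((convex_Icc _ _).inter (convex_Icc _ _)) ?_ ?_
    · rw [Real.norm_eq_abs, Real.norm_eq_abs, sub_sub_cancel] at hmv
      have : X i ω * f (W ω) - X i ω * f (W ω - Y ω) - X i ω * Y ω * c =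
          X i ω * (f (W ω) - W ω * c - (f (W ω - Y ω) - (W ω - Y ω) * c)) := by ring
      rw [this, abs_mul, abs_mul]
      calc _ ≤ |X i ω| * (Θ i ω * |Y ω|) := by gcongr
        _ = _ := by ring
    · intro x _
      have := ((hf x).sub ((hasDerivAt_id x).mul_const c)).hasDerivWithinAt
        (s := Set.Icc (W ω - V) (W ω + V) ∩ Set.Icc (W ω - Z ω - V) (W ω - Z ω + V))
      exact this.congr_deriv (by simp)
    · intro x hx
      obtain ⟨⟨hx1, hx2⟩, hx3, hx4⟩ := hx
      refine hΘ i hi ω _ _ ?_ ?_ ?_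
      · rw [abs_le]; constructor <;> linarith
      · rw [sub_sub_cancel_left, abs_neg]; exact hZV ω
      · rw [abs_le]; constructor <;> linarith
    · have h1 := abs_le.1 (hYV ω)
      have h2 := abs_le.1 (hZY ω)
      exact ⟨⟨by linarith, by linarith⟩, by linarith, by linarith⟩
    · have h1 := hV0 ω
      have h2 := abs_le.1 (hZV ω)
      exact ⟨⟨by linarith, by linarith⟩, by linarith, by linarith⟩
  have e5 : |∫ ω, X i ω * f (W ω) ∂μ - (∫ ω, X i ω * Y ω ∂μ) * ∫ ω, f' (W ω - Z ω) ∂μ| ≤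
      ∫ ω, |X i ω * Y ω| * Θ i ω ∂μ := by
    have : ∫ ω, X i ω * f (W ω) ∂μ - (∫ ω, X i ω * Y ω ∂μ) * ∫ ω, f' (W ω - Z ω) ∂μ =
        ∫ ω, (X i ω * f (W ω) - X i ω * f (W ω - Y ω) - X i ω * Y ω * f' (W ω - Z ω)) ∂μ := by
      have i12 : Integrable (fun ω => X i ω * f (W ω) - X i ω * f (W ω - Y ω)) μ :=
        (h1 i hi).sub (h2 i hi)
      rw [integral_sub i12 i3, integral_sub (h1 i hi) (h2 i hi), e2, e3, sub_zero]
    rw [this]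
    exact abs_integral_le_integral_abs.trans
      (integral_mono (((h1 i hi).sub (h2 i hi)).sub i3).abs (h6 i hi) e4)
  have e6 : |∫ ω, f' (W ω - Z ω) ∂μ - ∫ ω, f' (W ω) ∂μ| ≤ ∫ ω, Θ i ω ∂μ := by
    rw [← integral_sub (h3 i hi) h4]
    refine abs_integral_le_integral_abs.trans
      (integral_mono ((h3 i hi).sub h4).abs (h5 i hi) fun ω => ?_)
    refine hΘ i hi ω _ _ ?_ ?_ ?_
    · rw [sub_sub_cancel_left, abs_neg]; exact hZV ω
    · simpa using hV0 ω
    · rw [sub_sub_cancel_left, abs_neg]; exact hZV ω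
  have e7 : |∫ ω, X i ω * Y ω ∂μ| ≤ ∫ ω, |X i ω * Y ω| ∂μ := abs_integral_le_integral_abs
  calc |∫ ω, X i ω * f (W ω) ∂μ - (∫ ω, X i ω * Y ω ∂μ) * ∫ ω, f' (W ω) ∂μ|
      = |(∫ ω, X i ω * f (W ω) ∂μ - (∫ ω, X i ω * Y ω ∂μ) * ∫ ω, f' (W ω - Z ω) ∂μ) +
        (∫ ω, X i ω * Y ω ∂μ) * (∫ ω, f' (W ω - Z ω) ∂μ - ∫ ω, f' (W ω) ∂μ)| := by
        congr 1; ring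
    _ ≤ _ := by
        refine (abs_add_le _ _).trans (add_le_add e5 ?_)
        rw [abs_mul]
        exact mul_le_mul e7 e6 (abs_nonneg _) ((abs_nonneg _).trans e7)

end LocField

/-! ### The concentration inequality -/

section Kernel

open Set

/-- The contribution of the index `j` to the (random, truncated) Stein kernel. -/
noncomputable def kterm {ι Ω : Type*} [PseudoMetricSpace ι] (m : ℝ) (J : Finset ι)
    (X : ι → Ω → ℝ) (j : ι) (t : ℝ) (ω : Ω) : ℝ :=
  X j ω * (if |psum X (nbhd m J 1 j) ω| ≤ 1 then incKer (psum X (nbhd m J 1 j) ω) t else 0)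

/-- The random Stein kernel of the indices in `G`. -/
noncomputable def ksum {ι Ω : Type*} [PseudoMetricSpace ι] (m : ℝ) (J : Finset ι)
    (X : ι → Ω → ℝ) (G : Finset ι) (t : ℝ) (ω : Ω) : ℝ := ∑ j ∈ G, kterm m J X j t ω

/-- Lebesgue measure on `[-1, 1]`. -/
noncomputable def unitLeb : Measure ℝ := volume.restrict (Icc (-1 : ℝ) 1)

instance : IsFiniteMeasure unitLeb := by unfold unitLeb; infer_instance

variable {ι Ω : Type*} [PseudoMetricSpace ι] {m κ : ℝ} {J : Finset ι} {X : ι → Ω → ℝ}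

lemma abs_kterm_le (j : ι) (t : ℝ) (ω : Ω) : |kterm m J X j t ω| ≤ |X j ω| := by
  rw [kterm, abs_mul]
  apply mul_le_of_le_one_right (abs_nonneg _)
  split_ifs
  · exact abs_incKer_le_one _ _
  · simp

lemma abs_ksum_le (G : Finset ι) (t : ℝ) (ω : Ω) : |ksum m J X G t ω| ≤ asum X G ω :=
  (Finset.abs_sum_le_sum_abs _ _).trans (Finset.sum_le_sum fun j _ => abs_kterm_le j t ω)

lemma measurable_kterm (hm : 0 ≤ m) {j : ι} (hj : j ∈ J) (t : ℝ) :
    Measurable[sigmaOf X (nbhd m J 1 j)] (kterm m J X j t) := by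
  have h1 : Measurable[sigmaOf X (nbhd m J 1 j)] (psum X (nbhd m J 1 j)) := measurable_psum le_rfl
  have h2 : Measurable (fun y : ℝ => if |y| ≤ 1 then incKer y t else 0) := by
    refine Measurable.ite (measurableSet_le (by fun_prop) measurable_const) ?_ measurable_const
    exact measurable_incKer.comp (measurable_id.prodMk measurable_const)
  exact (measurable_sigmaOf (self_mem_nbhd hm 1 hj)).mul (h2.comp h1)

variable [mΩ : MeasurableSpace Ω] {μ : Measure Ω}

lemma MDep.measurable_kterm_uncurry (hX : MDep m J X μ) {j : ι} (hj : j ∈ J) :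
    Measurable (fun q : Ω × ℝ => kterm m J X j q.2 q.1) := by
  have h1 : Measurable (psum X (nbhd m J 1 j)) := hX.measurable_psum (nbhd_subset 1 j)
  unfold kterm
  refine ((hX.meas j hj).comp measurable_fst).mul ?_
  refine Measurable.ite (measurableSet_le ?_ measurable_const) ?_ measurable_const
  · exact (measurable_norm.comp h1).comp measurable_fst
  · exact measurable_incKer.comp ((h1.comp measurable_fst).prodMk measurable_snd)

lemma MDep.measurable_ksum_uncurry (hX : MDep m J X μ) {G : Finset ι} (hG : G ⊆ J) :
    Measurable (fun q : Ω × ℝ => ksum m J X G q.2 q.1) := by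
  unfold ksum
  exact Finset.measurable_fun_sum G fun j hj => hX.measurable_kterm_uncurry (hG hj)

lemma MDep.measurable_ksum (hX : MDep m J X μ) {G : Finset ι} (hG : G ⊆ J) (t : ℝ) :
    Measurable (ksum m J X G t) :=
  (hX.measurable_ksum_uncurry hG).comp (measurable_id.prodMk measurable_const)

variable [IsProbabilityMeasure μ]

/-- The mean of `ksum`. -/
noncomputable def kmean (m : ℝ) (J : Finset ι) (X : ι → Ω → ℝ) (μ : Measure Ω) (G : Finset ι)
    (t : ℝ) : ℝ := ∫ ω, ksum m J X G t ω ∂μ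

lemma MDep.measurable_kmean (hX : MDep m J X μ) {G : Finset ι} (hG : G ⊆ J) :
    Measurable (kmean m J X μ G) := by
  unfold kmean
  exact ((hX.measurable_ksum_uncurry hG).comp
    measurable_swap).stronglyMeasurable.integral_prod_right'.measurable

omit [IsProbabilityMeasure μ] in
/-- A measurable function on `Ω × [-1, 1]` dominated by an integrable function on `Ω`. -/
lemma integrable_prod_of_bound {F : Ω × ℝ → ℝ} (hF : Measurable F) {g : Ω → ℝ}
    (hg : Integrable g μ) (h : ∀ ω t, |F (ω, t)| ≤ g ω) :
    Integrable F (μ.prod unitLeb) := by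
  have hg' : Integrable (fun q : Ω × ℝ => g q.1) (μ.prod unitLeb) := hg.comp_fst unitLeb
  exact hg'.mono' hF.aestronglyMeasurable (ae_of_all _ fun q => h q.1 q.2)

namespace LocField

lemma integrable_kterm (hX : LocField m κ J X μ) {j : ι} (hj : j ∈ J) (t : ℝ) :
    Integrable (kterm m J X j t) μ := by
  refine (hX.integrable hj).abs.mono' ?_ (ae_of_all _ fun ω => abs_kterm_le j t ω)
  exact ((measurable_kterm hX.m_nonneg hj t).mono (hX.sigmaOf_le (nbhd_subset 1 j))
    le_rfl).aestronglyMeasurable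

lemma integrable_asum (hX : LocField m κ J X μ) {A : Finset ι} (hA : A ⊆ J) :
    Integrable (asum X A) μ := (hX.memLp_asum hA).integrable (by norm_num)

lemma integrable_ksum (hX : LocField m κ J X μ) {G : Finset ι} (hG : G ⊆ J) (t : ℝ) :
    Integrable (ksum m J X G t) μ :=
  (hX.integrable_asum hG).mono' (hX.measurable_ksum hG t).aestronglyMeasurable
    (ae_of_all _ fun ω => abs_ksum_le G t ω)

lemma abs_kmean_le (hX : LocField m κ J X μ) {G : Finset ι} (hG : G ⊆ J) (t : ℝ) :
    |kmean m J X μ G t| ≤ ∫ ω, asum X G ω ∂μ :=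
  abs_integral_le_integral_abs.trans (integral_mono (hX.integrable_ksum hG t).abs
    (hX.integrable_asum hG) fun ω => abs_ksum_le G t ω)

lemma integral_kmean (hX : LocField m κ J X μ) {G : Finset ι} (hG : G ⊆ J) :
    ∫ t, kmean m J X μ G t ∂unitLeb = ∑ j ∈ G, ∫ ω, X j ω *
      (if |psum X (nbhd m J 1 j) ω| ≤ 1 then psum X (nbhd m J 1 j) ω else 0) ∂μ := by
  have hint : ∀ j ∈ G, Integrable (fun q : Ω × ℝ => kterm m J X j q.2 q.1) (μ.prod unitLeb) :=
    fun j hj => integrable_prod_of_bound (hX.measurable_kterm_uncurry (hG hj))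
      (hX.integrable (hG hj)).abs fun ω t => abs_kterm_le j t ω
  have h1 : ∀ t, kmean m J X μ G t = ∑ j ∈ G, ∫ ω, kterm m J X j t ω ∂μ := fun t =>
    integral_finsetSum _ fun j hj => hX.integrable_kterm (hG hj) t
  simp_rw [h1]
  rw [integral_finsetSum _ fun j hj => (hint j hj).integral_prod_right]
  refine Finset.sum_congr rfl fun j hj => ?_
  rw [← integral_integral_swap (f := fun ω t => kterm m J X j t ω) (hint j hj)]
  congr 1; ext ω
  unfold kterm
  rw [integral_const_mul]
  split_ifs with h
  · rw [unitLeb, integral_incKer h]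
  · simp

/-- The basic inequality behind the concentration inequality for the `ζ`-weighted law of `W`,
where `ζ` depends only on the field near `i`: the Stein identity is applied to a primitive of the
trapezoid function and the partial sum over indices far from `i`. -/
theorem concentration_core (hX : LocField m κ J X μ) {i : ι} {G : Finset ι}
    (hG : G ⊆ J) (hGi : ∀ j ∈ G, j ∉ nbhd m J 4 i) {ζ : Ω → ℝ}
    (hζ : Measurable[sigmaOf X (nbhd m J 2 i)] ζ) (hζ0 : ∀ ω, 0 ≤ ζ ω) (hζ1 : ∀ ω, ζ ω ≤ 1)
    {a : ℝ} (ha : 0 < a) (x : ℝ) :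
    (∫ t, kmean m J X μ G t ∂unitLeb) * ∫ ω, ζ ω * trap x a (psum X J ω) ∂μ ≤
      |∫ ω, ζ ω * psum X G ω * trapInt x a (psum X J ω) ∂μ| +
      3 * a * (∫ ω, ζ ω ∂μ) *
        (∑ j ∈ G, ∫ ω, |X j ω| * (if |psum X (nbhd m J 1 j) ω| ≤ 1 then 0 else 1) ∂μ) +
      (∫ t, |kmean m J X μ G t| *
        ∫ ω, ζ ω * |trap x a (psum X J ω + t) - trap x a (psum X J ω)| ∂μ ∂unitLeb) +
      ∫ q, ζ q.1 * (trap x a (psum X J q.1 + q.2) *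
        |ksum m J X G q.2 q.1 - kmean m J X μ G q.2|) ∂(μ.prod unitLeb) := by
  classical
  have hm0 := hX.m_nonneg
  set W := psum X J
  set Y := fun j => psum X (nbhd m J 1 j)
  set F := trapInt x a with hF
  have hFc : Continuous F := continuous_trapInt x a
  have hζm : Measurable ζ := hζ.mono (hX.sigmaOf_le (nbhd_subset 2 i)) le_rfl
  have hWm : Measurable W := hX.measurable_psum le_rfl
  have hYm : ∀ j, Measurable (Y j) := fun j => hX.measurable_psum (nbhd_subset 1 j)
  have hGm := hX.measurable_ksum_uncurry hG
  have hMm : Measurable (kmean m J X μ G) := hX.measurable_kmean hG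
  have hζi : Integrable ζ μ := Integrable.of_bound (C := 1) hζm.aestronglyMeasurable
    (ae_of_all _ fun ω => by rw [Real.norm_eq_abs, abs_of_nonneg (hζ0 ω)]; exact hζ1 ω)
  have hFb : ∀ v, |F v| ≤ 3 * a := fun v => by
    rw [abs_of_nonneg (trapInt_nonneg ha x v)]; exact trapInt_le ha x v
  have hbd : ∀ {g f : Ω → ℝ} {c : ℝ}, Integrable g μ → Measurable f → (∀ ω, |f ω| ≤ c) →
      Integrable (fun ω => g ω * f ω) μ := fun hg hf hb =>
    hg.mul_bdd hf.aestronglyMeasurable (ae_of_all _ hb)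
  -- the Stein identity, term by term
  have e1 : ∀ j ∈ G, ∫ ω, ζ ω * X j ω * F (W ω) ∂μ =
      ∫ ω, ζ ω * (X j ω * (F (W ω) - F (W ω - Y j ω))) ∂μ := by
    intro j hj
    have hjJ := hG hj
    have hsub : nbhd m J 2 i ⊆ J \ nbhd m J 1 j := by
      intro k hk
      rw [Finset.mem_sdiff]
      refine ⟨nbhd_subset _ _ hk, fun hkj => hGi j hj ?_⟩
      exact nbhd_mono hm0 (by norm_num) i (nbhd_trans (t := 3) rfl hk (nbhd_symm hjJ hkj))
    have h0 : ∫ ω, X j ω * (ζ ω * F (W ω - Y j ω)) ∂μ = 0 := by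
      rw [hX.integral_mul_nbhd (r := 0) (s := 1) rfl j (u := X j)
        (v := fun ω => ζ ω * F (W ω - Y j ω)) (measurable_sigmaOf (self_mem_nbhd hm0 0 hjJ))
        ((hζ.mono (sigmaOf_mono hsub) le_rfl).mul
          (hFc.measurable.comp (measurable_psum_sub (nbhd_subset 1 j)))), hX.mean j hjJ, zero_mul]
    have i1 : Integrable (fun ω => X j ω * (ζ ω * F (W ω))) μ :=
      hbd (c := 1 * (3 * a)) (hX.integrable hjJ) (hζm.mul (hFc.measurable.comp hWm)) fun ω => by
        rw [abs_mul, abs_of_nonneg (hζ0 ω)]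
        exact mul_le_mul (hζ1 ω) (hFb _) (abs_nonneg _) zero_le_one
    have i2 : Integrable (fun ω => X j ω * (ζ ω * F (W ω - Y j ω))) μ :=
      hbd (c := 1 * (3 * a)) (hX.integrable hjJ)
        (hζm.mul (hFc.measurable.comp (hWm.sub (hYm j)))) fun ω => by
        rw [abs_mul, abs_of_nonneg (hζ0 ω)]
        exact mul_le_mul (hζ1 ω) (hFb _) (abs_nonneg _) zero_le_one
    calc ∫ ω, ζ ω * X j ω * F (W ω) ∂μ = ∫ ω, X j ω * (ζ ω * F (W ω)) ∂μ := by
          congr 1; ext ω; ring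
      _ = ∫ ω, X j ω * (ζ ω * F (W ω)) ∂μ - ∫ ω, X j ω * (ζ ω * F (W ω - Y j ω)) ∂μ := by
          rw [h0, sub_zero]
      _ = _ := by
          rw [← integral_sub i1 i2]; congr 1; ext ω; ring
  -- representation of the increments by the kernel
  have e2 : ∀ j ω, X j ω * (F (W ω) - F (W ω - Y j ω)) =
      (∫ t, trap x a (W ω + t) * kterm m J X j t ω ∂unitLeb) +
        X j ω * (if |Y j ω| ≤ 1 then 0 else 1) * (F (W ω) - F (W ω - Y j ω)) := by
    intro j ω
    unfold kterm
    by_cases h : |Y j ω| ≤ 1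
    · have := integral_trap_mul_incKer h x a (W ω)
      have h' : |psum X (nbhd m J 1 j) ω| ≤ 1 := h
      simp only [if_pos h, if_pos h', hF, ← this]
      rw [unitLeb, ← integral_const_mul, mul_zero, zero_mul, add_zero]
      congr 1; ext t; ring
    · have h' : ¬|psum X (nbhd m J 1 j) ω| ≤ 1 := h
      simp [if_neg h, if_neg h']
  have htr : Continuous (trap x a) := continuous_trap x a
  have htW : Measurable (fun q : Ω × ℝ => trap x a (W q.1 + q.2)) :=
    htr.measurable.comp ((hWm.comp measurable_fst).add measurable_snd)
  have htb : ∀ v, |trap x a v| ≤ 1 := fun v => by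
    rw [abs_of_nonneg (trap_nonneg x a v)]; exact trap_le_one x a v
  have hζb : ∀ ω, |ζ ω| ≤ 1 := fun ω => by rw [abs_of_nonneg (hζ0 ω)]; exact hζ1 ω
  have ik : ∀ j ∈ G, Integrable (fun q : Ω × ℝ => ζ q.1 * (trap x a (W q.1 + q.2) *
      kterm m J X j q.2 q.1)) (μ.prod unitLeb) := fun j hj =>
    integrable_prod_of_bound ((hζm.comp measurable_fst).mul
      (htW.mul (hX.measurable_kterm_uncurry (hG hj)))) (hX.integrable (hG hj)).abs fun ω t => by
      rw [abs_mul, abs_mul]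
      calc _ ≤ 1 * (1 * |X j ω|) :=
            mul_le_mul (hζb ω) (mul_le_mul (htb _) (abs_kterm_le j t ω) (abs_nonneg _)
              zero_le_one) (by positivity) zero_le_one
        _ = _ := by ring
  have hind : ∀ j ω, |(if |Y j ω| ≤ 1 then (0 : ℝ) else 1)| ≤ 1 := fun j ω => by
    split_ifs <;> simp
  have hind0 : ∀ j ω, (0 : ℝ) ≤ (if |Y j ω| ≤ 1 then (0 : ℝ) else 1) := fun j ω => by
    split_ifs <;> simp
  have hindm : Measurable (fun y : ℝ => if |y| ≤ 1 then (0 : ℝ) else 1) :=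
    Measurable.ite (measurableSet_le (by fun_prop) measurable_const) measurable_const
      measurable_const
  have e3 : ∀ j ∈ G,
      (∫ q, ζ q.1 * (trap x a (W q.1 + q.2) * kterm m J X j q.2 q.1) ∂(μ.prod unitLeb)) ≤
      ∫ ω, ζ ω * (X j ω * (F (W ω) - F (W ω - Y j ω))) ∂μ +
      (3 * a * ∫ ω, ζ ω ∂μ) * ∫ ω, |X j ω| * (if |Y j ω| ≤ 1 then 0 else 1) ∂μ := by
    intro j hj
    have hjJ := hG hj
    have hsub : nbhd m J 1 j ⊆ J \ nbhd m J 3 i := nbhd_subset_sdiff rfl hjJ (hGi j hj)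
    have hv : Measurable[sigmaOf X (nbhd m J 1 j)]
        (fun ω => |X j ω| * (if |Y j ω| ≤ 1 then (0 : ℝ) else 1)) :=
      (measurable_norm.comp (measurable_sigmaOf (self_mem_nbhd hm0 1 hjJ))).mul
        (hindm.comp (measurable_psum le_rfl))
    have i1 : Integrable (fun ω => |X j ω| * (if |Y j ω| ≤ 1 then (0 : ℝ) else 1)) μ :=
      hbd (c := 1) (hX.integrable hjJ).abs (hindm.comp (hYm j)) (hind j)
    have f1 := hX.integral_mul_nbhd (r := 2) (s := 3) rfl i hζ
      (hv.mono (sigmaOf_mono hsub) le_rfl)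
    have i2 : Integrable (fun ω => ζ ω * (X j ω * (F (W ω) - F (W ω - Y j ω)))) μ := by
      refine ((hX.integrable hjJ).abs.mul_const (3 * a)).mono' ?_ (ae_of_all _ fun ω => ?_)
      · exact (hζm.mul ((hX.meas j hjJ).mul ((hFc.measurable.comp hWm).sub
          (hFc.measurable.comp (hWm.sub (hYm j)))))).aestronglyMeasurable
      · rw [Real.norm_eq_abs, abs_mul, abs_mul]
        calc _ ≤ 1 * (|X j ω| * (3 * a)) := by
              gcongr
              · exact hζb ω
              · exact abs_trapInt_sub_le ha x _ _
          _ = _ := one_mul _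
    have i3 : Integrable (fun ω => 3 * a * (ζ ω * (|X j ω| *
        (if |Y j ω| ≤ 1 then (0 : ℝ) else 1)))) μ :=
      (hX.integrable_mul_nbhd (r := 2) (s := 3) rfl i hζ (hv.mono (sigmaOf_mono hsub) le_rfl)
        hζi i1).const_mul _
    have f2 : (3 * a * ∫ ω, ζ ω ∂μ) * ∫ ω, |X j ω| * (if |Y j ω| ≤ 1 then 0 else 1) ∂μ =
        ∫ ω, 3 * a * (ζ ω * (|X j ω| * (if |Y j ω| ≤ 1 then (0 : ℝ) else 1))) ∂μ := by
      rw [integral_const_mul, f1]; ring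
    rw [f2, ← integral_add i2 i3, integral_prod _ (ik j hj)]
    refine integral_mono (ik j hj).integral_prod_left (i2.add i3) fun ω => ?_
    dsimp only
    rw [integral_const_mul, e2, mul_add]
    have f3 : -(X j ω * (if |Y j ω| ≤ 1 then 0 else 1) * (F (W ω) - F (W ω - Y j ω))) ≤
        3 * a * (|X j ω| * (if |Y j ω| ≤ 1 then (0 : ℝ) else 1)) := by
      refine (neg_le_abs _).trans ?_
      rw [abs_mul, abs_mul, abs_of_nonneg (hind0 j ω), mul_comm]
      exact mul_le_mul_of_nonneg_right (abs_trapInt_sub_le ha x _ _)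
        (mul_nonneg (abs_nonneg _) (hind0 j ω))
    have := mul_le_mul_of_nonneg_left f3 (hζ0 ω)
    linarith
  have e4 : (∫ q, ζ q.1 * (trap x a (W q.1 + q.2) * ksum m J X G q.2 q.1) ∂(μ.prod unitLeb)) ≤
      |∫ ω, ζ ω * psum X G ω * F (W ω) ∂μ| + 3 * a * (∫ ω, ζ ω ∂μ) *
        (∑ j ∈ G, ∫ ω, |X j ω| * (if |Y j ω| ≤ 1 then 0 else 1) ∂μ) := by
    have g1 : ∫ q, ζ q.1 * (trap x a (W q.1 + q.2) * ksum m J X G q.2 q.1) ∂(μ.prod unitLeb) =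
        ∑ j ∈ G, ∫ q, ζ q.1 * (trap x a (W q.1 + q.2) * kterm m J X j q.2 q.1)
          ∂(μ.prod unitLeb) := by
      rw [← integral_finsetSum _ ik]
      congr 1; ext q
      rw [ksum, Finset.mul_sum, Finset.mul_sum]
    have g2 : ∫ ω, ζ ω * psum X G ω * F (W ω) ∂μ =
        ∑ j ∈ G, ∫ ω, ζ ω * X j ω * F (W ω) ∂μ := by
      rw [← integral_finsetSum]
      · congr 1; ext ω
        rw [psum, Finset.mul_sum, Finset.sum_mul]
      · intro j hj
        refine (hbd (c := 1 * (3 * a)) (f := fun ω => ζ ω * F (W ω)) (hX.integrable (hG hj))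
          (hζm.mul (hFc.measurable.comp hWm)) fun ω => ?_).congr (ae_of_all _ fun ω => ?_)
        · rw [abs_mul]
          exact mul_le_mul (hζb ω) (hFb _) (abs_nonneg _) zero_le_one
        · dsimp only; ring
    refine le_trans ?_ (add_le_add_left (le_abs_self _) _)
    rw [g1, g2, Finset.mul_sum, ← Finset.sum_add_distrib]
    refine Finset.sum_le_sum fun j hj => ?_
    rw [e1 j hj]
    exact e3 j hj
  -- replace the random kernel by its mean
  have iM : Integrable (fun q : Ω × ℝ => ζ q.1 * (trap x a (W q.1 + q.2) *
      kmean m J X μ G q.2)) (μ.prod unitLeb) :=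
    integrable_prod_of_bound ((hζm.comp measurable_fst).mul
      (htW.mul (hMm.comp measurable_snd))) (g := fun _ => ∫ ω, asum X G ω ∂μ)
      (integrable_const _) fun ω t => by
      rw [abs_mul, abs_mul]
      calc _ ≤ 1 * (1 * ∫ ω, asum X G ω ∂μ) := by
            gcongr
            · exact hζb ω
            · exact htb _
            · exact hX.abs_kmean_le hG t
        _ = _ := by ring
  have iK : Integrable (fun q : Ω × ℝ => ζ q.1 * (trap x a (W q.1 + q.2) *
      ksum m J X G q.2 q.1)) (μ.prod unitLeb) :=
    integrable_prod_of_bound ((hζm.comp measurable_fst).mul (htW.mul hGm))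
      (hX.integrable_asum hG) fun ω t => by
      rw [abs_mul, abs_mul]
      calc _ ≤ 1 * (1 * asum X G ω) := by
            gcongr
            · exact hζb ω
            · exact htb _
            · exact abs_ksum_le G t ω
        _ = _ := by ring
  have e5 : (∫ q, ζ q.1 * (trap x a (W q.1 + q.2) * kmean m J X μ G q.2) ∂(μ.prod unitLeb)) ≤
      (∫ q, ζ q.1 * (trap x a (W q.1 + q.2) * ksum m J X G q.2 q.1) ∂(μ.prod unitLeb)) +
      ∫ q, ζ q.1 * (trap x a (W q.1 + q.2) *
        |ksum m J X G q.2 q.1 - kmean m J X μ G q.2|) ∂(μ.prod unitLeb) := by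
    have iD : Integrable (fun q : Ω × ℝ => ζ q.1 * (trap x a (W q.1 + q.2) *
        |ksum m J X G q.2 q.1 - kmean m J X μ G q.2|)) (μ.prod unitLeb) := by
      refine (iK.sub iM).abs.congr (ae_of_all _ fun q => ?_)
      simp only [Pi.sub_apply]
      rw [← mul_sub, ← mul_sub, abs_mul, abs_mul, abs_of_nonneg (hζ0 _),
        abs_of_nonneg (trap_nonneg _ _ _)]
    rw [← integral_add iK iD]
    refine integral_mono iM (iK.add iD) fun q => ?_
    dsimp only
    rw [← mul_add, ← mul_add]
    refine mul_le_mul_of_nonneg_left (mul_le_mul_of_nonneg_left ?_ (trap_nonneg _ _ _)) (hζ0 _)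
    linarith [neg_abs_le (ksum m J X G q.2 q.1 - kmean m J X μ G q.2)]
  -- remove the shift
  have iW : ∀ t, Integrable (fun ω => ζ ω * trap x a (W ω + t)) μ := fun t =>
    hbd hζi (htr.measurable.comp (hWm.add_const t)) fun ω => htb _
  have iW0 : Integrable (fun ω => ζ ω * trap x a (W ω)) μ :=
    hbd hζi (htr.measurable.comp hWm) fun ω => htb _
  have e6 : (∫ t, kmean m J X μ G t ∂unitLeb) * ∫ ω, ζ ω * trap x a (W ω) ∂μ ≤
      (∫ q, ζ q.1 * (trap x a (W q.1 + q.2) * kmean m J X μ G q.2) ∂(μ.prod unitLeb)) +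
      ∫ t, |kmean m J X μ G t| *
        ∫ ω, ζ ω * |trap x a (W ω + t) - trap x a (W ω)| ∂μ ∂unitLeb := by
    have iMt : Integrable (kmean m J X μ G) unitLeb :=
      Integrable.of_bound hMm.aestronglyMeasurable _ (ae_of_all _ fun t => hX.abs_kmean_le hG t)
    have hdm : Measurable (fun q : Ω × ℝ => ζ q.1 * |trap x a (W q.1 + q.2) - trap x a (W q.1)|) :=
      (hζm.comp measurable_fst).mul (measurable_norm.comp
        (htW.sub (htr.measurable.comp (hWm.comp measurable_fst))))
    have hd1 : ∀ ω t, |ζ ω * (|trap x a (W ω + t) - trap x a (W ω)|)| ≤ 1 := fun ω t => by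
      rw [abs_mul, abs_abs]
      refine mul_le_one₀ (hζb ω) (abs_nonneg _) ?_
      have h1 := trap_nonneg x a (W ω + t)
      have h2 := trap_nonneg x a (W ω)
      have h3 := trap_le_one x a (W ω + t)
      have h4 := trap_le_one x a (W ω)
      rw [abs_le]; constructor <;> linarith
    have iD : Integrable (fun t => |kmean m J X μ G t| *
        ∫ ω, ζ ω * |trap x a (W ω + t) - trap x a (W ω)| ∂μ) unitLeb := by
      refine iMt.abs.mul_bdd (c := 1) ?_ (ae_of_all _ fun t => ?_)
      · exact (hdm.comp
          measurable_swap).stronglyMeasurable.integral_prod_right'.aestronglyMeasurable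
      · rw [Real.norm_eq_abs]
        refine abs_integral_le_integral_abs.trans ?_
        calc _ ≤ ∫ _, (1 : ℝ) ∂μ := by
              apply integral_mono_of_nonneg (ae_of_all _ fun _ => abs_nonneg _)
                (integrable_const _) (ae_of_all _ fun ω => hd1 ω t)
          _ = 1 := by simp
    rw [integral_prod_symm _ iM, ← integral_mul_const, ← integral_add iM.integral_prod_right iD]
    refine integral_mono (iMt.mul_const _) (iM.integral_prod_right.add iD) fun t => ?_
    dsimp only
    have g1 : ∫ ω, ζ ω * (trap x a (W ω + t) * kmean m J X μ G t) ∂μ =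
        kmean m J X μ G t * ∫ ω, ζ ω * trap x a (W ω + t) ∂μ := by
      rw [← integral_const_mul]; congr 1; ext ω; ring
    have g2 : |∫ ω, ζ ω * trap x a (W ω) ∂μ - ∫ ω, ζ ω * trap x a (W ω + t) ∂μ| ≤
        ∫ ω, ζ ω * |trap x a (W ω + t) - trap x a (W ω)| ∂μ := by
      rw [← integral_sub iW0 (iW t)]
      refine abs_integral_le_integral_abs.trans (le_of_eq ?_)
      congr 1; ext ω
      rw [← mul_sub, abs_mul, abs_of_nonneg (hζ0 ω), abs_sub_comm]
    rw [g1]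
    have g3 := mul_le_mul_of_nonneg_left g2 (abs_nonneg (kmean m J X μ G t))
    rw [← abs_mul] at g3
    have g4 := (le_abs_self _).trans g3
    rw [mul_sub] at g4
    linarith
  refine e6.trans ?_
  linarith

end LocField
end Kernel

section Kernel

open Set

variable {ι Ω : Type*} [PseudoMetricSpace ι] {m κ : ℝ} {J : Finset ι} {X : ι → Ω → ℝ}
  [mΩ : MeasurableSpace Ω] {μ : Measure Ω} [IsProbabilityMeasure μ]

namespace LocField

/-- The concentration inequality with a weight `w` in the location of the interval: if the
remaining terms of `concentration_core` are at most `S / w x`, so is the `ζ`-weighted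
probability that `W` falls into `[x, x + a]`, up to a constant. The shifted intervals on the right
of the core inequality are absorbed on the left by taking a supremum over `x`. -/
theorem concentration_weighted (hX : LocField m κ J X μ) {i : ι} {G : Finset ι}
    (hG : G ⊆ J) (hGi : ∀ j ∈ G, j ∉ nbhd m J 4 i) {ζ : Ω → ℝ}
    (hζ : Measurable[sigmaOf X (nbhd m J 2 i)] ζ) (hζ0 : ∀ ω, 0 ≤ ζ ω) (hζ1 : ∀ ω, ζ ω ≤ 1)
    {a : ℝ} (ha : 0 < a) {w : ℝ → ℝ} (hw0 : ∀ x, 0 ≤ w x) {B : ℝ} (hwB : ∀ x, w x ≤ B) {Λ : ℝ}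
    (hΛ : 0 ≤ Λ) (hwΛ : ∀ x y, |x - y| ≤ 1 + a → w x ≤ Λ * w y) {S c q : ℝ}
    (hS : ∀ x, w x * (|∫ ω, ζ ω * psum X G ω * trapInt x a (psum X J ω) ∂μ| +
      3 * a * (∫ ω, ζ ω ∂μ) *
        (∑ j ∈ G, ∫ ω, |X j ω| * (if |psum X (nbhd m J 1 j) ω| ≤ 1 then 0 else 1) ∂μ) +
      ∫ q, ζ q.1 * (trap x a (psum X J q.1 + q.2) *
        |ksum m J X G q.2 q.1 - kmean m J X μ G q.2|) ∂(μ.prod unitLeb)) ≤ S)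
    (hc : c ≤ ∫ t, kmean m J X μ G t ∂unitLeb)
    (hq : ∫ t, |kmean m J X μ G t| * min 1 (|t| / a) ∂unitLeb ≤ q)
    (hcq : 0 ≤ c - 6 * Λ * q) (x : ℝ) :
    (c - 6 * Λ * q) * (w x * ∫ ω, ζ ω * ivl x a (psum X J ω) ∂μ) ≤ S := by
  set W := psum X J
  have hζm : Measurable ζ := hζ.mono (hX.sigmaOf_le (nbhd_subset 2 i)) le_rfl
  have hWm : Measurable W := hX.measurable_psum le_rfl
  have hMm : Measurable (kmean m J X μ G) := hX.measurable_kmean hG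
  have hζi : Integrable ζ μ := Integrable.of_bound hζm.aestronglyMeasurable 1
    (ae_of_all _ fun ω => by rw [Real.norm_eq_abs, abs_of_nonneg (hζ0 ω)]; exact hζ1 ω)
  have hbd : ∀ {f : Ω → ℝ} {c : ℝ}, Measurable f → (∀ ω, |f ω| ≤ c) →
      Integrable (fun ω => ζ ω * f ω) μ := fun hf hb =>
    hζi.mul_bdd hf.aestronglyMeasurable (ae_of_all _ hb)
  set ell : ℝ → ℝ := fun x => ∫ ω, ζ ω * ivl x a (W ω) ∂μ with hell
  have iv : ∀ x, Integrable (fun ω => ζ ω * ivl x a (W ω)) μ := fun x =>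
    hbd (c := 1) ((measurable_ivl x a).comp hWm) fun ω => by
      rw [abs_of_nonneg (ivl_nonneg _ _ _)]; exact ivl_le_one _ _ _
  have hell0 : ∀ x, 0 ≤ ell x := fun x =>
    integral_nonneg fun ω => mul_nonneg (hζ0 ω) (ivl_nonneg _ _ _)
  have hell1 : ∀ x, ell x ≤ 1 := fun x => by
    calc ell x ≤ ∫ _, (1 : ℝ) ∂μ := integral_mono (iv x) (integrable_const _) fun ω =>
          mul_le_one₀ (hζ1 ω) (ivl_nonneg _ _ _) (ivl_le_one _ _ _)
      _ = 1 := by simp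
  have hbdd : BddAbove (range fun x => w x * ell x) := by
    refine ⟨B * 1, ?_⟩
    rintro _ ⟨y, rfl⟩
    exact mul_le_mul (hwB y) (hell1 y) (hell0 y) ((hw0 y).trans (hwB y))
  set L := ⨆ x, w x * ell x with hL
  have hle : ∀ x, w x * ell x ≤ L := fun x => le_ciSup hbdd x
  have hL0 : 0 ≤ L := (mul_nonneg (hw0 0) (hell0 0)).trans (hle 0)
  have hshift : ∀ x y, |x - y| ≤ 1 + a → w x * ell y ≤ Λ * L := fun x y h =>
    calc w x * ell y ≤ Λ * w y * ell y := mul_le_mul_of_nonneg_right (hwΛ x y h) (hell0 y)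
      _ = Λ * (w y * ell y) := by ring
      _ ≤ Λ * L := mul_le_mul_of_nonneg_left (hle y) hΛ
  have h3 : ∀ x t, |t| ≤ 1 → w x * ∫ ω, ζ ω * ivl3 x a (W ω + t) ∂μ ≤ 3 * (Λ * L) := by
    intro x t ht
    have : ∫ ω, ζ ω * ivl3 x a (W ω + t) ∂μ = ell (x - a - t) + ell (x - t) + ell (x + a - t) := by
      simp only [hell]
      have i12 : Integrable (fun ω => ζ ω * ivl (x - a - t) a (W ω) +
          ζ ω * ivl (x - t) a (W ω)) μ := (iv _).add (iv _)
      rw [← integral_add (iv _) (iv _), ← integral_add i12 (iv _)]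
      congr 1; ext ω
      simp only [ivl3, ivl_add]
      ring
    rw [this, mul_add, mul_add]
    rw [abs_le] at ht
    have h1 := hshift x (x - a - t) (by rw [abs_le]; constructor <;> linarith [ht.1, ht.2])
    have h2 := hshift x (x - t) (by rw [abs_le]; constructor <;> linarith [ht.1, ht.2])
    have h3 := hshift x (x + a - t) (by rw [abs_le]; constructor <;> linarith [ht.1, ht.2])
    linarith
  have hiv3 : ∀ x v, ivl3 x a v ≤ 3 := fun x v => by
    have h1 := ivl_le_one (x - a) a v
    have h2 := ivl_le_one x a v
    have h3 := ivl_le_one (x + a) a v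
    unfold ivl3; linarith
  have i3 : ∀ x t, Integrable (fun ω => ζ ω * ivl3 x a (W ω + t)) μ := fun x t =>
    hbd (c := 3) ((measurable_ivl3 x a).comp (hWm.add_const t)) fun ω => by
      rw [abs_of_nonneg (ivl3_nonneg _ _ _)]; exact hiv3 _ _
  have iMt : Integrable (fun t => |kmean m J X μ G t| * min 1 (|t| / a)) unitLeb := by
    have : Integrable (kmean m J X μ G) unitLeb :=
      Integrable.of_bound hMm.aestronglyMeasurable _ (ae_of_all _ fun t => hX.abs_kmean_le hG t)
    refine this.abs.mul_bdd (c := 1) ?_ (ae_of_all _ fun t => ?_)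
    · exact Measurable.aestronglyMeasurable (by fun_prop)
    · rw [Real.norm_eq_abs, abs_of_nonneg (by positivity)]; exact min_le_left _ _
  have hq0 : 0 ≤ q := le_trans (integral_nonneg fun t => by positivity) hq
  -- the terms with shifted intervals
  have hT : ∀ x, w x * ∫ t, |kmean m J X μ G t| *
      ∫ ω, ζ ω * |trap x a (W ω + t) - trap x a (W ω)| ∂μ ∂unitLeb ≤ q * (6 * (Λ * L)) := by
    intro x
    have hin : ∀ t, |t| ≤ 1 → w x * (|kmean m J X μ G t| *
        ∫ ω, ζ ω * |trap x a (W ω + t) - trap x a (W ω)| ∂μ) ≤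
        |kmean m J X μ G t| * min 1 (|t| / a) * (6 * (Λ * L)) := by
      intro t ht
      have h1 : ∫ ω, ζ ω * |trap x a (W ω + t) - trap x a (W ω)| ∂μ ≤
          min 1 (|t| / a) * (∫ ω, ζ ω * ivl3 x a (W ω + t) ∂μ +
            ∫ ω, ζ ω * ivl3 x a (W ω + 0) ∂μ) := by
        rw [← integral_add (i3 x t) (i3 x 0), ← integral_const_mul]
        refine integral_mono_of_nonneg (ae_of_all _ fun ω => mul_nonneg (hζ0 ω) (abs_nonneg _))
          (((i3 x t).add (i3 x 0)).const_mul _) (ae_of_all _ fun ω => ?_)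
        have := mul_le_mul_of_nonneg_left (trap_shift_le ha x (W ω) t) (hζ0 ω)
        refine this.trans (le_of_eq ?_)
        simp only [add_zero]
        ring
      have h2 := h3 x t ht
      have h4 := h3 x 0 (by simp)
      calc w x * (|kmean m J X μ G t| *
            ∫ ω, ζ ω * |trap x a (W ω + t) - trap x a (W ω)| ∂μ)
          ≤ w x * (|kmean m J X μ G t| * (min 1 (|t| / a) *
            (∫ ω, ζ ω * ivl3 x a (W ω + t) ∂μ + ∫ ω, ζ ω * ivl3 x a (W ω + 0) ∂μ))) := by
            have := hw0 x
            gcongr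
        _ = |kmean m J X μ G t| * min 1 (|t| / a) *
            (w x * (∫ ω, ζ ω * ivl3 x a (W ω + t) ∂μ) +
              w x * ∫ ω, ζ ω * ivl3 x a (W ω + 0) ∂μ) := by ring
        _ ≤ _ := by gcongr; linarith
    rw [← integral_const_mul]
    calc _ ≤ ∫ t, |kmean m J X μ G t| * min 1 (|t| / a) * (6 * (Λ * L)) ∂unitLeb := by
          refine integral_mono_of_nonneg (ae_of_all _ fun t => ?_) (iMt.mul_const _) ?_
          · exact mul_nonneg (hw0 x) (mul_nonneg (abs_nonneg _)
              (integral_nonneg fun ω => mul_nonneg (hζ0 ω) (abs_nonneg _)))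
          · rw [unitLeb]
            filter_upwards [ae_restrict_mem measurableSet_Icc] with t ht
            exact hin t (abs_le.2 ht)
      _ ≤ _ := by
          rw [integral_mul_const]
          gcongr
  have hmain : ∀ x, c * (w x * ell x) ≤ S + q * (6 * (Λ * L)) := by
    intro x
    have h1 := hX.concentration_core hG hGi hζ hζ0 hζ1 ha x
    have h2 := mul_le_mul_of_nonneg_left h1 (hw0 x)
    have h4 : ell x ≤ ∫ ω, ζ ω * trap x a (W ω) ∂μ := by
      refine integral_mono (iv x) (hbd (c := 1) ((continuous_trap x a).measurable.comp hWm)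
        fun ω => ?_) fun ω => mul_le_mul_of_nonneg_left (ivl_le_trap ha x _) (hζ0 ω)
      rw [abs_of_nonneg (trap_nonneg _ _ _)]; exact trap_le_one _ _ _
    have h5 := hT x
    have h6 := hS x
    have hc0 : 0 ≤ c := by
      have : 0 ≤ 6 * Λ * q := by positivity
      linarith
    have h7 : c * (w x * ell x) ≤ w x * ((∫ t, kmean m J X μ G t ∂unitLeb) *
        ∫ ω, ζ ω * trap x a (W ω) ∂μ) := by
      calc c * (w x * ell x) = w x * (c * ell x) := by ring
        _ ≤ _ := mul_le_mul_of_nonneg_left (mul_le_mul hc h4 (hell0 x) (hc0.trans hc)) (hw0 x)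
    rw [mul_add, mul_add, mul_add] at h2
    rw [mul_add, mul_add] at h6
    linarith
  have hfin : (c - 6 * Λ * q) * L ≤ S := by
    have hc0 : 0 ≤ c := by
      have : 0 ≤ 6 * Λ * q := by positivity
      linarith
    have : c * L ≤ S + q * (6 * (Λ * L)) := by
      rw [hL, Real.mul_iSup_of_nonneg hc0]
      exact ciSup_le hmain
    linarith
  exact (mul_le_mul_of_nonneg_left (hle x) hcq).trans hfin

end LocField
end Kernel

/-! ### Moments of local sums -/

section Moments

/-- Young's inequality in the scaling used for sums over at most `κ` neighbours. -/
lemma young_scaled {x u κ p b : ℝ} (hx : 0 ≤ x) (hu : 0 ≤ u) (hκ : 0 < κ) (hp : 0 < p)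
    (hb0 : 0 ≤ b) (hbp : b ≤ p) :
    κ ^ (b - 1) * (x ^ b * u ^ (p - b)) ≤
      b / p * (κ ^ (p - 1) * x ^ p) + (p - b) / p * (κ⁻¹ * u ^ p) := by
  have h := Real.geom_mean_le_arith_mean2_weighted (w₁ := b / p) (w₂ := (p - b) / p)
    (p₁ := κ ^ (p - 1) * x ^ p) (p₂ := κ⁻¹ * u ^ p) (by positivity)
    (div_nonneg (by linarith) hp.le) (by positivity) (by positivity) (by field_simp; ring)
  refine le_trans (le_of_eq ?_) h
  rw [Real.mul_rpow (by positivity) (by positivity), Real.mul_rpow (by positivity) (by positivity),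
    ← Real.rpow_mul hκ.le, ← Real.rpow_mul hx, ← Real.rpow_mul hu, Real.inv_rpow hκ.le,
    ← Real.rpow_neg hκ.le]
  rw [show p * (b / p) = b by field_simp, show p * ((p - b) / p) = p - b by field_simp]
  have : κ ^ (b - 1) = κ ^ ((p - 1) * (b / p)) * κ ^ (-((p - b) / p)) := by
    rw [← Real.rpow_add hκ]; congr 1; field_simp; ring
  rw [this]; ring

lemma young_scaled3 {x u v κ p : ℝ} (hx : 0 ≤ x) (hu : 0 ≤ u) (hv : 0 ≤ v) (hκ : 0 < κ)
    (hp : 2 < p) :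
    (x * u) * v ^ (p - 2) ≤
      1 / p * (κ ^ (p - 1) * x ^ p) + 1 / p * (κ⁻¹ * u ^ p) + (p - 2) / p * (κ⁻¹ * v ^ p) := by
  have hp0 : 0 < p := by linarith
  have h := Real.geom_mean_le_arith_mean3_weighted (w₁ := 1 / p) (w₂ := 1 / p)
    (w₃ := (p - 2) / p) (p₁ := κ ^ (p - 1) * x ^ p) (p₂ := κ⁻¹ * u ^ p) (p₃ := κ⁻¹ * v ^ p)
    (by positivity) (by positivity) (div_nonneg (by linarith) hp0.le)
    (by positivity) (by positivity) (by positivity) (by field_simp; ring)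
  refine le_trans (le_of_eq ?_) h
  rw [Real.mul_rpow (by positivity) (by positivity), Real.mul_rpow (by positivity) (by positivity),
    Real.mul_rpow (by positivity) (by positivity),
    ← Real.rpow_mul hκ.le, ← Real.rpow_mul hx, ← Real.rpow_mul hu, ← Real.rpow_mul hv,
    Real.inv_rpow hκ.le, ← Real.rpow_neg hκ.le, Real.inv_rpow hκ.le, ← Real.rpow_neg hκ.le]
  rw [show p * (1 / p) = 1 by field_simp, show p * ((p - 2) / p) = p - 2 by field_simp,
    Real.rpow_one, Real.rpow_one]
  have : (1 : ℝ) = κ ^ ((p - 1) * (1 / p)) * κ ^ (-(1 / p)) * κ ^ (-((p - 2) / p)) := by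
    rw [← Real.rpow_add hκ, ← Real.rpow_add hκ]
    symm
    convert Real.rpow_zero κ using 2
    field_simp; ring
  calc x * u * v ^ (p - 2) = (κ ^ ((p - 1) * (1 / p)) * κ ^ (-(1 / p)) * κ ^ (-((p - 2) / p))) *
        (x * u * v ^ (p - 2)) := by rw [← this, one_mul]
    _ = _ := by ring

lemma le_add_rpow {u s p : ℝ} (hu : 0 ≤ u) (hs : 0 < s) (hp : 1 ≤ p) :
    u ≤ s + s ^ (1 - p) * u ^ p := by
  rcases le_total u s with h | h
  · have : 0 ≤ s ^ (1 - p) * u ^ p := by positivity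
    linarith
  · have h0 : 0 < u := hs.trans_le h
    have h1 : u ^ (1 - p) ≤ s ^ (1 - p) :=
      Real.rpow_le_rpow_of_nonpos hs h (by linarith)
    have h2 : u = u ^ (1 - p) * u ^ p := by
      rw [← Real.rpow_add h0]; simp
    have h3 : u ^ (1 - p) * u ^ p ≤ s ^ (1 - p) * u ^ p := by gcongr
    linarith

lemma sq_le_add_rpow {u s p : ℝ} (hu : 0 ≤ u) (hs : 0 < s) (hp : 2 ≤ p) :
    u ^ 2 ≤ s ^ 2 + s ^ (2 - p) * u ^ p := by
  rcases le_total u s with h | h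
  · have : 0 ≤ s ^ (2 - p) * u ^ p := by positivity
    have : u ^ 2 ≤ s ^ 2 := by gcongr
    linarith
  · have h0 : 0 < u := hs.trans_le h
    have h1 : u ^ (2 - p) ≤ s ^ (2 - p) :=
      Real.rpow_le_rpow_of_nonpos hs h (by linarith)
    have h2 : u ^ 2 = u ^ (2 - p) * u ^ p := by
      rw [← Real.rpow_add h0]; simp
    have h3 : u ^ (2 - p) * u ^ p ≤ s ^ (2 - p) * u ^ p := by gcongr
    nlinarith [sq_nonneg s]

/-- A locally dependent field with finite `p`-th moments, `2 < p ≤ 3`. The quantity `b` bounds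
`κ ^ (p - 1) ∑ E |X i| ^ p`. -/
structure PField {ι Ω : Type*} [PseudoMetricSpace ι] [MeasurableSpace Ω] (m κ : ℝ)
    (J : Finset ι) (X : ι → Ω → ℝ) (μ : Measure Ω) (p b : ℝ) : Prop
    extends LocField m κ J X μ where
  two_lt : 2 < p
  le_three : p ≤ 3
  kappa_pos : 0 < κ
  integrable_rpow : ∀ i ∈ J, Integrable (fun ω => |X i ω| ^ p) μ
  sum_le : κ ^ (p - 1) * ∑ i ∈ J, ∫ ω, |X i ω| ^ p ∂μ ≤ b

variable {ι Ω : Type*} [PseudoMetricSpace ι] {m κ : ℝ} {J : Finset ι} {X : ι → Ω → ℝ}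
  [mΩ : MeasurableSpace Ω] {μ : Measure Ω} {p b : ℝ}

lemma LocField.sum_nbhd_le (hX : LocField m κ J X μ) {r : ℕ} (hr : r ≤ 5) {c : ι → ℝ}
    (hc : ∀ i ∈ J, 0 ≤ c i) :
    ∑ i ∈ J, ∑ k ∈ nbhd m J r i, c k ≤ κ * ∑ k ∈ J, c k := by
  rw [Finset.sum_comm' (s' := fun k => nbhd m J r k) (t' := J), Finset.mul_sum]
  · refine Finset.sum_le_sum fun k hk => ?_
    rw [Finset.sum_const, nsmul_eq_mul]
    refine mul_le_mul_of_nonneg_right (le_trans ?_ (hX.card_le k hk)) (hc k hk)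
    exact_mod_cast Finset.card_le_card (nbhd_mono hX.m_nonneg hr k)
  · intro i k
    constructor
    · rintro ⟨h1, h2⟩
      exact ⟨nbhd_symm h1 h2, nbhd_subset _ _ h2⟩
    · rintro ⟨h1, h2⟩
      exact ⟨nbhd_subset _ _ h1, nbhd_symm h2 h1⟩

namespace PField

/-- The bound for all local quantities near `i`. -/
lemma integrable_asum_rpow (hX : PField m κ J X μ p b) {i : ι} (hi : i ∈ J) :
    Integrable (fun ω => asum X (nbhd m J 5 i) ω ^ p) μ ∧
    ∫ ω, asum X (nbhd m J 5 i) ω ^ p ∂μ ≤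
      κ ^ (p - 1) * ∑ k ∈ nbhd m J 5 i, ∫ ω, |X k ω| ^ p ∂μ := by
  have hp := hX.two_lt
  have h1 : ∀ ω, asum X (nbhd m J 5 i) ω ^ p ≤
      κ ^ (p - 1) * ∑ k ∈ nbhd m J 5 i, |X k ω| ^ p := by
    intro ω
    refine (Real.rpow_sum_le_const_mul_sum_rpow _ _ (by linarith)).trans ?_
    exact mul_le_mul_of_nonneg_right (Real.rpow_le_rpow (by positivity) (hX.card_le i hi)
      (by linarith)) (Finset.sum_nonneg fun _ _ => by positivity)
  have h2 : Integrable (fun ω => κ ^ (p - 1) * ∑ k ∈ nbhd m J 5 i, |X k ω| ^ p) μ :=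
    (integrable_finsetSum _ fun k hk => hX.integrable_rpow k (nbhd_subset _ _ hk)).const_mul _
  have h3 : Integrable (fun ω => asum X (nbhd m J 5 i) ω ^ p) μ := by
    refine h2.mono' ?_ (ae_of_all _ fun ω => ?_)
    · exact ((hX.measurable_asum (nbhd_subset 5 i)).pow_const p).aestronglyMeasurable
    · rw [Real.norm_eq_abs, abs_of_nonneg (Real.rpow_nonneg (asum_nonneg _ _) _)]
      exact h1 ω
  refine ⟨h3, (integral_mono h3 h2 h1).trans (le_of_eq ?_)⟩
  rw [integral_const_mul,
    integral_finsetSum _ fun k hk => hX.integrable_rpow k (nbhd_subset _ _ hk)]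

lemma integral_asum_rpow_le (hX : PField m κ J X μ p b) {i : ι} (hi : i ∈ J) :
    ∫ ω, asum X (nbhd m J 5 i) ω ^ p ∂μ ≤ b := by
  have hκ := hX.kappa_pos
  refine (hX.integrable_asum_rpow hi).2.trans (le_trans ?_ hX.sum_le)
  exact mul_le_mul_of_nonneg_left (Finset.sum_le_sum_of_subset_of_nonneg (nbhd_subset 5 i)
    fun _ _ _ => integral_nonneg fun _ => by positivity) (by positivity)

lemma b_nonneg (hX : PField m κ J X μ p b) : 0 ≤ b := by
  have := hX.kappa_pos
  refine le_trans ?_ hX.sum_le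
  exact mul_nonneg (by positivity) (Finset.sum_nonneg fun _ _ => integral_nonneg fun _ =>
    by positivity)

lemma sum_integral_asum_rpow_le (hX : PField m κ J X μ p b) :
    κ⁻¹ * ∑ i ∈ J, ∫ ω, asum X (nbhd m J 5 i) ω ^ p ∂μ ≤ b := by
  have hκ := hX.kappa_pos
  rw [inv_mul_le_iff₀ hκ]
  calc _ ≤ ∑ i ∈ J, κ ^ (p - 1) * ∑ k ∈ nbhd m J 5 i, ∫ ω, |X k ω| ^ p ∂μ :=
        Finset.sum_le_sum fun i hi => (hX.integrable_asum_rpow hi).2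
    _ = κ ^ (p - 1) * ∑ i ∈ J, ∑ k ∈ nbhd m J 5 i, ∫ ω, |X k ω| ^ p ∂μ := by
        rw [Finset.mul_sum]
    _ ≤ κ ^ (p - 1) * (κ * ∑ k ∈ J, ∫ ω, |X k ω| ^ p ∂μ) := by
        gcongr
        exact hX.sum_nbhd_le le_rfl fun _ _ => integral_nonneg fun _ => by positivity
    _ = κ * (κ ^ (p - 1) * ∑ k ∈ J, ∫ ω, |X k ω| ^ p ∂μ) := by ring
    _ ≤ κ * b := by gcongr; exact hX.sum_le

lemma measurable_U (hX : PField m κ J X μ p b) (i : ι) :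
    Measurable (asum X (nbhd m J 5 i)) := hX.measurable_asum (nbhd_subset 5 i)

lemma abs_le_U (hX : PField m κ J X μ p b) {i : ι} (hi : i ∈ J) (ω : Ω) :
    |X i ω| ≤ asum X (nbhd m J 5 i) ω :=
  abs_le_asum (self_mem_nbhd hX.m_nonneg 5 hi) ω

lemma integrable_mixed (hX : PField m κ J X μ p b) {i : ι} (hi : i ∈ J) {c : ℝ} (hc0 : 0 ≤ c)
    (hcp : c ≤ p) :
    Integrable (fun ω => |X i ω| ^ c * asum X (nbhd m J 5 i) ω ^ (p - c)) μ := by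
  refine (hX.integrable_asum_rpow hi).1.mono' ?_ (ae_of_all _ fun ω => ?_)
  · exact (((measurable_norm.comp (hX.meas i hi)).pow_const c).mul
      ((hX.measurable_U i).pow_const _)).aestronglyMeasurable
  · have hU := asum_nonneg (X := X) (nbhd m J 5 i) ω
    rw [Real.norm_eq_abs, abs_of_nonneg (by positivity)]
    calc _ ≤ asum X (nbhd m J 5 i) ω ^ c * asum X (nbhd m J 5 i) ω ^ (p - c) := by
          gcongr
          exact hX.abs_le_U hi ω
      _ = _ := by
          rw [← Real.rpow_add_of_nonneg hU hc0 (by linarith)]; congr 1; ring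

/-- Mixed moments of a variable and of its neighbours. -/
lemma sum_mixed_le (hX : PField m κ J X μ p b) {c : ℝ} (hc0 : 0 ≤ c) (hcp : c ≤ p) :
    ∑ i ∈ J, κ ^ (c - 1) * ∫ ω, |X i ω| ^ c * asum X (nbhd m J 5 i) ω ^ (p - c) ∂μ ≤ b := by
  have hκ := hX.kappa_pos
  have hp : 0 < p := by linarith [hX.two_lt]
  have h1 : ∀ i ∈ J, κ ^ (c - 1) * ∫ ω, |X i ω| ^ c * asum X (nbhd m J 5 i) ω ^ (p - c) ∂μ ≤
      c / p * (κ ^ (p - 1) * ∫ ω, |X i ω| ^ p ∂μ) +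
        (p - c) / p * (κ⁻¹ * ∫ ω, asum X (nbhd m J 5 i) ω ^ p ∂μ) := by
    intro i hi
    have j1 := ((hX.integrable_rpow i hi).const_mul (κ ^ (p - 1))).const_mul (c / p)
    have j2 := ((hX.integrable_asum_rpow hi).1.const_mul κ⁻¹).const_mul ((p - c) / p)
    rw [← integral_const_mul, ← integral_const_mul, ← integral_const_mul, ← integral_const_mul,
      ← integral_const_mul, ← integral_add j1 j2]
    exact integral_mono ((hX.integrable_mixed hi hc0 hcp).const_mul _) (j1.add j2) fun ω =>
      young_scaled (abs_nonneg _) (asum_nonneg _ _) hκ hp hc0 hcp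
  refine (Finset.sum_le_sum h1).trans ?_
  rw [Finset.sum_add_distrib, ← Finset.mul_sum, ← Finset.mul_sum, ← Finset.mul_sum,
    ← Finset.mul_sum]
  have e1 := hX.sum_le
  have e2 := hX.sum_integral_asum_rpow_le
  calc _ ≤ c / p * b + (p - c) / p * b := by
        gcongr
    _ = b := by field_simp; ring

lemma sum_one_le (hX : PField m κ J X μ p b) :
    ∑ i ∈ J, ∫ ω, |X i ω| * asum X (nbhd m J 5 i) ω ^ (p - 1) ∂μ ≤ b := by
  have := hX.sum_mixed_le (c := 1) (by norm_num) (by linarith [hX.two_lt])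
  simpa using this

lemma sum_two_le (hX : PField m κ J X μ p b) :
    κ * ∑ i ∈ J, ∫ ω, X i ω ^ 2 * asum X (nbhd m J 5 i) ω ^ (p - 2) ∂μ ≤ b := by
  have := hX.sum_mixed_le (c := 2) (by norm_num) (by linarith [hX.two_lt])
  rw [← Finset.mul_sum] at this
  norm_num at this
  exact this

variable [IsProbabilityMeasure μ]

lemma integrable_U_rpow (hX : PField m κ J X μ p b) {i : ι} (hi : i ∈ J) {c : ℝ} (hc0 : 0 ≤ c)
    (hcp : c ≤ p) : Integrable (fun ω => asum X (nbhd m J 5 i) ω ^ c) μ := by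
  refine ((integrable_const 1).add (hX.integrable_asum_rpow hi).1).mono'
    ((hX.measurable_U i).pow_const c).aestronglyMeasurable (ae_of_all _ fun ω => ?_)
  have hU := asum_nonneg (X := X) (nbhd m J 5 i) ω
  rw [Real.norm_eq_abs, abs_of_nonneg (by positivity)]
  simp only [Pi.add_apply]
  rcases le_total (asum X (nbhd m J 5 i) ω) 1 with h | h
  · have h1 := Real.rpow_le_one hU h hc0
    have h2 : 0 ≤ asum X (nbhd m J 5 i) ω ^ p := by positivity
    linarith
  · have := Real.rpow_le_rpow_of_exponent_le h hcp
    linarith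

/-- The decoupled version of `sum_one_le`. -/
lemma sum_decoupled_le (hX : PField m κ J X μ p b) :
    ∑ i ∈ J, (∫ ω, |X i ω| * asum X (nbhd m J 5 i) ω ∂μ) *
      ∫ ω, asum X (nbhd m J 5 i) ω ^ (p - 2) ∂μ ≤ b := by
  have hκ := hX.kappa_pos
  have hp2 := hX.two_lt
  have hp : 0 < p := by linarith
  have h1 : ∀ i ∈ J, (∫ ω, |X i ω| * asum X (nbhd m J 5 i) ω ∂μ) *
      ∫ ω, asum X (nbhd m J 5 i) ω ^ (p - 2) ∂μ ≤
      1 / p * (κ ^ (p - 1) * ∫ ω, |X i ω| ^ p ∂μ) +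
        (p - 1) / p * (κ⁻¹ * ∫ ω, asum X (nbhd m J 5 i) ω ^ p ∂μ) := by
    intro i hi
    set U := asum X (nbhd m J 5 i) with hU
    have hU0 : ∀ ω, 0 ≤ U ω := fun ω => asum_nonneg _ ω
    have hUp := (hX.integrable_asum_rpow hi).1
    have hXU : Integrable (fun ω => |X i ω| * U ω) μ :=
      ((hX.memLp i hi).abs).integrable_mul (hX.memLp_asum (nbhd_subset 5 i))
    have j1 := ((hX.integrable_rpow i hi).const_mul (κ ^ (p - 1))).const_mul (1 / p)
    have j2 := (hUp.const_mul κ⁻¹).const_mul (1 / p)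
    have h2 : ∀ ω', (∫ ω, |X i ω| * U ω ∂μ) * U ω' ^ (p - 2) ≤
        1 / p * (κ ^ (p - 1) * ∫ ω, |X i ω| ^ p ∂μ) + 1 / p * (κ⁻¹ * ∫ ω, U ω ^ p ∂μ) +
          (p - 2) / p * (κ⁻¹ * U ω' ^ p) := by
      intro ω'
      have j12 : Integrable (fun ω => 1 / p * (κ ^ (p - 1) * |X i ω| ^ p) +
        1 / p * (κ⁻¹ * U ω ^ p)) μ := j1.add j2
      have e := integral_mono (hXU.mul_const (U ω' ^ (p - 2)))
        (j12.add (integrable_const ((p - 2) / p * (κ⁻¹ * U ω' ^ p)))) fun ω =>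
          young_scaled3 (abs_nonneg (X i ω)) (hU0 ω) (hU0 ω') hκ hp2
      simp only [Pi.add_apply] at e
      rw [integral_mul_const, integral_add j12 (integrable_const _), integral_add j1 j2,
        integral_const_mul, integral_const_mul, integral_const_mul, integral_const_mul] at e
      simpa using e
    have j3 : Integrable (fun ω => (p - 2) / p * (κ⁻¹ * U ω ^ p)) μ :=
      (hUp.const_mul κ⁻¹).const_mul _
    have e := integral_mono ((hX.integrable_U_rpow hi (c := p - 2) (by linarith)
      (by linarith)).const_mul _) ((integrable_const _).add j3) h2
    rw [integral_const_mul] at e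
    simp only [Pi.add_apply] at e
    rw [integral_add (integrable_const _) j3, integral_const_mul, integral_const_mul] at e
    simp only [integral_const, probReal_univ, one_smul] at e
    refine e.trans (le_of_eq ?_)
    rw [hU]; ring
  refine (Finset.sum_le_sum h1).trans ?_
  rw [Finset.sum_add_distrib, ← Finset.mul_sum, ← Finset.mul_sum, ← Finset.mul_sum,
    ← Finset.mul_sum]
  have e1 := hX.sum_le
  have e2 := hX.sum_integral_asum_rpow_le
  calc _ ≤ 1 / p * b + (p - 1) / p * b := by
        have : 0 ≤ (p - 1) / p := div_nonneg (by linarith) hp.le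
        gcongr
    _ = b := by field_simp; ring

lemma integral_U_le (hX : PField m κ J X μ p b) {i : ι} (hi : i ∈ J) {s : ℝ} (hs : 0 < s) :
    ∫ ω, asum X (nbhd m J 5 i) ω ∂μ ≤ s + s ^ (1 - p) * b := by
  have hUp := (hX.integrable_asum_rpow hi).1
  have h := integral_mono (hX.integrable_asum (nbhd_subset 5 i))
    ((integrable_const s).add (hUp.const_mul (s ^ (1 - p)))) fun ω =>
      le_add_rpow (asum_nonneg _ ω) hs (by linarith [hX.two_lt])
  simp only [Pi.add_apply] at h
  rw [integral_add (integrable_const s) (hUp.const_mul (s ^ (1 - p))), integral_const_mul] at h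
  simp only [integral_const, probReal_univ, one_smul] at h
  refine h.trans ?_
  gcongr
  exact hX.integral_asum_rpow_le hi

lemma integral_U_sq_le (hX : PField m κ J X μ p b) {i : ι} (hi : i ∈ J) {s : ℝ} (hs : 0 < s) :
    ∫ ω, asum X (nbhd m J 5 i) ω ^ 2 ∂μ ≤ s ^ 2 + s ^ (2 - p) * b := by
  have hUp := (hX.integrable_asum_rpow hi).1
  have h := integral_mono (hX.memLp_asum (nbhd_subset 5 i)).integrable_sq
    ((integrable_const (s ^ 2)).add (hUp.const_mul (s ^ (2 - p)))) fun ω =>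
      sq_le_add_rpow (asum_nonneg _ ω) hs hX.two_lt.le
  simp only [Pi.add_apply] at h
  rw [integral_add (integrable_const (s ^ 2)) (hUp.const_mul (s ^ (2 - p))),
    integral_const_mul] at h
  simp only [integral_const, probReal_univ, one_smul] at h
  refine h.trans ?_
  gcongr
  exact hX.integral_asum_rpow_le hi

end PField
end Moments

/-! ### Fluctuations of the Stein kernel -/

section KernelBounds

variable {ι Ω : Type*} [PseudoMetricSpace ι] {m κ : ℝ} {J : Finset ι} {X : ι → Ω → ℝ}
  [mΩ : MeasurableSpace Ω] {μ : Measure Ω} {p b : ℝ}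

section Prob

variable [IsProbabilityMeasure μ]

/-- The variance of a sum of local functions of the field. -/
lemma LocField.integral_sq_sum_sub_le (hX : LocField m κ J X μ) {G : Finset ι} (hG : G ⊆ J)
    {K : ι → Ω → ℝ} (hK : ∀ j ∈ G, Measurable[sigmaOf X (nbhd m J 1 j)] (K j))
    (hK2 : ∀ j ∈ G, MemLp (K j) 2 μ) :
    ∫ ω, (∑ j ∈ G, K j ω - ∑ j ∈ G, ∫ ω', K j ω' ∂μ) ^ 2 ∂μ ≤
      κ * ∑ j ∈ G, ∫ ω, K j ω ^ 2 ∂μ := by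
  classical
  set L : ι → Ω → ℝ := fun j ω => K j ω - ∫ ω', K j ω' ∂μ with hL
  have hL2 : ∀ j ∈ G, MemLp (L j) 2 μ := fun j hj => (hK2 j hj).sub (memLp_const _)
  set v : ι → ℝ := fun j => ∫ ω, K j ω ^ 2 ∂μ
  have hv0 : ∀ j, 0 ≤ v j := fun j => integral_nonneg fun ω => sq_nonneg _
  have hLv : ∀ j ∈ G, ∫ ω, L j ω ^ 2 ∂μ ≤ v j := by
    intro j hj
    have h1 := variance_le_expectation_sq (μ := μ) (X := K j) (hK2 j hj).aestronglyMeasurable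
    rw [variance_eq_integral (hK2 j hj).aemeasurable] at h1
    exact h1
  have h1 : ∀ ω, (∑ j ∈ G, K j ω - ∑ j ∈ G, ∫ ω', K j ω' ∂μ) ^ 2 =
      ∑ j ∈ G, ∑ k ∈ G, L j ω * L k ω := by
    intro ω; rw [← Finset.sum_sub_distrib, sq, Finset.sum_mul_sum]
  have hLi : ∀ j ∈ G, ∀ k ∈ G, Integrable (fun ω => L j ω * L k ω) μ := fun j hj k hk =>
    (hL2 j hj).integrable_mul (hL2 k hk)
  simp_rw [h1]
  rw [integral_finsetSum _ fun j hj => integrable_finsetSum _ fun k hk => hLi j hj k hk]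
  have h2 : ∀ j ∈ G, ∀ k ∈ G, ∫ ω, L j ω * L k ω ∂μ ≤
      if k ∈ nbhd m J 3 j then v j / 2 + v k / 2 else 0 := by
    intro j hj k hk
    split_ifs with hjk
    · have h3 := integral_mono (hLi j hj k hk)
        (((hL2 j hj).integrable_sq.div_const 2).add ((hL2 k hk).integrable_sq.div_const 2))
        fun ω => by
          simp only [Pi.add_apply]; nlinarith [sq_nonneg (L j ω - L k ω)]
      simp only [Pi.add_apply] at h3
      rw [integral_add ((hL2 j hj).integrable_sq.div_const 2)
        ((hL2 k hk).integrable_sq.div_const 2), integral_div, integral_div] at h3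
      linarith [hLv j hj, hLv k hk]
    · have hm : Measurable[sigmaOf X (J \ nbhd m J 2 j)] (L k) :=
        ((hK k hk).sub measurable_const).mono
          (sigmaOf_mono (nbhd_subset_sdiff (s := 1) rfl (hG hk) hjk)) le_rfl
      have hm' : Measurable[sigmaOf X (nbhd m J 1 j)] (L j) := (hK j hj).sub measurable_const
      rw [hX.integral_mul_nbhd (r := 1) (s := 2) rfl j hm' hm]
      have : ∫ ω, L j ω ∂μ = 0 := by
        simp only [hL]
        rw [integral_sub ((hK2 j hj).integrable (by norm_num)) (integrable_const _)]
        simp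
      rw [this, zero_mul]
  have hcount : ∀ j ∈ G, ∑ k ∈ G, (if k ∈ nbhd m J 3 j then v j / 2 else 0) ≤ κ * (v j / 2) := by
    intro j hj
    rw [← Finset.sum_filter, Finset.sum_const, nsmul_eq_mul]
    refine mul_le_mul_of_nonneg_right (le_trans ?_ (hX.card_le j (hG hj))) (by linarith [hv0 j])
    exact_mod_cast Finset.card_le_card fun k hk => nbhd_mono hX.m_nonneg (by norm_num) j
      (Finset.mem_filter.1 hk).2
  calc _ ≤ ∑ j ∈ G, ∑ k ∈ G, ((if k ∈ nbhd m J 3 j then v j / 2 else 0) +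
        (if j ∈ nbhd m J 3 k then v k / 2 else 0)) := by
        rw [Finset.sum_congr rfl fun j hj => integral_finsetSum _ fun k hk => hLi j hj k hk]
        refine Finset.sum_le_sum fun j hj => Finset.sum_le_sum fun k hk => (h2 j hj k hk).trans ?_
        by_cases hjk : k ∈ nbhd m J 3 j
        · rw [if_pos hjk, if_pos hjk, if_pos (nbhd_symm (hG hj) hjk)]
        · rw [if_neg hjk, if_neg hjk, if_neg fun h => hjk (nbhd_symm (hG hk) h), add_zero]
    _ = ∑ j ∈ G, ∑ k ∈ G, (if k ∈ nbhd m J 3 j then v j / 2 else 0) +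
        ∑ k ∈ G, ∑ j ∈ G, (if j ∈ nbhd m J 3 k then v k / 2 else 0) := by
        have := Finset.sum_comm (s := G) (t := G)
          (f := fun k j => if j ∈ nbhd m J 3 k then v k / 2 else 0)
        refine Eq.trans ?_ (congrArg (_ + ·) this.symm)
        rw [← Finset.sum_add_distrib]
        exact Finset.sum_congr rfl fun j _ => Finset.sum_add_distrib
    _ ≤ ∑ j ∈ G, κ * (v j / 2) + ∑ j ∈ G, κ * (v j / 2) :=
        add_le_add (Finset.sum_le_sum hcount) (Finset.sum_le_sum hcount)
    _ = κ * ∑ j ∈ G, v j := by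
        rw [← Finset.sum_add_distrib, Finset.mul_sum]
        exact Finset.sum_congr rfl fun j _ => by ring

/-- The total variance proxy of the random Stein kernel. -/
lemma LocField.integral_sum_sq_kterm (hX : LocField m κ J X μ) {G : Finset ι} (hG : G ⊆ J) :
    Integrable (fun t => κ * ∑ j ∈ G, ∫ ω, kterm m J X j t ω ^ 2 ∂μ) unitLeb ∧
    ∫ t, κ * ∑ j ∈ G, ∫ ω, kterm m J X j t ω ^ 2 ∂μ ∂unitLeb =
      κ * ∑ j ∈ G, ∫ ω, X j ω ^ 2 * (if |psum X (nbhd m J 1 j) ω| ≤ 1 then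
        |psum X (nbhd m J 1 j) ω| else 0) ∂μ := by
  have hi : ∀ j ∈ G, Integrable (fun q : Ω × ℝ => kterm m J X j q.2 q.1 ^ 2) (μ.prod unitLeb) :=
    fun j hj => integrable_prod_of_bound ((hX.measurable_kterm_uncurry (hG hj)).pow_const 2)
      (hX.memLp j (hG hj)).integrable_sq fun ω t => by
        rw [abs_pow, ← sq_abs (X j ω)]
        exact pow_le_pow_left₀ (abs_nonneg _) (abs_kterm_le j t ω) 2
  refine ⟨(integrable_finsetSum _ fun j hj => (hi j hj).integral_prod_right).const_mul _, ?_⟩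
  rw [integral_const_mul, integral_finsetSum _ fun j hj => (hi j hj).integral_prod_right]
  congr 1
  refine Finset.sum_congr rfl fun j hj => ?_
  rw [← integral_integral_swap (f := fun ω t => kterm m J X j t ω ^ 2) (hi j hj)]
  congr 1; ext ω
  unfold kterm
  split_ifs with h
  · simp_rw [mul_pow, incKer_sq]
    rw [integral_const_mul, unitLeb, integral_abs_incKer h]
  · simp

omit [IsProbabilityMeasure μ] in
lemma LocField.memLp_kterm (hX : LocField m κ J X μ) {j : ι} (hj : j ∈ J) (t : ℝ) :
    MemLp (kterm m J X j t) 2 μ :=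
  (hX.memLp j hj).mono (((measurable_kterm hX.m_nonneg hj t).mono
    (hX.sigmaOf_le (nbhd_subset 1 j)) le_rfl).aestronglyMeasurable)
    (ae_of_all _ fun ω => abs_kterm_le j t ω)

lemma LocField.kmean_eq (hX : LocField m κ J X μ) {G : Finset ι} (hG : G ⊆ J) (t : ℝ) :
    kmean m J X μ G t = ∑ j ∈ G, ∫ ω, kterm m J X j t ω ∂μ :=
  integral_finsetSum _ fun _ hj => hX.integrable_kterm (hG hj) t

lemma LocField.integral_sq_ksum_sub_le_sum (hX : LocField m κ J X μ) {G : Finset ι} (hG : G ⊆ J)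
    (t : ℝ) : ∫ ω, (ksum m J X G t ω - kmean m J X μ G t) ^ 2 ∂μ ≤
      κ * ∑ j ∈ G, ∫ ω, kterm m J X j t ω ^ 2 ∂μ := by
  rw [hX.kmean_eq hG]
  exact hX.integral_sq_sum_sub_le hG (K := fun j => kterm m J X j t)
    (fun j hj => measurable_kterm hX.m_nonneg (hG hj) t) fun j hj => hX.memLp_kterm (hG hj) t

end Prob

namespace PField

lemma rpow_aux (hX : PField m κ J X μ p b) {y u : ℝ} (hy0 : 0 ≤ y) (hy1 : y ≤ 1) (hyu : y ≤ u) :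
    y ≤ u ^ (p - 2) := by
  have hp := hX.two_lt
  have hp3 := hX.le_three
  rcases hy0.eq_or_lt with h | h
  · rw [← h]; exact Real.rpow_nonneg (hy0.trans hyu) _
  · calc y = y ^ (1 : ℝ) := (Real.rpow_one y).symm
      _ ≤ y ^ (p - 2) := Real.rpow_le_rpow_of_exponent_ge h hy1 (by linarith)
      _ ≤ u ^ (p - 2) := Real.rpow_le_rpow hy0 hyu (by linarith)

lemma mul_rpow_aux (hX : PField m κ J X μ p b) {u : ℝ} (hu : 0 ≤ u) :
    u * u ^ (p - 2) = u ^ (p - 1) := by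
  have hp := hX.two_lt
  rw [← Real.rpow_one_add' hu (by linarith)]; congr 1; ring

lemma abs_Y_le (hX : PField m κ J X μ p b) (j : ι) (ω : Ω) :
    |psum X (nbhd m J 1 j) ω| ≤ asum X (nbhd m J 5 j) ω :=
  abs_psum_le (nbhd_mono hX.m_nonneg (by norm_num) j) ω

lemma integrable_one (hX : PField m κ J X μ p b) {j : ι} (hj : j ∈ J) :
    Integrable (fun ω => |X j ω| * asum X (nbhd m J 5 j) ω ^ (p - 1)) μ := by
  have := hX.integrable_mixed hj (c := 1) (by norm_num) (by linarith [hX.two_lt])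
  simpa using this

lemma integrable_two (hX : PField m κ J X μ p b) {j : ι} (hj : j ∈ J) :
    Integrable (fun ω => X j ω ^ 2 * asum X (nbhd m J 5 j) ω ^ (p - 2)) μ := by
  have := hX.integrable_mixed hj (c := 2) (by norm_num) (by linarith [hX.two_lt])
  simpa using this

/-- Large local sums contribute little. -/
lemma sum_large_le (hX : PField m κ J X μ p b) {G : Finset ι} (hG : G ⊆ J) :
    ∑ j ∈ G, ∫ ω, |X j ω| * (if |psum X (nbhd m J 1 j) ω| ≤ 1 then 0 else 1) ∂μ ≤ b := by
  refine le_trans ?_ hX.sum_one_le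
  refine le_trans (Finset.sum_le_sum fun j hj => ?_)
    (Finset.sum_le_sum_of_subset_of_nonneg hG fun j _ _ => integral_nonneg fun ω =>
      mul_nonneg (abs_nonneg _) (Real.rpow_nonneg (asum_nonneg _ _) _))
  refine integral_mono_of_nonneg (ae_of_all _ fun ω => ?_) (hX.integrable_one (hG hj))
    (ae_of_all _ fun ω => ?_)
  · dsimp only; split_ifs <;> positivity
  · dsimp only
    refine mul_le_mul_of_nonneg_left ?_ (abs_nonneg _)
    split_ifs with h
    · exact Real.rpow_nonneg (asum_nonneg _ _) _
    · exact Real.one_le_rpow ((le_of_not_ge h).trans (hX.abs_Y_le j ω)) (by linarith [hX.two_lt])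

variable [IsProbabilityMeasure μ]

lemma integral_sum_sq_kterm_le (hX : PField m κ J X μ p b) {G : Finset ι} (hG : G ⊆ J) :
    ∫ t, κ * ∑ j ∈ G, ∫ ω, kterm m J X j t ω ^ 2 ∂μ ∂unitLeb ≤ b := by
  have hκ := hX.kappa_pos
  rw [(hX.toLocField.integral_sum_sq_kterm hG).2]
  refine le_trans ?_ hX.sum_two_le
  refine mul_le_mul_of_nonneg_left ?_ hκ.le
  refine le_trans (Finset.sum_le_sum fun j hj => ?_)
    (Finset.sum_le_sum_of_subset_of_nonneg hG fun j _ _ => integral_nonneg fun ω =>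
      mul_nonneg (sq_nonneg _) (Real.rpow_nonneg (asum_nonneg _ _) _))
  refine integral_mono_of_nonneg (ae_of_all _ fun ω => ?_) (hX.integrable_two (hG hj))
    (ae_of_all _ fun ω => ?_)
  · dsimp only; split_ifs <;> positivity
  · dsimp only
    refine mul_le_mul_of_nonneg_left ?_ (sq_nonneg _)
    split_ifs with h
    · exact hX.rpow_aux (abs_nonneg _) h (hX.abs_Y_le j ω)
    · exact Real.rpow_nonneg (asum_nonneg _ _) _

/-- The total fluctuation of the random Stein kernel. -/
lemma integral_sq_ksum_sub_le (hX : PField m κ J X μ p b) {G : Finset ι} (hG : G ⊆ J) :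
    ∫ t, ∫ ω, (ksum m J X G t ω - kmean m J X μ G t) ^ 2 ∂μ ∂unitLeb ≤ b :=
  (integral_mono_of_nonneg (ae_of_all _ fun _ => integral_nonneg fun _ => sq_nonneg _)
    (hX.integral_sum_sq_kterm hG).1 (ae_of_all _ fun t =>
      hX.integral_sq_ksum_sub_le_sum hG t)).trans (hX.integral_sum_sq_kterm_le hG)

/-- The mean Stein kernel has little mass away from the origin. -/
lemma integral_abs_kmean_mul_le (hX : PField m κ J X μ p b) {G : Finset ι} (hG : G ⊆ J)
    {a : ℝ} (ha : 0 < a) :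
    ∫ t, |kmean m J X μ G t| * min 1 (|t| / a) ∂unitLeb ≤ b / a := by
  have hminm : Measurable (fun t : ℝ => min 1 (|t| / a)) := by fun_prop
  have hmin0 : ∀ t : ℝ, 0 ≤ min 1 (|t| / a) := fun t => by positivity
  have hi : ∀ j ∈ G, Integrable (fun q : Ω × ℝ => |kterm m J X j q.2 q.1| * min 1 (|q.2| / a))
      (μ.prod unitLeb) := fun j hj =>
    integrable_prod_of_bound ((measurable_norm.comp (hX.measurable_kterm_uncurry (hG hj))).mul
      (hminm.comp measurable_snd)) (hX.integrable (hG hj)).abs fun ω t => by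
        dsimp only
        rw [abs_mul, abs_abs, abs_of_nonneg (hmin0 t)]
        calc _ ≤ |X j ω| * 1 := mul_le_mul (abs_kterm_le j t ω) (min_le_left _ _) (hmin0 t)
              (abs_nonneg _)
          _ = _ := mul_one _
  have h1 : ∀ t, |kmean m J X μ G t| * min 1 (|t| / a) ≤
      ∑ j ∈ G, ∫ ω, |kterm m J X j t ω| * min 1 (|t| / a) ∂μ := by
    intro t
    have e : kmean m J X μ G t = ∑ j ∈ G, ∫ ω, kterm m J X j t ω ∂μ :=
      integral_finsetSum _ fun j hj => hX.integrable_kterm (hG hj) t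
    rw [e]
    simp_rw [integral_mul_const]
    rw [← Finset.sum_mul]
    refine mul_le_mul_of_nonneg_right ?_ (hmin0 t)
    exact (Finset.abs_sum_le_sum_abs _ _).trans
      (Finset.sum_le_sum fun j _ => abs_integral_le_integral_abs)
  calc _ ≤ ∫ t, ∑ j ∈ G, ∫ ω, |kterm m J X j t ω| * min 1 (|t| / a) ∂μ ∂unitLeb :=
        integral_mono_of_nonneg (ae_of_all _ fun t => mul_nonneg (abs_nonneg _) (hmin0 t))
          (integrable_finsetSum _ fun j hj => (hi j hj).integral_prod_right) (ae_of_all _ h1)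
    _ = ∑ j ∈ G, ∫ ω, ∫ t, |kterm m J X j t ω| * min 1 (|t| / a) ∂unitLeb ∂μ := by
        rw [integral_finsetSum _ fun j hj => (hi j hj).integral_prod_right]
        refine Finset.sum_congr rfl fun j hj => ?_
        rw [← integral_integral_swap (f := fun ω t => |kterm m J X j t ω| * min 1 (|t| / a))
          (hi j hj)]
    _ ≤ ∑ j ∈ G, ∫ ω, a⁻¹ * (|X j ω| * asum X (nbhd m J 5 j) ω ^ (p - 1)) ∂μ := by
        refine Finset.sum_le_sum fun j hj => ?_
        refine integral_mono_of_nonneg (ae_of_all _ fun ω => integral_nonneg fun t =>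
          mul_nonneg (abs_nonneg _) (hmin0 t)) ((hX.integrable_one (hG hj)).const_mul _)
          (ae_of_all _ fun ω => ?_)
        dsimp only
        set y := psum X (nbhd m J 1 j) ω with hy
        set u := asum X (nbhd m J 5 j) ω
        have hu0 : 0 ≤ u := asum_nonneg _ _
        have hyu : |y| ≤ u := hX.abs_Y_le j ω
        unfold kterm
        rw [← hy]
        by_cases h : |y| ≤ 1
        · simp only [if_pos h]
          calc _ ≤ ∫ t, |X j ω| * (|incKer y t| * (|y| / a)) ∂unitLeb := by
                refine integral_mono_of_nonneg (ae_of_all _ fun t =>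
                  mul_nonneg (abs_nonneg _) (hmin0 t))
                  (((integrable_incKer y).abs.mul_const _).const_mul _) (ae_of_all _ fun t => ?_)
                dsimp only
                rw [abs_mul, mul_assoc]
                refine mul_le_mul_of_nonneg_left ?_ (abs_nonneg _)
                rcases le_or_gt |t| |y| with ht | ht
                · exact mul_le_mul_of_nonneg_left ((min_le_right _ _).trans (by gcongr))
                    (abs_nonneg _)
                · rw [abs_incKer_le_of_lt ht]; simp
            _ = |X j ω| * (|y| * (|y| / a)) := by
                rw [integral_const_mul, integral_mul_const, unitLeb, integral_abs_incKer h]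
            _ = a⁻¹ * (|X j ω| * (|y| * |y|)) := by ring
            _ ≤ _ := by
                rw [← hX.mul_rpow_aux hu0]
                have := hX.rpow_aux (abs_nonneg y) h hyu
                gcongr
        · simp only [if_neg h, mul_zero, abs_zero, zero_mul, integral_zero]
          positivity
    _ ≤ a⁻¹ * b := by
        simp_rw [integral_const_mul]
        rw [← Finset.mul_sum]
        refine mul_le_mul_of_nonneg_left ?_ (by positivity)
        refine le_trans ?_ hX.sum_one_le
        exact Finset.sum_le_sum_of_subset_of_nonneg hG fun j _ _ => integral_nonneg fun ω =>
          mul_nonneg (abs_nonneg _) (Real.rpow_nonneg (asum_nonneg _ _) _)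
    _ = b / a := by ring

open Classical in
/-- The total mass of the mean Stein kernel is close to the variance. -/
lemma le_integral_kmean (hX : PField m κ J X μ p b) (i : ι) :
    ∫ ω, psum X J ω ^ 2 ∂μ - ∫ ω, asum X (nbhd m J 5 i) ω ^ 2 ∂μ - b ≤
      ∫ t, kmean m J X μ (J \ nbhd m J 4 i) t ∂unitLeb := by
  have hp := hX.two_lt
  have hG : J \ nbhd m J 4 i ⊆ J := Finset.sdiff_subset
  rw [hX.toLocField.integral_kmean hG]
  have h1 : ∀ j ∈ J \ nbhd m J 4 i, ∫ ω, X j ω * psum X (nbhd m J 1 j) ω ∂μ -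
      ∫ ω, |X j ω| * asum X (nbhd m J 5 j) ω ^ (p - 1) ∂μ ≤ ∫ ω, X j ω *
      (if |psum X (nbhd m J 1 j) ω| ≤ 1 then psum X (nbhd m J 1 j) ω else 0) ∂μ := by
    intro j hj
    rw [← integral_sub (hX.integrable_mul (hG hj) 1) (hX.integrable_one (hG hj))]
    refine integral_mono ((hX.integrable_mul (hG hj) 1).sub (hX.integrable_one (hG hj))) ?_
      fun ω => ?_
    · refine (hX.integrable (hG hj)).mul_bdd (c := 1) ?_ (ae_of_all _ fun ω => ?_)
      · have h2 : Measurable (psum X (nbhd m J 1 j)) := hX.measurable_psum (nbhd_subset 1 j)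
        exact (Measurable.ite (measurableSet_le (measurable_norm.comp h2) measurable_const) h2
          measurable_const).aestronglyMeasurable
      · split_ifs with h
        · exact h
        · simp
    · set y := psum X (nbhd m J 1 j) ω
      set u := asum X (nbhd m J 5 j) ω
      have hu0 : 0 ≤ u := asum_nonneg _ _
      have hyu : |y| ≤ u := hX.abs_Y_le j ω
      dsimp only
      rw [← hX.mul_rpow_aux hu0]
      split_ifs with h
      · have : 0 ≤ |X j ω| * (u * u ^ (p - 2)) := by positivity
        linarith
      · have h2 : 1 ≤ u ^ (p - 2) :=
          Real.one_le_rpow ((le_of_not_ge h).trans hyu) (by linarith)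
        have h3 : X j ω * y ≤ |X j ω| * (u * u ^ (p - 2)) := by
          calc X j ω * y ≤ |X j ω| * |y| := by rw [← abs_mul]; exact le_abs_self _
            _ ≤ |X j ω| * (u * 1) := by rw [mul_one]; gcongr
            _ ≤ _ := by gcongr
        linarith
  have h2 := Finset.sum_le_sum h1
  rw [Finset.sum_sub_distrib] at h2
  have h3 : ∑ j ∈ J \ nbhd m J 4 i, ∫ ω, |X j ω| * asum X (nbhd m J 5 j) ω ^ (p - 1) ∂μ ≤ b :=
    le_trans (Finset.sum_le_sum_of_subset_of_nonneg hG fun j _ _ => integral_nonneg fun ω =>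
      mul_nonneg (abs_nonneg _) (Real.rpow_nonneg (asum_nonneg _ _) _)) hX.sum_one_le
  have h4 : ∑ j ∈ nbhd m J 4 i, ∫ ω, X j ω * psum X (nbhd m J 1 j) ω ∂μ ≤
      ∫ ω, asum X (nbhd m J 5 i) ω ^ 2 ∂μ := by
    have e : ∀ j ∈ nbhd m J 4 i, ∫ ω, X j ω * psum X (nbhd m J 1 j) ω ∂μ =
        ∫ ω, X j ω * psum X (nbhd m J 5 i) ω ∂μ := fun j hj =>
      (hX.integral_mul_psum (nbhd_subset _ _ hj) (nbhd_subset 5 i) (nbhd_trans rfl hj)).symm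
    rw [Finset.sum_congr rfl e, ← integral_finsetSum]
    · refine integral_mono ?_ (hX.memLp_asum (nbhd_subset 5 i)).integrable_sq fun ω => ?_
      · exact integrable_finsetSum _ fun j hj => (hX.memLp j (nbhd_subset _ _ hj)).integrable_mul
          (hX.memLp_psum (nbhd_subset 5 i))
      · dsimp only
        rw [← Finset.sum_mul]
        change psum X (nbhd m J 4 i) ω * psum X (nbhd m J 5 i) ω ≤ _
        have h5 := abs_psum_le (X := X)
          (nbhd_mono hX.m_nonneg (by norm_num : 4 ≤ 5) i : nbhd m J 4 i ⊆ _) ω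
        have h6 := abs_psum_le (X := X) (le_refl (nbhd m J 5 i)) ω
        calc _ ≤ |psum X (nbhd m J 4 i) ω| * |psum X (nbhd m J 5 i) ω| := by
              rw [← abs_mul]; exact le_abs_self _
          _ ≤ asum X (nbhd m J 5 i) ω * asum X (nbhd m J 5 i) ω := by
              gcongr
              exact asum_nonneg _ _
          _ = _ := (sq _).symm
    · exact fun j hj => (hX.memLp j (nbhd_subset _ _ hj)).integrable_mul
        (hX.memLp_psum (nbhd_subset 5 i))
  have h5 := hX.integral_sq_psum
  rw [← Finset.sum_sdiff (nbhd_subset 4 i)] at h5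
  linarith

end PField
end KernelBounds

/-! ### Oscillation of the ramp, and fluctuations against the trapezoid -/

section Smoothing

open Set

/-- A bound for the oscillation of `ramp z a` on the interval of radius `V` around `w`, valid for
`V ≤ 1`. -/
noncomputable def rampOsc (z a V w : ℝ) : ℝ :=
  a⁻¹ * ∫ t, (if |t| ≤ V then 1 else 0) * ivl z a (w + t) ∂unitLeb

lemma measurable_rampOsc_integrand (z a : ℝ) :
    Measurable (fun q : (ℝ × ℝ) × ℝ => (if |q.2| ≤ q.1.1 then (1 : ℝ) else 0) *
      ivl z a (q.1.2 + q.2)) := by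
  refine Measurable.mul (Measurable.ite (measurableSet_le (by fun_prop) (by fun_prop))
    measurable_const measurable_const) ?_
  exact (measurable_ivl z a).comp (by fun_prop)

lemma measurable_rampOsc (z a : ℝ) : Measurable (fun q : ℝ × ℝ => rampOsc z a q.1 q.2) :=
  ((measurable_rampOsc_integrand z a).stronglyMeasurable.integral_prod_right').measurable.const_mul
    a⁻¹

lemma rampOsc_nonneg {z a : ℝ} (ha : 0 < a) (V w : ℝ) : 0 ≤ rampOsc z a V w :=
  mul_nonneg (by positivity) (integral_nonneg fun t =>
    mul_nonneg (by split_ifs <;> simp) (ivl_nonneg _ _ _))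

lemma rampOsc_le {z a : ℝ} (ha : 0 < a) (V w : ℝ) : rampOsc z a V w ≤ a⁻¹ * 2 := by
  refine mul_le_mul_of_nonneg_left ?_ (by positivity)
  calc _ ≤ ∫ t, (1 : ℝ) ∂unitLeb := by
        refine integral_mono_of_nonneg (ae_of_all _ fun t => mul_nonneg (by split_ifs <;> simp)
          (ivl_nonneg _ _ _)) (integrable_const _) (ae_of_all _ fun t => ?_)
        exact mul_le_one₀ (by split_ifs <;> simp) (ivl_nonneg _ _ _) (ivl_le_one _ _ _)
    _ = 2 := by simp [unitLeb]; norm_num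

lemma abs_ramp_sub_le_rampOsc {z a : ℝ} (ha : 0 < a) {V w x y : ℝ} (hV : V ≤ 1)
    (hx : |x - w| ≤ V) (hy : |y - w| ≤ V) : |ramp z a x - ramp z a y| ≤ rampOsc z a V w :=
  ramp_sub_le ha hV hx hy

lemma integral_abs_le_unit {V : ℝ} (hV0 : 0 ≤ V) (hV1 : V ≤ 1) :
    ∫ t, (if |t| ≤ V then (1 : ℝ) else 0) ∂unitLeb = 2 * V := by
  have h1 : (fun t : ℝ => if |t| ≤ V then (1 : ℝ) else 0) = (Icc (-V) V).indicator 1 := by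
    ext t
    simp only [indicator, mem_Icc, abs_le, Pi.one_apply]
  rw [h1, integral_indicator_one measurableSet_Icc, unitLeb, measureReal_restrict_apply
    measurableSet_Icc, inter_eq_left.2 (Icc_subset_Icc (by linarith) hV1),
    Real.volume_real_Icc_of_le (by linarith)]
  ring

/-- The concentration inequality turns the oscillation of `ramp` into a bound free of `a`. -/
lemma integral_mul_rampOsc_le {Ω : Type*} {F : MeasurableSpace Ω}
    [mΩ : MeasurableSpace Ω] {μ : Measure Ω} [IsProbabilityMeasure μ] (hF : F ≤ mΩ) {W V ξ : Ω → ℝ}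
    (hW : Measurable W) (hV : Measurable[F] V) (hξ : Measurable[F] ξ) (hV0 : ∀ ω, 0 ≤ V ω)
    (hξ0 : ∀ ω, 0 ≤ ξ ω) (hξ1 : ∀ ω, V ω ≤ 1 → ξ ω ≤ 1) {z a D : ℝ} (ha : 0 < a)
    (hconc : ∀ ζ : Ω → ℝ, Measurable[F] ζ → (∀ ω, 0 ≤ ζ ω) → (∀ ω, ζ ω ≤ 1) → ∀ x,
      |x - z| ≤ 1 → ∫ ω, ζ ω * ivl x a (W ω) ∂μ ≤ D * a * ∫ ω, ζ ω ∂μ) :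
    ∫ ω, ξ ω * (if V ω ≤ 1 then rampOsc z a (V ω) (W ω) else 0) ∂μ ≤
      2 * D * ∫ ω, ξ ω * (if V ω ≤ 1 then V ω else 0) ∂μ := by
  have hVm := hV.mono hF le_rfl
  have hξm := hξ.mono hF le_rfl
  -- the part of `ξ` seen at the shift `t`
  set ζ : ℝ → Ω → ℝ := fun t ω => ξ ω * (if V ω ≤ 1 then (if |t| ≤ V ω then 1 else 0) else 0)
    with hζ
  have hind : ∀ (t : ℝ) (v : ℝ), (0 : ℝ) ≤ (if v ≤ 1 then (if |t| ≤ v then 1 else 0) else 0) ∧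
      (if v ≤ 1 then (if |t| ≤ v then (1 : ℝ) else 0) else 0) ≤ 1 := fun t v => by
    split_ifs <;> norm_num
  have hindm : Measurable (fun q : ℝ × ℝ => if q.1 ≤ 1 then (if |q.2| ≤ q.1 then (1 : ℝ) else 0)
      else 0) :=
    Measurable.ite (measurableSet_le measurable_fst measurable_const)
      (Measurable.ite (measurableSet_le (by fun_prop) measurable_fst) measurable_const
        measurable_const) measurable_const
  have hζm : ∀ t, Measurable[F] (ζ t) := fun t =>
    hξ.mul (hindm.comp (hV.prodMk measurable_const))
  have hζmm : Measurable (fun q : Ω × ℝ => ζ q.2 q.1) :=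
    (hξm.comp measurable_fst).mul (hindm.comp ((hVm.comp measurable_fst).prodMk measurable_snd))
  have hζ0 : ∀ t ω, 0 ≤ ζ t ω := fun t ω => mul_nonneg (hξ0 ω) (hind _ _).1
  have hζ1 : ∀ t ω, ζ t ω ≤ 1 := fun t ω => by
    by_cases h : V ω ≤ 1
    · exact mul_le_one₀ (hξ1 ω h) (hind _ _).1 (hind _ _).2
    · simp [hζ, h]
  have hζa : ∀ t ω, |ζ t ω| ≤ 1 := fun t ω => by rw [abs_of_nonneg (hζ0 t ω)]; exact hζ1 t ω
  have i1 : Integrable (fun q : Ω × ℝ => ζ q.2 q.1) (μ.prod unitLeb) :=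
    integrable_prod_of_bound hζmm (integrable_const 1) fun ω t => hζa t ω
  have i2 : Integrable (fun q : Ω × ℝ => ζ q.2 q.1 * ivl z a (W q.1 + q.2)) (μ.prod unitLeb) := by
    refine integrable_prod_of_bound (hζmm.mul ((measurable_ivl z a).comp
      ((hW.comp measurable_fst).add measurable_snd))) (integrable_const 1) fun ω t => ?_
    rw [abs_mul, abs_of_nonneg (ivl_nonneg _ _ _)]
    exact mul_le_one₀ (hζa t ω) (ivl_nonneg _ _ _) (ivl_le_one _ _ _)
  have e1 : ∀ ω, ξ ω * (if V ω ≤ 1 then rampOsc z a (V ω) (W ω) else 0) =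
      a⁻¹ * ∫ t, ζ t ω * ivl z a (W ω + t) ∂unitLeb := by
    intro ω
    simp only [hζ]
    split_ifs with h
    · simp_rw [mul_assoc]
      rw [integral_const_mul, rampOsc]; ring
    · simp
  have e2 : ∀ ω, ξ ω * (if V ω ≤ 1 then V ω else 0) = 2⁻¹ * ∫ t, ζ t ω ∂unitLeb := by
    intro ω
    simp only [hζ]
    rw [integral_const_mul]
    split_ifs with h
    · rw [integral_abs_le_unit (hV0 ω) h]; ring
    · simp
  simp_rw [e1, e2]
  rw [integral_const_mul, integral_const_mul,
    integral_integral_swap (f := fun ω t => ζ t ω * ivl z a (W ω + t)) i2,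
    integral_integral_swap (f := fun ω t => ζ t ω) i1]
  have h3 : ∫ t, ∫ ω, ζ t ω * ivl z a (W ω + t) ∂μ ∂unitLeb ≤
      ∫ t, D * a * ∫ ω, ζ t ω ∂μ ∂unitLeb := by
    refine integral_mono_ae i2.integral_prod_right (i1.integral_prod_right.const_mul _) ?_
    rw [unitLeb]
    filter_upwards [ae_restrict_mem measurableSet_Icc] with t ht
    simp_rw [ivl_add]
    refine hconc (ζ t) (hζm t) (hζ0 t) (hζ1 t) _ ?_
    rw [sub_sub_cancel_left, abs_neg]
    exact abs_le.2 ht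
  rw [integral_const_mul] at h3
  have h4 := mul_le_mul_of_nonneg_left h3 (inv_nonneg.2 ha.le)
  refine h4.trans (le_of_eq ?_)
  field_simp

end Smoothing

section Fluct

variable {ι Ω : Type*} [PseudoMetricSpace ι] {m κ : ℝ} {J : Finset ι} {X : ι → Ω → ℝ}
  [mΩ : MeasurableSpace Ω] {μ : Measure Ω} [IsProbabilityMeasure μ] {p b : ℝ}

open Classical in
omit [IsProbabilityMeasure μ] mΩ in
lemma measurable_ksum_far (hm : 0 ≤ m) (i : ι) (t : ℝ) :
    Measurable[sigmaOf X (J \ nbhd m J 3 i)] (ksum m J X (J \ nbhd m J 4 i) t) := by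
  unfold ksum
  refine Finset.measurable_fun_sum _ fun j hj => ?_
  rw [Finset.mem_sdiff] at hj
  exact (measurable_kterm hm hj.1 t).mono (sigmaOf_mono (nbhd_subset_sdiff (s := 1) rfl hj.1 hj.2))
    le_rfl

open Classical in
/-- The fluctuation term of the concentration inequality, for functions `ζ` of the field near
`i`. -/
lemma PField.integral_trap_mul_abs_le (hX : PField m κ J X μ p b) {i : ι} {ζ : Ω → ℝ}
    (hζ : Measurable[sigmaOf X (nbhd m J 2 i)] ζ) (hζ0 : ∀ ω, 0 ≤ ζ ω) (hζ1 : ∀ ω, ζ ω ≤ 1)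
    {a l : ℝ} (ha : 0 < a) (hl : 0 < l) (x : ℝ) :
    ∫ q, ζ q.1 * (trap x a (psum X J q.1 + q.2) *
      |ksum m J X (J \ nbhd m J 4 i) q.2 q.1 - kmean m J X μ (J \ nbhd m J 4 i) q.2|)
        ∂(μ.prod unitLeb) ≤ (3 / 2 * l * a + b / (2 * l)) * ∫ ω, ζ ω ∂μ := by
  set G := J \ nbhd m J 4 i
  have hG : G ⊆ J := Finset.sdiff_subset
  set M : ℝ → Ω → ℝ := fun t ω => ksum m J X G t ω - kmean m J X μ G t
  have hζm : Measurable ζ := hζ.mono (hX.sigmaOf_le (nbhd_subset 2 i)) le_rfl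
  have hWm : Measurable (psum X J) := hX.measurable_psum le_rfl
  have hζb : ∀ ω, |ζ ω| ≤ 1 := fun ω => by rw [abs_of_nonneg (hζ0 ω)]; exact hζ1 ω
  have hζi : Integrable ζ μ := Integrable.of_bound hζm.aestronglyMeasurable 1 (ae_of_all _ hζb)
  have hMm : Measurable (fun q : Ω × ℝ => M q.2 q.1) :=
    (hX.measurable_ksum_uncurry hG).sub ((hX.measurable_kmean hG).comp measurable_snd)
  have hMb : ∀ t ω, |M t ω| ≤ asum X G ω + ∫ ω', asum X G ω' ∂μ := fun t ω =>
    (abs_sub _ _).trans (add_le_add (abs_ksum_le G t ω) (hX.abs_kmean_le hG t))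
  have hM2 : MemLp (fun ω => asum X G ω + ∫ ω', asum X G ω' ∂μ) 2 μ :=
    (hX.memLp_asum hG).add (memLp_const _)
  have htm : Measurable (fun q : Ω × ℝ => trap x a (psum X J q.1 + q.2)) :=
    (continuous_trap x a).measurable.comp ((hWm.comp measurable_fst).add measurable_snd)
  have i1 : Integrable (fun q : Ω × ℝ => M q.2 q.1 ^ 2) (μ.prod unitLeb) :=
    integrable_prod_of_bound (hMm.pow_const 2) hM2.integrable_sq fun ω t => by
      rw [abs_pow]; exact pow_le_pow_left₀ (abs_nonneg _) (hMb t ω) 2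
  have i2 : Integrable (fun q : Ω × ℝ => ζ q.1 * M q.2 q.1 ^ 2) (μ.prod unitLeb) :=
    (i1.bdd_mul (c := 1) (hζm.comp measurable_fst).aestronglyMeasurable
      (ae_of_all _ fun q => hζb q.1))
  have i3 : Integrable (fun q : Ω × ℝ => ζ q.1 * trap x a (psum X J q.1 + q.2))
      (μ.prod unitLeb) :=
    integrable_prod_of_bound ((hζm.comp measurable_fst).mul htm) (integrable_const 1) fun ω t => by
      dsimp only
      rw [abs_mul, abs_of_nonneg (trap_nonneg _ _ _)]
      exact mul_le_one₀ (hζb ω) (trap_nonneg _ _ _) (trap_le_one _ _ _)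
  have h1 : ∫ q, ζ q.1 * trap x a (psum X J q.1 + q.2) ∂(μ.prod unitLeb) ≤ 3 * a * ∫ ω, ζ ω ∂μ := by
    rw [integral_prod _ i3, ← integral_const_mul]
    refine integral_mono i3.integral_prod_left (hζi.const_mul _) fun ω => ?_
    dsimp only
    rw [integral_const_mul, mul_comm]
    exact mul_le_mul_of_nonneg_right (integral_trap_shift_le ha x _) (hζ0 ω)
  have h2 : ∫ q, ζ q.1 * M q.2 q.1 ^ 2 ∂(μ.prod unitLeb) ≤ b * ∫ ω, ζ ω ∂μ := by
    rw [integral_prod_symm _ i2]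
    have e : ∀ t, ∫ ω, ζ ω * M t ω ^ 2 ∂μ = (∫ ω, ζ ω ∂μ) * ∫ ω, M t ω ^ 2 ∂μ := fun t =>
      hX.integral_mul_nbhd (r := 2) (s := 3) rfl i hζ
        (((measurable_ksum_far hX.m_nonneg i t).sub measurable_const).pow_const 2)
    simp_rw [e]
    rw [integral_const_mul, mul_comm]
    exact mul_le_mul_of_nonneg_right (hX.integral_sq_ksum_sub_le hG) (integral_nonneg hζ0)
  calc _ ≤ ∫ q, (l / 2 * (ζ q.1 * trap x a (psum X J q.1 + q.2)) +
        1 / (2 * l) * (ζ q.1 * M q.2 q.1 ^ 2)) ∂(μ.prod unitLeb) := by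
        refine integral_mono_of_nonneg (ae_of_all _ fun q => mul_nonneg (hζ0 _)
          (mul_nonneg (trap_nonneg _ _ _) (abs_nonneg _))) ((i3.const_mul _).add (i2.const_mul _))
          (ae_of_all _ fun q => ?_)
        dsimp only
        have ht0 := trap_nonneg x a (psum X J q.1 + q.2)
        have ht1 := trap_le_one x a (psum X J q.1 + q.2)
        set τ := trap x a (psum X J q.1 + q.2)
        have h3 : τ * |M q.2 q.1| ≤ l / 2 * τ + 1 / (2 * l) * M q.2 q.1 ^ 2 := by
          rw [← sq_abs (M q.2 q.1)]
          set y := |M q.2 q.1|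
          have h4 : 0 ≤ (l * τ - y) ^ 2 / (2 * l) := by positivity
          have h5 : (l * τ - y) ^ 2 / (2 * l) = l / 2 * τ ^ 2 - τ * y + 1 / (2 * l) * y ^ 2 := by
            field_simp; ring
          have h6 : l / 2 * τ ^ 2 ≤ l / 2 * τ := by
            have : τ ^ 2 ≤ τ := by nlinarith
            gcongr
          linarith
        have := mul_le_mul_of_nonneg_left h3 (hζ0 q.1)
        change ζ q.1 * (τ * |M q.2 q.1|) ≤ _
        linarith
    _ = l / 2 * ∫ q, ζ q.1 * trap x a (psum X J q.1 + q.2) ∂(μ.prod unitLeb) +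
        1 / (2 * l) * ∫ q, ζ q.1 * M q.2 q.1 ^ 2 ∂(μ.prod unitLeb) := by
        rw [integral_add (i3.const_mul _) (i2.const_mul _), integral_const_mul, integral_const_mul]
    _ ≤ l / 2 * (3 * a * ∫ ω, ζ ω ∂μ) + 1 / (2 * l) * (b * ∫ ω, ζ ω ∂μ) := by gcongr
    _ = _ := by field_simp

end Fluct

/-! ### Stein's equation for smoothed indicators -/

section SteinRamp

variable {ι Ω : Type*} [PseudoMetricSpace ι] {m κ : ℝ} {J : Finset ι} {X : ι → Ω → ℝ}
  [mΩ : MeasurableSpace Ω] {μ : Measure Ω} [IsProbabilityMeasure μ] {p b : ℝ}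

open Classical in
/-- Given a concentration inequality at scale `a`, the expansion of `E W f(W)` for the Stein
solution `f` of `ramp z a` has an error free of `a`. The variables `γ i` bound the slope of
`w ↦ w * f w` near `W`, and `l i` takes care of the event that the neighbours of `i` are large. -/
theorem LocField.stein_ramp (hX : LocField m κ J X μ) {z a D Γ : ℝ} (ha : 0 < a)
    {γ l : ι → Ω → ℝ}
    (hγm : ∀ i ∈ J, Measurable[sigmaOf X (J \ nbhd m J 3 i)] (γ i))
    (hγi : ∀ i ∈ J, Integrable (γ i) μ) (hγ : ∀ i ∈ J, ∫ ω, γ i ω ∂μ ≤ Γ)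
    (hlm : ∀ i ∈ J, Measurable (l i)) (hl0 : ∀ i ω, 0 ≤ l i ω) (hl3 : ∀ i ω, l i ω ≤ 3)
    (hconc : ∀ i ∈ J, ∀ ζ : Ω → ℝ, Measurable[sigmaOf X (nbhd m J 2 i)] ζ → (∀ ω, 0 ≤ ζ ω) →
      (∀ ω, ζ ω ≤ 1) → ∀ x, |x - z| ≤ 1 →
      ∫ ω, ζ ω * ivl x a (psum X J ω) ∂μ ≤ D * a * ∫ ω, ζ ω ∂μ)
    (hlarge : ∀ i ∈ J, ∀ ω, 1 < asum X (nbhd m J 2 i) ω → 3 ≤ l i ω)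
    (hosc : ∀ i ∈ J, ∀ ω u v, |u - psum X J ω| ≤ asum X (nbhd m J 2 i) ω →
      |v - psum X J ω| ≤ asum X (nbhd m J 2 i) ω → |u - v| ≤ asum X (nbhd m J 2 i) ω →
      asum X (nbhd m J 2 i) ω ≤ 1 →
      |u * steinSol (ramp z a) (∫ x, ramp z a x ∂(gaussianReal 0 1)) u -
        v * steinSol (ramp z a) (∫ x, ramp z a x ∂(gaussianReal 0 1)) v| ≤
        asum X (nbhd m J 2 i) ω * γ i ω + l i ω) :
    |∫ ω, psum X J ω * steinSol (ramp z a) (∫ x, ramp z a x ∂(gaussianReal 0 1)) (psum X J ω) ∂μ -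
      (∫ ω, psum X J ω ^ 2 ∂μ) *
        ∫ ω, steinDer (ramp z a) (∫ x, ramp z a x ∂(gaussianReal 0 1)) (psum X J ω) ∂μ| ≤
      ∑ i ∈ J, ((∫ ω, |X i ω * psum X (nbhd m J 1 i) ω| * ((2 * D + Γ) *
          (if asum X (nbhd m J 2 i) ω ≤ 1 then asum X (nbhd m J 2 i) ω else 0) + l i ω) ∂μ) +
        (∫ ω, |X i ω * psum X (nbhd m J 1 i) ω| ∂μ) * ∫ ω, ((2 * D + Γ) *
          (if asum X (nbhd m J 2 i) ω ≤ 1 then asum X (nbhd m J 2 i) ω else 0) + l i ω) ∂μ) := by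
  set W := psum X J
  set c := ∫ x, ramp z a x ∂(gaussianReal 0 1)
  have H : SteinTest (ramp z a) c := steinTest_ramp z a
  have hWm : Measurable W := hX.measurable_psum le_rfl
  have hm0 := hX.m_nonneg
  set V : ι → Ω → ℝ := fun i => asum X (nbhd m J 2 i)
  have hV0 : ∀ i ω, 0 ≤ V i ω := fun i ω => asum_nonneg _ _
  have hVF : ∀ i, Measurable[sigmaOf X (nbhd m J 2 i)] (V i) := fun i => measurable_asum le_rfl
  have hVm : ∀ i, Measurable (V i) := fun i => hX.measurable_asum (nbhd_subset 2 i)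
  set ξ : ι → Ω → ℝ := fun i ω => |X i ω * psum X (nbhd m J 1 i) ω| with hξ
  have hξ0 : ∀ i ω, 0 ≤ ξ i ω := fun i ω => abs_nonneg _
  have hξF : ∀ i ∈ J, Measurable[sigmaOf X (nbhd m J 2 i)] (ξ i) := fun i hi =>
    measurable_norm.comp ((measurable_sigmaOf (self_mem_nbhd hm0 2 hi)).mul
      (measurable_psum (nbhd_mono hm0 (by norm_num) i)))
  have hξi : ∀ i ∈ J, Integrable (ξ i) μ := fun i hi => (hX.integrable_mul hi 1).abs
  have hξ1 : ∀ i ∈ J, ∀ ω, V i ω ≤ 1 → ξ i ω ≤ 1 := fun i hi ω h => by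
    simp only [hξ]
    rw [abs_mul]
    exact mul_le_one₀ ((abs_le_asum (self_mem_nbhd hm0 2 hi) ω).trans h) (abs_nonneg _)
      ((abs_psum_le (nbhd_mono hm0 (by norm_num) i) ω).trans h)
  set o : ι → Ω → ℝ := fun i ω => if V i ω ≤ 1 then rampOsc z a (V i ω) (W ω) else 0 with ho
  set t : ι → Ω → ℝ := fun i ω => if V i ω ≤ 1 then V i ω else 0 with ht
  have hmt : Measurable (fun v : ℝ => if v ≤ 1 then v else 0) :=
    Measurable.ite (measurableSet_le measurable_id measurable_const) measurable_id measurable_const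
  have htF : ∀ i, Measurable[sigmaOf X (nbhd m J 2 i)] (t i) := fun i => hmt.comp (hVF i)
  have htm : ∀ i, Measurable (t i) := fun i => hmt.comp (hVm i)
  have ht0 : ∀ i ω, 0 ≤ t i ω := fun i ω => by
    simp only [ht]; split_ifs; exacts [hV0 i ω, le_rfl]
  have ht1 : ∀ i ω, t i ω ≤ 1 := fun i ω => by
    simp only [ht]; split_ifs with h; exacts [h, zero_le_one]
  have hom : ∀ i, Measurable (o i) := fun i =>
    Measurable.ite (measurableSet_le (hVm i) measurable_const)
      ((measurable_rampOsc z a).comp ((hVm i).prodMk hWm)) measurable_const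
  have ho1 : ∀ i ω, |o i ω| ≤ a⁻¹ * 2 := fun i ω => by
    simp only [ho]
    split_ifs
    · rw [abs_of_nonneg (rampOsc_nonneg ha _ _)]; exact rampOsc_le ha _ _
    · simp; positivity
  have hobd : ∀ i, ∀ g : Ω → ℝ, Integrable g μ → Integrable (fun ω => g ω * o i ω) μ :=
    fun i g hg => hg.mul_bdd (hom i).aestronglyMeasurable (ae_of_all _ (ho1 i))
  have hlbd : ∀ i ∈ J, ∀ g : Ω → ℝ, Integrable g μ → Integrable (fun ω => g ω * l i ω) μ :=
    fun i hi g hg => hg.mul_bdd (c := 3) (hlm i hi).aestronglyMeasurable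
      (ae_of_all _ fun ω => by rw [Real.norm_eq_abs, abs_of_nonneg (hl0 i ω)]; exact hl3 i ω)
  have htbd : ∀ i, ∀ g : Ω → ℝ, Integrable g μ → Integrable (fun ω => g ω * t i ω) μ :=
    fun i g hg => hg.mul_bdd (c := 1) (htm i).aestronglyMeasurable
      (ae_of_all _ fun ω => by rw [Real.norm_eq_abs, abs_of_nonneg (ht0 i ω)]; exact ht1 i ω)
  -- the bound for functions `g` of the field near `i`
  have key : ∀ i ∈ J, ∀ g : Ω → ℝ, Measurable[sigmaOf X (nbhd m J 2 i)] g → Integrable g μ →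
      (∀ ω, 0 ≤ g ω) → (∀ ω, V i ω ≤ 1 → g ω ≤ 1) →
      Integrable (fun ω => g ω * (o i ω + t i ω * γ i ω + l i ω)) μ ∧
      ∫ ω, g ω * (o i ω + t i ω * γ i ω + l i ω) ∂μ ≤
        ∫ ω, g ω * ((2 * D + Γ) * t i ω + l i ω) ∂μ := by
    intro i hi g hgF hg hg0 hg1
    have e1 : ∀ ω, g ω * (o i ω + t i ω * γ i ω + l i ω) =
        g ω * o i ω + (g ω * t i ω) * γ i ω + g ω * l i ω := fun ω => by ring
    have e2 : ∀ ω, g ω * ((2 * D + Γ) * t i ω + l i ω) =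
        (2 * D + Γ) * (g ω * t i ω) + g ω * l i ω := fun ω => by ring
    have hgt := htbd i g hg
    have hgtγ : Integrable (fun ω => (g ω * t i ω) * γ i ω) μ :=
      hX.integrable_mul_nbhd (r := 2) (s := 3) rfl i (hgF.mul (htF i)) (hγm i hi) hgt (hγi i hi)
    have i1 : Integrable (fun ω => g ω * o i ω + (g ω * t i ω) * γ i ω) μ := (hobd i g hg).add hgtγ
    simp_rw [e1, e2]
    refine ⟨i1.add (hlbd i hi g hg), ?_⟩
    rw [integral_add i1 (hlbd i hi g hg), integral_add (hobd i g hg) hgtγ,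
      integral_add (hgt.const_mul _) (hlbd i hi g hg), integral_const_mul,
      hX.integral_mul_nbhd (r := 2) (s := 3) rfl i (u := fun ω => g ω * t i ω)
        (hgF.mul (htF i)) (hγm i hi)]
    have h1 := integral_mul_rampOsc_le (hX.sigmaOf_le (nbhd_subset 2 i)) hWm (hVF i) hgF (hV0 i)
      hg0 hg1 ha (hconc i hi)
    have h2 := mul_le_mul_of_nonneg_left (hγ i hi)
      (integral_nonneg (μ := μ) fun ω => mul_nonneg (hg0 ω) (ht0 i ω))
    change ∫ ω, g ω * o i ω ∂μ ≤ 2 * D * ∫ ω, g ω * t i ω ∂μ at h1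
    linarith
  have hfb : ∀ w, |steinSol (ramp z a) c w| ≤ 1.26 := H.abs_steinSol_le
  have hfm : Measurable (steinSol (ramp z a) c) := H.continuous_steinSol.measurable
  have hdm : Measurable (steinDer (ramp z a) c) := H.continuous_steinDer.measurable
  have hYm : ∀ r i, Measurable (psum X (nbhd m J r i)) := fun r i =>
    hX.measurable_psum (nbhd_subset r i)
  have h5 : ∀ i ∈ J, Integrable (fun ω => o i ω + t i ω * γ i ω + l i ω) μ := fun i hi => by
    have := (key i hi (fun _ => 1) measurable_const (integrable_const 1) (fun _ => zero_le_one)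
      fun _ _ => le_rfl).1
    simpa only [one_mul] using this
  refine (hX.expand (f := steinSol (ramp z a) c) H.hasDerivAt hdm
    (Θ := fun i ω => o i ω + t i ω * γ i ω + l i ω) ?_ ?_ ?_ ?_ ?_ h5 ?_).trans ?_
  · intro i hi ω u v hu hv huv
    have e : steinDer (ramp z a) c u - steinDer (ramp z a) c v =
        (u * steinSol (ramp z a) c u - v * steinSol (ramp z a) c v) +
          (ramp z a u - ramp z a v) := by unfold steinDer; ring
    rw [e]
    refine (abs_add_le _ _).trans ?_
    by_cases h : V i ω ≤ 1
    · have h1 := hosc i hi ω u v hu hv huv h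
      have h2 := abs_ramp_sub_le_rampOsc (z := z) ha h hu hv
      simp only [ho, ht, if_pos h]
      linarith
    · have h1 := hlarge i hi ω (not_le.1 h)
      have h2 := abs_le.1 (H.abs_mul_steinSol_le u)
      have h3 := abs_le.1 (H.abs_mul_steinSol_le v)
      have h4 : |u * steinSol (ramp z a) c u - v * steinSol (ramp z a) c v| ≤ 2 := by
        rw [abs_le]; constructor <;> linarith
      have h5 : |ramp z a u - ramp z a v| ≤ 1 := by
        rw [abs_le]
        constructor <;> linarith [ramp_nonneg z a u, ramp_nonneg z a v, ramp_le_one z a u,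
          ramp_le_one z a v]
      simp only [ho, ht, if_neg h]
      linarith
  · exact fun i hi => (hX.integrable hi).mul_bdd (c := 1.26) (hfm.comp hWm).aestronglyMeasurable
      (ae_of_all _ fun ω => hfb _)
  · exact fun i hi => (hX.integrable hi).mul_bdd (c := 1.26)
      (hfm.comp (hWm.sub (hYm 1 i))).aestronglyMeasurable (ae_of_all _ fun ω => hfb _)
  · exact fun i hi => Integrable.of_bound (hdm.comp (hWm.sub (hYm 2 i))).aestronglyMeasurable 2
      (ae_of_all _ fun ω => H.abs_steinDer_le _)
  · exact Integrable.of_bound (hdm.comp hWm).aestronglyMeasurable 2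
      (ae_of_all _ fun ω => H.abs_steinDer_le _)
  · exact fun i hi => (key i hi (ξ i) (hξF i hi) (hξi i hi) (hξ0 i) (hξ1 i hi)).1
  · refine Finset.sum_le_sum fun i hi => add_le_add ?_ ?_
    · exact (key i hi (ξ i) (hξF i hi) (hξi i hi) (hξ0 i) (hξ1 i hi)).2
    · refine mul_le_mul_of_nonneg_left ?_ (integral_nonneg (hξ0 i))
      have := (key i hi (fun _ => 1) measurable_const (integrable_const 1) (fun _ => zero_le_one)
        fun _ _ => le_rfl).2
      simpa only [one_mul] using this

end SteinRamp

/-! ### The uniform bound -/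

section Uniform

variable {ι Ω : Type*} [PseudoMetricSpace ι] {m κ : ℝ} {J : Finset ι} {X : ι → Ω → ℝ}
  [mΩ : MeasurableSpace Ω] {μ : Measure Ω} [IsProbabilityMeasure μ] {p b : ℝ}

namespace PField

lemma integral_abs_psum_le (hX : PField m κ J X μ p b) (hvar : ∫ ω, psum X J ω ^ 2 ∂μ = 1) :
    ∫ ω, |psum X J ω| ∂μ ≤ 1 := by
  have h2 := (hX.memLp_psum (le_refl J)).integrable_sq
  have h := integral_mono (hX.integrable_psum le_rfl).abs
    ((h2.add (integrable_const 1)).div_const 2) fun ω => by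
      simp only [Pi.add_apply]
      rw [← sq_abs]
      nlinarith [sq_nonneg (|psum X J ω| - 1)]
  rw [integral_div, integral_add' h2 (integrable_const 1), hvar] at h
  simp at h
  linarith

open Classical in
/-- The mean absolute value of the sum over the indices away from `i`. -/
lemma integral_abs_psum_sdiff_le (hX : PField m κ J X μ p b) (hb1 : b ≤ 1 / 75)
    (hvar : ∫ ω, psum X J ω ^ 2 ∂μ = 1) {i : ι} (hi : i ∈ J) {r : ℕ} (hr : r ≤ 5) :
    ∫ ω, |psum X (J \ nbhd m J r i) ω| ∂μ ≤ 1.4534 := by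
  have hp3 := hX.le_three
  have h1 := hX.integral_abs_psum_le hvar
  have h2 := hX.integral_U_le hi (s := 1 / 3) (by norm_num)
  have h3 : (1 / 3 : ℝ) ^ (1 - p) ≤ 9 := by
    rw [one_div, Real.inv_rpow (by norm_num), ← Real.rpow_neg (by norm_num), neg_sub]
    calc (3 : ℝ) ^ (p - 1) ≤ 3 ^ (2 : ℝ) :=
          Real.rpow_le_rpow_of_exponent_le (by norm_num) (by linarith)
      _ = 9 := by norm_num
  have h4 : (1 / 3 : ℝ) ^ (1 - p) * b ≤ 9 * b := mul_le_mul_of_nonneg_right h3 hX.b_nonneg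
  have h5 := integral_mono (hX.integrable_psum (A := J \ nbhd m J r i) Finset.sdiff_subset).abs
    ((hX.integrable_psum (le_refl J)).abs.add (hX.integrable_asum (nbhd_subset 5 i))) fun ω => by
      simp only [Pi.add_apply]
      rw [psum_sdiff (nbhd_subset r i)]
      refine (abs_sub _ _).trans ?_
      gcongr
      exact abs_psum_le (nbhd_mono hX.m_nonneg hr i) ω
  rw [integral_add' (hX.integrable_psum (le_refl J)).abs (hX.integrable_asum (nbhd_subset 5 i))]
    at h5
  norm_num at h1 h2 h3 h4 h5 hb1 ⊢
  linarith

open Classical in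
/-- The concentration inequality at scale `20 * b`. -/
lemma concentration_uniform (hX : PField m κ J X μ p b) (hb : 0 < b) (hb1 : b ≤ 1 / 75)
    (hvar : ∫ ω, psum X J ω ^ 2 ∂μ = 1) {i : ι} (hi : i ∈ J) {ζ : Ω → ℝ}
    (hζ : Measurable[sigmaOf X (nbhd m J 2 i)] ζ) (hζ0 : ∀ ω, 0 ≤ ζ ω) (hζ1 : ∀ ω, ζ ω ≤ 1)
    (x : ℝ) :
    ∫ ω, ζ ω * ivl x (20 * b) (psum X J ω) ∂μ ≤ 8.4 * (20 * b) * ∫ ω, ζ ω ∂μ := by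
  have hp3 := hX.le_three
  set a := 20 * b with hadef
  have ha : 0 < a := by positivity
  set G := J \ nbhd m J 4 i
  have hG : G ⊆ J := Finset.sdiff_subset
  set Z := ∫ ω, ζ ω ∂μ
  have hZ0 : 0 ≤ Z := integral_nonneg hζ0
  have hζm : Measurable ζ := hζ.mono (hX.sigmaOf_le (nbhd_subset 2 i)) le_rfl
  have hζb : ∀ ω, |ζ ω| ≤ 1 := fun ω => by rw [abs_of_nonneg (hζ0 ω)]; exact hζ1 ω
  have hR : ∫ ω, ζ ω * |psum X G ω| ∂μ ≤ 1.4534 * Z := by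
    have hRF : Measurable[sigmaOf X (J \ nbhd m J 3 i)] (fun ω => |psum X G ω|) :=
      measurable_norm.comp (measurable_psum
        (Finset.sdiff_subset_sdiff le_rfl (nbhd_mono hX.m_nonneg (by norm_num) i)))
    rw [hX.integral_mul_nbhd (r := 2) (s := 3) rfl i hζ hRF, mul_comm]
    exact mul_le_mul_of_nonneg_right (hX.integral_abs_psum_sdiff_le hb1 hvar hi (by norm_num)) hZ0
  have h1 : ∀ x, |∫ ω, ζ ω * psum X G ω * trapInt x a (psum X J ω) ∂μ| ≤ 3 * a * (1.4534 * Z) := by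
    intro x
    have hRi : Integrable (fun ω => ζ ω * |psum X G ω|) μ :=
      (hX.integrable_psum hG).abs.bdd_mul hζm.aestronglyMeasurable (ae_of_all _ hζb)
    calc _ ≤ ∫ ω, 3 * a * (ζ ω * |psum X G ω|) ∂μ := by
          refine abs_integral_le_integral_abs.trans (integral_mono_of_nonneg
            (ae_of_all _ fun ω => abs_nonneg _) (hRi.const_mul _) (ae_of_all _ fun ω => ?_))
          dsimp only
          rw [abs_mul, abs_mul, abs_of_nonneg (hζ0 ω), abs_of_nonneg (trapInt_nonneg ha x _),
            mul_comm]
          exact mul_le_mul_of_nonneg_right (trapInt_le ha x _)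
            (mul_nonneg (hζ0 ω) (abs_nonneg _))
      _ ≤ _ := by
          rw [integral_const_mul]; gcongr
  have h2 := hX.sum_large_le hG
  have h3 : (0.88 : ℝ) ≤ ∫ t, kmean m J X μ G t ∂unitLeb := by
    refine le_trans ?_ (hX.le_integral_kmean i)
    have h4 := hX.integral_U_sq_le hi (s := 1 / 5) (by norm_num)
    have h5 : (1 / 5 : ℝ) ^ (2 - p) ≤ 5 := by
      rw [one_div, Real.inv_rpow (by norm_num), ← Real.rpow_neg (by norm_num), neg_sub]
      calc (5 : ℝ) ^ (p - 2) ≤ 5 ^ (1 : ℝ) :=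
            Real.rpow_le_rpow_of_exponent_le (by norm_num) (by linarith)
        _ = 5 := by norm_num
    have h6 : (1 / 5 : ℝ) ^ (2 - p) * b ≤ 5 * b := mul_le_mul_of_nonneg_right h5 hb.le
    rw [hvar]
    norm_num at h4 h5 h6 hb1 ⊢
    linarith
  have h4 : ∫ t, |kmean m J X μ G t| * min 1 (|t| / a) ∂unitLeb ≤ 1 / 20 := by
    refine (hX.integral_abs_kmean_mul_le hG ha).trans (le_of_eq ?_)
    rw [hadef]; field_simp
  have h5 := hX.concentration_weighted hG (fun j hj => (Finset.mem_sdiff.1 hj).2) hζ hζ0 hζ1 ha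
    (w := fun _ => 1) (fun _ => zero_le_one) (B := 1) (fun _ => le_rfl) (Λ := 1) zero_le_one
    (fun _ _ _ => by norm_num) (S := 4.788 * a * Z) (c := 0.88) (q := 1 / 20) ?_ h3 h4
    (by norm_num) x
  · rw [one_mul] at h5
    have : 0 ≤ a * Z := by positivity
    norm_num at h5 ⊢
    linarith
  · intro y
    rw [one_mul]
    have h6 := hX.integral_trap_mul_abs_le hζ hζ0 hζ1 ha (l := 1 / 8) (by norm_num) y
    have h7 := h1 y
    have h8 := mul_le_mul_of_nonneg_left (h2.trans hb1) (by positivity : 0 ≤ 3 * a * Z)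
    have e : (3 / 2 * (1 / 8) * a + b / (2 * (1 / 8))) * Z = 0.3875 * a * Z := by
      rw [hadef]; ring
    rw [e] at h6
    have : 0 ≤ a * Z := by positivity
    norm_num at h6 h7 h8 ⊢
    linarith

open Classical in
/-- Normal approximation for `ramp z (20 * b)`. The neighbours of `i` are called large when their
absolute sum exceeds `1`. -/
lemma abs_integral_ramp_sub_le (hX : PField m κ J X μ p b) (hb : 0 < b) (hb1 : b ≤ 1 / 75)
    (hvar : ∫ ω, psum X J ω ^ 2 ∂μ = 1) (z : ℝ) :
    |∫ ω, ramp z (20 * b) (psum X J ω) ∂μ - ∫ x, ramp z (20 * b) x ∂(gaussianReal 0 1)| ≤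
      56 * b := by
  have hp2 := hX.two_lt
  have hm0 := hX.m_nonneg
  set a := 20 * b
  have ha : 0 < a := by positivity
  set W := psum X J
  set c := ∫ x, ramp z a x ∂(gaussianReal 0 1)
  have H : SteinTest (ramp z a) c := steinTest_ramp z a
  have hWm : Measurable W := hX.measurable_psum le_rfl
  have hT : ∀ i, Integrable (psum X (J \ nbhd m J 3 i)) μ := fun i =>
    hX.integrable_psum Finset.sdiff_subset
  have hUm : ∀ i, Measurable (asum X (nbhd m J 5 i)) := fun i => hX.measurable_U i
  have hVU : ∀ i ω, asum X (nbhd m J 2 i) ω ≤ asum X (nbhd m J 5 i) ω := fun i ω =>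
    asum_mono (nbhd_mono hm0 (by norm_num) i) ω
  have hmain := hX.stein_ramp (z := z) (D := 8.4) (Γ := 8.167) ha
    (γ := fun i ω => 5.26 + 2 * |psum X (J \ nbhd m J 3 i) ω|)
    (l := fun i ω => if asum X (nbhd m J 5 i) ω ≤ 1 then 0 else 3)
    (fun i hi => ((measurable_norm.comp (measurable_psum le_rfl)).const_mul 2).const_add 5.26)
    (fun i hi => (integrable_const _).add ((hT i).abs.const_mul 2)) ?_
    (fun i hi => Measurable.ite (measurableSet_le (hUm i) measurable_const) measurable_const
      measurable_const) ?_ ?_ ?_ ?_ ?_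
  · -- the two sides of the Stein equation
    have e : ∫ ω, W ω * steinSol (ramp z a) c (W ω) ∂μ -
        (∫ ω, W ω ^ 2 ∂μ) * ∫ ω, steinDer (ramp z a) c (W ω) ∂μ =
        -(∫ ω, ramp z a (W ω) ∂μ - c) := by
      have i1 : Integrable (fun ω => W ω * steinSol (ramp z a) c (W ω)) μ :=
        Integrable.of_bound (hWm.mul (H.continuous_steinSol.measurable.comp
          hWm)).aestronglyMeasurable 1 (ae_of_all _ fun ω => H.abs_mul_steinSol_le _)
      have i2 : Integrable (fun ω => steinDer (ramp z a) c (W ω)) μ :=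
        Integrable.of_bound (H.continuous_steinDer.measurable.comp hWm).aestronglyMeasurable 2
          (ae_of_all _ fun ω => H.abs_steinDer_le _)
      have i3 : Integrable (fun ω => ramp z a (W ω)) μ :=
        Integrable.of_bound ((continuous_ramp z a).measurable.comp hWm).aestronglyMeasurable 1
          (ae_of_all _ fun ω => by
            rw [Real.norm_eq_abs, abs_of_nonneg (ramp_nonneg _ _ _)]; exact ramp_le_one _ _ _)
      rw [hvar, one_mul, ← integral_sub i1 i2]
      have : ∀ ω, W ω * steinSol (ramp z a) c (W ω) - steinDer (ramp z a) c (W ω) =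
          c - ramp z a (W ω) := fun ω => by unfold steinDer; ring
      simp_rw [this]
      rw [integral_sub (integrable_const _) i3]
      simp
    rw [e, abs_neg] at hmain
    refine hmain.trans ?_
    have hpt : ∀ i ω, (2 * 8.4 + 8.167) * (if asum X (nbhd m J 2 i) ω ≤ 1 then
        asum X (nbhd m J 2 i) ω else 0) + (if asum X (nbhd m J 5 i) ω ≤ 1 then (0 : ℝ) else 3) ≤
        28 * asum X (nbhd m J 5 i) ω ^ (p - 2) := by
      intro i ω
      set V := asum X (nbhd m J 2 i) ω
      set U := asum X (nbhd m J 5 i) ω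
      have hV0 : 0 ≤ V := asum_nonneg _ _
      have hVU' : V ≤ U := hVU i ω
      have hU0 : 0 ≤ U := hV0.trans hVU'
      have h1 : (if V ≤ 1 then V else 0) ≤ U ^ (p - 2) := by
        split_ifs with h
        · exact hX.rpow_aux hV0 h hVU'
        · positivity
      have h2 : (if U ≤ 1 then (0 : ℝ) else 3) ≤ 3 * U ^ (p - 2) := by
        split_ifs with h
        · positivity
        · have := Real.one_le_rpow (le_of_not_ge h) (by linarith : 0 ≤ p - 2)
          linarith
      have : 0 ≤ U ^ (p - 2) := by positivity
      generalize (if V ≤ 1 then V else 0) = α at h1 ⊢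
      generalize (if U ≤ 1 then (0 : ℝ) else 3) = β at h2 ⊢
      linarith
    have hXY : ∀ i ∈ J, ∀ ω, |X i ω * psum X (nbhd m J 1 i) ω| ≤
        |X i ω| * asum X (nbhd m J 5 i) ω := fun i hi ω => by
      rw [abs_mul]
      exact mul_le_mul_of_nonneg_left (hX.abs_Y_le i ω) (abs_nonneg _)
    have hl0 : ∀ i ω, (0 : ℝ) ≤ (2 * 8.4 + 8.167) * (if asum X (nbhd m J 2 i) ω ≤ 1 then
        asum X (nbhd m J 2 i) ω else 0) + (if asum X (nbhd m J 5 i) ω ≤ 1 then (0 : ℝ) else 3) := by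
      intro i ω
      have h1 := asum_nonneg (X := X) (nbhd m J 2 i) ω
      split_ifs <;> linarith
    have hUi : ∀ i ∈ J, Integrable (fun ω => 28 * asum X (nbhd m J 5 i) ω ^ (p - 2)) μ :=
      fun i hi => (hX.integrable_U_rpow hi (by linarith) (by linarith)).const_mul _
    calc _ ≤ ∑ i ∈ J, (28 * ∫ ω, |X i ω| * asum X (nbhd m J 5 i) ω ^ (p - 1) ∂μ +
          28 * ((∫ ω, |X i ω| * asum X (nbhd m J 5 i) ω ∂μ) *
            ∫ ω, asum X (nbhd m J 5 i) ω ^ (p - 2) ∂μ)) := by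
          refine Finset.sum_le_sum fun i hi => add_le_add ?_ ?_
          · rw [← integral_const_mul]
            refine integral_mono_of_nonneg (ae_of_all _ fun ω => mul_nonneg (abs_nonneg _)
              (hl0 i ω)) ((hX.integrable_one hi).const_mul _) (ae_of_all _ fun ω => ?_)
            dsimp only
            rw [← hX.mul_rpow_aux (asum_nonneg _ _)]
            calc _ ≤ (|X i ω| * asum X (nbhd m J 5 i) ω) *
                  (28 * asum X (nbhd m J 5 i) ω ^ (p - 2)) :=
                  mul_le_mul (hXY i hi ω) (hpt i ω) (hl0 i ω)
                    (mul_nonneg (abs_nonneg _) (asum_nonneg _ _))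
              _ = _ := by ring
          · calc _ ≤ (∫ ω, |X i ω| * asum X (nbhd m J 5 i) ω ∂μ) *
                  ∫ ω, 28 * asum X (nbhd m J 5 i) ω ^ (p - 2) ∂μ := by
                  refine mul_le_mul ?_ ?_ (integral_nonneg (hl0 i))
                    (integral_nonneg fun ω => mul_nonneg (abs_nonneg _) (asum_nonneg _ _))
                  · exact integral_mono (hX.integrable_mul hi 1).abs
                      ((hX.memLp i hi).abs.integrable_mul (hX.memLp_asum (nbhd_subset 5 i)))
                      (hXY i hi)
                  · exact integral_mono_of_nonneg (ae_of_all _ (hl0 i)) (hUi i hi)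
                      (ae_of_all _ (hpt i))
              _ = _ := by rw [integral_const_mul]; ring
      _ ≤ 28 * b + 28 * b := by
          rw [Finset.sum_add_distrib, ← Finset.mul_sum, ← Finset.mul_sum]
          have h1 := hX.sum_one_le
          have h2 := hX.sum_decoupled_le
          gcongr
      _ = 56 * b := by ring
  · intro i hi
    rw [integral_add (integrable_const _) ((hT i).abs.const_mul 2), integral_const_mul]
    have := hX.integral_abs_psum_sdiff_le hb1 hvar hi (r := 3) (by norm_num)
    simp only [integral_const, probReal_univ, one_smul]
    norm_num at this ⊢
    linarith
  · intro i ω; split_ifs <;> norm_num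
  · intro i ω; split_ifs <;> norm_num
  · exact fun i hi ζ h1 h2 h3 x _ => hX.concentration_uniform hb hb1 hvar hi h1 h2 h3 x
  · intro i hi ω h
    rw [if_neg (not_le.2 (h.trans_le (hVU i ω)))]
  · intro i hi ω u v hu hv huv hV1
    set V := asum X (nbhd m J 2 i) ω
    set U := asum X (nbhd m J 5 i) ω
    have hV0 : 0 ≤ V := asum_nonneg _ _
    set T := psum X (J \ nbhd m J 3 i) ω with hTdef
    split_ifs with h
    · have hWT : |W ω| ≤ |T| + 1 := by
        have h1 : W ω = T + psum X (nbhd m J 3 i) ω := by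
          rw [hTdef, psum_sdiff (nbhd_subset 3 i)]; ring
        rw [h1]
        refine (abs_add_le _ _).trans (add_le_add le_rfl ?_)
        exact (abs_psum_le (nbhd_mono hm0 (by norm_num) i) ω).trans h
      have := Convex.norm_image_sub_le_of_norm_hasDerivWithin_le
        (s := Set.Icc (W ω - V) (W ω + V)) (f := fun w => w * steinSol (ramp z a) c w)
        (f' := fun w => steinSol (ramp z a) c w + w * steinDer (ramp z a) c w)
        (x := v) (y := u) (C := 5.26 + 2 * |T|)
        (fun w _ => (H.hasDerivAt_mul w).hasDerivWithinAt) ?_ (convex_Icc _ _) ?_ ?_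
      · rw [Real.norm_eq_abs, Real.norm_eq_abs] at this
        refine this.trans ?_
        rw [add_zero, mul_comm]
        gcongr
      · intro w hw
        refine (H.abs_deriv_mul_le w).trans ?_
        have : |w| ≤ |W ω| + V := by
          have h1 : |w - W ω| ≤ V := abs_le.2 ⟨by linarith [hw.1], by linarith [hw.2]⟩
          have h2 := abs_add_le (w - W ω) (W ω)
          rw [sub_add_cancel] at h2
          linarith
        linarith
      · rw [abs_le] at hv; exact ⟨by linarith, by linarith⟩
      · rw [abs_le] at hu; exact ⟨by linarith, by linarith⟩
    · have h2 := abs_le.1 (H.abs_mul_steinSol_le u)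
      have h3 := abs_le.1 (H.abs_mul_steinSol_le v)
      have h4 : |u * steinSol (ramp z a) c u - v * steinSol (ramp z a) c v| ≤ 2 := by
        rw [abs_le]; constructor <;> linarith
      have : 0 ≤ V * (5.26 + 2 * |T|) := by positivity
      linarith

end PField
end Uniform

section Sandwich

variable {Ω : Type*} [MeasurableSpace Ω] {μ : Measure Ω} [IsProbabilityMeasure μ] {W : Ω → ℝ}
  {z a : ℝ}

lemma integrable_ramp_comp (hW : Measurable W) (z a : ℝ) :
    Integrable (fun ω => ramp z a (W ω)) μ :=
  Integrable.of_bound ((continuous_ramp z a).measurable.comp hW).aestronglyMeasurable 1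
    (ae_of_all _ fun ω => by
      rw [Real.norm_eq_abs, abs_of_nonneg (ramp_nonneg _ _ _)]; exact ramp_le_one _ _ _)

lemma measureReal_le_integral_ramp (hW : Measurable W) (ha : 0 < a) :
    μ.real {ω | W ω ≤ z} ≤ ∫ ω, ramp z a (W ω) ∂μ := by
  have hs : MeasurableSet {ω | W ω ≤ z} := measurableSet_le hW measurable_const
  rw [← integral_indicator_one hs]
  refine integral_mono ((integrable_const 1).indicator hs) (integrable_ramp_comp hW z a)
    fun ω => ?_
  by_cases h : W ω ≤ z
  · rw [Set.indicator_of_mem (by exact h), ramp_of_le ha h]; rfl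
  · rw [Set.indicator_of_notMem (by exact h)]; exact ramp_nonneg _ _ _

lemma integral_ramp_le_measureReal (hW : Measurable W) (ha : 0 < a) :
    ∫ ω, ramp (z - a) a (W ω) ∂μ ≤ μ.real {ω | W ω < z} := by
  have hs : MeasurableSet {ω | W ω < z} := measurableSet_lt hW measurable_const
  rw [← integral_indicator_one hs]
  refine integral_mono (integrable_ramp_comp hW _ a) ((integrable_const 1).indicator hs)
    fun ω => ?_
  by_cases h : W ω < z
  · rw [Set.indicator_of_mem (by exact h)]; exact ramp_le_one _ _ _
  · rw [Set.indicator_of_notMem (by exact h)]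
    exact (ramp_of_ge ha (by linarith)).le

lemma cdf_map_eq (hW : Measurable W) (z : ℝ) : cdf (μ.map W) z = μ.real {ω | W ω ≤ z} := by
  have := Measure.isProbabilityMeasure_map (μ := μ) hW.aemeasurable
  rw [cdf_eq_real, map_measureReal_apply hW measurableSet_Iic]
  rfl

lemma abs_cdf_sub_le_one (ν₁ ν₂ : Measure ℝ) (z : ℝ) : |cdf ν₁ z - cdf ν₂ z| ≤ 1 := by
  rw [abs_le]
  constructor <;> linarith [cdf_nonneg ν₁ z, cdf_nonneg ν₂ z, cdf_le_one ν₁ z, cdf_le_one ν₂ z]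

end Sandwich

section UniformFinal

variable {ι Ω : Type*} [PseudoMetricSpace ι] {m κ : ℝ} {J : Finset ι} {X : ι → Ω → ℝ}
  [mΩ : MeasurableSpace Ω] {μ : Measure Ω} [IsProbabilityMeasure μ] {p b : ℝ}

namespace PField

omit [IsProbabilityMeasure μ] in
lemma mono (hX : PField m κ J X μ p b) {b' : ℝ} (h : b ≤ b') : PField m κ J X μ p b' :=
  { hX with sum_le := hX.sum_le.trans h }

lemma abs_cdf_sub_le (hX : PField m κ J X μ p b) (hb : 0 < b) (hb1 : b ≤ 1 / 75)
    (hvar : ∫ ω, psum X J ω ^ 2 ∂μ = 1) (z : ℝ) :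
    |cdf (μ.map (psum X J)) z - cdf (gaussianReal 0 1) z| ≤ 64 * b := by
  have hWm : Measurable (psum X J) := hX.measurable_psum le_rfl
  have ha : 0 < 20 * b := by positivity
  rw [cdf_map_eq hWm]
  have h1 := measureReal_le_integral_ramp (μ := μ) (z := z) hWm ha
  have h2 := integral_ramp_le_measureReal (μ := μ) (z := z) hWm ha
  have h3 := abs_le.1 (hX.abs_integral_ramp_sub_le hb hb1 hvar z)
  have h4 := abs_le.1 (hX.abs_integral_ramp_sub_le hb hb1 hvar (z - 20 * b))
  have h5 := mean_ramp_le_cdf (z := z) ha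
  have h6 := cdf_le_mean_ramp (z := z - 20 * b) ha
  have h7 := cdf_gaussian_sub_le (z := z) ha
  have h8 := cdf_gaussian_sub_le (z := z - 20 * b) ha
  rw [sub_add_cancel] at h8
  have h9 : μ.real {ω | psum X J ω < z} ≤ μ.real {ω | psum X J ω ≤ z} :=
    measureReal_mono fun ω h => le_of_lt (show psum X J ω < z from h)
  rw [abs_le]
  constructor <;> linarith

/-- The uniform Berry–Esseen bound for locally dependent fields. -/
theorem abs_cdf_sub_le_uniform (hX : PField m κ J X μ p b)
    (hvar : ∫ ω, psum X J ω ^ 2 ∂μ = 1) (z : ℝ) :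
    |cdf (μ.map (psum X J)) z - cdf (gaussianReal 0 1) z| ≤ 75 * b := by
  have hb0 := hX.b_nonneg
  rcases le_or_gt (1 / 75) b with h | h
  · exact (abs_cdf_sub_le_one _ _ z).trans (by linarith)
  -- `b` is enlarged slightly since it may vanish
  refine le_of_forall_pos_le_add fun ε hε => ?_
  set δ := min (ε / 64) (1 / 75 - b)
  have hδ0 : 0 < δ := lt_min (by positivity) (by linarith)
  have h1 := min_le_left (ε / 64) (1 / 75 - b)
  have h2 := min_le_right (ε / 64) (1 / 75 - b)
  have := (hX.mono (b' := b + δ) (by linarith)).abs_cdf_sub_le (by linarith) (by linarith) hvar z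
  linarith

end PField
end UniformFinal

/-! ### Fields on the lattice -/

section Lattice

variable {d : ℕ} {Ω : Type*} [mΩ : MeasurableSpace Ω] {μ : Measure Ω} {J : Finset (Fin d → ℤ)}
  {X : (Fin d → ℤ) → Ω → ℝ}

lemma lt_latticeSetDist {m : ℕ} {A B : Finset (Fin d → ℤ)}
    (h : ∀ a ∈ A, ∀ b ∈ B, (m : ℝ) < dist a b) :
    (m : ℝ≥0∞) < latticeSetDist (A : Set (Fin d → ℤ)) B := by
  unfold latticeSetDist
  simp_rw [Finset.mem_coe, ← Finset.inf_eq_iInf]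
  have hm : (m : ℝ≥0∞) < ⊤ := by simp
  rw [Finset.lt_inf_iff hm]
  intro a ha
  rw [Finset.lt_inf_iff hm]
  intro b hb
  rw [edist_dist, ← ENNReal.ofReal_natCast]
  exact (ENNReal.ofReal_lt_ofReal_iff_of_nonneg (by positivity)).2 (h a ha b hb)

omit mΩ in
lemma sigmaOf_le_comap (A : Finset (Fin d → ℤ)) :
    sigmaOf X A ≤ MeasurableSpace.comap
      (fun (ω : Ω) (i : (A : Set (Fin d → ℤ))) => X i ω) inferInstance := by
  refine iSup₂_le fun i hi => Measurable.comap_le ?_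
  exact (measurable_pi_apply (X := fun _ : (A : Set (Fin d → ℤ)) => ℝ) ⟨i, hi⟩).comp
    (comap_measurable (fun (ω : Ω) (i : (A : Set (Fin d → ℤ))) => X i ω))

lemma IsMDependentField.mdep {m : ℕ} (hdep : IsMDependentField m (J : Set (Fin d → ℤ)) X μ)
    (hmeas : ∀ i ∈ J, Measurable (X i)) : MDep (m : ℝ) J X μ where
  m_nonneg := by positivity
  meas := hmeas
  indep A B hA hB hAB := by
    have := hdep A B (by exact_mod_cast hA) (by exact_mod_cast hB) (lt_latticeSetDist hAB)
    rw [IndepFun_iff_Indep] at this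
    exact indep_of_indep_of_le_left (indep_of_indep_of_le_right this (sigmaOf_le_comap B))
      (sigmaOf_le_comap A)

lemma card_nbhd_le (m r : ℕ) (J : Finset (Fin d → ℤ)) (i : Fin d → ℤ) :
    ((nbhd (m : ℝ) J r i).card : ℝ) ≤ (2 * r * m + 1 : ℝ) ^ d := by
  have h1 : nbhd (m : ℝ) J r i ⊆
      Fintype.piFinset fun l => Finset.Icc (i l - r * m) (i l + r * m) := by
    intro j hj
    rw [mem_nbhd] at hj
    rw [Fintype.mem_piFinset]
    intro l
    have h2 := (dist_le_pi_dist i j l).trans hj.2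
    rw [Int.dist_eq, ← Int.cast_sub, ← Int.cast_abs] at h2
    have h3 : |i l - j l| ≤ r * m := by exact_mod_cast h2
    rw [abs_le] at h3
    rw [Finset.mem_Icc]
    constructor <;> linarith
  have h2 := Finset.card_le_card h1
  rw [Fintype.card_piFinset] at h2
  simp only [Int.card_Icc] at h2
  have h3 : ∀ l : Fin d, (i l + r * m + 1 - (i l - r * m)).toNat = 2 * r * m + 1 := by
    intro l
    have : i l + r * m + 1 - (i l - r * m) = ((2 * r * m + 1 : ℕ) : ℤ) := by push_cast; ring
    rw [this, Int.toNat_natCast]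
  simp only [h3, Finset.prod_const, Finset.card_univ, Fintype.card_fin] at h2
  exact_mod_cast h2

lemma memLp_two_of_integrable_rpow [IsFiniteMeasure μ] {Y : Ω → ℝ} (hY : Measurable Y) {p : ℝ}
    (hp : 2 ≤ p) (h : Integrable (fun ω => |Y ω| ^ p) μ) : MemLp Y 2 μ := by
  have h1 : MemLp Y (ENNReal.ofReal p) μ := by
    rw [← integrable_norm_rpow_iff hY.aestronglyMeasurable (by simp; linarith) (by simp),
      ENNReal.toReal_ofReal (by linarith)]
    exact h
  refine h1.mono_exponent ?_
  rw [show (2 : ℝ≥0∞) = ENNReal.ofReal 2 by simp]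
  exact ENNReal.ofReal_le_ofReal hp

/-- The natural choice of `b`. -/
theorem MDep.pField [IsProbabilityMeasure μ] {ι : Type*} [PseudoMetricSpace ι] {m κ p : ℝ}
    {J : Finset ι} {X : ι → Ω → ℝ} (h : MDep m J X μ) (hκ : 0 < κ)
    (hcard : ∀ i ∈ J, ((nbhd m J 5 i).card : ℝ) ≤ κ) (hp2 : 2 < p) (hp3 : p ≤ 3)
    (hmom : ∀ i ∈ J, Integrable (fun ω => |X i ω| ^ p) μ) (hmean : ∀ i ∈ J, ∫ ω, X i ω ∂μ = 0) :
    PField m κ J X μ p (κ ^ (p - 1) * ∑ i ∈ J, ∫ ω, |X i ω| ^ p ∂μ) :=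
  { h with
    memLp := fun i hi => memLp_two_of_integrable_rpow (h.meas i hi) hp2.le (hmom i hi)
    mean := hmean
    card_le := hcard
    two_lt := hp2
    le_three := hp3
    kappa_pos := hκ
    integrable_rpow := hmom
    sum_le := le_rfl }

/-- The uniform bound on the lattice, where a ball of radius `5 m` has at most `(10 m + 1) ^ d`
points. -/
theorem lattice_uniform [IsProbabilityMeasure μ] {m : ℕ} {p : ℝ} (hp2 : 2 < p) (hp3 : p ≤ 3)
    (hmeas : ∀ i ∈ J, Measurable (X i)) (hmom : ∀ i ∈ J, Integrable (fun ω => |X i ω| ^ p) μ)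
    (hmean : ∀ i ∈ J, ∫ ω, X i ω ∂μ = 0)
    (hvar : variance (fun ω => ∑ i ∈ J, X i ω) μ = 1)
    (hdep : IsMDependentField m (J : Set (Fin d → ℤ)) X μ) (z : ℝ) :
    |cdf (μ.map (fun ω => ∑ i ∈ J, X i ω)) z - cdf (gaussianReal 0 1) z| ≤
      75 * (10 * (m : ℝ) + 1) ^ ((p - 1) * (d : ℝ)) * ∑ i ∈ J, ∫ ω, |X i ω| ^ p ∂μ := by
  have hX := (hdep.mdep hmeas).pField (κ := (10 * (m : ℝ) + 1) ^ d) (by positivity)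
    (fun i _ => by
      have := card_nbhd_le m 5 J i
      norm_num at this
      exact this) hp2 hp3 hmom hmean
  have hv : ∫ ω, psum X J ω ^ 2 ∂μ = 1 := by
    rw [← hvar, variance_of_integral_eq_zero]
    · rfl
    · exact (hX.measurable_psum le_rfl).aemeasurable
    · exact hX.integral_psum le_rfl
  have := hX.abs_cdf_sub_le_uniform hv z
  rw [← Real.rpow_natCast, ← Real.rpow_mul (by positivity), mul_comm (d : ℝ), ← mul_assoc] at this
  exact this

end Lattice

/-! ### Bounded fields -/

/-- A locally dependent field with `|X i| ≤ 1 / κ`, so that every sum over a neighbourhood is at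
most `1` in absolute value; `β` bounds `κ ^ 2 ∑ E |X i| ^ 3`. -/
structure BddField {ι Ω : Type*} [PseudoMetricSpace ι] [MeasurableSpace Ω] (m κ : ℝ)
    (J : Finset ι) (X : ι → Ω → ℝ) (μ : Measure Ω) (β : ℝ) : Prop
    extends PField m κ J X μ 3 β where
  bdd : ∀ i ∈ J, ∀ ω, |X i ω| ≤ κ⁻¹

namespace BddField

variable {ι Ω : Type*} [PseudoMetricSpace ι] {m κ : ℝ} {J : Finset ι} {X : ι → Ω → ℝ}
  [mΩ : MeasurableSpace Ω] {μ : Measure Ω} {β : ℝ}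

lemma asum_le_one (hX : BddField m κ J X μ β) {i : ι} (hi : i ∈ J) {r : ℕ} (hr : r ≤ 5) (ω : Ω) :
    asum X (nbhd m J r i) ω ≤ 1 := by
  have hκ := hX.kappa_pos
  refine (asum_mono (nbhd_mono hX.m_nonneg hr i) ω).trans ?_
  calc asum X (nbhd m J 5 i) ω ≤ ∑ _k ∈ nbhd m J 5 i, κ⁻¹ :=
        Finset.sum_le_sum fun k hk => hX.bdd k (nbhd_subset _ _ hk) ω
    _ = (nbhd m J 5 i).card * κ⁻¹ := by rw [Finset.sum_const, nsmul_eq_mul]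
    _ ≤ κ * κ⁻¹ := by gcongr; exact hX.card_le i hi
    _ = 1 := mul_inv_cancel₀ hκ.ne'

lemma abs_psum_le_one (hX : BddField m κ J X μ β) {i : ι} (hi : i ∈ J) {r : ℕ} (hr : r ≤ 5)
    {A : Finset ι} (hA : A ⊆ nbhd m J r i) (ω : Ω) : |psum X A ω| ≤ 1 :=
  (abs_psum_le hA ω).trans (hX.asum_le_one hi hr ω)

lemma abs_psum_le_card (hX : BddField m κ J X μ β) {A : Finset ι} (hA : A ⊆ J) (ω : Ω) :
    |psum X A ω| ≤ A.card * κ⁻¹ := by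
  refine (abs_psum_le le_rfl ω).trans ?_
  rw [← nsmul_eq_mul, ← Finset.sum_const]
  exact Finset.sum_le_sum fun k hk => hX.bdd k (hA hk) ω

/-- Continuous functions of partial sums are bounded. -/
lemma exists_bound_comp (hX : BddField m κ J X μ β) {A : Finset ι} (hA : A ⊆ J) {g : ℝ → ℝ}
    (hg : Continuous g) : ∃ C, ∀ ω, |g (psum X A ω)| ≤ C := by
  obtain ⟨C, hC⟩ :=
    (isCompact_Icc (a := -(A.card * κ⁻¹)) (b := A.card * κ⁻¹)).exists_bound_of_continuousOn
    hg.continuousOn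
  exact ⟨C, fun ω => hC _ (abs_le.1 (hX.abs_psum_le_card hA ω))⟩

/-- Products of an integrable function and a continuous function of a partial sum. -/
lemma integrable_mul_comp (hX : BddField m κ J X μ β) {A : Finset ι} (hA : A ⊆ J) {g : ℝ → ℝ}
    (hg : Continuous g) {f : Ω → ℝ} (hf : Integrable f μ) :
    Integrable (fun ω => f ω * g (psum X A ω)) μ := by
  obtain ⟨C, hC⟩ := hX.exists_bound_comp hA hg
  exact hf.mul_bdd (hg.measurable.comp (hX.measurable_psum hA)).aestronglyMeasurable
    (ae_of_all _ hC)

lemma sum_one_le' (hX : BddField m κ J X μ β) :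
    ∑ i ∈ J, ∫ ω, |X i ω| * asum X (nbhd m J 5 i) ω ^ 2 ∂μ ≤ β := by
  have := hX.sum_one_le
  norm_num at this
  exact this

lemma integrable_one' (hX : BddField m κ J X μ β) {i : ι} (hi : i ∈ J) :
    Integrable (fun ω => |X i ω| * asum X (nbhd m J 5 i) ω ^ 2) μ := by
  have := hX.integrable_one hi
  norm_num at this
  exact this

variable [IsProbabilityMeasure μ]

lemma integrable_comp (hX : BddField m κ J X μ β) {A : Finset ι} (hA : A ⊆ J) {g : ℝ → ℝ}
    (hg : Continuous g) : Integrable (fun ω => g (psum X A ω)) μ := by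
  simpa using hX.integrable_mul_comp hA hg (integrable_const (1 : ℝ))

lemma sum_decoupled_le' (hX : BddField m κ J X μ β) :
    ∑ i ∈ J, (∫ ω, |X i ω| * asum X (nbhd m J 5 i) ω ∂μ) * ∫ ω, asum X (nbhd m J 5 i) ω ∂μ ≤
      β := by
  have := hX.sum_decoupled_le
  norm_num at this
  exact this

lemma sum_decoupled_sq_le (hX : BddField m κ J X μ β) :
    ∑ i ∈ J, (∫ ω, |X i ω| ∂μ) * ∫ ω, asum X (nbhd m J 5 i) ω ^ 2 ∂μ ≤ β := by
  have hκ := hX.kappa_pos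
  have h1 : ∀ i ∈ J, (∫ ω, |X i ω| ∂μ) * ∫ ω, asum X (nbhd m J 5 i) ω ^ 2 ∂μ ≤
      1 / 3 * (κ ^ (2 : ℝ) * ∫ ω, |X i ω| ^ (3 : ℝ) ∂μ) +
        2 / 3 * (κ⁻¹ * ∫ ω, asum X (nbhd m J 5 i) ω ^ (3 : ℝ) ∂μ) := by
    intro i hi
    set U := asum X (nbhd m J 5 i)
    have hU0 : ∀ ω, 0 ≤ U ω := fun ω => asum_nonneg _ ω
    have hUp := (hX.integrable_asum_rpow hi).1
    have hXi : Integrable (fun ω => |X i ω|) μ := (hX.integrable hi).abs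
    have j1 := ((hX.integrable_rpow i hi).const_mul (κ ^ (2 : ℝ))).const_mul (1 / 3)
    have j3 : Integrable (fun ω => 2 / 3 * (κ⁻¹ * U ω ^ (3 : ℝ))) μ :=
      (hUp.const_mul κ⁻¹).const_mul _
    have h2 : ∀ ω', (∫ ω, |X i ω| ∂μ) * U ω' ^ 2 ≤
        1 / 3 * (κ ^ (2 : ℝ) * ∫ ω, |X i ω| ^ (3 : ℝ) ∂μ) + 2 / 3 * (κ⁻¹ * U ω' ^ (3 : ℝ)) := by
      intro ω'
      have e := integral_mono (hXi.mul_const (U ω' ^ 2))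
        (j1.add (integrable_const (2 / 3 * (κ⁻¹ * U ω' ^ (3 : ℝ))))) fun ω => by
          have := young_scaled (abs_nonneg (X i ω)) (hU0 ω') hκ (p := 3) (b := 1) (by norm_num)
            (by norm_num) (by norm_num)
          norm_num at this ⊢
          exact this
      rw [integral_mul_const, integral_add' j1 (integrable_const _), integral_const_mul,
        integral_const_mul] at e
      simpa using e
    have e := integral_mono ((hX.memLp_asum (nbhd_subset 5 i)).integrable_sq.const_mul
      (∫ ω, |X i ω| ∂μ)) ((integrable_const (1 / 3 * (κ ^ (2 : ℝ) * ∫ ω, |X i ω| ^ (3 : ℝ) ∂μ))).add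
      j3) h2
    rw [integral_const_mul, integral_add' (integrable_const _) j3] at e
    simp only [integral_const, probReal_univ, one_smul, integral_const_mul] at e ⊢
    exact e
  refine (Finset.sum_le_sum h1).trans ?_
  rw [Finset.sum_add_distrib, ← Finset.mul_sum, ← Finset.mul_sum, ← Finset.mul_sum,
    ← Finset.mul_sum]
  have e1 := hX.sum_le
  have e2 := hX.sum_integral_asum_rpow_le
  norm_num at e1 e2 ⊢
  linarith

/-- The error terms of the expansion `LocField.expand`. -/
lemma sum_expand_le (hX : BddField m κ J X μ β) :
    ∑ i ∈ J, ((∫ ω, |X i ω * psum X (nbhd m J 1 i) ω| * asum X (nbhd m J 2 i) ω ∂μ) +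
      (∫ ω, |X i ω * psum X (nbhd m J 1 i) ω| ∂μ) * ∫ ω, asum X (nbhd m J 2 i) ω ∂μ) ≤ 2 * β := by
  have h1 := hX.sum_one_le'
  have h2 := hX.sum_decoupled_le'
  have h3 : ∀ i ω, asum X (nbhd m J 2 i) ω ≤ asum X (nbhd m J 5 i) ω := fun i ω =>
    asum_mono (nbhd_mono hX.m_nonneg (by norm_num) i) ω
  have h4 : ∀ i ω, |X i ω * psum X (nbhd m J 1 i) ω| ≤ |X i ω| * asum X (nbhd m J 5 i) ω :=
    fun i ω => by
      rw [abs_mul]; exact mul_le_mul_of_nonneg_left (hX.abs_Y_le i ω) (abs_nonneg _)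
  have h5 : ∀ r i ω, 0 ≤ asum X (nbhd m J r i) ω := fun r i ω => asum_nonneg _ _
  have h6 : ∀ i ∈ J, Integrable (fun ω => |X i ω| * asum X (nbhd m J 5 i) ω) μ := fun i hi =>
    (hX.memLp i hi).abs.integrable_mul (hX.memLp_asum (nbhd_subset 5 i))
  calc _ ≤ ∑ i ∈ J, (∫ ω, |X i ω| * asum X (nbhd m J 5 i) ω ^ 2 ∂μ +
        (∫ ω, |X i ω| * asum X (nbhd m J 5 i) ω ∂μ) * ∫ ω, asum X (nbhd m J 5 i) ω ∂μ) := by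
        refine Finset.sum_le_sum fun i hi => add_le_add ?_ ?_
        · refine integral_mono_of_nonneg (ae_of_all _ fun ω => mul_nonneg (abs_nonneg _)
            (h5 _ _ _)) (hX.integrable_one' hi) (ae_of_all _ fun ω => ?_)
          dsimp only
          rw [sq, ← mul_assoc]
          exact mul_le_mul (h4 i ω) (h3 i ω) (h5 _ _ _) (mul_nonneg (abs_nonneg _) (h5 _ _ _))
        · refine mul_le_mul ?_ ?_ (integral_nonneg (h5 _ _))
            (integral_nonneg fun ω => mul_nonneg (abs_nonneg _) (h5 _ _ _))
          · exact integral_mono (hX.integrable_mul hi 1).abs (h6 i hi) (h4 i)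
          · exact integral_mono (hX.integrable_asum (nbhd_subset 2 i))
              (hX.integrable_asum (nbhd_subset 5 i)) (h3 i)
    _ ≤ 2 * β := by rw [Finset.sum_add_distrib]; linarith

lemma integral_abs_psum_le' (hX : BddField m κ J X μ β) :
    ∫ ω, |psum X J ω| ∂μ ≤ (∫ ω, psum X J ω ^ 2 ∂μ + 1) / 2 := by
  have h2 := (hX.memLp_psum (le_refl J)).integrable_sq
  have h := integral_mono (hX.integrable_psum le_rfl).abs
    ((h2.add (integrable_const 1)).div_const 2) fun ω => by
      simp only [Pi.add_apply]
      rw [← sq_abs]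
      nlinarith [sq_nonneg (|psum X J ω| - 1)]
  rw [integral_div, integral_add' h2 (integrable_const 1)] at h
  simpa using h

open Classical in
/-- The fourth moment of a bounded locally dependent sum. -/
theorem integral_pow_four_le (hX : BddField m κ J X μ β) :
    ∫ ω, psum X J ω ^ 4 ∂μ ≤ 3 * (∫ ω, psum X J ω ^ 2 ∂μ) ^ 2 +
      6 * β * (∫ ω, psum X J ω ^ 2 ∂μ + 7) := by
  set W := psum X J
  set v := ∫ ω, W ω ^ 2 ∂μ
  have hm0 := hX.m_nonneg
  set V : ι → Ω → ℝ := fun i => asum X (nbhd m J 2 i)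
  set T : ι → Ω → ℝ := fun i => psum X (J \ nbhd m J 3 i) with hT
  have hV0 : ∀ i ω, 0 ≤ V i ω := fun i ω => asum_nonneg _ _
  have hVF : ∀ i, Measurable[sigmaOf X (nbhd m J 2 i)] (V i) := fun i => measurable_asum le_rfl
  have hTJ : ∀ i, J \ nbhd m J 3 i ⊆ J := fun i => Finset.sdiff_subset
  have hγF : ∀ i, Measurable[sigmaOf X (J \ nbhd m J 3 i)] (fun ω => 6 * (|T i ω| + 2)) :=
    fun i => ((measurable_norm.comp (measurable_psum le_rfl)).add_const 2).const_mul 6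
  have hγc : Continuous fun x : ℝ => 6 * (|x| + 2) := by fun_prop
  have hWT : ∀ i ∈ J, ∀ ω, |W ω - T i ω| ≤ 1 := fun i hi ω => by
    simp only [hT]
    rw [psum_sdiff (nbhd_subset 3 i), sub_sub_cancel]
    exact hX.abs_psum_le_one hi (by norm_num) le_rfl ω
  have hVi : ∀ i, Integrable (V i) μ := fun i => hX.integrable_asum (nbhd_subset 2 i)
  have hξi : ∀ i ∈ J, Integrable (fun ω => |X i ω * psum X (nbhd m J 1 i) ω|) μ := fun i hi =>
    (hX.integrable_mul hi 1).abs
  have hξF : ∀ i ∈ J, Measurable[sigmaOf X (nbhd m J 2 i)]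
      (fun ω => |X i ω * psum X (nbhd m J 1 i) ω|) := fun i hi =>
    measurable_norm.comp ((measurable_sigmaOf (self_mem_nbhd hm0 2 hi)).mul
      (measurable_psum (nbhd_mono hm0 (by norm_num) i)))
  have hξV : ∀ i ∈ J, Integrable (fun ω => |X i ω * psum X (nbhd m J 1 i) ω| * V i ω) μ :=
    fun i hi => (hξi i hi).mul_bdd (c := 1) (hVi i).aestronglyMeasurable (ae_of_all _ fun ω => by
      rw [Real.norm_eq_abs, abs_of_nonneg (hV0 i ω)]
      exact hX.asum_le_one hi (by norm_num) ω)
  have hγ : ∀ i ∈ J, ∫ ω, 6 * (|T i ω| + 2) ∂μ ≤ 3 * (v + 7) := by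
    intro i hi
    have hTi : Integrable (T i) μ := hX.integrable_psum (hTJ i)
    have h1 := integral_mono hTi.abs ((hX.integrable_psum (le_refl J)).abs.add (integrable_const 1))
      fun ω => by
        simp only [Pi.add_apply]
        have h2 := abs_sub_abs_le_abs_sub (T i ω) (W ω)
        have h3 := hWT i hi ω
        rw [abs_sub_comm] at h3
        linarith
    rw [integral_add' (hX.integrable_psum (le_refl J)).abs (integrable_const 1)] at h1
    have h2 := hX.integral_abs_psum_le'
    rw [integral_const_mul, integral_add hTi.abs (integrable_const _)]
    simp only [integral_const, probReal_univ, one_smul] at h1 ⊢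
    linarith
  have hV1 : ∀ i ∈ J, ∀ ω, V i ω ≤ 1 := fun i hi ω => hX.asum_le_one hi (by norm_num) ω
  have hmain := hX.expand (f := fun x => x ^ 3) (f' := fun x => 3 * x ^ 2)
    (fun x => by simpa using hasDerivAt_pow 3 x) (by fun_prop)
    (Θ := fun i ω => V i ω * (6 * (|T i ω| + 2))) ?_ ?_ ?_ ?_ ?_ ?_ ?_
  · have e1 : ∫ ω, W ω * W ω ^ 3 ∂μ = ∫ ω, W ω ^ 4 ∂μ := by congr 1; ext ω; ring
    rw [e1, integral_const_mul] at hmain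
    have h1 := (abs_le.1 hmain).2
    have h2 : ∑ i ∈ J, (∫ ω, |X i ω * psum X (nbhd m J 1 i) ω| * (V i ω * (6 * (|T i ω| + 2))) ∂μ +
        (∫ ω, |X i ω * psum X (nbhd m J 1 i) ω| ∂μ) * ∫ ω, V i ω * (6 * (|T i ω| + 2)) ∂μ) ≤
        3 * (v + 7) * (2 * β) := by
      refine le_trans (Finset.sum_le_sum fun i hi => ?_) (le_trans (Finset.mul_sum _ _ _).ge
        (mul_le_mul_of_nonneg_left hX.sum_expand_le ?_))
      · have e2 : ∫ ω, |X i ω * psum X (nbhd m J 1 i) ω| * (V i ω * (6 * (|T i ω| + 2))) ∂μ =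
            (∫ ω, |X i ω * psum X (nbhd m J 1 i) ω| * V i ω ∂μ) * ∫ ω, 6 * (|T i ω| + 2) ∂μ := by
          rw [← hX.integral_mul_nbhd (r := 2) (s := 3) rfl i
            (u := fun ω => |X i ω * psum X (nbhd m J 1 i) ω| * V i ω)
            ((hξF i hi).mul (hVF i)) (hγF i)]
          congr 1; ext ω; ring
        have e3 : ∫ ω, V i ω * (6 * (|T i ω| + 2)) ∂μ =
            (∫ ω, V i ω ∂μ) * ∫ ω, 6 * (|T i ω| + 2) ∂μ :=
          hX.integral_mul_nbhd (r := 2) (s := 3) rfl i (hVF i) (hγF i)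
        rw [e2, e3]
        have h3 : 0 ≤ ∫ ω, |X i ω * psum X (nbhd m J 1 i) ω| * V i ω ∂μ :=
          integral_nonneg fun ω => mul_nonneg (abs_nonneg _) (hV0 i ω)
        have h4 : 0 ≤ ∫ ω, |X i ω * psum X (nbhd m J 1 i) ω| ∂μ :=
          integral_nonneg fun ω => abs_nonneg _
        have h5 : 0 ≤ ∫ ω, V i ω ∂μ := integral_nonneg (hV0 i)
        have h6 := mul_le_mul_of_nonneg_left (hγ i hi) (add_nonneg h3 (mul_nonneg h4 h5))
        change _ ≤ 3 * (v + 7) * (∫ ω, |X i ω * psum X (nbhd m J 1 i) ω| * V i ω ∂μ +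
          (∫ ω, |X i ω * psum X (nbhd m J 1 i) ω| ∂μ) * ∫ ω, V i ω ∂μ)
        linarith
      · positivity
    change ∫ ω, W ω ^ 4 ∂μ - v * (3 * v) ≤ _ at h1
    linarith
  · intro i hi ω a b ha hb hab
    have hv1 := hV1 i hi ω
    have h1 := hWT i hi ω
    change |a - W ω| ≤ V i ω at ha
    change |b - W ω| ≤ V i ω at hb
    change |a - b| ≤ V i ω at hab
    have h2 : |a| ≤ |T i ω| + 2 := by
      have := abs_add_three (a - W ω) (W ω - T i ω) (T i ω)
      rw [show a - W ω + (W ω - T i ω) + T i ω = a by ring] at this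
      linarith
    have h3 : |b| ≤ |T i ω| + 2 := by
      have := abs_add_three (b - W ω) (W ω - T i ω) (T i ω)
      rw [show b - W ω + (W ω - T i ω) + T i ω = b by ring] at this
      linarith
    rw [show 3 * a ^ 2 - 3 * b ^ 2 = (a - b) * (3 * (a + b)) by ring, abs_mul]
    refine mul_le_mul hab ?_ (abs_nonneg _) (hV0 i ω)
    rw [abs_mul, abs_of_pos (by norm_num : (0 : ℝ) < 3)]
    have := abs_add_le a b
    linarith
  · exact fun i hi => hX.integrable_mul_comp le_rfl (g := fun x => x ^ 3) (by fun_prop)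
      (hX.integrable hi)
  · intro i hi
    have := hX.integrable_mul_comp (A := J \ nbhd m J 1 i) Finset.sdiff_subset
      (g := fun x => x ^ 3) (by fun_prop) (hX.integrable hi)
    simpa only [psum_sdiff (nbhd_subset 1 i)] using this
  · intro i hi
    have := hX.integrable_comp (A := J \ nbhd m J 2 i) Finset.sdiff_subset
      (g := fun x => 3 * x ^ 2) (by fun_prop)
    simpa only [psum_sdiff (nbhd_subset 2 i)] using this
  · exact hX.integrable_comp le_rfl (g := fun x => 3 * x ^ 2) (by fun_prop)
  · exact fun i hi => hX.integrable_mul_comp (hTJ i) hγc (hVi i)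
  · intro i hi
    have := hX.integrable_mul_comp (hTJ i) hγc (hξV i hi)
    simpa only [mul_assoc] using this

end BddField

/-! ### Second moments weighted by the square of the sum -/

section BddMeas

/-- Bounded measurable functions. -/
def BddMeas {Ω : Type*} [MeasurableSpace Ω] (f : Ω → ℝ) : Prop :=
  Measurable f ∧ ∃ C, ∀ ω, |f ω| ≤ C

namespace BddMeas

variable {Ω : Type*} [MeasurableSpace Ω] {μ : Measure Ω} {f g : Ω → ℝ}

lemma integrable [IsFiniteMeasure μ] (hf : BddMeas f) : Integrable f μ := by
  obtain ⟨h, C, hC⟩ := hf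
  exact Integrable.of_bound h.aestronglyMeasurable C (ae_of_all _ hC)

lemma add (hf : BddMeas f) (hg : BddMeas g) : BddMeas (fun ω => f ω + g ω) := by
  obtain ⟨h, C, hC⟩ := hf
  obtain ⟨h', C', hC'⟩ := hg
  exact ⟨h.add h', C + C', fun ω => (abs_add_le _ _).trans (add_le_add (hC ω) (hC' ω))⟩

lemma mul (hf : BddMeas f) (hg : BddMeas g) : BddMeas (fun ω => f ω * g ω) := by
  obtain ⟨h, C, hC⟩ := hf
  obtain ⟨h', C', hC'⟩ := hg
  refine ⟨h.mul h', C * C', fun ω => ?_⟩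
  rw [abs_mul]
  exact mul_le_mul (hC ω) (hC' ω) (abs_nonneg _) ((abs_nonneg _).trans (hC ω))

lemma abs (hf : BddMeas f) : BddMeas (fun ω => |f ω|) := by
  obtain ⟨h, C, hC⟩ := hf
  exact ⟨measurable_norm.comp h, C, fun ω => by rw [abs_abs]; exact hC ω⟩

lemma const (c : ℝ) : BddMeas (fun _ : Ω => c) := ⟨measurable_const, |c|, fun _ => le_rfl⟩

lemma neg (hf : BddMeas f) : BddMeas (fun ω => -f ω) := by
  simpa using (const (-1)).mul hf

lemma sub (hf : BddMeas f) (hg : BddMeas g) : BddMeas (fun ω => f ω - g ω) := by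
  simpa [sub_eq_add_neg] using hf.add hg.neg

lemma sq (hf : BddMeas f) : BddMeas (fun ω => f ω ^ 2) := by
  simpa [_root_.sq] using hf.mul hf

lemma sum {ι : Type*} {s : Finset ι} {F : ι → Ω → ℝ} (h : ∀ i ∈ s, BddMeas (F i)) :
    BddMeas (fun ω => ∑ i ∈ s, F i ω) := by
  classical
  induction s using Finset.induction_on with
  | empty => simpa using const 0
  | insert a s ha ih =>
    simp_rw [Finset.sum_insert ha]
    exact (h a (by simp)).add (ih fun i hi => h i (by simp [hi]))

end BddMeas

/-- The Cauchy–Schwarz inequality for bounded functions. -/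
lemma BddMeas.sq_integral_mul_le {Ω : Type*} [MeasurableSpace Ω] {μ : Measure Ω}
    [IsFiniteMeasure μ] {f g : Ω → ℝ} (hf : BddMeas f) (hg : BddMeas g) :
    (∫ ω, f ω * g ω ∂μ) ^ 2 ≤ (∫ ω, f ω ^ 2 ∂μ) * ∫ ω, g ω ^ 2 ∂μ := by
  have h : ∀ t : ℝ, 0 ≤ (∫ ω, f ω ^ 2 ∂μ) * (t * t) + (2 * ∫ ω, f ω * g ω ∂μ) * t +
      ∫ ω, g ω ^ 2 ∂μ := by
    intro t
    have h1 : 0 ≤ ∫ ω, (t * f ω + g ω) ^ 2 ∂μ := integral_nonneg fun ω => sq_nonneg _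
    have h2 : ∀ ω, (t * f ω + g ω) ^ 2 = t * t * f ω ^ 2 + 2 * t * (f ω * g ω) + g ω ^ 2 :=
      fun ω => by ring
    have i1 : Integrable (fun ω => t * t * f ω ^ 2) μ := hf.sq.integrable.const_mul _
    have i2 : Integrable (fun ω => 2 * t * (f ω * g ω)) μ := (hf.mul hg).integrable.const_mul _
    have i12 : Integrable (fun ω => t * t * f ω ^ 2 + 2 * t * (f ω * g ω)) μ := i1.add i2
    simp_rw [h2] at h1
    rw [integral_add i12 hg.sq.integrable, integral_add i1 i2, integral_const_mul,
      integral_const_mul] at h1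
    linarith
  have := discrim_le_zero h
  rw [discrim] at this
  linarith

end BddMeas

section NbhdSum

variable {ι Ω : Type*} [PseudoMetricSpace ι] {m κ : ℝ} {J : Finset ι} {X : ι → Ω → ℝ}
  [mΩ : MeasurableSpace Ω] {μ : Measure Ω}

open Classical in
lemma LocField.sum_inter_nbhd_le (hX : LocField m κ J X μ) {G : Finset ι} (hG : G ⊆ J) {r : ℕ}
    (hr : r ≤ 5) {c : ι → ℝ} (hc : ∀ i, 0 ≤ c i) :
    ∑ j ∈ G, ∑ k ∈ G ∩ nbhd m J r j, (c j / 2 + c k / 2) ≤ κ * ∑ j ∈ G, c j := by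
  have hcard : ∀ j ∈ G, ((G ∩ nbhd m J r j).card : ℝ) ≤ κ := fun j hj =>
    le_trans (Nat.cast_le.2 (Finset.card_le_card
      (Finset.inter_subset_right.trans (nbhd_mono hX.m_nonneg hr j)))) (hX.card_le j (hG hj))
  have h1 : ∑ j ∈ G, ∑ k ∈ G ∩ nbhd m J r j, c j / 2 ≤ ∑ j ∈ G, κ * (c j / 2) := by
    refine Finset.sum_le_sum fun j hj => ?_
    rw [Finset.sum_const, nsmul_eq_mul]
    exact mul_le_mul_of_nonneg_right (hcard j hj) (by linarith [hc j])
  have h2 : ∑ j ∈ G, ∑ k ∈ G ∩ nbhd m J r j, c k / 2 =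
      ∑ k ∈ G, ∑ j ∈ G ∩ nbhd m J r k, c k / 2 := by
    refine Finset.sum_comm' fun j k => ?_
    simp only [Finset.mem_inter]
    constructor
    · rintro ⟨h1, h2, h3⟩; exact ⟨⟨h1, nbhd_symm (hG h1) h3⟩, h2⟩
    · rintro ⟨⟨h1, h2⟩, h3⟩; exact ⟨h1, h3, nbhd_symm (hG h3) h2⟩
  simp_rw [Finset.sum_add_distrib]
  rw [h2]
  calc _ ≤ ∑ j ∈ G, κ * (c j / 2) + ∑ j ∈ G, κ * (c j / 2) := add_le_add h1 h1
    _ = κ * ∑ j ∈ G, c j := by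
        rw [← Finset.sum_add_distrib, Finset.mul_sum]
        exact Finset.sum_congr rfl fun j _ => by ring

end NbhdSum

namespace BddField

variable {ι Ω : Type*} [PseudoMetricSpace ι] {m κ : ℝ} {J : Finset ι} {X : ι → Ω → ℝ}
  [mΩ : MeasurableSpace Ω] {μ : Measure Ω} {β : ℝ}

lemma bddMeas (hX : BddField m κ J X μ β) {i : ι} (hi : i ∈ J) : BddMeas (X i) :=
  ⟨hX.meas i hi, _, hX.bdd i hi⟩

lemma bddMeas_psum (hX : BddField m κ J X μ β) {A : Finset ι} (hA : A ⊆ J) : BddMeas (psum X A) :=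
  BddMeas.sum fun _ hi => hX.bddMeas (hA hi)

lemma bddMeas_asum (hX : BddField m κ J X μ β) {A : Finset ι} (hA : A ⊆ J) : BddMeas (asum X A) :=
  BddMeas.sum fun _ hi => (hX.bddMeas (hA hi)).abs

variable [IsProbabilityMeasure μ]

/-- The sums which control the weighted second moments, in terms of centred variables. -/
lemma sum_centred_le (hX : BddField m κ J X μ β) :
    ∑ j ∈ J, ∫ ω, (|X j ω| + ∫ ω', |X j ω'| ∂μ) * asum X (nbhd m J 5 j) ω ^ 2 ∂μ ≤ 2 * β ∧
    ∑ j ∈ J, (∫ ω, (|X j ω| + ∫ ω', |X j ω'| ∂μ) * asum X (nbhd m J 5 j) ω ∂μ) *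
      ∫ ω, asum X (nbhd m J 5 j) ω ∂μ ≤ 2 * β := by
  have hU : ∀ j, BddMeas (asum X (nbhd m J 5 j)) := fun j => hX.bddMeas_asum (nbhd_subset 5 j)
  have h1 := hX.sum_one_le'
  have h2 := hX.sum_decoupled_sq_le
  have h3 := hX.sum_decoupled_le'
  constructor
  · have e : ∀ j ∈ J, ∫ ω, (|X j ω| + ∫ ω', |X j ω'| ∂μ) * asum X (nbhd m J 5 j) ω ^ 2 ∂μ =
        ∫ ω, |X j ω| * asum X (nbhd m J 5 j) ω ^ 2 ∂μ +
          (∫ ω, |X j ω| ∂μ) * ∫ ω, asum X (nbhd m J 5 j) ω ^ 2 ∂μ := by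
      intro j hj
      simp_rw [add_mul]
      rw [integral_add ((hX.bddMeas hj).abs.mul (hU j).sq).integrable
        ((hU j).sq.integrable.const_mul _), integral_const_mul]
    rw [Finset.sum_congr rfl e, Finset.sum_add_distrib]
    linarith
  · have e : ∀ j ∈ J, (∫ ω, (|X j ω| + ∫ ω', |X j ω'| ∂μ) * asum X (nbhd m J 5 j) ω ∂μ) *
        ∫ ω, asum X (nbhd m J 5 j) ω ∂μ ≤
        (∫ ω, |X j ω| * asum X (nbhd m J 5 j) ω ∂μ) * ∫ ω, asum X (nbhd m J 5 j) ω ∂μ +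
          (∫ ω, |X j ω| ∂μ) * ∫ ω, asum X (nbhd m J 5 j) ω ^ 2 ∂μ := by
      intro j hj
      simp_rw [add_mul]
      rw [integral_add ((hX.bddMeas hj).abs.mul (hU j)).integrable
        ((hU j).integrable.const_mul _), integral_const_mul, add_mul, mul_assoc (∫ ω, |X j ω| ∂μ)]
      have h4 := (BddMeas.const 1).sq_integral_mul_le (μ := μ) (hU j)
      simp only [one_mul, one_pow, integral_const, probReal_univ, smul_eq_mul] at h4
      rw [sq] at h4
      gcongr
    refine (Finset.sum_le_sum e).trans ?_
    rw [Finset.sum_add_distrib]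
    linarith

open Classical in
/-- Second moments of centred sums `M` of local functions, weighted by the square of the partial
sum `R`. One splits `M` at each index `j` into a local and a distant part; the products of distant
parts are expanded once more, and add up to `2 (E R M) ^ 2`. -/
theorem integral_sq_mul_sq_le (hX : BddField m κ J X μ β) (hβ : β ≤ 1) {G : Finset ι} (hG : G ⊆ J)
    {H : ℝ} (hH : ∫ ω, psum X G ω ^ 2 ∂μ ≤ H) {K : ι → Ω → ℝ}
    (hK : ∀ j ∈ G, Measurable[sigmaOf X (nbhd m J 1 j)] (K j))
    (hKX : ∀ j ∈ G, ∀ ω, |K j ω| ≤ |X j ω|) :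
    ∫ ω, psum X G ω ^ 2 * (∑ j ∈ G, K j ω - ∑ j ∈ G, ∫ ω', K j ω' ∂μ) ^ 2 ∂μ ≤
      (6 * H + 9) * (κ * ∑ j ∈ G, ∫ ω, K j ω ^ 2 ∂μ) + 11 * β := by
  have hm0 := hX.m_nonneg
  have hκ := hX.kappa_pos
  have hKm : ∀ j ∈ G, BddMeas (K j) := fun j hj =>
    ⟨(hK j hj).mono (hX.sigmaOf_le (nbhd_subset 1 j)) le_rfl, κ⁻¹, fun ω =>
      (hKX j hj ω).trans (hX.bdd j (hG hj) ω)⟩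
  set L : ι → Ω → ℝ := fun j ω => K j ω - ∫ ω', K j ω' ∂μ with hL
  have hLm : ∀ j ∈ G, BddMeas (L j) := fun j hj => (hKm j hj).sub (BddMeas.const _)
  have hLF : ∀ j ∈ G, Measurable[sigmaOf X (nbhd m J 1 j)] (L j) := fun j hj =>
    (hK j hj).sub measurable_const
  have hL0 : ∀ j ∈ G, ∫ ω, L j ω ∂μ = 0 := fun j hj => by
    simp only [hL]
    rw [integral_sub (hKm j hj).integrable (integrable_const _)]; simp
  have hLK : ∀ j ∈ G, ∫ ω, L j ω ^ 2 ∂μ ≤ ∫ ω, K j ω ^ 2 ∂μ := by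
    intro j hj
    have h1 := variance_le_expectation_sq (μ := μ) (X := K j) (hKm j hj).1.aestronglyMeasurable
    rwa [variance_eq_integral (hKm j hj).1.aemeasurable] at h1
  have hLX : ∀ j ∈ G, ∀ ω, |L j ω| ≤ |X j ω| + ∫ ω', |X j ω'| ∂μ := fun j hj ω => by
    refine (abs_sub _ _).trans (add_le_add (hKX j hj ω) ?_)
    exact abs_integral_le_integral_abs.trans (integral_mono (hKm j hj).integrable.abs
      (hX.bddMeas (hG hj)).abs.integrable (hKX j hj))
  set R := psum X G
  have hRm : BddMeas R := hX.bddMeas_psum hG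
  set M : Ω → ℝ := fun ω => ∑ j ∈ G, L j ω with hM
  have hMm : BddMeas M := BddMeas.sum hLm
  set v := κ * ∑ j ∈ G, ∫ ω, K j ω ^ 2 ∂μ with hv
  have hv0 : 0 ≤ v := mul_nonneg hκ.le (Finset.sum_nonneg fun j _ =>
    integral_nonneg fun ω => sq_nonneg _)
  have hH0 : 0 ≤ H := le_trans (integral_nonneg fun ω => sq_nonneg _) hH
  -- sums over subsets of `G`
  have hvar : ∀ A ⊆ G, ∫ ω, (∑ j ∈ A, L j ω) ^ 2 ∂μ ≤ v := by
    intro A hA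
    have := hX.integral_sq_sum_sub_le (hA.trans hG) (fun j hj => hK j (hA hj))
      (fun j hj => (hX.memLp j (hG (hA hj))).mono (hKm j (hA hj)).1.aestronglyMeasurable
        (ae_of_all _ (hKX j (hA hj))))
    simp_rw [← Finset.sum_sub_distrib] at this
    refine this.trans (mul_le_mul_of_nonneg_left ?_ hκ.le)
    exact Finset.sum_le_sum_of_subset_of_nonneg hA fun j _ _ => integral_nonneg fun ω => sq_nonneg _
  set S : ι → Ω → ℝ := fun j => psum X (G ∩ nbhd m J 2 j)
  set S' : ι → Ω → ℝ := fun j => psum X (G ∩ nbhd m J 3 j)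
  set Q : ι → Ω → ℝ := fun j => psum X (G \ nbhd m J 2 j)
  set Q' : ι → Ω → ℝ := fun j => psum X (G \ nbhd m J 3 j)
  have hGi : ∀ r j, G ∩ nbhd m J r j ⊆ J := fun r j => Finset.inter_subset_left.trans hG
  have hGd : ∀ r j, G \ nbhd m J r j ⊆ J := fun r j => Finset.sdiff_subset.trans hG
  have hSm : ∀ j, BddMeas (S j) := fun j => hX.bddMeas_psum (hGi _ _)
  have hSm' : ∀ j, BddMeas (S' j) := fun j => hX.bddMeas_psum (hGi _ _)
  have hQm : ∀ j, BddMeas (Q j) := fun j => hX.bddMeas_psum (hGd _ _)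
  have hQm' : ∀ j, BddMeas (Q' j) := fun j => hX.bddMeas_psum (hGd _ _)
  have hRS : ∀ j ω, R ω = S j ω + Q j ω := fun j ω =>
    (Finset.sum_inter_add_sum_sdiff G (nbhd m J 2 j) fun k => X k ω).symm
  have hRS' : ∀ j ω, R ω = S' j ω + Q' j ω := fun j ω =>
    (Finset.sum_inter_add_sum_sdiff G (nbhd m J 3 j) fun k => X k ω).symm
  have hSF : ∀ j, Measurable[sigmaOf X (nbhd m J 2 j)] (S j) := fun j =>
    measurable_psum Finset.inter_subset_right
  have hSF' : ∀ j, Measurable[sigmaOf X (nbhd m J 3 j)] (S' j) := fun j =>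
    measurable_psum Finset.inter_subset_right
  have hQF : ∀ j, Measurable[sigmaOf X (J \ nbhd m J 2 j)] (Q j) := fun j =>
    measurable_psum (Finset.sdiff_subset_sdiff hG le_rfl)
  have hQF' : ∀ j, Measurable[sigmaOf X (J \ nbhd m J 3 j)] (Q' j) := fun j =>
    measurable_psum (Finset.sdiff_subset_sdiff hG le_rfl)
  set near : ι → Ω → ℝ := fun j ω => ∑ k ∈ G ∩ nbhd m J 5 j, L k ω with hnear
  set far : ι → Ω → ℝ := fun j ω => ∑ k ∈ G \ nbhd m J 5 j, L k ω with hfar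
  have hMsplit : ∀ j ω, M ω = near j ω + far j ω := fun j ω =>
    (Finset.sum_inter_add_sum_sdiff G (nbhd m J 5 j) fun k => L k ω).symm
  have hnearm : ∀ j, BddMeas (near j) := fun j =>
    BddMeas.sum fun k hk => hLm k (Finset.mem_inter.1 hk).1
  have hfarm : ∀ j, BddMeas (far j) := fun j =>
    BddMeas.sum fun k hk => hLm k (Finset.mem_sdiff.1 hk).1
  have hfarF : ∀ j, Measurable[sigmaOf X (J \ nbhd m J 4 j)] (far j) := fun j =>
    Finset.measurable_fun_sum _ fun k hk => (hLF k (Finset.mem_sdiff.1 hk).1).mono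
      (sigmaOf_mono (nbhd_subset_sdiff (s := 1) rfl (hG (Finset.mem_sdiff.1 hk).1)
        (Finset.mem_sdiff.1 hk).2)) le_rfl
  have hfar0 : ∀ j, ∫ ω, far j ω ∂μ = 0 := fun j => by
    simp only [hfar]
    rw [integral_finsetSum _ fun k hk => (hLm k (Finset.mem_sdiff.1 hk).1).integrable]
    exact Finset.sum_eq_zero fun k hk => hL0 k (Finset.mem_sdiff.1 hk).1
  have hJmono : ∀ {r s : ℕ} (j : ι), r ≤ s →
      sigmaOf X (J \ nbhd m J s j) ≤ sigmaOf X (J \ nbhd m J r j) := fun j h =>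
    sigmaOf_mono (Finset.sdiff_subset_sdiff le_rfl (nbhd_mono hm0 h j))
  have hNmono : ∀ {r s : ℕ} (j : ι), r ≤ s →
      sigmaOf X (nbhd m J r j) ≤ sigmaOf X (nbhd m J s j) := fun j h =>
    sigmaOf_mono (nbhd_mono hm0 h j)
  have hU0 : ∀ j ω, 0 ≤ asum X (nbhd m J 5 j) ω := fun j ω => asum_nonneg _ _
  have hUm : ∀ j, BddMeas (asum X (nbhd m J 5 j)) := fun j => hX.bddMeas_asum (nbhd_subset 5 j)
  have hS1 : ∀ j ∈ G, ∀ ω, |S j ω| ≤ 1 := fun j hj ω =>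
    hX.abs_psum_le_one (hG hj) (by norm_num) Finset.inter_subset_right ω
  have hSU : ∀ j ω, |S j ω| ≤ asum X (nbhd m J 5 j) ω := fun j ω =>
    abs_psum_le (Finset.inter_subset_right.trans (nbhd_mono hm0 (by norm_num) j)) ω
  -- the local part of the square
  have hnear_le : ∑ j ∈ G, ∫ ω, R ω ^ 2 * (L j ω * near j ω) ∂μ ≤ (4 * H + 6) * v := by
    set c : ι → ℝ := fun j => ∫ ω, R ω ^ 2 * L j ω ^ 2 ∂μ
    have hc0 : ∀ j, 0 ≤ c j := fun j => integral_nonneg fun ω => by positivity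
    have hcK : ∀ j ∈ G, c j ≤ (4 * H + 6) * ∫ ω, K j ω ^ 2 ∂μ := by
      intro j hj
      have h1 : c j ≤ ∫ ω, (2 * (L j ω ^ 2 * Q j ω ^ 2) + 2 * L j ω ^ 2) ∂μ := by
        refine integral_mono (hRm.sq.mul (hLm j hj).sq).integrable
          ((((hLm j hj).sq.mul (hQm j).sq).integrable.const_mul 2).add
            ((hLm j hj).sq.integrable.const_mul 2)) fun ω => ?_
        dsimp only
        have h2 : R ω ^ 2 ≤ 2 * Q j ω ^ 2 + 2 := by
          have h3 : S j ω ^ 2 ≤ 1 := by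
            rw [← sq_abs]; exact pow_le_one₀ (abs_nonneg _) (hS1 j hj ω)
          rw [hRS j ω]
          nlinarith [sq_nonneg (S j ω - Q j ω)]
        nlinarith [mul_le_mul_of_nonneg_right h2 (sq_nonneg (L j ω))]
      have h4 : ∫ ω, Q j ω ^ 2 ∂μ ≤ 2 * H + 2 := by
        have h5 := integral_mono (hQm j).sq.integrable
          ((hRm.sq.integrable.const_mul 2).add (integrable_const 2)) (μ := μ) fun ω => by
            simp only [Pi.add_apply]
            have h3 : S j ω ^ 2 ≤ 1 := by
              rw [← sq_abs]; exact pow_le_one₀ (abs_nonneg _) (hS1 j hj ω)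
            have := hRS j ω
            have h6 : Q j ω = R ω - S j ω := by linarith
            rw [h6]
            nlinarith [sq_nonneg (R ω + S j ω)]
        rw [integral_add' (hRm.sq.integrable.const_mul 2) (integrable_const 2),
          integral_const_mul] at h5
        simp only [integral_const, probReal_univ, one_smul] at h5
        linarith
      rw [integral_add (((hLm j hj).sq.mul (hQm j).sq).integrable.const_mul 2)
        ((hLm j hj).sq.integrable.const_mul 2), integral_const_mul, integral_const_mul,
        hX.integral_mul_nbhd (r := 1) (s := 2) rfl j ((hLF j hj).pow_const 2)
          ((hQF j).pow_const 2)] at h1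
      have h7 : 0 ≤ ∫ ω, L j ω ^ 2 ∂μ := integral_nonneg fun ω => sq_nonneg _
      have h8 := mul_le_mul_of_nonneg_left h4 h7
      have h9 := mul_le_mul_of_nonneg_left (hLK j hj) (by positivity : 0 ≤ 4 * H + 6)
      linarith
    have h1 : ∀ j ∈ G, ∫ ω, R ω ^ 2 * (L j ω * near j ω) ∂μ ≤
        ∑ k ∈ G ∩ nbhd m J 5 j, (c j / 2 + c k / 2) := by
      intro j hj
      have e : ∀ ω, R ω ^ 2 * (L j ω * near j ω) =
          ∑ k ∈ G ∩ nbhd m J 5 j, R ω ^ 2 * (L j ω * L k ω) := fun ω => by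
        simp only [hnear]; rw [Finset.mul_sum, Finset.mul_sum]
      simp_rw [e]
      have hk : ∀ k ∈ G ∩ nbhd m J 5 j, k ∈ G := fun k hk => (Finset.mem_inter.1 hk).1
      rw [integral_finsetSum _ fun k h => (hRm.sq.mul ((hLm j hj).mul (hLm k (hk k h)))).integrable]
      refine Finset.sum_le_sum fun k h => ?_
      have i1 := (hRm.sq.mul (hLm j hj).sq).integrable (μ := μ)
      have i2 := (hRm.sq.mul (hLm k (hk k h)).sq).integrable (μ := μ)
      have h2 := integral_mono (hRm.sq.mul ((hLm j hj).mul (hLm k (hk k h)))).integrable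
        ((i1.div_const 2).add (i2.div_const 2)) fun ω => by
          simp only [Pi.add_apply]
          nlinarith [mul_nonneg (sq_nonneg (R ω)) (sq_nonneg (L j ω - L k ω))]
      rw [integral_add' (i1.div_const 2) (i2.div_const 2), integral_div, integral_div] at h2
      exact h2
    calc _ ≤ ∑ j ∈ G, ∑ k ∈ G ∩ nbhd m J 5 j, (c j / 2 + c k / 2) := Finset.sum_le_sum h1
      _ ≤ κ * ∑ j ∈ G, c j := hX.sum_inter_nbhd_le hG le_rfl hc0
      _ ≤ κ * ∑ j ∈ G, (4 * H + 6) * ∫ ω, K j ω ^ 2 ∂μ := by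
          gcongr with j hj; exact hcK j hj
      _ = _ := by rw [← Finset.mul_sum, hv]; ring
  -- correlations with the whole sum
  set e : ι → ℝ := fun j => ∫ ω, S j ω * L j ω ∂μ
  set c := ∫ ω, R ω * M ω ∂μ with hc
  have hRL : ∀ j ∈ G, ∫ ω, R ω * L j ω ∂μ = e j := by
    intro j hj
    have h1 : ∀ ω, R ω * L j ω = S j ω * L j ω + L j ω * Q j ω := fun ω => by
      rw [hRS j ω]; ring
    simp_rw [h1]
    rw [integral_add ((hSm j).mul (hLm j hj)).integrable ((hLm j hj).mul (hQm j)).integrable,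
      hX.integral_mul_nbhd (r := 1) (s := 2) rfl j (hLF j hj) (hQF j), hL0 j hj, zero_mul,
      add_zero]
  have hsum_e : ∑ j ∈ G, e j = c := by
    rw [← Finset.sum_congr rfl hRL, ← integral_finsetSum _ fun j hj =>
      (hRm.mul (hLm j hj)).integrable, hc]
    congr 1; ext ω; rw [hM, Finset.mul_sum]
  have hc2 : c ^ 2 ≤ H * v :=
    (hRm.sq_integral_mul_le hMm).trans (mul_le_mul hH (hvar G le_rfl)
      (integral_nonneg fun ω => sq_nonneg _) hH0)
  have he1 : ∀ k ∈ G, |e k| ≤ 2 * ∫ ω, |X k ω| ∂μ := by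
    intro k hk
    have i1 := (hX.bddMeas (hG hk)).abs.integrable (μ := μ)
    have h1 := integral_mono (((hSm k).mul (hLm k hk)).abs.integrable (μ := μ))
      (i1.add (integrable_const (∫ ω', |X k ω'| ∂μ))) fun ω => by
        simp only [Pi.add_apply]
        rw [abs_mul]
        exact (mul_le_of_le_one_left (abs_nonneg _) (hS1 k hk ω)).trans (hLX k hk ω)
    rw [integral_add' i1 (integrable_const _)] at h1
    simp only [integral_const, probReal_univ, one_smul] at h1
    have := abs_integral_le_integral_abs (μ := μ) (f := fun ω => S k ω * L k ω)
    linarith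
  have he2 : ∀ j ∈ G, |e j| ≤
      ∫ ω, (|X j ω| + ∫ ω', |X j ω'| ∂μ) * asum X (nbhd m J 5 j) ω ∂μ := by
    intro j hj
    refine abs_integral_le_integral_abs.trans (integral_mono
      ((hSm j).mul (hLm j hj)).abs.integrable
      (((hX.bddMeas (hG hj)).abs.add (BddMeas.const _)).mul (hUm j)).integrable fun ω => ?_)
    dsimp only
    rw [abs_mul, mul_comm]
    exact mul_le_mul (hLX j hj ω) (hSU j ω) (abs_nonneg _) ((abs_nonneg _).trans (hLX j hj ω))
  have hRnear : ∀ j ∈ G, |∫ ω, R ω * near j ω ∂μ| ≤ 2 * ∫ ω, asum X (nbhd m J 5 j) ω ∂μ := by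
    intro j hj
    have h1 : ∀ ω, R ω * near j ω = ∑ k ∈ G ∩ nbhd m J 5 j, R ω * L k ω := fun ω => by
      simp only [hnear]; rw [Finset.mul_sum]
    have hk : ∀ k ∈ G ∩ nbhd m J 5 j, k ∈ G := fun k hk => (Finset.mem_inter.1 hk).1
    simp_rw [h1]
    rw [integral_finsetSum _ fun k h => (hRm.mul (hLm k (hk k h))).integrable,
      Finset.sum_congr rfl fun k h => hRL k (hk k h)]
    have h2 : ∫ ω, asum X (nbhd m J 5 j) ω ∂μ = ∑ k ∈ nbhd m J 5 j, ∫ ω, |X k ω| ∂μ :=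
      integral_finsetSum _ fun k h => (hX.bddMeas (nbhd_subset _ _ h)).abs.integrable
    rw [h2, Finset.mul_sum]
    refine (Finset.abs_sum_le_sum_abs _ _).trans ((Finset.sum_le_sum fun k h =>
      he1 k (hk k h)).trans ?_)
    exact Finset.sum_le_sum_of_subset_of_nonneg Finset.inter_subset_right fun k _ _ =>
      mul_nonneg zero_le_two (integral_nonneg fun ω => abs_nonneg _)
  have hd : ∀ j, ∫ ω, Q' j ω * far j ω ∂μ = c - ∫ ω, R ω * near j ω ∂μ := by
    intro j
    have h1 : ∀ ω, R ω * M ω = R ω * near j ω + Q' j ω * far j ω + S' j ω * far j ω := fun ω => by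
      rw [hMsplit j ω, mul_add]
      nth_rewrite 2 [hRS' j ω]
      ring
    have h2 : ∫ ω, S' j ω * far j ω ∂μ = 0 := by
      rw [hX.integral_mul_nbhd (r := 3) (s := 4) rfl j (hSF' j) (hfarF j), hfar0, mul_zero]
    rw [hc]
    simp_rw [h1]
    rw [integral_add ((hRm.mul (hnearm j)).add ((hQm' j).mul (hfarm j))).integrable
      ((hSm' j).mul (hfarm j)).integrable, integral_add (hRm.mul (hnearm j)).integrable
      ((hQm' j).mul (hfarm j)).integrable, h2]
    ring
  -- the distant part of the square
  have hfar_le : ∀ j ∈ G, ∫ ω, R ω ^ 2 * (L j ω * far j ω) ∂μ ≤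
      2 * c * e j + 4 * ((∫ ω, (|X j ω| + ∫ ω', |X j ω'| ∂μ) * asum X (nbhd m J 5 j) ω ∂μ) *
        ∫ ω, asum X (nbhd m J 5 j) ω ∂μ) +
      (3 / 2 * (1 + v)) *
        ∫ ω, (|X j ω| + ∫ ω', |X j ω'| ∂μ) * asum X (nbhd m J 5 j) ω ^ 2 ∂μ := by
    intro j hj
    set D : Ω → ℝ := fun ω => 2 * (Q j ω - Q' j ω) + S j ω with hD
    set u : Ω → ℝ := asum X (nbhd m J 3 j)
    have hum : BddMeas u := hX.bddMeas_asum (nbhd_subset 3 j)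
    have hDm : BddMeas D := ((BddMeas.const 2).mul ((hQm j).sub (hQm' j))).add (hSm j)
    have h1 : ∀ ω, R ω ^ 2 * (L j ω * far j ω) = L j ω * (Q j ω ^ 2 * far j ω) +
        2 * ((S j ω * L j ω) * (Q' j ω * far j ω)) + (S j ω * L j ω) * (D ω * far j ω) :=
      fun ω => by rw [hRS j ω]; simp only [hD]; ring
    have t1 : ∫ ω, L j ω * (Q j ω ^ 2 * far j ω) ∂μ = 0 := by
      rw [hX.integral_mul_nbhd (r := 1) (s := 2) rfl j (hLF j hj)
        (v := fun ω => Q j ω ^ 2 * far j ω)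
        (((hQF j).pow_const 2).mul ((hfarF j).mono (hJmono j (by norm_num)) le_rfl)), hL0 j hj,
        zero_mul]
    have t2 : ∫ ω, (S j ω * L j ω) * (Q' j ω * far j ω) ∂μ =
        e j * (c - ∫ ω, R ω * near j ω ∂μ) := by
      rw [hX.integral_mul_nbhd (r := 2) (s := 3) rfl j (u := fun ω => S j ω * L j ω)
        (v := fun ω => Q' j ω * far j ω)
        ((hSF j).mul ((hLF j hj).mono (hNmono j (by norm_num)) le_rfl))
        ((hQF' j).mul ((hfarF j).mono (hJmono j (by norm_num)) le_rfl)), hd j]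
    have hDu : ∀ ω, |D ω| ≤ 3 * u ω := by
      intro ω
      have h2 : |Q j ω - Q' j ω| ≤ u ω := by
        have h3 : Q j ω - Q' j ω = S' j ω - S j ω := by linarith [hRS j ω, hRS' j ω]
        have h4 : S' j ω - S j ω = psum X ((G ∩ nbhd m J 3 j) \ (G ∩ nbhd m J 2 j)) ω := by
          rw [psum_sdiff]
          exact Finset.inter_subset_inter le_rfl (nbhd_mono hm0 (by norm_num) j)
        rw [h3, h4]
        exact abs_psum_le (Finset.sdiff_subset.trans Finset.inter_subset_right) ω
      have h5 : |S j ω| ≤ u ω :=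
        abs_psum_le (Finset.inter_subset_right.trans (nbhd_mono hm0 (by norm_num) j)) ω
      simp only [hD]
      refine (abs_add_le _ _).trans ?_
      rw [abs_mul, abs_two]
      linarith
    have t3 : ∫ ω, (S j ω * L j ω) * (D ω * far j ω) ∂μ ≤ (3 / 2 * (1 + v)) *
        ∫ ω, (|X j ω| + ∫ ω', |X j ω'| ∂μ) * asum X (nbhd m J 5 j) ω ^ 2 ∂μ := by
      have hb : BddMeas (fun ω => |S j ω * L j ω| * u ω) := ((hSm j).mul (hLm j hj)).abs.mul hum
      have h2 : ∫ ω, (S j ω * L j ω) * (D ω * far j ω) ∂μ ≤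
          ∫ ω, 3 * ((|S j ω * L j ω| * u ω) * |far j ω|) ∂μ := by
        refine integral_mono (((hSm j).mul (hLm j hj)).mul (hDm.mul (hfarm j))).integrable
          ((hb.mul (hfarm j).abs).integrable.const_mul 3) fun ω => ?_
        dsimp only
        refine (le_abs_self _).trans ?_
        rw [abs_mul, abs_mul (D ω)]
        calc _ ≤ |S j ω * L j ω| * (3 * u ω * |far j ω|) := by gcongr; exact hDu ω
          _ = _ := by ring
      rw [integral_const_mul, hX.integral_mul_nbhd (r := 3) (s := 4) rfl j
        (u := fun ω => |S j ω * L j ω| * u ω) (v := fun ω => |far j ω|)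
        ((measurable_norm.comp (((hSF j).mono (hNmono j (by norm_num)) le_rfl).mul
          ((hLF j hj).mono (hNmono j (by norm_num)) le_rfl))).mul (measurable_asum le_rfl))
        (measurable_norm.comp (hfarF j))] at h2
      have h3 : ∫ ω, |far j ω| ∂μ ≤ (1 + v) / 2 := by
        have h4 := integral_mono ((hfarm j).abs.integrable (μ := μ))
          (((hfarm j).sq.integrable.add (integrable_const 1)).div_const 2) fun ω => by
            simp only [Pi.add_apply]
            rw [← sq_abs]
            nlinarith [sq_nonneg (|far j ω| - 1)]
        rw [integral_div, integral_add' (hfarm j).sq.integrable (integrable_const 1)] at h4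
        have h5 := hvar (G \ nbhd m J 5 j) Finset.sdiff_subset
        simp only [integral_const, probReal_univ, one_smul] at h4
        change ∫ ω, far j ω ^ 2 ∂μ ≤ v at h5
        linarith
      have h6 : ∫ ω, |S j ω * L j ω| * u ω ∂μ ≤
          ∫ ω, (|X j ω| + ∫ ω', |X j ω'| ∂μ) * asum X (nbhd m J 5 j) ω ^ 2 ∂μ := by
        refine integral_mono hb.integrable (((hX.bddMeas (hG hj)).abs.add
          (BddMeas.const _)).mul (hUm j).sq).integrable fun ω => ?_
        dsimp only
        rw [abs_mul, sq, ← mul_assoc, mul_comm (|S j ω|)]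
        have h7 : u ω ≤ asum X (nbhd m J 5 j) ω := asum_mono (nbhd_mono hm0 (by norm_num) j) ω
        have h8 := (abs_nonneg _).trans (hLX j hj ω)
        exact mul_le_mul (mul_le_mul (hLX j hj ω) (hSU j ω) (abs_nonneg _) h8) h7
          (asum_nonneg _ _) (mul_nonneg h8 (hU0 j ω))
      calc _ ≤ 3 * ((∫ ω, |S j ω * L j ω| * u ω ∂μ) * ∫ ω, |far j ω| ∂μ) := h2
        _ ≤ 3 * ((∫ ω, (|X j ω| + ∫ ω', |X j ω'| ∂μ) * asum X (nbhd m J 5 j) ω ^ 2 ∂μ) *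
            ((1 + v) / 2)) := by
            gcongr
        _ = _ := by ring
    have t4 : -(2 * (e j * ∫ ω, R ω * near j ω ∂μ)) ≤
        4 * ((∫ ω, (|X j ω| + ∫ ω', |X j ω'| ∂μ) * asum X (nbhd m J 5 j) ω ∂μ) *
        ∫ ω, asum X (nbhd m J 5 j) ω ∂μ) := by
      have h2 : |e j * ∫ ω, R ω * near j ω ∂μ| ≤
          (∫ ω, (|X j ω| + ∫ ω', |X j ω'| ∂μ) * asum X (nbhd m J 5 j) ω ∂μ) *
          (2 * ∫ ω, asum X (nbhd m J 5 j) ω ∂μ) := by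
        rw [abs_mul]
        exact mul_le_mul (he2 j hj) (hRnear j hj) (abs_nonneg _) ((abs_nonneg _).trans (he2 j hj))
      have := neg_abs_le (e j * ∫ ω, R ω * near j ω ∂μ)
      linarith
    have i1 : BddMeas (fun ω => L j ω * (Q j ω ^ 2 * far j ω)) :=
      (hLm j hj).mul ((hQm j).sq.mul (hfarm j))
    have i2 : BddMeas (fun ω => 2 * ((S j ω * L j ω) * (Q' j ω * far j ω))) :=
      (BddMeas.const 2).mul (((hSm j).mul (hLm j hj)).mul ((hQm' j).mul (hfarm j)))
    have i3 : BddMeas (fun ω => (S j ω * L j ω) * (D ω * far j ω)) :=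
      ((hSm j).mul (hLm j hj)).mul (hDm.mul (hfarm j))
    simp_rw [h1]
    rw [integral_add (i1.add i2).integrable i3.integrable, integral_add i1.integrable
      i2.integrable, integral_const_mul, t1, t2]
    linarith
  have hsplit : ∀ ω, R ω ^ 2 * (∑ j ∈ G, K j ω - ∑ j ∈ G, ∫ ω', K j ω' ∂μ) ^ 2 =
      ∑ j ∈ G, (R ω ^ 2 * (L j ω * near j ω) + R ω ^ 2 * (L j ω * far j ω)) := by
    intro ω
    rw [← Finset.sum_sub_distrib]
    change R ω ^ 2 * M ω ^ 2 = _
    have : ∀ j ∈ G, R ω ^ 2 * (L j ω * near j ω) + R ω ^ 2 * (L j ω * far j ω) =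
        (R ω ^ 2 * M ω) * L j ω := fun j _ => by rw [hMsplit j ω]; ring
    rw [Finset.sum_congr rfl this, ← Finset.mul_sum]
    change _ = R ω ^ 2 * M ω * M ω
    ring
  have inear : ∀ j ∈ G, Integrable (fun ω => R ω ^ 2 * (L j ω * near j ω)) μ := fun j hj =>
    (hRm.sq.mul ((hLm j hj).mul (hnearm j))).integrable
  have ifar : ∀ j ∈ G, Integrable (fun ω => R ω ^ 2 * (L j ω * far j ω)) μ := fun j hj =>
    (hRm.sq.mul ((hLm j hj).mul (hfarm j))).integrable
  have isum : ∀ j ∈ G, Integrable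
      (fun ω => R ω ^ 2 * (L j ω * near j ω) + R ω ^ 2 * (L j ω * far j ω)) μ := fun j hj =>
    (inear j hj).add (ifar j hj)
  simp_rw [hsplit]
  rw [integral_finsetSum _ isum,
    Finset.sum_congr rfl fun j hj => integral_add (inear j hj) (ifar j hj),
    Finset.sum_add_distrib]
  have hf := Finset.sum_le_sum hfar_le
  rw [Finset.sum_add_distrib, Finset.sum_add_distrib, ← Finset.mul_sum, ← Finset.mul_sum,
    ← Finset.mul_sum, hsum_e] at hf
  obtain ⟨hs1, hs2⟩ := hX.sum_centred_le
  have hs1' : ∑ j ∈ G, ∫ ω, (|X j ω| + ∫ ω', |X j ω'| ∂μ) * asum X (nbhd m J 5 j) ω ^ 2 ∂μ ≤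
      2 * β := le_trans (Finset.sum_le_sum_of_subset_of_nonneg hG fun j _ _ =>
    integral_nonneg fun ω => mul_nonneg (add_nonneg (abs_nonneg _)
      (integral_nonneg fun ω => abs_nonneg _)) (sq_nonneg _)) hs1
  have hs2' : ∑ j ∈ G, (∫ ω, (|X j ω| + ∫ ω', |X j ω'| ∂μ) * asum X (nbhd m J 5 j) ω ∂μ) *
      ∫ ω, asum X (nbhd m J 5 j) ω ∂μ ≤ 2 * β :=
    le_trans (Finset.sum_le_sum_of_subset_of_nonneg hG fun j _ _ => mul_nonneg
      (integral_nonneg fun ω => mul_nonneg (add_nonneg (abs_nonneg _)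
        (integral_nonneg fun ω => abs_nonneg _)) (hU0 j ω)) (integral_nonneg (hU0 j))) hs2
  have h3 := mul_le_mul_of_nonneg_left hs1' (by positivity : 0 ≤ 3 / 2 * (1 + v))
  have h4 : β * v ≤ v := by nlinarith
  nlinarith

end BddField

/-! ### Nonuniform concentration and Stein bounds -/

namespace BddField

variable {ι Ω : Type*} [PseudoMetricSpace ι] {m κ : ℝ} {J : Finset ι} {X : ι → Ω → ℝ}
  [mΩ : MeasurableSpace Ω] {μ : Measure Ω} [IsProbabilityMeasure μ] {β : ℝ}

lemma fourth_moment_le (hX : BddField m κ J X μ β) (hβ1 : β ≤ 1 / 1000)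
    (hv : |∫ ω, psum X J ω ^ 2 ∂μ - 1| ≤ 1 / 10) : ∫ ω, psum X J ω ^ 4 ∂μ ≤ 4 := by
  have h1 := hX.integral_pow_four_le
  rw [abs_le] at hv
  set v := ∫ ω, psum X J ω ^ 2 ∂μ
  nlinarith

open Classical in
/-- Removing a neighbourhood changes the sum by at most `1`, hence the moments by constants. -/
lemma moments_sdiff (hX : BddField m κ J X μ β) (hβ1 : β ≤ 1 / 1000)
    (hv : |∫ ω, psum X J ω ^ 2 ∂μ - 1| ≤ 1 / 10) {i : ι} (hi : i ∈ J) {r : ℕ} (hr : r ≤ 5) :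
    ∫ ω, psum X (J \ nbhd m J r i) ω ^ 2 ∂μ ≤ 5 ∧
    ∫ ω, (1 + psum X (J \ nbhd m J r i) ω ^ 4) ∂μ ≤ 41 := by
  have hR : J \ nbhd m J r i ⊆ J := Finset.sdiff_subset
  have hs : ∀ ω, |psum X (nbhd m J r i) ω| ≤ 1 := hX.abs_psum_le_one hi hr le_rfl
  have i2 : ∀ {A : Finset ι}, A ⊆ J → Integrable (fun ω => psum X A ω ^ 2) μ := fun hA =>
    hX.integrable_comp hA (g := fun x => x ^ 2) (by fun_prop)
  have i4 : ∀ {A : Finset ι}, A ⊆ J → Integrable (fun ω => psum X A ω ^ 4) μ := fun hA =>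
    hX.integrable_comp hA (g := fun x => x ^ 4) (by fun_prop)
  have h4 := hX.fourth_moment_le hβ1 hv
  rw [abs_le] at hv
  have hsq : ∀ ω, psum X (J \ nbhd m J r i) ω ^ 2 ≤ 2 * psum X J ω ^ 2 + 2 := fun ω => by
    rw [psum_sdiff (nbhd_subset r i)]
    have h1 : psum X (nbhd m J r i) ω ^ 2 ≤ 1 := by
      rw [← sq_abs]; exact pow_le_one₀ (abs_nonneg _) (hs ω)
    nlinarith [sq_nonneg (psum X J ω + psum X (nbhd m J r i) ω)]
  constructor
  · have h := integral_mono (i2 hR) (((i2 le_rfl).const_mul 2).add (integrable_const 2)) hsq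
    rw [integral_add' ((i2 le_rfl).const_mul 2) (integrable_const 2), integral_const_mul] at h
    simp only [integral_const, probReal_univ, one_smul] at h
    linarith
  · have h := integral_mono (i4 hR) (((i4 le_rfl).const_mul 8).add (integrable_const 8))
      fun ω => by
        simp only [Pi.add_apply]
        have h2 := hsq ω
        nlinarith [sq_nonneg (psum X J ω ^ 2 - 1)]
    rw [integral_add' ((i4 le_rfl).const_mul 8) (integrable_const 8), integral_const_mul] at h
    simp only [integral_const, probReal_univ, one_smul] at h
    rw [integral_add (integrable_const 1) (i4 hR)]
    simp only [integral_const, probReal_univ, one_smul]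
    linarith

open Classical in
/-- The concentration inequality with polynomial decay in the location of the interval. -/
theorem concentration_nonuniform (hX : BddField m κ J X μ β) (hβ : 0 < β) (hβ1 : β ≤ 1 / 1000)
    (hv : |∫ ω, psum X J ω ^ 2 ∂μ - 1| ≤ 1 / 10) {i : ι} (hi : i ∈ J) {ζ : Ω → ℝ}
    (hζ : Measurable[sigmaOf X (nbhd m J 2 i)] ζ) (hζ0 : ∀ ω, 0 ≤ ζ ω) (hζ1 : ∀ ω, ζ ω ≤ 1)
    (x : ℝ) :
    (1 + max x 0) ^ 3 * ∫ ω, ζ ω * ivl x (1000 * β) (psum X J ω) ∂μ ≤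
      300000 * (1000 * β) * ∫ ω, ζ ω ∂μ := by
  set a := 1000 * β with hadef
  have ha : 0 < a := by positivity
  have ha1 : a ≤ 1 := by linarith
  set W := psum X J
  set G := J \ nbhd m J 4 i with hGdef
  have hG : G ⊆ J := Finset.sdiff_subset
  set R := psum X G with hRdef
  set Z := ∫ ω, ζ ω ∂μ
  have hZ0 : 0 ≤ Z := integral_nonneg hζ0
  have hζm : Measurable ζ := hζ.mono (hX.sigmaOf_le (nbhd_subset 2 i)) le_rfl
  have hζb : BddMeas ζ := ⟨hζm, 1, fun ω => by rw [abs_of_nonneg (hζ0 ω)]; exact hζ1 ω⟩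
  have hWb : BddMeas W := hX.bddMeas_psum le_rfl
  have hRb : BddMeas R := hX.bddMeas_psum hG
  obtain ⟨hR2, hR4⟩ := hX.moments_sdiff hβ1 hv hi (r := 4) (by norm_num)
  have hWR : ∀ ω, |W ω - R ω| ≤ 1 := fun ω => by
    simp only [hRdef, hGdef]
    rw [psum_sdiff (nbhd_subset 4 i), sub_sub_cancel]
    exact hX.abs_psum_le_one hi (by norm_num) le_rfl ω
  have hRF : Measurable[sigmaOf X (J \ nbhd m J 3 i)] R := measurable_psum
    (Finset.sdiff_subset_sdiff le_rfl (nbhd_mono hX.m_nonneg (by norm_num) i))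
  set φ : Ω → ℝ := fun ω => 1 + R ω ^ 4 with hφ
  have hφb : BddMeas φ := by
    have h1 := (BddMeas.const 1).add (hRb.mul (hRb.mul (hRb.mul hRb)))
    have e : φ = fun ω => 1 + R ω * (R ω * (R ω * R ω)) := by
      ext ω; simp only [hφ]; ring
    rw [e]; exact h1
  have hζφ : ∫ ω, ζ ω * φ ω ∂μ ≤ 41 * Z := by
    rw [hX.integral_mul_nbhd (r := 2) (s := 3) rfl i hζ ((hRF.pow_const 4).const_add 1), mul_comm]
    exact mul_le_mul_of_nonneg_right hR4 hZ0
  -- truncated weights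
  set y : ℝ → ℝ := fun u => 1 + min (max u 0) (max x 0) with hy
  have hy1 : ∀ u, 1 ≤ y u := fun u => by
    have : 0 ≤ min (max u 0) (max x 0) := le_min (le_max_right _ _) (le_max_right _ _)
    simp only [hy]; linarith
  have hyR : ∀ u t ω, |t| ≤ 1 → u - a < W ω + t → y u ≤ 4 + |R ω| := by
    intro u t ω ht hu
    have h1 := (abs_le.1 (hWR ω)).2
    have h2 := (abs_le.1 ht).2
    have h3 := le_abs_self (R ω)
    have h4 := abs_nonneg (R ω)
    have : max u 0 ≤ 3 + |R ω| := max_le (by linarith) (by linarith)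
    have h5 := min_le_left (max u 0) (max x 0)
    simp only [hy]; linarith
  have hyΛ : ∀ u u', |u - u'| ≤ 1 + a → y u ^ 3 ≤ 27 * y u' ^ 3 := by
    intro u u' h
    have h0 := hy1 u
    have h1 : y u ≤ 3 * y u' := by
      have h2 := (abs_le.1 h).2
      simp only [hy]
      have h3 : max u 0 ≤ max u' 0 + 2 := max_le (by linarith [le_max_left u' 0])
        (by linarith [le_max_right u' 0])
      have h4 : min (max u 0) (max x 0) ≤ min (max u' 0) (max x 0) + 2 := by
        rw [← min_add_add_right]
        exact min_le_min h3 (by linarith)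
      have h5 : 0 ≤ min (max u' 0) (max x 0) := le_min (le_max_right _ _) (le_max_right _ _)
      linarith
    calc y u ^ 3 ≤ (3 * y u') ^ 3 := pow_le_pow_left₀ (by linarith) h1 3
      _ = 27 * y u' ^ 3 := by ring
  have hpoly : ∀ r : ℝ, 0 ≤ r → (4 + r) ^ 3 * r ≤ 125 * (1 + r ^ 4) := by
    intro r hr
    rcases le_total r 1 with h | h
    · calc (4 + r) ^ 3 * r ≤ 5 ^ 3 * 1 := by gcongr; linarith
        _ ≤ 125 * (1 + r ^ 4) := by nlinarith [pow_nonneg hr 4]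
    · calc (4 + r) ^ 3 * r ≤ (5 * r) ^ 3 * r := by gcongr; linarith
        _ ≤ 125 * (1 + r ^ 4) := by nlinarith
  have hpoly4 : ∀ r : ℝ, 0 ≤ r → (4 + r) ^ 4 ≤ 2048 * (1 + r ^ 4) := by
    intro r hr
    have h1 : (4 + r) ^ 2 ≤ 32 + 2 * r ^ 2 := by nlinarith [sq_nonneg (4 - r)]
    calc (4 + r) ^ 4 = ((4 + r) ^ 2) ^ 2 := by ring
      _ ≤ (32 + 2 * r ^ 2) ^ 2 := by gcongr
      _ ≤ _ := by nlinarith [sq_nonneg (r ^ 2 - 16), sq_nonneg (r ^ 2)]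
  -- the term with the partial sum `R`
  have t1 : ∀ u, y u ^ 3 * |∫ ω, ζ ω * R ω * trapInt u a (W ω) ∂μ| ≤ 15375 * a * Z := by
    intro u
    have hb : BddMeas (fun ω => ζ ω * R ω * trapInt u a (W ω)) :=
      (hζb.mul hRb).mul ⟨(continuous_trapInt u a).measurable.comp hWb.1, 3 * a, fun ω => by
        rw [abs_of_nonneg (trapInt_nonneg ha _ _)]; exact trapInt_le ha _ _⟩
    calc _ ≤ y u ^ 3 * ∫ ω, |ζ ω * R ω * trapInt u a (W ω)| ∂μ :=
          mul_le_mul_of_nonneg_left abs_integral_le_integral_abs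
            (pow_nonneg (by linarith [hy1 u]) 3)
      _ = ∫ ω, y u ^ 3 * |ζ ω * R ω * trapInt u a (W ω)| ∂μ := (integral_const_mul _ _).symm
      _ ≤ ∫ ω, 375 * a * (ζ ω * φ ω) ∂μ := by
          refine integral_mono (hb.abs.integrable.const_mul _)
            ((hζb.mul hφb).integrable.const_mul _) fun ω => ?_
          dsimp only
          rw [abs_mul, abs_mul, abs_of_nonneg (hζ0 ω), abs_of_nonneg (trapInt_nonneg ha u _)]
          rcases le_or_gt (W ω) (u - a) with h | h
          · rw [trapInt_eq_zero ha h]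
            have : 0 ≤ a * (ζ ω * φ ω) := mul_nonneg ha.le (mul_nonneg (hζ0 ω) (by
              simp only [hφ]; positivity))
            simp only [mul_zero]
            linarith
          · have h1 := hyR u 0 ω (by simp) (by linarith)
            have h2 : y u ^ 3 * |R ω| ≤ 125 * φ ω := by
              have h3 := hpoly |R ω| (abs_nonneg _)
              have h4 : |R ω| ^ 4 = R ω ^ 4 := by rw [pow_abs, abs_of_nonneg (by positivity)]
              rw [h4] at h3
              refine le_trans ?_ h3
              gcongr
            have h3 := trapInt_le ha u (W ω)
            calc _ = (ζ ω * (y u ^ 3 * |R ω|)) * trapInt u a (W ω) := by ring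
              _ ≤ (ζ ω * (125 * φ ω)) * (3 * a) := by
                  refine mul_le_mul (mul_le_mul_of_nonneg_left h2 (hζ0 ω)) h3
                    (trapInt_nonneg ha _ _) (mul_nonneg (hζ0 ω) ?_)
                  simp only [hφ]; positivity
              _ = _ := by ring
      _ ≤ _ := by
          rw [integral_const_mul]
          calc _ ≤ 375 * a * (41 * Z) := by gcongr
            _ = _ := by ring
  -- no truncation takes place
  have t2 : ∑ j ∈ G, ∫ ω, |X j ω| * (if |psum X (nbhd m J 1 j) ω| ≤ 1 then 0 else 1) ∂μ = 0 := by
    refine Finset.sum_eq_zero fun j hj => ?_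
    have : ∀ ω, |psum X (nbhd m J 1 j) ω| ≤ 1 := hX.abs_psum_le_one (hG hj) (by norm_num) le_rfl
    simp [this]
  -- the fluctuation term
  set M : ℝ → Ω → ℝ := fun t ω => ksum m J X G t ω - kmean m J X μ G t
  have hMm : Measurable (fun q : Ω × ℝ => M q.2 q.1) :=
    (hX.measurable_ksum_uncurry hG).sub ((hX.measurable_kmean hG).comp measurable_snd)
  obtain ⟨C₀, hC₀⟩ := (hX.bddMeas_asum hG).2
  have hMb : ∀ t ω, |M t ω| ≤ C₀ + C₀ := by
    intro t ω
    have h1 : asum X G ω ≤ C₀ := (le_abs_self _).trans (hC₀ ω)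
    have h2 : ∫ ω', asum X G ω' ∂μ ≤ C₀ := by
      have := integral_mono (hX.integrable_asum hG) (integrable_const C₀) fun ω =>
        (le_abs_self _).trans (hC₀ ω)
      simpa using this
    exact (abs_sub _ _).trans (add_le_add ((abs_ksum_le G t ω).trans h1)
      ((hX.abs_kmean_le hG t).trans h2))
  have hMbm : ∀ t, BddMeas (M t) := fun t =>
    ⟨(hX.measurable_ksum hG t).sub measurable_const, _, hMb t⟩
  have hM2 : ∫ t, ∫ ω, (1 + R ω ^ 2) * M t ω ^ 2 ∂μ ∂unitLeb ≤ 62 * β := by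
    have h1 : ∀ t, ∫ ω, (1 + R ω ^ 2) * M t ω ^ 2 ∂μ ≤
        40 * (κ * ∑ j ∈ G, ∫ ω, kterm m J X j t ω ^ 2 ∂μ) + 11 * β := by
      intro t
      have h2 := hX.integral_sq_ksum_sub_le_sum hG t
      have h3 := hX.integral_sq_mul_sq_le (by linarith) hG hR2 (K := fun j => kterm m J X j t)
        (fun j hj => measurable_kterm hX.m_nonneg (hG hj) t) (fun j hj ω => abs_kterm_le j t ω)
      rw [← hX.kmean_eq hG t] at h3
      have e : ∀ ω, (1 + R ω ^ 2) * M t ω ^ 2 = M t ω ^ 2 + R ω ^ 2 * M t ω ^ 2 := fun ω => by ring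
      simp_rw [e]
      rw [integral_add (hMbm t).sq.integrable (hRb.sq.mul (hMbm t).sq).integrable]
      change ∫ ω, M t ω ^ 2 ∂μ ≤ _ at h2
      change ∫ ω, R ω ^ 2 * M t ω ^ 2 ∂μ ≤ _ at h3
      linarith
    obtain ⟨i1, -⟩ := hX.integral_sum_sq_kterm hG
    have h2 := integral_mono_of_nonneg (μ := unitLeb) (ae_of_all _ fun t =>
      integral_nonneg fun ω => mul_nonneg (by positivity) (sq_nonneg _))
      ((i1.const_mul 40).add (integrable_const (11 * β))) (ae_of_all _ h1)
    rw [integral_add' (i1.const_mul 40) (integrable_const _), integral_const_mul] at h2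
    have h3 := hX.integral_sum_sq_kterm_le hG
    have h4 : ∫ _, 11 * β ∂unitLeb = 22 * β := by
      rw [integral_const, unitLeb, measureReal_restrict_apply_univ, Real.volume_real_Icc_of_le
        (by norm_num), smul_eq_mul]
      ring
    rw [h4] at h2
    linarith
  have t3 : ∀ u, y u ^ 3 * ∫ q, ζ q.1 * (trap u a (W q.1 + q.2) * |M q.2 q.1|)
      ∂(μ.prod unitLeb) ≤ 126944 * a * Z := by
    intro u
    have hτm : Measurable (fun q : Ω × ℝ => trap u a (W q.1 + q.2)) :=
      (continuous_trap u a).measurable.comp ((hWb.1.comp measurable_fst).add measurable_snd)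
    have hτb : ∀ q : Ω × ℝ, |trap u a (W q.1 + q.2)| ≤ 1 := fun q => by
      rw [abs_of_nonneg (trap_nonneg _ _ _)]; exact trap_le_one _ _ _
    have hfst : ∀ {f : Ω → ℝ}, BddMeas f → BddMeas (fun q : Ω × ℝ => f q.1) := fun hf =>
      ⟨hf.1.comp measurable_fst, hf.2.imp fun C hC q => hC q.1⟩
    have bτ : BddMeas (fun q : Ω × ℝ => trap u a (W q.1 + q.2)) := ⟨hτm, 1, hτb⟩
    have bM : BddMeas (fun q : Ω × ℝ => M q.2 q.1) := ⟨hMm, _, fun q => hMb q.2 q.1⟩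
    have b0 : BddMeas (fun q : Ω × ℝ => ζ q.1 * (trap u a (W q.1 + q.2) * |M q.2 q.1|)) :=
      (hfst hζb).mul (bτ.mul bM.abs)
    have b1 : BddMeas (fun q : Ω × ℝ => (ζ q.1 * φ q.1) * trap u a (W q.1 + q.2)) :=
      ((hfst hζb).mul (hfst hφb)).mul bτ
    have b2 : BddMeas (fun q : Ω × ℝ => ζ q.1 * ((1 + R q.1 ^ 2) * M q.2 q.1 ^ 2)) :=
      (hfst hζb).mul (((BddMeas.const 1).add (hfst hRb).sq).mul bM.sq)
    have i0 := b0.integrable (μ := μ.prod unitLeb)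
    have i1 := b1.integrable (μ := μ.prod unitLeb)
    have i2 := b2.integrable (μ := μ.prod unitLeb)
    have e1 : ∫ q, (ζ q.1 * φ q.1) * trap u a (W q.1 + q.2) ∂(μ.prod unitLeb) ≤
        123 * a * Z := by
      rw [integral_prod _ i1]
      calc _ ≤ ∫ ω, 3 * a * (ζ ω * φ ω) ∂μ := by
            refine integral_mono i1.integral_prod_left ((hζb.mul hφb).integrable.const_mul _)
              fun ω => ?_
            dsimp only
            rw [integral_const_mul, mul_comm]
            refine mul_le_mul_of_nonneg_right (integral_trap_shift_le ha u _)
              (mul_nonneg (hζ0 ω) ?_)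
            simp only [hφ]; positivity
        _ ≤ 3 * a * (41 * Z) := by rw [integral_const_mul]; gcongr
        _ = _ := by ring
    have e2 : ∫ q, ζ q.1 * ((1 + R q.1 ^ 2) * M q.2 q.1 ^ 2) ∂(μ.prod unitLeb) ≤
        62 * β * Z := by
      rw [integral_prod_symm _ i2]
      have e : ∀ t, ∫ ω, ζ ω * ((1 + R ω ^ 2) * M t ω ^ 2) ∂μ =
          Z * ∫ ω, (1 + R ω ^ 2) * M t ω ^ 2 ∂μ := fun t =>
        hX.integral_mul_nbhd (r := 2) (s := 3) rfl i hζ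
          (v := fun ω => (1 + R ω ^ 2) * M t ω ^ 2) (((hRF.pow_const 2).const_add 1).mul
          (((measurable_ksum_far hX.m_nonneg i t).sub measurable_const).pow_const 2))
      simp_rw [e]
      rw [integral_const_mul, mul_comm]
      exact mul_le_mul_of_nonneg_right hM2 hZ0
    have hpt : ∀ t, |t| ≤ 1 → ∀ ω, y u ^ 3 * (ζ ω * (trap u a (W ω + t) * |M t ω|)) ≤
        1024 * ((ζ ω * φ ω) * trap u a (W ω + t)) +
          16 * (ζ ω * ((1 + R ω ^ 2) * M t ω ^ 2)) := by
      intro t ht ω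
      have hτ0 := trap_nonneg u a (W ω + t)
      have hτ1 := trap_le_one u a (W ω + t)
      have h1 : y u ^ 3 * (trap u a (W ω + t) * |M t ω|) ≤
          1024 * (φ ω * trap u a (W ω + t)) + 16 * ((1 + R ω ^ 2) * M t ω ^ 2) := by
        rcases le_or_gt (W ω + t) (u - a) with h | h
        · rw [trap_eq_zero ha (Or.inl h)]
          simp only [zero_mul, mul_zero]
          positivity
        · have h2 := hyR u t ω ht h
          set τ := trap u a (W ω + t)
          set r := |R ω| with hr
          have hr0 : 0 ≤ r := abs_nonneg _
          have h4 : y u ^ 4 ≤ 2048 * φ ω := by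
            have h5 := hpoly4 r hr0
            have h6 : r ^ 4 = R ω ^ 4 := by rw [hr, pow_abs, abs_of_nonneg (by positivity)]
            rw [h6] at h5
            refine le_trans ?_ h5
            gcongr
          have h5 : y u ^ 2 ≤ 32 * (1 + R ω ^ 2) := by
            have h6 : r ^ 2 = R ω ^ 2 := sq_abs _
            calc y u ^ 2 ≤ (4 + r) ^ 2 := by gcongr
              _ ≤ _ := by rw [← h6]; nlinarith [sq_nonneg (4 - r)]
          have h6 : y u ^ 3 * (τ * |M t ω|) ≤ y u ^ 4 * τ / 2 + y u ^ 2 * M t ω ^ 2 / 2 := by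
            have h7 : τ ^ 2 ≤ τ := by nlinarith
            have h8 := mul_le_mul_of_nonneg_left h7 (by positivity : 0 ≤ y u ^ 4)
            have h9 := sq_nonneg (y u ^ 2 * τ - y u * |M t ω|)
            have h10 : |M t ω| ^ 2 = M t ω ^ 2 := sq_abs _
            have h11 : (y u ^ 2 * τ - y u * |M t ω|) ^ 2 = y u ^ 4 * τ ^ 2 -
                2 * (y u ^ 3 * (τ * |M t ω|)) + y u ^ 2 * M t ω ^ 2 := by rw [← h10]; ring
            linarith
          have h7 := mul_le_mul_of_nonneg_right h4 hτ0
          have h8 := mul_le_mul_of_nonneg_right h5 (sq_nonneg (M t ω))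
          linarith
      have := mul_le_mul_of_nonneg_left h1 (hζ0 ω)
      linarith
    calc _ = ∫ t, ∫ ω, y u ^ 3 * (ζ ω * (trap u a (W ω + t) * |M t ω|)) ∂μ ∂unitLeb := by
          rw [← integral_const_mul, integral_prod_symm _ (i0.const_mul _)]
      _ ≤ ∫ t, ∫ ω, (1024 * ((ζ ω * φ ω) * trap u a (W ω + t)) +
          16 * (ζ ω * ((1 + R ω ^ 2) * M t ω ^ 2))) ∂μ ∂unitLeb := by
          refine integral_mono_ae (i0.const_mul (y u ^ 3)).integral_prod_right
            ((i1.const_mul 1024).add (i2.const_mul 16)).integral_prod_right ?_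
          rw [unitLeb]
          filter_upwards [ae_restrict_mem measurableSet_Icc] with t ht
          have hsnd : ∀ {f : Ω × ℝ → ℝ}, BddMeas f → BddMeas (fun ω => f (ω, t)) := fun hf =>
            ⟨hf.1.comp (measurable_id.prodMk measurable_const), hf.2.imp fun C hC ω => hC (ω, t)⟩
          exact integral_mono ((hsnd b0).integrable.const_mul _)
            (((hsnd b1).integrable.const_mul 1024).add ((hsnd b2).integrable.const_mul 16))
            (hpt t (abs_le.2 ht))
      _ = 1024 * ∫ q, (ζ q.1 * φ q.1) * trap u a (W q.1 + q.2) ∂(μ.prod unitLeb) +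
          16 * ∫ q, ζ q.1 * ((1 + R q.1 ^ 2) * M q.2 q.1 ^ 2) ∂(μ.prod unitLeb) := by
          rw [← integral_const_mul, ← integral_const_mul, ← integral_add (i1.const_mul _)
            (i2.const_mul _)]
          have i12 : Integrable (fun q : Ω × ℝ =>
              1024 * ((ζ q.1 * φ q.1) * trap u a (W q.1 + q.2)) +
              16 * (ζ q.1 * ((1 + R q.1 ^ 2) * M q.2 q.1 ^ 2))) (μ.prod unitLeb) :=
            (i1.const_mul _).add (i2.const_mul _)
          rw [integral_prod_symm _ i12]
      _ ≤ 1024 * (123 * a * Z) + 16 * (62 * β * Z) := by gcongr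
      _ ≤ _ := by
          have : 0 ≤ β * Z := by positivity
          linarith
  have hc : (0.85 : ℝ) ≤ ∫ t, kmean m J X μ G t ∂unitLeb := by
    refine le_trans ?_ (hX.le_integral_kmean i)
    have h4 := hX.integral_U_sq_le hi (s := 1 / 5) (by norm_num)
    norm_num at h4
    have h5 := (abs_le.1 hv).1
    norm_num at h5 hβ1 ⊢
    linarith
  have hq : ∫ t, |kmean m J X μ G t| * min 1 (|t| / a) ∂unitLeb ≤ 1 / 1000 := by
    refine (hX.integral_abs_kmean_mul_le hG ha).trans (le_of_eq ?_)
    rw [hadef]; field_simp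
  have hfin := hX.concentration_weighted hG (fun j hj => (Finset.mem_sdiff.1 hj).2) hζ hζ0 hζ1 ha
    (w := fun u => y u ^ 3) (fun u => pow_nonneg (by linarith [hy1 u]) 3)
    (B := (1 + max x 0) ^ 3) (fun u => by
      have : y u ≤ 1 + max x 0 := add_le_add le_rfl (min_le_right _ _)
      gcongr) (Λ := 27) (by norm_num) hyΛ
    (S := 150000 * a * Z) (c := 0.85) (q := 1 / 1000) ?_ hc hq (by norm_num) x
  · have e : y x = 1 + max x 0 := by simp only [hy, min_self]
    rw [e] at hfin
    have h0 : 0 ≤ (1 + max x 0) ^ 3 * ∫ ω, ζ ω * ivl x a (W ω) ∂μ :=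
      mul_nonneg (pow_nonneg (by linarith [le_max_right x 0]) 3)
        (integral_nonneg fun ω => mul_nonneg (hζ0 ω) (ivl_nonneg _ _ _))
    norm_num at hfin
    nlinarith
  · intro u
    rw [t2, mul_zero, add_zero, mul_add]
    have h1 := t1 u
    have h2 := t3 u
    have : 0 ≤ a * Z := by positivity
    linarith

end BddField

/-! ### Nonuniform normal approximation of bounded fields -/

namespace BddField

variable {ι Ω : Type*} [PseudoMetricSpace ι] {m κ : ℝ} {J : Finset ι} {X : ι → Ω → ℝ}
  [mΩ : MeasurableSpace Ω] {μ : Measure Ω} [IsProbabilityMeasure μ] {β : ℝ}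

lemma one_add_max_pow_le {x z : ℝ} (h : |x - z| ≤ 1) :
    (1 + max z 0) ^ 3 ≤ 8 * (1 + max x 0) ^ 3 := by
  have h1 : 1 + max z 0 ≤ 2 * (1 + max x 0) := by
    have h2 := (abs_le.1 h).1
    have : max z 0 ≤ max x 0 + 1 :=
      max_le (by linarith [le_max_left x 0]) (by linarith [le_max_right x 0])
    linarith [le_max_right x 0]
  calc (1 + max z 0) ^ 3 ≤ (2 * (1 + max x 0)) ^ 3 :=
        pow_le_pow_left₀ (by linarith [le_max_right z 0]) h1 3
    _ = _ := by ring

open Classical in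
/-- Normal approximation for `ramp z (1000 * β)`, with an error that decays in `z`. The variance
need not be `1`, since it changes under truncation. -/
theorem abs_integral_ramp_sub_le_nonuniform (hX : BddField m κ J X μ β) (hβ : 0 < β)
    (hβ1 : β ≤ 1 / 1000) (hv : |∫ ω, psum X J ω ^ 2 ∂μ - 1| ≤ 1 / 10) (z : ℝ) :
    (1 + max z 0) ^ 3 * |∫ ω, ramp z (1000 * β) (psum X J ω) ∂μ -
      ∫ x, ramp z (1000 * β) x ∂(gaussianReal 0 1)| ≤
      400000000 * (β + |∫ ω, psum X J ω ^ 2 ∂μ - 1|) := by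
  set a := 1000 * β
  have ha : 0 < a := by positivity
  set W := psum X J
  set v := ∫ ω, W ω ^ 2 ∂μ
  set c := ∫ x, ramp z a x ∂(gaussianReal 0 1)
  set P := (1 + max z 0) ^ 3
  have hP0 : 0 < P := by have := le_max_right z 0; positivity
  have H : SteinTest (ramp z a) c := steinTest_ramp z a
  have hz1 : ∀ x ≤ z, ramp z a x = 1 := fun x hx => ramp_of_le ha hx
  have hWm : Measurable W := hX.measurable_psum le_rfl
  set T : ι → Ω → ℝ := fun i => psum X (J \ nbhd m J 3 i) with hT
  have hT4 : ∀ i, Integrable (fun ω => 1 + T i ω ^ 4) μ := fun i =>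
    hX.integrable_comp Finset.sdiff_subset (g := fun x => 1 + x ^ 4) (by fun_prop)
  have hV1 : ∀ i ∈ J, ∀ ω, asum X (nbhd m J 2 i) ω ≤ 1 := fun i hi ω =>
    hX.asum_le_one hi (by norm_num) ω
  -- Both the concentration bound and the moment bounds carry the factor `1 / P`; the terms of the
  -- latter are multiples of `1 + T i ^ 4`, whose mean is bounded.
  have hmain := hX.stein_ramp (z := z) (D := 2400000 / P) (Γ := 160000000 / P) ha
    (γ := fun i ω => 3870000 / P * (1 + T i ω ^ 4)) (l := fun _ _ => 0)
    (fun i _ => (((measurable_psum le_rfl).pow_const 4).const_add 1).const_mul _)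
    (fun i _ => (hT4 i).const_mul _) ?_ (fun _ _ => measurable_const) (fun _ _ => le_rfl)
    (fun _ _ => by norm_num) ?_ ?_ ?_
  · have hdm : Measurable (steinDer (ramp z a) c) := H.continuous_steinDer.measurable
    have i1 : Integrable (fun ω => W ω * steinSol (ramp z a) c (W ω)) μ :=
      Integrable.of_bound (hWm.mul (H.continuous_steinSol.measurable.comp
        hWm)).aestronglyMeasurable 1 (ae_of_all _ fun ω => H.abs_mul_steinSol_le _)
    have i2 : Integrable (fun ω => steinDer (ramp z a) c (W ω)) μ :=
      Integrable.of_bound (hdm.comp hWm).aestronglyMeasurable 2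
        (ae_of_all _ fun ω => H.abs_steinDer_le _)
    have i3 : Integrable (fun ω => ramp z a (W ω)) μ := integrable_ramp_comp hWm z a
    have e : ∫ ω, ramp z a (W ω) ∂μ - c =
        -(∫ ω, W ω * steinSol (ramp z a) c (W ω) ∂μ -
          v * ∫ ω, steinDer (ramp z a) c (W ω) ∂μ) -
        (v - 1) * ∫ ω, steinDer (ramp z a) c (W ω) ∂μ := by
      have e1 : ∀ ω, steinDer (ramp z a) c (W ω) - W ω * steinSol (ramp z a) c (W ω) =
          ramp z a (W ω) - c := fun ω => by unfold steinDer; ring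
      have e2 : ∫ ω, (steinDer (ramp z a) c (W ω) - W ω * steinSol (ramp z a) c (W ω)) ∂μ =
          ∫ ω, ramp z a (W ω) ∂μ - c := by
        simp_rw [e1]
        rw [integral_sub i3 (integrable_const _)]
        simp
      rw [integral_sub i2 i1] at e2
      linarith
    have hK : 2 * (2400000 / P) + 160000000 / P = 164800000 / P := by ring
    have h1 : |∫ ω, W ω * steinSol (ramp z a) c (W ω) ∂μ -
        v * ∫ ω, steinDer (ramp z a) c (W ω) ∂μ| ≤ 164800000 / P * (2 * β) := by
      refine hmain.trans (le_trans (le_of_eq ?_)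
        (mul_le_mul_of_nonneg_left hX.sum_expand_le (by positivity)))
      rw [Finset.mul_sum]
      refine Finset.sum_congr rfl fun i hi => ?_
      simp_rw [if_pos (hV1 i hi _), add_zero, hK]
      have q : ∀ ω, |X i ω * psum X (nbhd m J 1 i) ω| * (164800000 / P * asum X (nbhd m J 2 i) ω) =
          164800000 / P * (|X i ω * psum X (nbhd m J 1 i) ω| * asum X (nbhd m J 2 i) ω) :=
        fun ω => by ring
      simp_rw [q, integral_const_mul]
      ring
    have h2 : |∫ ω, steinDer (ramp z a) c (W ω) ∂μ| ≤ 150000 / P := by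
      have i4 : Integrable (fun ω => 30000 / P * (1 + W ω ^ 4)) μ :=
        (hX.integrable_comp le_rfl (g := fun x => 1 + x ^ 4) (by fun_prop)).const_mul _
      have h4 := hX.fourth_moment_le hβ1 hv
      calc _ ≤ ∫ ω, 30000 / P * (1 + W ω ^ 4) ∂μ := by
            refine abs_integral_le_integral_abs.trans (integral_mono i2.abs i4 fun ω => ?_)
            dsimp only
            have := (H.nonuniform hz1 (W ω)).1
            rw [div_mul_eq_mul_div, le_div_iff₀ hP0]
            linarith
        _ = 30000 / P * (1 + ∫ ω, W ω ^ 4 ∂μ) := by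
            rw [integral_const_mul, integral_add (integrable_const 1)
              (hX.integrable_comp le_rfl (g := fun x => x ^ 4) (by fun_prop))]
            rw [integral_const, probReal_univ, one_smul]
        _ ≤ 30000 / P * 5 := by gcongr; linarith
        _ = _ := by ring
    have h3 : |∫ ω, ramp z a (W ω) ∂μ - c| ≤
        164800000 / P * (2 * β) + |v - 1| * (150000 / P) := by
      rw [e]
      refine (abs_sub _ _).trans (add_le_add (by rw [abs_neg]; exact h1) ?_)
      rw [abs_mul]
      gcongr
    calc _ ≤ P * (164800000 / P * (2 * β) + |v - 1| * (150000 / P)) := by gcongr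
      _ = 329600000 * β + 150000 * |v - 1| := by field_simp; ring
      _ ≤ _ := by linarith [abs_nonneg (v - 1)]
  · intro i hi
    rw [integral_const_mul]
    have := (hX.moments_sdiff hβ1 hv hi (r := 3) (by norm_num)).2
    calc _ ≤ 3870000 / P * 41 := by gcongr
      _ ≤ _ := by rw [div_mul_eq_mul_div]; gcongr; norm_num
  · intro i hi ζ h1 h2 h3 x hx
    have h4 := hX.concentration_nonuniform hβ hβ1 hv hi h1 h2 h3 x
    have h5 := one_add_max_pow_le hx
    have h6 : 0 ≤ ∫ ω, ζ ω * ivl x (1000 * β) (psum X J ω) ∂μ :=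
      integral_nonneg fun ω => mul_nonneg (h2 ω) (ivl_nonneg _ _ _)
    have h7 := mul_le_mul_of_nonneg_right h5 h6
    rw [div_mul_eq_mul_div, div_mul_eq_mul_div, le_div_iff₀ hP0]
    linarith
  · intro i hi ω h
    exact absurd h (not_lt.2 (hV1 i hi ω))
  · intro i hi ω u w hu hw huw hV1'
    set V := asum X (nbhd m J 2 i) ω
    have hWT : |W ω - T i ω| ≤ 1 := by
      simp only [hT]
      rw [psum_sdiff (nbhd_subset 3 i), sub_sub_cancel]
      exact hX.abs_psum_le_one hi (by norm_num) le_rfl ω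
    have := Convex.norm_image_sub_le_of_norm_hasDerivWithin_le
      (s := Set.Icc (W ω - V) (W ω + V)) (f := fun w => w * steinSol (ramp z a) c w)
      (f' := fun w => steinSol (ramp z a) c w + w * steinDer (ramp z a) c w)
      (x := w) (y := u) (C := 3870000 / P * (1 + T i ω ^ 4))
      (fun w _ => (H.hasDerivAt_mul w).hasDerivWithinAt) ?_ (convex_Icc _ _) ?_ ?_
    · rw [Real.norm_eq_abs, Real.norm_eq_abs] at this
      refine this.trans ?_
      rw [add_zero, mul_comm]
      gcongr
    · intro x hx
      have h1 := (H.nonuniform hz1 x).2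
      have h2 : |x| ≤ |T i ω| + 2 := by
        have h3 : |x - W ω| ≤ 1 := abs_le.2 ⟨by linarith [hx.1], by linarith [hx.2]⟩
        have h4 := abs_add_three (x - W ω) (W ω - T i ω) (T i ω)
        rw [sub_add_sub_cancel, sub_add_cancel] at h4
        linarith
      have h3 : x ^ 4 ≤ 8 * T i ω ^ 4 + 128 := by
        have h4 : x ^ 4 ≤ (|T i ω| + 2) ^ 4 := by
          rw [← Even.pow_abs (by decide : Even 4) x]
          exact pow_le_pow_left₀ (abs_nonneg _) h2 4
        have h5 : T i ω ^ 4 = |T i ω| ^ 4 := (Even.pow_abs (by decide : Even 4) _).symm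
        rw [h5]
        have h6 : (|T i ω| + 2) ^ 2 ≤ 2 * |T i ω| ^ 2 + 8 := by
          nlinarith [sq_nonneg (|T i ω| - 2)]
        have h7 := pow_le_pow_left₀ (sq_nonneg (|T i ω| + 2)) h6 2
        nlinarith [sq_nonneg (|T i ω| ^ 2 - 4)]
      rw [Real.norm_eq_abs, div_mul_eq_mul_div, le_div_iff₀ hP0, mul_comm]
      refine h1.trans ?_
      have : 0 ≤ T i ω ^ 4 := by positivity
      linarith
    · rw [abs_le] at hw; exact ⟨by linarith, by linarith⟩
    · rw [abs_le] at hu; exact ⟨by linarith, by linarith⟩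

/-- One-sided bounds for the distribution function, decaying with the third power. -/
theorem nonuniform (hX : BddField m κ J X μ β) (hβ : 0 < β)
    (hβ1 : β ≤ 1 / 1000) (hv : |∫ ω, psum X J ω ^ 2 ∂μ - 1| ≤ 1 / 10) (z : ℝ) :
    (1 + max z 0) ^ 3 * (μ.real {ω | psum X J ω ≤ z} - cdf (gaussianReal 0 1) z) ≤
      4000000000 * (β + |∫ ω, psum X J ω ^ 2 ∂μ - 1|) ∧
    (1 + max z 0) ^ 3 * (cdf (gaussianReal 0 1) z - μ.real {ω | psum X J ω < z}) ≤
      4000000000 * (β + |∫ ω, psum X J ω ^ 2 ∂μ - 1|) := by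
  have hWm : Measurable (psum X J) := hX.measurable_psum le_rfl
  have ha : 0 < 1000 * β := by positivity
  have hP : ∀ x : ℝ, 0 < (1 + max x 0) ^ 3 := fun x => by
    have := le_max_right x 0; positivity
  set Δ := |∫ ω, psum X J ω ^ 2 ∂μ - 1|
  have hΔ0 : 0 ≤ Δ := abs_nonneg _
  constructor
  · have h1 := measureReal_le_integral_ramp (μ := μ) (z := z) hWm ha
    have h2 := hX.abs_integral_ramp_sub_le_nonuniform hβ hβ1 hv z
    have h3 := mean_ramp_le_cdf (z := z) ha
    have h4 := cdf_gaussian_sub_le_nonuniform (z := z) ha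
    have h5 : μ.real {ω | psum X J ω ≤ z} - cdf (gaussianReal 0 1) z ≤
        |∫ ω, ramp z (1000 * β) (psum X J ω) ∂μ - ∫ x, ramp z (1000 * β) x ∂(gaussianReal 0 1)| +
        (cdf (gaussianReal 0 1) (z + 1000 * β) - cdf (gaussianReal 0 1) z) := by
      linarith [le_abs_self (∫ ω, ramp z (1000 * β) (psum X J ω) ∂μ -
        ∫ x, ramp z (1000 * β) x ∂(gaussianReal 0 1))]
    have h6 := mul_le_mul_of_nonneg_left h5 (hP z).le
    rw [mul_add] at h6
    linarith
  · set y := z - 1000 * β with hy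
    have h1 := integral_ramp_le_measureReal (μ := μ) (z := z) hWm ha
    have h2 := hX.abs_integral_ramp_sub_le_nonuniform hβ hβ1 hv y
    have h3 := cdf_le_mean_ramp (z := y) ha
    have h4 := cdf_gaussian_sub_le_nonuniform (z := y) ha
    rw [hy, sub_add_cancel, ← hy] at h4
    have h5 : cdf (gaussianReal 0 1) z - μ.real {ω | psum X J ω < z} ≤
        |∫ ω, ramp y (1000 * β) (psum X J ω) ∂μ - ∫ x, ramp y (1000 * β) x ∂(gaussianReal 0 1)| +
        (cdf (gaussianReal 0 1) z - cdf (gaussianReal 0 1) y) := by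
      linarith [neg_abs_le (∫ ω, ramp y (1000 * β) (psum X J ω) ∂μ -
        ∫ x, ramp y (1000 * β) x ∂(gaussianReal 0 1))]
    have h6 := mul_le_mul_of_nonneg_left h5 (hP y).le
    have h7 : (1 + max z 0) ^ 3 ≤ 8 * (1 + max y 0) ^ 3 := one_add_max_pow_le (by
      rw [hy, sub_sub_cancel_left, abs_neg, abs_of_pos ha]; linarith)
    rw [mul_add] at h6
    rcases le_total (cdf (gaussianReal 0 1) z - μ.real {ω | psum X J ω < z}) 0 with h0 | h0
    · exact (mul_nonpos_of_nonneg_of_nonpos (hP z).le h0).trans (by positivity)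
    · have h8 := mul_le_mul_of_nonneg_right h7 h0
      linarith

end BddField

/-! ### Truncation -/

section Trunc

/-- Truncation at level `τ`. -/
noncomputable def trunc (τ x : ℝ) : ℝ := if |x| ≤ τ then x else 0

lemma measurable_trunc (τ : ℝ) : Measurable (trunc τ) :=
  Measurable.ite (measurableSet_le measurable_norm measurable_const) measurable_id measurable_const

lemma abs_trunc_le {τ : ℝ} (hτ : 0 ≤ τ) (x : ℝ) : |trunc τ x| ≤ τ := by
  unfold trunc; split_ifs with h
  · exact h
  · rwa [abs_zero]

lemma trunc_of_le {τ x : ℝ} (h : |x| ≤ τ) : trunc τ x = x := if_pos h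

variable {τ p : ℝ}

lemma abs_trunc_rpow_le (hτ : 0 < τ) (hp : 0 < p) {c : ℝ} (hc : p ≤ c) (x : ℝ) :
    |trunc τ x| ^ c ≤ τ ^ (c - p) * |x| ^ p := by
  unfold trunc; split_ifs with h
  · rcases eq_or_ne x 0 with rfl | hx
    · rw [abs_zero, Real.zero_rpow (by linarith), Real.zero_rpow hp.ne', mul_zero]
    · have hx := abs_pos.2 hx
      calc |x| ^ c = |x| ^ (c - p) * |x| ^ p := by rw [← Real.rpow_add hx, sub_add_cancel]
        _ ≤ _ := by gcongr
  · rw [abs_zero, Real.zero_rpow (by linarith)]; positivity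

lemma abs_sub_trunc_rpow_le (hτ : 0 < τ) {c : ℝ} (hc0 : 0 < c) (hc : c ≤ p) (x : ℝ) :
    |x - trunc τ x| ^ c ≤ τ ^ (c - p) * |x| ^ p := by
  unfold trunc; split_ifs with h
  · rw [sub_self, abs_zero, Real.zero_rpow hc0.ne']; positivity
  · have hx : 0 < |x| := hτ.trans (not_le.1 h)
    rw [sub_zero]
    calc |x| ^ c = |x| ^ (c - p) * |x| ^ p := by rw [← Real.rpow_add hx, sub_add_cancel]
      _ ≤ _ := mul_le_mul_of_nonneg_right
          (Real.rpow_le_rpow_of_nonpos hτ (not_le.1 h).le (by linarith)) (by positivity)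

lemma one_le_of_trunc_ne (hτ : 0 < τ) (hp : 0 < p) {x : ℝ} (h : ¬ |x| ≤ τ) :
    1 ≤ τ ^ (-p) * |x| ^ p := by
  have hx : 0 < |x| := hτ.trans (not_le.1 h)
  calc (1 : ℝ) = |x| ^ (-p) * |x| ^ p := by rw [← Real.rpow_add hx]; simp
    _ ≤ _ := mul_le_mul_of_nonneg_right
        (Real.rpow_le_rpow_of_nonpos hτ (not_le.1 h).le (by linarith)) (by positivity)

end Trunc

section MDepComp

variable {ι Ω : Type*} {J : Finset ι} {X : ι → Ω → ℝ}

lemma sigmaOf_comp_le {g : ι → ℝ → ℝ} (hg : ∀ i, Measurable (g i)) (A : Finset ι) :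
    sigmaOf (fun i ω => g i (X i ω)) A ≤ sigmaOf X A :=
  iSup₂_le fun i hi => Measurable.comap_le ((hg i).comp (measurable_sigmaOf hi))

lemma MDep.comp [PseudoMetricSpace ι] [mΩ : MeasurableSpace Ω] {μ : Measure Ω} {m : ℝ}
    (h : MDep m J X μ) {g : ι → ℝ → ℝ} (hg : ∀ i, Measurable (g i)) :
    MDep m J (fun i ω => g i (X i ω)) μ where
  m_nonneg := h.m_nonneg
  meas i hi := (hg i).comp (h.meas i hi)
  indep A B hA hB hAB := indep_of_indep_of_le_left (indep_of_indep_of_le_right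
    (h.indep A B hA hB hAB) (sigmaOf_comp_le hg B)) (sigmaOf_comp_le hg A)

end MDepComp

/-- The variables truncated at `1 / (2 κ)` and centred. -/
noncomputable def truncField {ι Ω : Type*} [MeasurableSpace Ω] (κ : ℝ) (X : ι → Ω → ℝ)
    (μ : Measure Ω) (i : ι) (ω : Ω) : ℝ :=
  trunc (2 * κ)⁻¹ (X i ω) - ∫ ω', trunc (2 * κ)⁻¹ (X i ω') ∂μ

namespace PField

variable {ι Ω : Type*} [PseudoMetricSpace ι] {m κ : ℝ} {J : Finset ι} {X : ι → Ω → ℝ}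
  [mΩ : MeasurableSpace Ω] {μ : Measure Ω} {p b : ℝ}

lemma tau_pos (hX : PField m κ J X μ p b) : 0 < (2 * κ)⁻¹ := by
  have := hX.kappa_pos; positivity

/-- Truncation at `1 / (2 κ)` is the choice for which moments of order `c` of the truncated
(`c = 3`) or removed (`c < p`) parts scale with `κ` as needed. -/
lemma tau_rpow_mul_sum_le (hX : PField m κ J X μ p b) {c : ℝ} (hc : 0 ≤ c) :
    (2 * κ)⁻¹ ^ (c - p) * ∑ i ∈ J, ∫ ω, |X i ω| ^ p ∂μ ≤ 8 * κ ^ (1 - c) * b := by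
  have hκ := hX.kappa_pos
  have hp3 := hX.le_three
  have h1 : (2 * κ)⁻¹ ^ (c - p) = 2 ^ (p - c) * (κ ^ (1 - c) * κ ^ (p - 1)) := by
    rw [Real.inv_rpow (by positivity), ← Real.rpow_neg (by positivity), neg_sub,
      Real.mul_rpow (by norm_num) hκ.le, ← Real.rpow_add hκ]
    congr 2; ring
  have h2 : (2 : ℝ) ^ (p - c) ≤ 8 := by
    calc (2 : ℝ) ^ (p - c) ≤ 2 ^ (3 : ℝ) :=
          Real.rpow_le_rpow_of_exponent_le (by norm_num) (by linarith)
      _ = 8 := by norm_num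
  calc _ = 2 ^ (p - c) * κ ^ (1 - c) * (κ ^ (p - 1) * ∑ i ∈ J, ∫ ω, |X i ω| ^ p ∂μ) := by
        rw [h1]; ring
    _ ≤ 8 * κ ^ (1 - c) * b := by
        have := hX.sum_le
        gcongr

lemma sum_integral_le_of_le_tau (hX : PField m κ J X μ p b) {c : ℝ} (hc : 0 ≤ c) {f : ι → Ω → ℝ}
    (hf0 : ∀ i ω, 0 ≤ f i ω) (hf : ∀ i ω, f i ω ≤ (2 * κ)⁻¹ ^ (c - p) * |X i ω| ^ p) :
    ∑ i ∈ J, ∫ ω, f i ω ∂μ ≤ 8 * κ ^ (1 - c) * b := by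
  refine le_trans ?_ (hX.tau_rpow_mul_sum_le hc)
  rw [Finset.mul_sum]
  refine Finset.sum_le_sum fun i hi => ?_
  rw [← integral_const_mul]
  exact integral_mono_of_nonneg (ae_of_all _ (hf0 i)) ((hX.integrable_rpow i hi).const_mul _)
    (ae_of_all _ (hf i))

lemma sum_integral_abs_sub_trunc_le (hX : PField m κ J X μ p b) :
    ∑ i ∈ J, ∫ ω, |X i ω - trunc (2 * κ)⁻¹ (X i ω)| ∂μ ≤ 8 * b := by
  have hp := hX.two_lt
  have := hX.sum_integral_le_of_le_tau (c := 1) zero_le_one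
    (f := fun i ω => |X i ω - trunc (2 * κ)⁻¹ (X i ω)|) (fun i ω => abs_nonneg _) fun i ω => by
      have := abs_sub_trunc_rpow_le (p := p) hX.tau_pos zero_lt_one (by linarith) (X i ω)
      rwa [Real.rpow_one] at this
  rwa [sub_self, Real.rpow_zero, mul_one] at this

lemma sum_integral_sq_sub_trunc_le (hX : PField m κ J X μ p b) :
    κ * ∑ i ∈ J, ∫ ω, (X i ω - trunc (2 * κ)⁻¹ (X i ω)) ^ 2 ∂μ ≤ 8 * b := by
  have hp := hX.two_lt
  have hκ := hX.kappa_pos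
  have := hX.sum_integral_le_of_le_tau (c := 2) zero_le_two
    (f := fun i ω => (X i ω - trunc (2 * κ)⁻¹ (X i ω)) ^ 2) (fun i ω => sq_nonneg _) fun i ω => by
      have := abs_sub_trunc_rpow_le (p := p) hX.tau_pos zero_lt_two hp.le (X i ω)
      rwa [Real.rpow_two, sq_abs] at this
  rw [show (1 : ℝ) - 2 = -1 by norm_num, Real.rpow_neg_one] at this
  calc _ ≤ κ * (8 * κ⁻¹ * b) := by gcongr
    _ = _ := by field_simp

lemma sum_measure_large_le (hX : PField m κ J X μ p b) :
    ∑ i ∈ J, μ.real {ω | ¬ |X i ω| ≤ (2 * κ)⁻¹} ≤ 8 * (κ * b) := by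
  have hp := hX.two_lt
  have := hX.sum_integral_le_of_le_tau (c := 0) le_rfl
    (f := fun i => Set.indicator {ω | ¬ |X i ω| ≤ (2 * κ)⁻¹} 1)
    (fun i ω => Set.indicator_nonneg (fun _ _ => zero_le_one) _) fun i ω => by
      by_cases h : |X i ω| ≤ (2 * κ)⁻¹
      · rw [Set.indicator_of_notMem (by simpa using h)]
        have := hX.kappa_pos
        positivity
      · rw [Set.indicator_of_mem (by exact h), zero_sub]
        exact one_le_of_trunc_ne hX.tau_pos (by linarith) h
  rw [sub_zero, Real.rpow_one, mul_assoc] at this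
  refine le_trans (le_of_eq (Finset.sum_congr rfl fun i hi => ?_)) this
  rw [integral_indicator_one]
  exact (measurableSet_le (measurable_norm.comp (hX.meas i hi)) measurable_const).compl

variable [IsProbabilityMeasure μ]

lemma integrable_trunc (hX : PField m κ J X μ p b) {i : ι} (hi : i ∈ J) :
    Integrable (fun ω => trunc (2 * κ)⁻¹ (X i ω)) μ :=
  Integrable.of_bound ((measurable_trunc _).comp (hX.meas i hi)).aestronglyMeasurable (2 * κ)⁻¹
    (ae_of_all _ fun _ => abs_trunc_le hX.tau_pos.le _)

lemma abs_integral_trunc_le (hX : PField m κ J X μ p b) (i : ι) :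
    |∫ ω, trunc (2 * κ)⁻¹ (X i ω) ∂μ| ≤ (2 * κ)⁻¹ := by
  have := norm_integral_le_of_norm_le_const (μ := μ) (f := fun ω => trunc (2 * κ)⁻¹ (X i ω))
    (ae_of_all _ fun ω => abs_trunc_le hX.tau_pos.le (X i ω))
  rwa [probReal_univ, mul_one] at this

lemma sum_abs_integral_trunc_le (hX : PField m κ J X μ p b) :
    ∑ i ∈ J, |∫ ω, trunc (2 * κ)⁻¹ (X i ω) ∂μ| ≤ 8 * b := by
  refine le_trans (Finset.sum_le_sum fun i hi => ?_) hX.sum_integral_abs_sub_trunc_le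
  have h := integral_sub (hX.integrable hi) (hX.integrable_trunc hi)
  rw [hX.mean i hi, zero_sub] at h
  rw [← abs_neg, ← h]
  exact abs_integral_le_integral_abs

/-- The third absolute moment of a centred variable. -/
lemma integral_abs_sub_integral_pow_three_le {f : Ω → ℝ} (hf : Integrable f μ)
    (hf3 : Integrable (fun ω => |f ω| ^ 3) μ) :
    ∫ ω, |f ω - ∫ ω', f ω' ∂μ| ^ 3 ∂μ ≤ 8 * ∫ ω, |f ω| ^ 3 ∂μ := by
  set M := ∫ ω, |f ω| ∂μ with hM
  have hM0 : 0 ≤ M := integral_nonneg fun ω => abs_nonneg _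
  have h1 : |∫ ω', f ω' ∂μ| ≤ M := abs_integral_le_integral_abs
  -- Jensen's inequality, from the tangent to the cube at `M`
  have h2 : M ^ 3 ≤ ∫ ω, |f ω| ^ 3 ∂μ := by
    have h := integral_mono ((hf.abs.const_mul (3 * M ^ 2)).sub (integrable_const (2 * M ^ 3))) hf3
      fun ω => by
        simp only [Pi.sub_apply]
        have h3 := abs_nonneg (f ω)
        nlinarith [mul_nonneg (sq_nonneg (|f ω| - M)) (by linarith : 0 ≤ |f ω| + 2 * M)]
    rw [integral_sub' (hf.abs.const_mul _) (integrable_const _), integral_const_mul,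
      integral_const, probReal_univ, one_smul, ← hM] at h
    linarith
  have h3 := integral_mono_of_nonneg (μ := μ) (f := fun ω => |f ω - ∫ ω', f ω' ∂μ| ^ 3)
    (ae_of_all _ fun ω => by positivity)
    ((hf3.const_mul 4).add (integrable_const (4 * M ^ 3))) (ae_of_all _ fun ω => by
      simp only [Pi.add_apply]
      have h4 : |f ω - ∫ ω', f ω' ∂μ| ≤ |f ω| + M := (abs_sub _ _).trans (by gcongr)
      have h5 := pow_le_pow_left₀ (abs_nonneg _) h4 3
      have h6 := abs_nonneg (f ω)
      nlinarith [mul_nonneg (sq_nonneg (|f ω| - M)) (by linarith : 0 ≤ |f ω| + M)])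
  rw [integral_add' (hf3.const_mul _) (integrable_const _), integral_const_mul,
    integral_const, probReal_univ, one_smul] at h3
  linarith

/-- The truncated field is bounded, and its third moments cost no more than the `p`-th moments of
`X`, up to a constant. -/
theorem bddField_trunc (hX : PField m κ J X μ p b) :
    BddField m κ J (truncField κ X μ) μ (64 * b) := by
  have hp := hX.two_lt
  have hp3 := hX.le_three
  have hκ := hX.kappa_pos
  have hM : MDep m J (truncField κ X μ) μ := hX.comp
    (g := fun i x => trunc (2 * κ)⁻¹ x - ∫ ω', trunc (2 * κ)⁻¹ (X i ω') ∂μ)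
    fun i => (measurable_trunc _).sub_const _
  have hbd : ∀ i ∈ J, ∀ ω, |truncField κ X μ i ω| ≤ κ⁻¹ := fun i _ ω => by
    refine (abs_sub _ _).trans ((add_le_add (abs_trunc_le hX.tau_pos.le _)
      (hX.abs_integral_trunc_le i)).trans (le_of_eq ?_))
    field_simp; norm_num
  have hbm : ∀ i ∈ J, BddMeas (truncField κ X μ i) := fun i hi => ⟨hM.meas i hi, _, hbd i hi⟩
  refine { hM with
    memLp := fun i hi => MemLp.of_bound (hM.meas i hi).aestronglyMeasurable κ⁻¹
      (ae_of_all _ (hbd i hi))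
    mean := fun i hi => ?_
    card_le := hX.card_le
    two_lt := by norm_num
    le_three := le_rfl
    kappa_pos := hκ
    integrable_rpow := fun i hi => ?_
    sum_le := ?_
    bdd := hbd }
  · unfold truncField
    rw [integral_sub (hX.integrable_trunc hi) (integrable_const _)]
    simp
  · have h := (hbm i hi).abs
    have h' := (h.mul h.sq).integrable (μ := μ)
    refine h'.congr (ae_of_all _ fun ω => ?_)
    dsimp only
    rw [show (3 : ℝ) = ((3 : ℕ) : ℝ) by norm_num, Real.rpow_natCast]
    ring
  · have h3 : ∀ i ω, |trunc (2 * κ)⁻¹ (X i ω)| ^ 3 ≤ (2 * κ)⁻¹ ^ (3 - p) * |X i ω| ^ p :=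
      fun i ω => by
        have := abs_trunc_rpow_le hX.tau_pos (by linarith) hp3 (X i ω)
        rwa [show (3 : ℝ) = ((3 : ℕ) : ℝ) by norm_num, Real.rpow_natCast] at this
    have h4 := hX.sum_integral_le_of_le_tau (c := 3) (by norm_num)
      (f := fun i ω => |trunc (2 * κ)⁻¹ (X i ω)| ^ 3) (fun i ω => by positivity) h3
    have h5 : ∀ i ∈ J, ∫ ω, |truncField κ X μ i ω| ^ (3 : ℝ) ∂μ ≤
        8 * ∫ ω, |trunc (2 * κ)⁻¹ (X i ω)| ^ 3 ∂μ := fun i hi => by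
      have h6 : Integrable (fun ω => |trunc (2 * κ)⁻¹ (X i ω)| ^ 3) μ :=
        Integrable.of_bound (measurable_norm.comp ((measurable_trunc _).comp
          (hX.meas i hi)) |>.pow_const 3).aestronglyMeasurable ((2 * κ)⁻¹ ^ 3)
          (ae_of_all _ fun _ => by
            rw [Real.norm_eq_abs, abs_pow, abs_abs]
            exact pow_le_pow_left₀ (abs_nonneg _) (abs_trunc_le hX.tau_pos.le _) 3)
      have h7 := integral_abs_sub_integral_pow_three_le (hX.integrable_trunc hi) h6
      refine le_trans (le_of_eq ?_) h7
      refine integral_congr_ae (ae_of_all _ fun ω => ?_)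
      dsimp only
      rw [show (3 : ℝ) = ((3 : ℕ) : ℝ) by norm_num, Real.rpow_natCast]
      rfl
    have h6 := Finset.sum_le_sum h5
    rw [← Finset.mul_sum] at h6
    rw [show (1 : ℝ) - 3 = -2 by norm_num, Real.rpow_neg hκ.le, Real.rpow_two] at h4
    rw [show (3 : ℝ) - 1 = 2 by norm_num, Real.rpow_two]
    calc _ ≤ κ ^ 2 * (8 * (8 * (κ ^ 2)⁻¹ * b)) := by
          gcongr
          exact h6.trans (by linarith)
      _ = _ := by field_simp; ring

open Classical in
/-- Truncation hardly changes the variance of the sum. -/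
theorem abs_integral_sq_trunc_sub_le (hX : PField m κ J X μ p b) :
    |∫ ω, psum (truncField κ X μ) J ω ^ 2 ∂μ - ∫ ω, psum X J ω ^ 2 ∂μ| ≤ 24 * b := by
  have hξ := hX.bddField_trunc
  set ξ := truncField κ X μ with hξdef
  set η : ι → Ω → ℝ := fun i ω => X i ω - trunc (2 * κ)⁻¹ (X i ω) with hη
  set T := psum ξ J with hT
  set W := psum X J with hW
  have hTb : BddMeas T := hξ.bddMeas_psum le_rfl
  have hηm : ∀ i ∈ J, Measurable[sigmaOf X (nbhd m J 0 i)] (η i) := fun i hi => by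
    have h := measurable_sigmaOf (X := X) (self_mem_nbhd hX.m_nonneg 0 hi)
    exact h.sub ((measurable_trunc _).comp h)
  have hη2 : ∀ i ∈ J, MemLp (η i) 2 μ := fun i hi => (hX.memLp i hi).sub
    (MemLp.of_bound ((measurable_trunc _).comp (hX.meas i hi)).aestronglyMeasurable (2 * κ)⁻¹
      (ae_of_all _ fun ω => abs_trunc_le hX.tau_pos.le _))
  have hηi : ∀ i ∈ J, Integrable (η i) μ := fun i hi => (hη2 i hi).integrable one_le_two
  have hEη : ∀ i ∈ J, ∫ ω, η i ω ∂μ = -∫ ω, trunc (2 * κ)⁻¹ (X i ω) ∂μ := fun i hi => by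
    rw [hη, integral_sub (hX.integrable hi) (hX.integrable_trunc hi), hX.mean i hi, zero_sub]
  have hWT : ∀ ω, W ω = T ω + (∑ i ∈ J, η i ω - ∑ i ∈ J, ∫ ω, η i ω ∂μ) := fun ω => by
    rw [← Finset.sum_sub_distrib]
    simp only [hW, hT, psum]
    rw [← Finset.sum_add_distrib]
    refine Finset.sum_congr rfl fun i hi => ?_
    rw [hEη i hi]
    simp only [hη, hξdef, truncField]
    ring
  set H : Ω → ℝ := fun ω => ∑ i ∈ J, η i ω - ∑ i ∈ J, ∫ ω, η i ω ∂μ with hH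
  have hH2 : MemLp H 2 μ := (memLp_finsetSum J hη2).sub (memLp_const _)
  have hHsq : ∫ ω, H ω ^ 2 ∂μ ≤ 8 * b :=
    (hX.integral_sq_sum_sub_le le_rfl (fun i hi => (hηm i hi).mono
      (sigmaOf_mono (nbhd_mono hX.m_nonneg (by norm_num) i)) le_rfl) hη2).trans
      hX.sum_integral_sq_sub_trunc_le
  have hTη : ∀ i ∈ J, |∫ ω, T ω * η i ω ∂μ| ≤ ∫ ω, |η i ω| ∂μ := by
    intro i hi
    have hN : ∀ ω, |psum ξ (nbhd m J 1 i) ω| ≤ 1 := hξ.abs_psum_le_one hi (by norm_num) le_rfl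
    have hNb : BddMeas (psum ξ (nbhd m J 1 i)) := hξ.bddMeas_psum (nbhd_subset 1 i)
    have hFb : BddMeas (psum ξ (J \ nbhd m J 1 i)) := hξ.bddMeas_psum Finset.sdiff_subset
    have i1 : Integrable (fun ω => psum ξ (nbhd m J 1 i) ω * η i ω) μ :=
      (hηi i hi).bdd_mul (c := 1) hNb.1.aestronglyMeasurable (ae_of_all _ hN)
    obtain ⟨c, hc⟩ := hFb.2
    have i2 : Integrable (fun ω => η i ω * psum ξ (J \ nbhd m J 1 i) ω) μ :=
      (hηi i hi).mul_bdd (c := c) hFb.1.aestronglyMeasurable (ae_of_all _ hc)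
    have e : ∀ ω, T ω * η i ω =
        psum ξ (nbhd m J 1 i) ω * η i ω + η i ω * psum ξ (J \ nbhd m J 1 i) ω := fun ω => by
      rw [psum_sdiff (nbhd_subset 1 i)]; ring
    have hfar : Measurable[sigmaOf X (J \ nbhd m J 1 i)] (psum ξ (J \ nbhd m J 1 i)) :=
      (measurable_psum (X := ξ) le_rfl).mono (sigmaOf_comp_le
        (g := fun i x => trunc (2 * κ)⁻¹ x - ∫ ω', trunc (2 * κ)⁻¹ (X i ω') ∂μ)
        (fun i => (measurable_trunc _).sub_const _) _) le_rfl
    simp_rw [e]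
    rw [integral_add i1 i2, hX.integral_mul_nbhd (r := 0) (s := 1) rfl i (hηm i hi) hfar,
      hξ.integral_psum Finset.sdiff_subset, mul_zero, add_zero]
    refine abs_integral_le_integral_abs.trans (integral_mono i1.abs (hηi i hi).abs fun ω => ?_)
    dsimp only
    rw [abs_mul]
    exact mul_le_of_le_one_left (abs_nonneg _) (hN ω)
  obtain ⟨c, hc⟩ := hTb.2
  have iTη : ∀ i ∈ J, Integrable (fun ω => T ω * η i ω) μ := fun i hi =>
    (hηi i hi).bdd_mul (c := c) hTb.1.aestronglyMeasurable (ae_of_all _ hc)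
  have hTH : |∫ ω, T ω * H ω ∂μ| ≤ 8 * b := by
    have e : ∀ ω, T ω * H ω = ∑ i ∈ J, T ω * η i ω - T ω * ∑ i ∈ J, ∫ ω, η i ω ∂μ := fun ω => by
      simp only [hH]; rw [mul_sub, Finset.mul_sum]
    simp_rw [e]
    rw [integral_sub (integrable_finsetSum _ iTη) (hTb.integrable.mul_const _),
      integral_finsetSum _ iTη, integral_mul_const, hξ.integral_psum le_rfl, zero_mul, sub_zero]
    exact (Finset.abs_sum_le_sum_abs _ _).trans ((Finset.sum_le_sum hTη).trans
      hX.sum_integral_abs_sub_trunc_le)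
  have e : ∫ ω, W ω ^ 2 ∂μ = ∫ ω, T ω ^ 2 ∂μ + 2 * ∫ ω, T ω * H ω ∂μ + ∫ ω, H ω ^ 2 ∂μ := by
    have e1 : ∀ ω, W ω ^ 2 = T ω ^ 2 + 2 * (T ω * H ω) + H ω ^ 2 := fun ω => by
      rw [hWT ω]; ring
    have i1 : Integrable (fun ω => T ω * H ω) μ :=
      (hH2.integrable one_le_two).bdd_mul (c := c) hTb.1.aestronglyMeasurable (ae_of_all _ hc)
    have i2 : Integrable (fun ω => T ω ^ 2 + 2 * (T ω * H ω)) μ :=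
      hTb.sq.integrable.add (i1.const_mul 2)
    simp_rw [e1]
    rw [integral_add i2 hH2.integrable_sq, integral_add hTb.sq.integrable (i1.const_mul 2),
      integral_const_mul]
  have h0 : 0 ≤ ∫ ω, H ω ^ 2 ∂μ := integral_nonneg fun ω => sq_nonneg _
  rw [abs_le] at hTH ⊢
  constructor <;> linarith

end PField

/-! ### Tails -/

section Gaussian

lemma cdf_gaussian_neg (z : ℝ) :
    cdf (gaussianReal 0 1) (-z) = 1 - cdf (gaussianReal 0 1) z := by
  have h0 : (gaussianReal 0 1).map (fun x => -x) = gaussianReal 0 1 := by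
    rw [gaussianReal_map_neg, neg_zero]
  have h1 : (gaussianReal 0 1).real (Set.Iic (-z)) = (gaussianReal 0 1).real (Set.Ici z) := by
    conv_lhs => rw [← h0]
    rw [map_measureReal_apply measurable_neg measurableSet_Iic]
    congr 1
    ext x; simp
  have h2 : (gaussianReal 0 1).real (Set.Ici z) = (gaussianReal 0 1).real (Set.Ioi z) := by
    have := nullSingletonClass_gaussianReal (μ := 0) (v := 1) one_ne_zero
    exact measureReal_congr Ioi_ae_eq_Ici.symm
  rw [cdf_eq_real, cdf_eq_real, h1, h2, ← Set.compl_Iic,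
    probReal_compl_eq_one_sub measurableSet_Iic]

lemma pow_mul_one_sub_cdf_gaussian_le {z : ℝ} (hz : 1 ≤ z) :
    z ^ 3 * (1 - cdf (gaussianReal 0 1) z) ≤ 3700 := by
  have h1 := (steinTest_ramp (z - 1) 1).one_sub_c_le (z := z - 1) (by linarith)
    fun x hx => ramp_of_le one_pos hx
  have h2 := mean_ramp_le_cdf (z := z - 1) one_pos
  rw [sub_add_cancel] at h2
  have h3 := pow_mul_exp_le (z := z - 1) (by linarith)
  rw [add_sub_cancel] at h3
  have h4 : Real.exp (-(z - 1) ^ 2 / 2) ≤ Real.exp (-(3 / 8) * (z - 1) ^ 2) :=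
    Real.exp_le_exp.2 (by nlinarith [sq_nonneg (z - 1)])
  have h5 : z ^ 3 ≤ z ^ 5 := pow_le_pow_right₀ hz (by norm_num)
  calc _ ≤ z ^ 3 * Real.exp (-(3 / 8) * (z - 1) ^ 2) := by gcongr; linarith
    _ ≤ z ^ 5 * Real.exp (-(3 / 8) * (z - 1) ^ 2) := by gcongr
    _ ≤ _ := h3

end Gaussian

lemma MDep.measureReal_inter {ι Ω : Type*} [PseudoMetricSpace ι] [mΩ : MeasurableSpace Ω]
    {m : ℝ} {J : Finset ι} {X : ι → Ω → ℝ} {μ : Measure Ω} (hX : MDep m J X μ) {A B : Finset ι}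
    (hA : A ⊆ J) (hB : B ⊆ J) (hAB : ∀ a ∈ A, ∀ b ∈ B, m < dist a b) {s t : Set Ω}
    (hs : MeasurableSet[sigmaOf X A] s) (ht : MeasurableSet[sigmaOf X B] t) :
    μ.real (s ∩ t) = μ.real s * μ.real t := by
  rw [measureReal_def, (Indep_iff _ _ _).1 (hX.indep A B hA hB hAB) s t hs ht, ENNReal.toReal_mul]
  rfl

namespace PField

variable {ι Ω : Type*} [PseudoMetricSpace ι] {m κ : ℝ} {J : Finset ι} {X : ι → Ω → ℝ}
  [mΩ : MeasurableSpace Ω] {μ : Measure Ω} {p b : ℝ}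

lemma div_const (hX : PField m κ J X μ p b) {s : ℝ} (hs : 0 < s) :
    PField m κ J (fun i ω => X i ω / s) μ p (s ^ (-p) * b) := by
  have h : ∀ i ω, |X i ω / s| ^ p = s ^ (-p) * |X i ω| ^ p := fun i ω => by
    rw [abs_div, abs_of_pos hs, Real.div_rpow (abs_nonneg _) hs.le, Real.rpow_neg hs.le]
    ring
  have hM : MDep m J (fun i ω => X i ω / s) μ :=
    hX.comp (g := fun _ x => x / s) fun _ => measurable_id.div_const s
  refine { hM with
    memLp := fun i hi => ?_
    mean := fun i hi => by rw [integral_div, hX.mean i hi, zero_div]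
    card_le := hX.card_le
    two_lt := hX.two_lt
    le_three := hX.le_three
    kappa_pos := hX.kappa_pos
    integrable_rpow := fun i hi => ?_
    sum_le := ?_ }
  · have := (hX.memLp i hi).mul_const s⁻¹
    simpa only [div_eq_mul_inv] using this
  · simp_rw [h]
    exact (hX.integrable_rpow i hi).const_mul _
  · simp_rw [h, integral_const_mul]
    rw [← Finset.mul_sum, mul_left_comm]
    exact mul_le_mul_of_nonneg_left hX.sum_le (by positivity)

lemma neg (hX : PField m κ J X μ p b) : PField m κ J (fun i ω => -X i ω) μ p b := by
  have hM : MDep m J (fun i ω => -X i ω) μ := hX.comp (g := fun _ x => -x) fun _ => measurable_neg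
  refine { hM with
    memLp := fun i hi => (hX.memLp i hi).neg
    mean := fun i hi => by rw [integral_neg, hX.mean i hi, neg_zero]
    card_le := hX.card_le
    two_lt := hX.two_lt
    le_three := hX.le_three
    kappa_pos := hX.kappa_pos
    integrable_rpow := fun i hi => ?_
    sum_le := ?_ }
  · simp_rw [abs_neg]; exact hX.integrable_rpow i hi
  · simp_rw [abs_neg]; exact hX.sum_le

/-- The event that some variable is truncated. -/
def largeSet (κ : ℝ) (J : Finset ι) (X : ι → Ω → ℝ) : Set Ω :=
  ⋃ i ∈ J, {ω | ¬ |X i ω| ≤ (2 * κ)⁻¹}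

lemma measureReal_largeSet_le (hX : PField m κ J X μ p b) :
    μ.real (largeSet κ J X) ≤ 8 * (κ * b) :=
  (measureReal_biUnion_finset_le _ _).trans hX.sum_measure_large_le

/-- The mean of the sum of the truncated variables. -/
noncomputable def truncShift (κ : ℝ) (J : Finset ι) (X : ι → Ω → ℝ) (μ : Measure Ω) : ℝ :=
  ∑ i ∈ J, ∫ ω, trunc (2 * κ)⁻¹ (X i ω) ∂μ

omit [PseudoMetricSpace ι] in
lemma psum_eq_of_notMem_largeSet {ω : Ω} (h : ω ∉ largeSet κ J X) :
    psum X J ω = psum (truncField κ X μ) J ω + truncShift κ J X μ := by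
  simp only [largeSet, Set.mem_iUnion, not_exists, Set.mem_ofPred_eq, not_not] at h
  rw [psum, psum, truncShift, ← Finset.sum_add_distrib]
  refine Finset.sum_congr rfl fun i hi => ?_
  rw [truncField, trunc_of_le (h i hi), sub_add_cancel]

variable [IsProbabilityMeasure μ]

lemma abs_truncShift_le (hX : PField m κ J X μ p b) : |truncShift κ J X μ| ≤ 8 * b :=
  (Finset.abs_sum_le_sum_abs _ _).trans hX.sum_abs_integral_trunc_le

/-- Markov's inequality for the fourth power. -/
lemma measureReal_le_abs_le {f : Ω → ℝ} (hf : BddMeas f) {t : ℝ} (ht : 0 < t) :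
    μ.real {ω | t ≤ |f ω|} ≤ (∫ ω, f ω ^ 4 ∂μ) / t ^ 4 := by
  rw [le_div_iff₀ (by positivity), mul_comm]
  have e : {ω | t ≤ |f ω|} = {ω | t ^ 4 ≤ f ω ^ 4} := by
    ext ω
    have h : f ω ^ 4 = |f ω| ^ 4 := (Even.pow_abs (by decide : Even 4) _).symm
    rw [Set.mem_ofPred_eq, Set.mem_ofPred_eq, h,
      pow_le_pow_iff_left₀ ht.le (abs_nonneg _) (by norm_num)]
  rw [e]
  refine mul_meas_ge_le_integral_of_nonneg (ae_of_all _ fun ω => ?_) ?_ _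
  · positivity
  · refine hf.sq.sq.integrable.congr (ae_of_all _ fun ω => ?_)
    dsimp only; ring

/-- A tail bound at a fixed level but with arbitrary variance, which scales to the tail bound at
any level. -/
lemma measureReal_one_le_abs_psum_le (hX : PField m κ J X μ p b) (hκ : 1 ≤ κ)
    (hv1 : ∫ ω, psum X J ω ^ 2 ∂μ ≤ 1) :
    μ.real {ω | 1 ≤ |psum X J ω|} ≤
      96 * (∫ ω, psum X J ω ^ 2 ∂μ) ^ 2 + 62000 * (κ * b) := by
  have hb0 := hX.b_nonneg
  have hbκ : b ≤ κ * b := le_mul_of_one_le_left hb0 hκ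
  have hv0 : 0 ≤ ∫ ω, psum X J ω ^ 2 ∂μ := integral_nonneg fun ω => sq_nonneg _
  rcases le_or_gt (1 / 16) b with h | h
  · refine measureReal_le_one.trans ?_
    nlinarith [sq_nonneg (∫ ω, psum X J ω ^ 2 ∂μ)]
  have hξ := hX.bddField_trunc
  have h4 := hξ.integral_pow_four_le
  have hv := (abs_le.1 hX.abs_integral_sq_trunc_sub_le).2
  have hw0 : 0 ≤ ∫ ω, psum (truncField κ X μ) J ω ^ 2 ∂μ := integral_nonneg fun ω => sq_nonneg _
  have h1 : {ω | 1 ≤ |psum X J ω|} ⊆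
      largeSet κ J X ∪ {ω | 1 / 2 ≤ |psum (truncField κ X μ) J ω|} := by
    intro ω hω
    by_cases hL : ω ∈ largeSet κ J X
    · exact Or.inl hL
    · right
      rw [Set.mem_ofPred_eq, psum_eq_of_notMem_largeSet (μ := μ) hL] at hω
      have := abs_add_le (psum (truncField κ X μ) J ω) (truncShift κ J X μ)
      have := hX.abs_truncShift_le
      rw [Set.mem_ofPred_eq]
      linarith
  have h2 := (measureReal_mono h1).trans (measureReal_union_le (μ := μ) _ _)
  have h3 := measureReal_le_abs_le (μ := μ) (hξ.bddMeas_psum (le_refl J))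
    (t := 1 / 2) (by norm_num)
  have h5 := hX.measureReal_largeSet_le
  norm_num at h3
  set v := ∫ ω, psum X J ω ^ 2 ∂μ
  set w := ∫ ω, psum (truncField κ X μ) J ω ^ 2 ∂μ
  have h6 : w ^ 2 ≤ 2 * v ^ 2 + 72 * b := by nlinarith [sq_nonneg (v - 24 * b)]
  have h7 : b * w ≤ b * (5 / 2) := mul_le_mul_of_nonneg_left (by linarith) hb0
  nlinarith

/-- The tail of the normalized sum. -/
lemma measureReal_le_abs_psum_le (hX : PField m κ J X μ p b) (hκ : 1 ≤ κ)
    (hvar : ∫ ω, psum X J ω ^ 2 ∂μ = 1) {z : ℝ} (hz : 1 ≤ z) :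
    μ.real {ω | z ≤ |psum X J ω|} ≤ 96 * (z ^ 4)⁻¹ + 62000 * (κ * b) * z ^ (-p) := by
  have hz0 : 0 < z := by linarith
  have e : ∀ ω, psum (fun i ω => X i ω / z) J ω = psum X J ω / z := fun ω =>
    (Finset.sum_div _ _ _).symm
  have hv : ∫ ω, psum (fun i ω => X i ω / z) J ω ^ 2 ∂μ = (z ^ 2)⁻¹ := by
    simp_rw [e, div_pow]
    rw [integral_div, hvar, one_div]
  have h := (hX.div_const hz0).measureReal_one_le_abs_psum_le hκ (by
    rw [hv]; exact inv_le_one_of_one_le₀ (one_le_pow₀ hz))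
  rw [hv] at h
  have hs : {ω | 1 ≤ |psum (fun i ω => X i ω / z) J ω|} = {ω | z ≤ |psum X J ω|} := by
    ext ω
    rw [Set.mem_ofPred_eq, Set.mem_ofPred_eq, e, abs_div, abs_of_pos hz0, one_le_div hz0]
  rw [hs] at h
  refine h.trans (le_of_eq ?_)
  rw [inv_pow, ← pow_mul]
  ring

end PField

/-! ### The nonuniform bound for locally dependent fields -/

lemma measurableSet_large {ι Ω : Type*} {X : ι → Ω → ℝ} {κ : ℝ} {i : ι} {A : Finset ι}
    (hi : i ∈ A) : MeasurableSet[sigmaOf X A] {ω | ¬ |X i ω| ≤ (2 * κ)⁻¹} :=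
  (measurableSet_le (measurable_norm.comp (measurable_sigmaOf hi)) measurable_const).compl

namespace PField

variable {ι Ω : Type*} [PseudoMetricSpace ι] {m κ : ℝ} {J : Finset ι} {X : ι → Ω → ℝ}
  [mΩ : MeasurableSpace Ω] {μ : Measure Ω} {p b : ℝ}

lemma inv_pow_four_le (hX : PField m κ J X μ p b) {z : ℝ} (hz : 1 ≤ z) :
    (z ^ 4)⁻¹ ≤ z ^ (-p) := by
  have hp3 := hX.le_three
  rw [Real.rpow_neg (by linarith)]
  refine inv_anti₀ (by positivity) ?_
  rw [← Real.rpow_natCast]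
  exact Real.rpow_le_rpow_of_exponent_le hz (by norm_num; linarith)

lemma div_four_rpow_le (hX : PField m κ J X μ p b) {z : ℝ} (hz : 0 < z) :
    (z / 4) ^ (-p) ≤ 64 * z ^ (-p) := by
  have hp3 := hX.le_three
  rw [Real.div_rpow hz.le (by norm_num), Real.rpow_neg (by norm_num : (0 : ℝ) ≤ 4), div_inv_eq_mul,
    mul_comm]
  gcongr
  calc (4 : ℝ) ^ p ≤ 4 ^ (3 : ℝ) := Real.rpow_le_rpow_of_exponent_le (by norm_num) hp3
    _ = 64 := by norm_num

lemma rpow_le_one_add_rpow (hX : PField m κ J X μ p b) {z : ℝ} (hz : 1 ≤ z) :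
    z ^ (-p) ≤ 8 * (1 + z) ^ (-p) := by
  have hp2 := hX.two_lt
  have hp3 := hX.le_three
  have h1 : (2 * z) ^ (-p) ≤ (1 + z) ^ (-p) :=
    Real.rpow_le_rpow_of_nonpos (by linarith) (by linarith) (by linarith)
  have h2 : (1 / 8 : ℝ) ≤ 2 ^ (-p) := by
    calc (1 / 8 : ℝ) = 2 ^ (-3 : ℝ) := by rw [Real.rpow_neg (by norm_num)]; norm_num
      _ ≤ _ := Real.rpow_le_rpow_of_exponent_le (by norm_num) (by linarith)
  have h3 : 0 ≤ z ^ (-p) := by positivity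
  rw [Real.mul_rpow (by norm_num) (by linarith)] at h1
  have h4 := mul_le_mul_of_nonneg_right h2 h3
  linarith

lemma le_rpow_of_pow_three_mul_le (hX : PField m κ J X μ p b) {z x c : ℝ} (hz : 0 ≤ z) (hc : 0 ≤ c)
    (h : (1 + z) ^ 3 * x ≤ c) : x ≤ c * (1 + z) ^ (-p) := by
  have hp3 := hX.le_three
  have h1 : ((1 + z) ^ 3)⁻¹ ≤ (1 + z) ^ (-p) := by
    rw [Real.rpow_neg (by linarith)]
    refine inv_anti₀ (by positivity) ?_
    rw [← Real.rpow_natCast]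
    exact Real.rpow_le_rpow_of_exponent_le (by linarith) (by norm_num; linarith)
  calc x = ((1 + z) ^ 3 * x) * ((1 + z) ^ 3)⁻¹ := by field_simp
    _ ≤ c * (1 + z) ^ (-p) := mul_le_mul h h1 (by positivity) hc

variable [IsProbabilityMeasure μ]

open Classical in
/-- The sum is rarely far out when a variable is large: a large `X i` is independent of the
sum over the indices far from `i`. -/
lemma measureReal_largeSet_inter_le (hX : PField m κ J X μ p b) (hκ : 1 ≤ κ)
    (hE : κ * b ≤ 1 / 8) (hvar : ∫ ω, psum X J ω ^ 2 ∂μ = 1) {z : ℝ} (hz : 4 ≤ z) :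
    μ.real (largeSet κ J X ∩ {ω | z ≤ |psum X J ω|}) ≤ 5000000 * (κ * b) * z ^ (-p) := by
  have hz0 : 0 < z := by linarith
  have hp2 := hX.two_lt
  have hp0 : 0 < p := by linarith
  have hκ0 := hX.kappa_pos
  have hb0 := hX.b_nonneg
  set E := κ * b
  set L : ι → Set Ω := fun i => {ω | ¬ |X i ω| ≤ (2 * κ)⁻¹}
  set Y : ι → Ω → ℝ := fun i => psum X (nbhd m J 1 i) with hY
  set R : ι → Ω → ℝ := fun i => psum X (J \ nbhd m J 1 i) with hR
  set q : ι → ℝ := fun i => μ.real {ω | z / 4 ≤ |Y i ω|}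
  set w := z ^ (-p)
  set t := μ.real {ω | z / 4 ≤ |psum X J ω|}
  have htle : t ≤ 24576 * w + 62000 * E * (64 * w) := by
    have h1 := hX.measureReal_le_abs_psum_le hκ hvar (z := z / 4) (by linarith)
    have h2 : 96 * ((z / 4) ^ 4)⁻¹ = 24576 * (z ^ 4)⁻¹ := by field_simp; norm_num
    have h3 := hX.inv_pow_four_le (z := z) (by linarith)
    have h4 := mul_le_mul_of_nonneg_left (hX.div_four_rpow_le hz0)
      (by positivity : 0 ≤ 62000 * E)
    rw [h2] at h1
    linarith
  have hqsum : ∑ i ∈ J, q i ≤ 64 * w * E := by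
    have h1 : ∀ i ∈ J, q i ≤ 64 * w * ∫ ω, asum X (nbhd m J 5 i) ω ^ p ∂μ := by
      intro i hi
      have h2 : (z / 4) ^ p * q i ≤ ∫ ω, asum X (nbhd m J 5 i) ω ^ p ∂μ := by
        have h3 := mul_meas_ge_le_integral_of_nonneg (μ := μ)
          (f := fun ω => asum X (nbhd m J 5 i) ω ^ p)
          (ae_of_all _ fun ω => Real.rpow_nonneg (asum_nonneg _ _) _)
          (hX.integrable_asum_rpow hi).1 ((z / 4) ^ p)
        refine le_trans (mul_le_mul_of_nonneg_left (measureReal_mono fun ω hω => ?_)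
          (by positivity)) h3
        rw [Set.mem_ofPred_eq] at hω ⊢
        exact Real.rpow_le_rpow (by positivity) (hω.trans (hX.abs_Y_le i ω)) hp0.le
      calc q i = (z / 4) ^ (-p) * ((z / 4) ^ p * q i) := by
            rw [← mul_assoc, ← Real.rpow_add (by positivity)]; simp
        _ ≤ (64 * w) * ∫ ω, asum X (nbhd m J 5 i) ω ^ p ∂μ :=
            mul_le_mul (hX.div_four_rpow_le hz0) h2 (by positivity) (by positivity)
    have h2 := hX.sum_integral_asum_rpow_le
    rw [inv_mul_le_iff₀ hκ0] at h2
    refine (Finset.sum_le_sum h1).trans ?_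
    rw [← Finset.mul_sum]
    gcongr
  have hsub : largeSet κ J X ∩ {ω | z ≤ |psum X J ω|} ⊆
      ⋃ i ∈ J, ((L i ∩ {ω | z / 2 ≤ |R i ω|}) ∪ {ω | z / 4 ≤ |Y i ω|}) := by
    rintro ω ⟨h1, h2⟩
    simp only [largeSet, Set.mem_iUnion] at h1
    obtain ⟨i, hi, h3⟩ := h1
    rw [Set.mem_ofPred_eq] at h2
    simp only [Set.mem_iUnion]
    refine ⟨i, hi, ?_⟩
    by_cases h4 : z / 4 ≤ |Y i ω|
    · exact Or.inr h4
    · refine Or.inl ⟨h3, ?_⟩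
      have h5 : psum X J ω = R i ω + Y i ω := by
        simp only [hR, hY]; rw [psum_sdiff (nbhd_subset 1 i)]; ring
      have h6 := abs_add_le (R i ω) (Y i ω)
      rw [h5] at h2
      rw [Set.mem_ofPred_eq]
      linarith
  have hterm : ∀ i ∈ J, μ.real ((L i ∩ {ω | z / 2 ≤ |R i ω|}) ∪ {ω | z / 4 ≤ |Y i ω|}) ≤
      μ.real (L i) * t + 2 * q i := by
    intro i hi
    have h1 : μ.real (L i ∩ {ω | z / 2 ≤ |R i ω|}) = μ.real (L i) * μ.real {ω | z / 2 ≤ |R i ω|} :=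
      hX.measureReal_inter (nbhd_subset 0 i) Finset.sdiff_subset (far_sdiff (s := 1) rfl)
        (measurableSet_large (self_mem_nbhd hX.m_nonneg 0 hi))
        (measurableSet_le measurable_const (measurable_norm.comp (measurable_psum le_rfl)))
    have h2 : {ω | z / 2 ≤ |R i ω|} ⊆ {ω | z / 4 ≤ |psum X J ω|} ∪ {ω | z / 4 ≤ |Y i ω|} := by
      intro ω hω
      rw [Set.mem_ofPred_eq] at hω
      by_contra h
      rw [Set.mem_union, not_or, Set.mem_ofPred_eq, Set.mem_ofPred_eq, not_le, not_le] at h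
      have h5 : R i ω = psum X J ω - Y i ω := by
        simp only [hR, hY]; rw [psum_sdiff (nbhd_subset 1 i)]
      have h6 := abs_sub (psum X J ω) (Y i ω)
      rw [← h5] at h6
      linarith [h.1, h.2]
    have h3 := (measureReal_mono h2).trans (measureReal_union_le (μ := μ) _ _)
    have h4 : μ.real (L i) ≤ 1 := measureReal_le_one
    have h5 : 0 ≤ μ.real (L i) := measureReal_nonneg
    have h6 : 0 ≤ q i := measureReal_nonneg
    have h7 := mul_le_mul_of_nonneg_left h3 h5
    change _ ≤ μ.real (L i) * (t + q i) at h7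
    refine (measureReal_union_le _ _).trans ?_
    change _ + q i ≤ _
    rw [h1]
    nlinarith
  have hLs := hX.sum_measure_large_le
  calc _ ≤ ∑ i ∈ J, (μ.real (L i) * t + 2 * q i) :=
        (measureReal_mono hsub (measure_ne_top _ _)).trans
          ((measureReal_biUnion_finset_le _ _).trans
          (Finset.sum_le_sum hterm))
    _ = (∑ i ∈ J, μ.real (L i)) * t + 2 * ∑ i ∈ J, q i := by
        rw [Finset.sum_add_distrib, Finset.sum_mul, Finset.mul_sum]
    _ ≤ 8 * E * (24576 * w + 62000 * E * (64 * w)) + 2 * (64 * w * E) := by gcongr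
    _ ≤ _ := by
        have h1 : 0 ≤ E * w := by positivity
        have h2 : E * (E * w) ≤ 1 / 8 * (E * w) := mul_le_mul_of_nonneg_right hE h1
        nlinarith

open Classical in
/-- The counterpart of `measureReal_largeSet_inter_le` for the truncated variables. -/
lemma measureReal_largeSet_inter_trunc_le (hX : PField m κ J X μ p b) (hκ : 1 ≤ κ)
    (hE : κ * b ≤ 1 / 100000) (hvar : ∫ ω, psum X J ω ^ 2 ∂μ = 1) {z : ℝ} (hz : 4 ≤ z) :
    μ.real (largeSet κ J X ∩
      {ω | z ≤ |psum (truncField κ X μ) J ω + truncShift κ J X μ|}) ≤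
      5000000 * (κ * b) * z ^ (-p) := by
  have hb0 := hX.b_nonneg
  have hbκ : b ≤ κ * b := le_mul_of_one_le_left hb0 hκ
  have hξ := hX.bddField_trunc
  set ξ := truncField κ X μ
  set L : ι → Set Ω := fun i => {ω | ¬ |X i ω| ≤ (2 * κ)⁻¹}
  set R : ι → Ω → ℝ := fun i => psum ξ (J \ nbhd m J 1 i) with hR
  have hv := hX.abs_integral_sq_trunc_sub_le
  rw [hvar] at hv
  have hsub : largeSet κ J X ∩ {ω | z ≤ |psum ξ J ω + truncShift κ J X μ|} ⊆
      ⋃ i ∈ J, (L i ∩ {ω | z / 2 ≤ |R i ω|}) := by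
    rintro ω ⟨h1, h2⟩
    simp only [largeSet, Set.mem_iUnion] at h1
    obtain ⟨i, hi, h3⟩ := h1
    rw [Set.mem_ofPred_eq] at h2
    simp only [Set.mem_iUnion]
    refine ⟨i, hi, h3, ?_⟩
    have h5 : psum ξ J ω = R i ω + psum ξ (nbhd m J 1 i) ω := by
      simp only [hR]; rw [psum_sdiff (nbhd_subset 1 i)]; ring
    have h6 := abs_add_three (R i ω) (psum ξ (nbhd m J 1 i) ω) (truncShift κ J X μ)
    have h7 := hξ.abs_psum_le_one hi (r := 1) (by norm_num) le_rfl ω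
    have h8 := hX.abs_truncShift_le
    rw [h5] at h2
    rw [Set.mem_ofPred_eq]
    linarith
  have hterm : ∀ i ∈ J, μ.real (L i ∩ {ω | z / 2 ≤ |R i ω|}) ≤
      μ.real (L i) * (656 * z ^ (-p)) := by
    intro i hi
    have hfar : Measurable[sigmaOf X (J \ nbhd m J 1 i)] (R i) :=
      (measurable_psum (X := ξ) le_rfl).mono (sigmaOf_comp_le
        (g := fun i x => trunc (2 * κ)⁻¹ x - ∫ ω', trunc (2 * κ)⁻¹ (X i ω') ∂μ)
        (fun i => (measurable_trunc _).sub_const _) _) le_rfl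
    have h1 : μ.real (L i ∩ {ω | z / 2 ≤ |R i ω|}) = μ.real (L i) * μ.real {ω | z / 2 ≤ |R i ω|} :=
      hX.measureReal_inter (nbhd_subset 0 i) Finset.sdiff_subset (far_sdiff (s := 1) rfl)
        (measurableSet_large (self_mem_nbhd hX.m_nonneg 0 hi))
        (measurableSet_le measurable_const (measurable_norm.comp hfar))
    rw [h1]
    refine mul_le_mul_of_nonneg_left ?_ measureReal_nonneg
    have h2 := measureReal_le_abs_le (μ := μ) (hξ.bddMeas_psum
      (Finset.sdiff_subset (s := J) (t := nbhd m J 1 i))) (t := z / 2) (by positivity)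
    have h3 := (hξ.moments_sdiff (by linarith) (hv.trans (by linarith)) hi (r := 1)
      (by norm_num)).2
    have h4 : ∫ ω, R i ω ^ 4 ∂μ ≤ 41 := by
      refine le_trans (integral_mono ?_ ?_ fun ω => ?_) h3
      · exact hξ.integrable_comp Finset.sdiff_subset (g := fun x => x ^ 4) (by fun_prop)
      · exact hξ.integrable_comp Finset.sdiff_subset (g := fun x => 1 + x ^ 4) (by fun_prop)
      · dsimp only [hR]; linarith
    have h5 := hX.inv_pow_four_le (z := z) (by linarith)
    calc _ ≤ (∫ ω, R i ω ^ 4 ∂μ) / (z / 2) ^ 4 := h2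
      _ ≤ 41 / (z / 2) ^ 4 := by gcongr
      _ = 656 * (z ^ 4)⁻¹ := by field_simp; norm_num
      _ ≤ _ := by gcongr
  have hLs := hX.sum_measure_large_le
  calc _ ≤ ∑ i ∈ J, μ.real (L i) * (656 * z ^ (-p)) :=
        (measureReal_mono hsub (measure_ne_top _ _)).trans
          ((measureReal_biUnion_finset_le _ _).trans
          (Finset.sum_le_sum hterm))
    _ = (∑ i ∈ J, μ.real (L i)) * (656 * z ^ (-p)) := by rw [Finset.sum_mul]
    _ ≤ 8 * (κ * b) * (656 * z ^ (-p)) := by gcongr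
    _ ≤ _ := by
        have h1 : 0 ≤ κ * b * z ^ (-p) := by positivity
        nlinarith

/-- An event within `largeSet` that is unlikely for large `z` has a probability that decays
for all `z`. -/
lemma measureReal_le_of_subset_largeSet (hX : PField m κ J X μ p b) {z : ℝ} (hz : 0 ≤ z)
    {s : Set Ω} (hs : s ⊆ largeSet κ J X)
    (h : 4 ≤ z → μ.real s ≤ 5000000 * (κ * b) * z ^ (-p)) :
    μ.real s ≤ 40000000 * (κ * b) * (1 + z) ^ (-p) := by
  have hκ0 := hX.kappa_pos
  have hb0 := hX.b_nonneg
  have hp3 := hX.le_three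
  rcases le_or_gt 4 z with h4 | h4
  · refine (h h4).trans ?_
    calc _ ≤ 5000000 * (κ * b) * (8 * (1 + z) ^ (-p)) := by
          gcongr; exact hX.rpow_le_one_add_rpow (by linarith)
      _ = _ := by ring
  · refine (measureReal_mono hs).trans (hX.measureReal_largeSet_le.trans ?_)
    have h1 : (1 / 125 : ℝ) ≤ (1 + z) ^ (-p) := by
      have hp2 := hX.two_lt
      calc (1 / 125 : ℝ) = 5 ^ (-3 : ℝ) := by rw [Real.rpow_neg (by norm_num)]; norm_num
        _ ≤ 5 ^ (-p) := Real.rpow_le_rpow_of_exponent_le (by norm_num) (by linarith)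
        _ ≤ _ := Real.rpow_le_rpow_of_nonpos (by linarith) (by linarith) (by linarith)
    have h2 : 0 ≤ κ * b := by positivity
    nlinarith [mul_le_mul_of_nonneg_left h1 h2]

/-- The one-sided bounds when the moments are small. -/
lemma one_sided_of_small (hX : PField m κ J X μ p b) (hκ : 1 ≤ κ) (hb : 0 < b)
    (hE : κ * b ≤ 1 / 100000) (hvar : ∫ ω, psum X J ω ^ 2 ∂μ = 1) {z : ℝ} (hz : 0 ≤ z) :
    μ.real {ω | psum X J ω ≤ z} - cdf (gaussianReal 0 1) z ≤
      4000000000000 * (κ * b) * (1 + z) ^ (-p) ∧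
    cdf (gaussianReal 0 1) z - μ.real {ω | psum X J ω < z} ≤
      4000000000000 * (κ * b) * (1 + z) ^ (-p) := by
  have hbκ : b ≤ κ * b := le_mul_of_one_le_left hb.le hκ
  have hξ := hX.bddField_trunc
  have hv := hX.abs_integral_sq_trunc_sub_le
  rw [hvar] at hv
  have hδ := abs_le.1 hX.abs_truncShift_le
  set T := psum (truncField κ X μ) J
  set δ := truncShift κ J X μ
  have hnon := hξ.nonuniform (by linarith) (by linarith) (hv.trans (by linarith))
  have hbw : b * (1 + z) ^ (-p) ≤ κ * b * (1 + z) ^ (-p) := by gcongr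
  have hbw0 : 0 ≤ b * (1 + z) ^ (-p) := by positivity
  have h8 : 0 < 8 * b := by positivity
  constructor
  · have hsub : {ω | psum X J ω ≤ z} ⊆
        {ω | T ω ≤ z + 8 * b} ∪ (largeSet κ J X ∩ {ω | z ≤ |T ω + δ|}) := by
      intro ω hω
      rw [Set.mem_ofPred_eq] at hω
      by_cases hL : ω ∈ largeSet κ J X
      · rcases le_total (T ω + δ) z with h | h
        · left; rw [Set.mem_ofPred_eq]; linarith
        · exact Or.inr ⟨hL, h.trans (le_abs_self _)⟩
      · left
        rw [psum_eq_of_notMem_largeSet (μ := μ) hL] at hω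
        rw [Set.mem_ofPred_eq]; linarith
    have h1 := (measureReal_mono hsub).trans (measureReal_union_le (μ := μ) _ _)
    have h2 := hX.measureReal_le_of_subset_largeSet hz Set.inter_subset_left fun h4 =>
      hX.measureReal_largeSet_inter_trunc_le hκ hE hvar h4
    change μ.real (largeSet κ J X ∩ {ω | z ≤ |T ω + δ|}) ≤ _ at h2
    have h3 : μ.real {ω | T ω ≤ z + 8 * b} - cdf (gaussianReal 0 1) (z + 8 * b) ≤
        400000000000 * b * (1 + z) ^ (-p) := by
      refine hX.le_rpow_of_pow_three_mul_le hz (by positivity) ?_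
      have h4 := (hnon (z + 8 * b)).1
      rw [max_eq_left (by linarith)] at h4
      rcases le_total (μ.real {ω | T ω ≤ z + 8 * b} - cdf (gaussianReal 0 1) (z + 8 * b)) 0
        with h0 | h0
      · exact (mul_nonpos_of_nonneg_of_nonpos (by positivity) h0).trans (by positivity)
      · have h5 : (1 + z) ^ 3 ≤ (1 + (z + 8 * b)) ^ 3 := by gcongr; linarith
        have h6 := mul_le_mul_of_nonneg_right h5 h0
        linarith
    have h4 : cdf (gaussianReal 0 1) (z + 8 * b) - cdf (gaussianReal 0 1) z ≤
        29600 * b * (1 + z) ^ (-p) := by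
      refine hX.le_rpow_of_pow_three_mul_le hz (by positivity) ?_
      have h5 := cdf_gaussian_sub_le_nonuniform (z := z) h8
      rw [max_eq_left hz] at h5
      linarith
    linarith
  · have hsub : {ω | T ω < z - 8 * b} ⊆
        {ω | psum X J ω < z} ∪ (largeSet κ J X ∩ {ω | z ≤ |psum X J ω|}) := by
      intro ω hω
      rw [Set.mem_ofPred_eq] at hω
      by_cases hL : ω ∈ largeSet κ J X
      · rcases lt_or_ge (psum X J ω) z with h | h
        · exact Or.inl h
        · exact Or.inr ⟨hL, h.trans (le_abs_self _)⟩
      · left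
        rw [Set.mem_ofPred_eq, psum_eq_of_notMem_largeSet (μ := μ) hL]
        linarith
    have h1 := (measureReal_mono hsub).trans (measureReal_union_le (μ := μ) _ _)
    have h2 := hX.measureReal_le_of_subset_largeSet hz Set.inter_subset_left fun h4 =>
      hX.measureReal_largeSet_inter_le hκ (hE.trans (by norm_num)) hvar h4
    have h5 : (1 + max z 0) ^ 3 ≤ 8 * (1 + max (z - 8 * b) 0) ^ 3 :=
      BddField.one_add_max_pow_le (by
        rw [sub_sub_cancel_left, abs_neg, abs_of_pos h8]; linarith)
    rw [max_eq_left hz] at h5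
    have h3 : cdf (gaussianReal 0 1) (z - 8 * b) - μ.real {ω | T ω < z - 8 * b} ≤
        3000000000000 * b * (1 + z) ^ (-p) := by
      refine hX.le_rpow_of_pow_three_mul_le hz (by positivity) ?_
      have h4 := (hnon (z - 8 * b)).2
      rcases le_total (cdf (gaussianReal 0 1) (z - 8 * b) - μ.real {ω | T ω < z - 8 * b}) 0
        with h0 | h0
      · exact (mul_nonpos_of_nonneg_of_nonpos (by positivity) h0).trans (by positivity)
      · have h6 := mul_le_mul_of_nonneg_right h5 h0
        linarith
    have h4 : cdf (gaussianReal 0 1) z - cdf (gaussianReal 0 1) (z - 8 * b) ≤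
        240000 * b * (1 + z) ^ (-p) := by
      refine hX.le_rpow_of_pow_three_mul_le hz (by positivity) ?_
      have h6 := cdf_gaussian_sub_le_nonuniform (z := z - 8 * b) h8
      rw [sub_add_cancel] at h6
      have h0 : 0 ≤ cdf (gaussianReal 0 1) z - cdf (gaussianReal 0 1) (z - 8 * b) :=
        sub_nonneg.2 (monotone_cdf _ (by linarith))
      have h7 := mul_le_mul_of_nonneg_right h5 h0
      linarith
    linarith

/-- The one-sided bounds when the moments are not small: both tails decay by themselves. -/
lemma one_sided_of_large (hX : PField m κ J X μ p b) (hκ : 1 ≤ κ)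
    (hE : 1 / 100000 < κ * b) (hvar : ∫ ω, psum X J ω ^ 2 ∂μ = 1) {z : ℝ} (hz : 0 ≤ z) :
    μ.real {ω | psum X J ω ≤ z} - cdf (gaussianReal 0 1) z ≤
      4000000000000 * (κ * b) * (1 + z) ^ (-p) ∧
    cdf (gaussianReal 0 1) z - μ.real {ω | psum X J ω < z} ≤
      4000000000000 * (κ * b) * (1 + z) ^ (-p) := by
  have hp2 := hX.two_lt
  have hp3 := hX.le_three
  have hw0 : 0 ≤ (1 + z) ^ (-p) := by positivity
  have hEw := mul_le_mul_of_nonneg_right hE.le hw0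
  have hΦ0 := cdf_nonneg (gaussianReal 0 1) z
  have hΦ1 := cdf_le_one (gaussianReal 0 1) z
  have h1 : μ.real {ω | psum X J ω ≤ z} ≤ 1 := measureReal_le_one
  have h0 : 0 ≤ μ.real {ω | psum X J ω < z} := measureReal_nonneg
  rcases le_total z 1 with h | h
  · have h2 : (1 / 8 : ℝ) ≤ (1 + z) ^ (-p) := by
      calc (1 / 8 : ℝ) = 2 ^ (-3 : ℝ) := by rw [Real.rpow_neg (by norm_num)]; norm_num
        _ ≤ 2 ^ (-p) := Real.rpow_le_rpow_of_exponent_le (by norm_num) (by linarith)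
        _ ≤ _ := Real.rpow_le_rpow_of_nonpos (by linarith) (by linarith) (by linarith)
    constructor <;> nlinarith
  · have h2 : 1 - cdf (gaussianReal 0 1) z ≤ 29600 * (1 + z) ^ (-p) := by
      refine hX.le_rpow_of_pow_three_mul_le hz (by norm_num) ?_
      have h3 := pow_mul_one_sub_cdf_gaussian_le h
      have h4 : (1 + z) ^ 3 ≤ (2 * z) ^ 3 := by gcongr; linarith
      have h5 := mul_le_mul_of_nonneg_right h4 (by linarith : 0 ≤ 1 - cdf (gaussianReal 0 1) z)
      linarith
    have h3 := hX.measureReal_le_abs_psum_le hκ hvar h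
    have h4 := hX.inv_pow_four_le h
    have h5 := hX.rpow_le_one_add_rpow h
    have h6 := mul_le_mul_of_nonneg_left h5 (by linarith : 0 ≤ κ * b)
    have h7 : 1 ≤ μ.real {ω | psum X J ω < z} + μ.real {ω | z ≤ |psum X J ω|} := by
      have h8 : (Set.univ : Set Ω) ⊆ {ω | psum X J ω < z} ∪ {ω | z ≤ |psum X J ω|} := fun ω _ => by
        rcases lt_or_ge (psum X J ω) z with h | h
        · exact Or.inl h
        · exact Or.inr (h.trans (le_abs_self _))
      have h9 := (measureReal_mono h8).trans (measureReal_union_le (μ := μ) _ _)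
      rwa [probReal_univ] at h9
    constructor <;> linarith

/-- The nonuniform Berry–Esseen bound for locally dependent fields. -/
theorem abs_cdf_sub_le_nonuniform (hX : PField m κ J X μ p b) (hκ : 1 ≤ κ)
    (hvar : ∫ ω, psum X J ω ^ 2 ∂μ = 1) (z : ℝ) :
    |cdf (μ.map (psum X J)) z - cdf (gaussianReal 0 1) z| ≤
      4000000000000 * (κ * b) * (1 + |z|) ^ (-p) := by
  have one_sided : ∀ {X : ι → Ω → ℝ} {b : ℝ}, PField m κ J X μ p b → 0 < b →
      ∫ ω, psum X J ω ^ 2 ∂μ = 1 → ∀ z, 0 ≤ z →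
      μ.real {ω | psum X J ω ≤ z} - cdf (gaussianReal 0 1) z ≤
        4000000000000 * (κ * b) * (1 + z) ^ (-p) ∧
      cdf (gaussianReal 0 1) z - μ.real {ω | psum X J ω < z} ≤
        4000000000000 * (κ * b) * (1 + z) ^ (-p) := fun h hb hv z hz =>
    (le_or_gt _ _).elim (fun hE => h.one_sided_of_small hκ hb hE hv hz)
      fun hE => h.one_sided_of_large hκ hE hv hz
  have hW : Measurable (psum X J) := hX.measurable_psum le_rfl
  have hlt : ∀ z, μ.real {ω | psum X J ω < z} ≤ μ.real {ω | psum X J ω ≤ z} := fun z =>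
    measureReal_mono fun ω h => le_of_lt (show psum X J ω < z from h)
  have hK : 0 < 4000000000000 * κ * (1 + |z|) ^ (-p) := by have := hX.kappa_pos; positivity
  -- `b` is enlarged slightly since it may vanish
  refine le_of_forall_pos_le_add fun ε hε => ?_
  set b' := b + ε / (4000000000000 * κ * (1 + |z|) ^ (-p)) with hb'
  have hb0 : 0 < b' := add_pos_of_nonneg_of_pos hX.b_nonneg (by positivity)
  have e : 4000000000000 * (κ * b) * (1 + |z|) ^ (-p) + ε =
      4000000000000 * (κ * b') * (1 + |z|) ^ (-p) := by
    have : (4000000000000 * κ * (1 + |z|) ^ (-p)) *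
        (ε / (4000000000000 * κ * (1 + |z|) ^ (-p))) = ε := mul_div_cancel₀ _ hK.ne'
    rw [hb']
    linarith
  rw [e, cdf_map_eq hW, abs_le]
  have hX' : PField m κ J X μ p b' := hX.mono (by rw [hb']; linarith [div_pos hε hK])
  rcases le_total 0 z with h | h
  · rw [abs_of_nonneg h]
    obtain ⟨h1, h2⟩ := one_sided hX' hb0 hvar z h
    constructor <;> linarith [hlt z]
  · rw [abs_of_nonpos h]
    have hneg : ∀ ω, psum (fun i ω => -X i ω) J ω = -psum X J ω := fun ω => by simp [psum]
    obtain ⟨h1, h2⟩ := one_sided hX'.neg hb0 (by simp_rw [hneg, neg_sq]; exact hvar) (-z)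
      (by linarith)
    simp_rw [hneg] at h1 h2
    rw [cdf_gaussian_neg] at h1 h2
    have h3 : μ.real {ω | -psum X J ω < -z} = 1 - μ.real {ω | psum X J ω ≤ z} := by
      rw [← probReal_compl_eq_one_sub (measurableSet_le hW measurable_const)]
      congr 1
      ext ω
      simp
    have h4 : μ.real {ω | -psum X J ω < -z} ≤ μ.real {ω | -psum X J ω ≤ -z} :=
      measureReal_mono fun ω h => le_of_lt (show -psum X J ω < -z from h)
    constructor <;> linarith

end PField

/-! ### Blocks -/

section Blocks

/-- The sums of `X` over the fibres of `q`. -/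
noncomputable def blockSum {ι ι' Ω : Type*} [DecidableEq ι'] (J : Finset ι) (q : ι → ι')
    (X : ι → Ω → ℝ) (k : ι') : Ω → ℝ :=
  psum X (J.filter fun i => q i = k)

lemma psum_blockSum {ι ι' Ω : Type*} [DecidableEq ι'] (J : Finset ι) (q : ι → ι')
    (X : ι → Ω → ℝ) (ω : Ω) :
    psum (blockSum J q X) (J.image q) ω = psum X J ω :=
  Finset.sum_fiberwise_of_maps_to (fun _ hi => Finset.mem_image_of_mem q hi) fun i => X i ω

lemma MDep.blockSum {ι ι' Ω : Type*} [DecidableEq ι'] [PseudoMetricSpace ι] [PseudoMetricSpace ι']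
    [mΩ : MeasurableSpace Ω] {μ : Measure Ω} {m m' : ℝ} {J : Finset ι} {X : ι → Ω → ℝ}
    (h : MDep m J X μ) (hm' : 0 ≤ m') {q : ι → ι'}
    (hq : ∀ i j, m' < dist (q i) (q j) → m < dist i j) :
    MDep m' (J.image q) (blockSum J q X) μ := by
  have hle : ∀ A : Finset ι', sigmaOf (_root_.blockSum J q X) A ≤
      sigmaOf X (J.filter fun i => q i ∈ A) := fun A =>
    iSup₂_le fun k hk => Measurable.comap_le (_root_.measurable_psum fun i hi => by
      rw [Finset.mem_filter] at hi ⊢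
      exact ⟨hi.1, hi.2 ▸ hk⟩)
  refine ⟨hm', fun k _ => h.measurable_psum (Finset.filter_subset _ _), fun A B _ _ hAB => ?_⟩
  refine indep_of_indep_of_le_left (indep_of_indep_of_le_right
    (h.indep _ _ (Finset.filter_subset _ _) (Finset.filter_subset _ _) fun i hi j hj => ?_)
    (hle B)) (hle A)
  exact hq i j (hAB _ (Finset.mem_filter.1 hi).2 _ (Finset.mem_filter.1 hj).2)

lemma abs_blockSum_rpow_le {ι ι' Ω : Type*} [DecidableEq ι'] {J : Finset ι} {q : ι → ι'}
    (X : ι → Ω → ℝ) {n p : ℝ} (hp : 1 ≤ p) {k : ι'}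
    (hk : ((J.filter fun i => q i = k).card : ℝ) ≤ n) (ω : Ω) :
    |blockSum J q X k ω| ^ p ≤
      n ^ (p - 1) * ∑ i ∈ J.filter (fun i => q i = k), |X i ω| ^ p := by
  calc |blockSum J q X k ω| ^ p ≤ (∑ i ∈ J.filter (fun i => q i = k), |X i ω|) ^ p :=
        Real.rpow_le_rpow (abs_nonneg _) (Finset.abs_sum_le_sum_abs _ _) (by linarith)
    _ ≤ ((J.filter fun i => q i = k).card : ℝ) ^ (p - 1) *
        ∑ i ∈ J.filter (fun i => q i = k), |X i ω| ^ p :=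
        Real.rpow_sum_le_const_mul_sum_rpow _ _ hp
    _ ≤ _ := by
        refine mul_le_mul_of_nonneg_right ?_ (Finset.sum_nonneg fun i _ => by positivity)
        exact Real.rpow_le_rpow (by positivity) hk (by linarith)

end Blocks

section LatticeBlocks

variable {d : ℕ}

/-- The index of the cube of side `m + 1` that contains a lattice point. -/
def cubeIndex (m : ℕ) (i : Fin d → ℤ) : Fin d → ℤ := fun l => i l / ((m : ℤ) + 1)

/-- Points of cubes which are not neighbours are more than `m` apart. -/
lemma lt_dist_of_lt_dist_cubeIndex {m : ℕ} {i j : Fin d → ℤ}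
    (h : ((1 : ℕ) : ℝ) < dist (cubeIndex m i) (cubeIndex m j)) : (m : ℝ) < dist i j := by
  rw [← not_le] at h ⊢
  intro hij
  refine h ((dist_pi_le_iff (by positivity)).2 fun l => ?_)
  have h1 := (dist_le_pi_dist i j l).trans hij
  rw [Int.dist_eq, ← Int.cast_sub, ← Int.cast_abs] at h1 ⊢
  have h2 : |i l - j l| ≤ m := by exact_mod_cast h1
  have hm : (0 : ℤ) < (m : ℤ) + 1 := by positivity
  have h3 : |cubeIndex m i l - cubeIndex m j l| ≤ 1 := by
    simp only [cubeIndex]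
    have a1 := Int.emod_add_mul_ediv (i l) ((m : ℤ) + 1)
    have a2 := Int.emod_add_mul_ediv (j l) ((m : ℤ) + 1)
    have a3 := Int.emod_nonneg (i l) hm.ne'
    have a4 := Int.emod_nonneg (j l) hm.ne'
    have a5 := Int.emod_lt_of_pos (i l) hm
    have a6 := Int.emod_lt_of_pos (j l) hm
    rw [abs_le] at h2 ⊢
    constructor
    · by_contra hc
      nlinarith
    · by_contra hc
      nlinarith
  exact_mod_cast h3

lemma card_filter_cubeIndex_le (m : ℕ) (J : Finset (Fin d → ℤ)) (k : Fin d → ℤ) :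
    ((J.filter fun i => cubeIndex m i = k).card : ℝ) ≤ ((m : ℝ) + 1) ^ d := by
  have hm : (0 : ℤ) < (m : ℤ) + 1 := by positivity
  have h1 : (J.filter fun i => cubeIndex m i = k) ⊆
      Fintype.piFinset fun l => Finset.Icc (((m : ℤ) + 1) * k l) (((m : ℤ) + 1) * k l + m) := by
    intro i hi
    rw [Finset.mem_filter] at hi
    rw [Fintype.mem_piFinset]
    intro l
    have h2 : i l / ((m : ℤ) + 1) = k l := congrFun hi.2 l
    have a1 := Int.emod_add_mul_ediv (i l) ((m : ℤ) + 1)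
    have a3 := Int.emod_nonneg (i l) hm.ne'
    have a5 := Int.emod_lt_of_pos (i l) hm
    rw [h2] at a1
    rw [Finset.mem_Icc]
    constructor <;> linarith
  have h2 := Finset.card_le_card h1
  rw [Fintype.card_piFinset] at h2
  simp only [Int.card_Icc] at h2
  have h3 : ∀ l : Fin d, (((m : ℤ) + 1) * k l + m + 1 - ((m : ℤ) + 1) * k l).toNat = m + 1 := by
    intro l
    have : ((m : ℤ) + 1) * k l + m + 1 - ((m : ℤ) + 1) * k l = ((m + 1 : ℕ) : ℤ) := by
      push_cast; ring
    rw [this, Int.toNat_natCast]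
  simp only [h3, Finset.prod_const, Finset.card_univ, Fintype.card_fin] at h2
  exact_mod_cast h2

/-- The nonuniform bound on the lattice. The cubes of side `m + 1` are indexed by a `1`-dependent
field, and a ball of radius `5` has at most `11 ^ d ≤ 19 ^ d` points. -/
theorem lattice_nonuniform {Ω : Type*} [mΩ : MeasurableSpace Ω] {μ : Measure Ω}
    [IsProbabilityMeasure μ] {J : Finset (Fin d → ℤ)} {X : (Fin d → ℤ) → Ω → ℝ} {m : ℕ} {p : ℝ}
    (hp2 : 2 < p) (hp3 : p ≤ 3)
    (hmeas : ∀ i ∈ J, Measurable (X i)) (hmom : ∀ i ∈ J, Integrable (fun ω => |X i ω| ^ p) μ)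
    (hmean : ∀ i ∈ J, ∫ ω, X i ω ∂μ = 0)
    (hvar : variance (fun ω => ∑ i ∈ J, X i ω) μ = 1)
    (hdep : IsMDependentField m (J : Set (Fin d → ℤ)) X μ) (z : ℝ) :
    |cdf (μ.map (fun ω => ∑ i ∈ J, X i ω)) z - cdf (gaussianReal 0 1) z| ≤
      4000000000000 * (1 + |z|) ^ (-p) * (19 : ℝ) ^ (p * (d : ℝ)) *
        ((m : ℝ) + 1) ^ ((p - 1) * (d : ℝ)) * ∑ i ∈ J, ∫ ω, |X i ω| ^ p ∂μ := by
  have hM := hdep.mdep hmeas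
  have hXi : ∀ i ∈ J, Integrable (X i) μ := fun i hi =>
    (memLp_two_of_integrable_rpow (hmeas i hi) hp2.le (hmom i hi)).integrable one_le_two
  set q : (Fin d → ℤ) → (Fin d → ℤ) := cubeIndex m
  set B := blockSum J q X with hB
  have hMB : MDep ((1 : ℕ) : ℝ) (J.image q) B μ :=
    hM.blockSum (by norm_num) fun i j => lt_dist_of_lt_dist_cubeIndex
  set n : ℝ := ((m : ℝ) + 1) ^ d with hn
  have hpt : ∀ k ω, |B k ω| ^ p ≤ n ^ (p - 1) * ∑ i ∈ J.filter (fun i => q i = k), |X i ω| ^ p :=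
    fun k ω => abs_blockSum_rpow_le X (by linarith) (card_filter_cubeIndex_le m J k) ω
  have hdom : ∀ k, Integrable (fun ω => n ^ (p - 1) *
      ∑ i ∈ J.filter (fun i => q i = k), |X i ω| ^ p) μ := fun k =>
    (integrable_finsetSum _ fun i hi => hmom i (Finset.mem_filter.1 hi).1).const_mul _
  have hmomB : ∀ k ∈ J.image q, Integrable (fun ω => |B k ω| ^ p) μ := fun k hk =>
    (hdom k).mono' ((measurable_norm.comp (hMB.meas k hk)).pow_const p).aestronglyMeasurable
      (ae_of_all _ fun ω => by
        rw [Real.norm_eq_abs, abs_of_nonneg (by positivity)]; exact hpt k ω)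
  have hmeanB : ∀ k ∈ J.image q, ∫ ω, B k ω ∂μ = 0 := fun k _ => by
    simp only [hB, blockSum, psum]
    rw [integral_finsetSum _ fun i hi => hXi i (Finset.mem_filter.1 hi).1]
    exact Finset.sum_eq_zero fun i hi => hmean i (Finset.mem_filter.1 hi).1
  have hPB := hMB.pField (κ := (19 : ℝ) ^ d) (by positivity) (fun k _ => by
    refine (card_nbhd_le 1 5 _ k).trans ?_
    norm_num
    gcongr
    norm_num) hp2 hp3 hmomB hmeanB
  have hW : psum B (J.image q) = fun ω => ∑ i ∈ J, X i ω := by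
    ext ω; exact psum_blockSum J q X ω
  have hv : ∫ ω, psum B (J.image q) ω ^ 2 ∂μ = 1 := by
    rw [← hvar, ← hW, variance_of_integral_eq_zero]
    · exact (hPB.measurable_psum le_rfl).aemeasurable
    · exact hPB.integral_psum le_rfl
  have h := hPB.abs_cdf_sub_le_nonuniform (one_le_pow₀ (by norm_num)) hv z
  rw [hW] at h
  refine h.trans ?_
  have hS : ∑ k ∈ J.image q, ∫ ω, |B k ω| ^ p ∂μ ≤
      n ^ (p - 1) * ∑ i ∈ J, ∫ ω, |X i ω| ^ p ∂μ := by
    have e : ∑ k ∈ J.image q, ∑ i ∈ J with q i = k, ∫ ω, |X i ω| ^ p ∂μ =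
        ∑ i ∈ J, ∫ ω, |X i ω| ^ p ∂μ :=
      Finset.sum_fiberwise_of_maps_to (fun _ hi => Finset.mem_image_of_mem q hi) _
    rw [← e, Finset.mul_sum]
    refine Finset.sum_le_sum fun k _ => ?_
    rw [← integral_finsetSum _ fun i hi => hmom i (Finset.mem_filter.1 hi).1,
      ← integral_const_mul]
    exact integral_mono_of_nonneg (ae_of_all _ fun ω => by positivity) (hdom k)
      (ae_of_all _ (hpt k))
  have e1 : (19 : ℝ) ^ (p * (d : ℝ)) = (19 : ℝ) ^ d * ((19 : ℝ) ^ d) ^ (p - 1) := by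
    rw [← Real.rpow_natCast, ← Real.rpow_mul (by norm_num), ← Real.rpow_add (by norm_num)]
    congr 1; ring
  have e2 : ((m : ℝ) + 1) ^ ((p - 1) * (d : ℝ)) = n ^ (p - 1) := by
    rw [hn, ← Real.rpow_natCast, ← Real.rpow_mul (by positivity), mul_comm]
  rw [e1, e2]
  calc _ ≤ 4000000000000 * ((19 : ℝ) ^ d * (((19 : ℝ) ^ d) ^ (p - 1) *
        (n ^ (p - 1) * ∑ i ∈ J, ∫ ω, |X i ω| ^ p ∂μ))) * (1 + |z|) ^ (-p) := by gcongr
    _ = _ := by ring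

end LatticeBlocks

theorem theorem2p6 :
    ∃ C : ℝ, 0 < C ∧
      ∀ (d : ℕ) (_hd : 1 ≤ d) (m : ℕ) (p : ℝ) (_hp2 : 2 < p) (_hp3 : p ≤ 3)
        (J : Finset (Fin d → ℤ))
        (Ω : Type*) [MeasurableSpace Ω] (μ : Measure Ω) [IsProbabilityMeasure μ]
        (X : (Fin d → ℤ) → Ω → ℝ)
        (_hmeas : ∀ i ∈ J, Measurable (X i))
        (_hmom : ∀ i ∈ J, Integrable (fun ω => |X i ω| ^ p) μ)
        (_hmean : ∀ i ∈ J, ∫ ω, X i ω ∂μ = 0)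
        (_hvar : variance (fun ω => ∑ i ∈ J, X i ω) μ = 1)
        (_hdep : IsMDependentField m (J : Set (Fin d → ℤ)) X μ),
        ((⨆ z : ℝ, |cdf (μ.map (fun ω => ∑ i ∈ J, X i ω)) z - cdf (gaussianReal 0 1) z|)
            ≤ 75 * (10 * (m : ℝ) + 1) ^ ((p - 1) * (d : ℝ)) * ∑ i ∈ J, ∫ ω, |X i ω| ^ p ∂μ)
        ∧ ∀ z : ℝ,
          |cdf (μ.map (fun ω => ∑ i ∈ J, X i ω)) z - cdf (gaussianReal 0 1) z|
            ≤ C * (1 + |z|) ^ (-p) * (19 : ℝ) ^ (p * (d : ℝ))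
                * ((m : ℝ) + 1) ^ ((p - 1) * (d : ℝ)) * ∑ i ∈ J, ∫ ω, |X i ω| ^ p ∂μ := by
  refine ⟨4000000000000, by norm_num, ?_⟩
  intro d _ m p hp2 hp3 J Ω _ μ _ X hmeas hmom hmean hvar hdep
  exact ⟨ciSup_le fun z => lattice_uniform hp2 hp3 hmeas hmom hmean hvar hdep z,
    lattice_nonuniform hp2 hp3 hmeas hmom hmean hvar hdep⟩
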